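/- **Conventions.** Let $k$ be a field and $G$ an abelian group. Let $A$ be an associative unital $\mathbb Z\oplus G$-graded $k$-algebra. With respect to the $\mathbb Z$-grading, assume that $A$ is connected ($A=k\oplus A_1\oplus A_2\oplus\cdots$, $A\neq 0$) and locally finitely generated (it is generated by a set of homogeneous elements having finitely many elements in each degree). Put $\mathfrak m=\bigoplus_{s\ge1}A_s$ and let $k_A=A/\mathfrak m$ be the trivial right module. "Graded" means $\mathbb Z\oplus G$-graded (Adams grading), and $W^\#$ denotes the graded dual, with $(W^\#)_e=(W_{-e})^*$. *Ext.* Let $P$ be a graded free resolution $\cdots\to P^{-1}\to P^0\to k_A\to0$ by right $A$-modules with differential $d$. $\operatorname{End}_A(P)$ is the DG algebra spanned by the endomorphisms $f$ that are homogeneous of some bidegree $(p,e)\in\mathbb Z\times(\mathbb Z\oplus G)$, with composition as product and $\partial f=d f-(-1)^p f d$. Its cohomology $E=\bigoplus_{p,e}E^p_e$ is the bigraded Ext-algebra $\operatorname{Ext}^*_A(k_A,k_A)$. *$A_\infty$-structures.* An Adams graded $A_\infty$-algebra is a bigraded vector space with maps $m_n$ ($n\ge1$) of bidegree $(2-n,0)$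 satisfying $\sum_{r+s+t=n,\,s\ge1}(-1)^{r+st}m_{r+1+t}(\mathrm{id}^{\otimes r}\otimes m_s\otimes \mathrm{id}^{\otimes t})=0$ for all $n\geq 1$ (Koszul sign rule on elements, for the first degree only), and with a strict unit. A morphism $f$ from it to a DG algebra $C$ consists of maps $f_n$ ($n\ge1$) of bidegree $(1-n,0)$ with $$\sum_{r+s+t=n,\,s\ge1}(-1)^{r+st}f_{r+1+t}(\mathrm{id}^{\otimes r}\otimes m_s\otimes \mathrm{id}^{\otimes t})=\partial f_n+\sum_{i+j=n,\ i,j\ge1}(-1)^{i-1}f_i\cdot f_j ,$$ $f_1(1)=1$, and $f_n(\dots,1,\dots)=0$ for $n\ge2$. An *$A_\infty$-model for $E$* is an Adams graded $A_\infty$-algebra structure on $E$ with $m_1=0$, with $m_2$ the product induced by composition, and admitting a morphism $f:E\to\operatorname{End}_A(P)$ such that $f_1$ induces the identity on cohomology (so $f$ is a quasi-isomorphism). *Generators and relations.* A *presentation* $(Q,\theta,R)$ of $A$ consists of: a graded complement $Q$ of $\mathfrak m^2$ in $\mathfrak m$; a graded linear section $\theta:A\to T(Q)$ of the multiplication map $T(Q)\to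 A$ that is the identity on $k$ and on $Q$ and satisfies $\theta(\mathfrak m)\subset Q\otimes\theta(A)$; and a graded subspace $R\subset Q\otimes\theta(\mathfrak m)\subset T(Q)$ that generates $\ker(T(Q)\to A)$ as a two-sided ideal and is minimal among graded subspaces with this property. **Proposition.** Presentations of $A$ exist. For every presentation $(Q,\theta,R)$ and every graded free resolution $P$ of $k_A$, the following natural identifications of graded vector spaces exist. Fix $u\in P^0$ of Adams degree $0$ over $1\in k$, and write $\bar x\in k$ for the image of $x\in P^0$. * $E^1\cong Q^\#$: $[z](q)=\overline{z(y)}$ whenever $y\in P^{-1}$ and $dy=uq$. * $E^2\cong R^\#$: $[z](r)=\overline{z(v)}$ whenever $r=\sum_i q_i\otimes\theta(a_i)$ with $q_i\in Q$, $a_i\in\mathfrak m$, and $y_i\in P^{-1}$, $v\in P^{-2}$ satisfy $dy_i=uq_i$ and $dv=\sum_i y_ia_i$. (These do not depend on the choices.) Moreover there is an $A_\infty$-model $(m_n)$ for $E$, all of whose multiplications preserve the full $\mathbb Z\oplus G$-grading, such that for all $n\ge2$ the restriction of $m_n$ to $(E^1)^{\otimes n}$ is the dual of the map $R\hookrightarrow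 T(Q)\to Q^{\otimes n}$: for homogeneous $b_1,\dots,b_n\in E^1=Q^\#$ and $r\in R$ with component $\sum_j q_{j,1}\otimes\cdots\otimes q_{j,n}$ of tensor length $n$, $$m_n(b_1\otimes\cdots\otimes b_n)(r)=(-1)^{n(n-1)/2}\sum_j b_n(q_{j,1})\,b_{n-1}(q_{j,2})\cdots b_1(q_{j,n}).$$ The sign is the Koszul sign of pairing degree $1$ with degree $-1$ elements; the order is reversed because endomorphisms of right modules compose on the left. -/

import Mathlib

open scoped DirectSum

namespace ExtAInf

/-! ### Graded vector spaces -/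

section Graded

variable {k : Type*} [Field k]

/-- `W` is a graded subspace of a vector space graded by the subspaces `𝒱 d`: it is spanned by
its homogeneous elements. -/
def IsGradedSubspace {ι V : Type*} [AddCommGroup V] [Module k V] (𝒱 : ι → Submodule k V)
    (W : Submodule k V) : Prop :=
  W ≤ ⨆ d, W ⊓ 𝒱 d

/-- The degree `e` part of the graded dual `W^#` of a graded subspace `W`: the functionals on `W`
that vanish on all homogeneous elements of `W` of degree different from `-e`. -/
def gradedDual {Γ V : Type*} [AddCommGroup Γ] [AddCommGroup V] [Module k V]
    (𝒱 : Γ → Submodule k V) (W : Submodule k V) (e : Γ) : Submodule k (Module.Dual k W) where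
  carrier := {b | ∀ d, d ≠ -e → ∀ x : W, (x : V) ∈ 𝒱 d → b x = 0}
  add_mem' := by
    intro b c hb hc d hd x hx
    simp [hb d hd x hx, hc d hd x hx]
  zero_mem' := by
    intro d hd x hx
    simp
  smul_mem' := by
    intro t b hb d hd x hx
    simp [hb d hd x hx]

end Graded

/-! ### `A_∞`-algebras with an Adams grading, DG algebras, and morphisms

Bidegrees are pairs `(p, e)`: `p : ℤ` is the (cohomological) degree, `e : Γ` the Adams degree.
Only `p` contributes to the Koszul signs. -/

set_option linter.unusedSectionVars false
set_option linter.unnecessarySeqFocus false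

section AInfinity

variable {k : Type*} [Field k] {Γ : Type*} [AddCommGroup Γ] [DecidableEq Γ]

/-- The sequence `a₀, …, a_{r-1}, x, a_{r+s}, a_{r+s+1}, …`: the block `a_r, …, a_{r+s-1}` of
length `s` is replaced by the single element `x`. -/
def splice {V : Type*} (a : ℕ → V) (r s : ℕ) (x : V) : ℕ → V :=
  fun i => if i < r then a i else if i = r then x else a (i - 1 + s)

/-- The alternating sum `∑ (-1)^(r+st) g_(r+1+t) (id^r ⊗ m_s ⊗ id^t)` over all `n = r + s + t` with
`s ≥ 1`, evaluated on homogeneous elements `a₀, a₁, …` of degrees `p₀, p₁, …`; by the Koszul rule,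
moving `m_s` (of degree `2 - s`) past `a₀, …, a_{r-1}` gives the sign with exponent
`(2 - s)(p₀ + ⋯ + p_{r-1})`. -/
def stasheffSum {V W : Type*} [AddCommGroup V] [Module k V] [AddCommGroup W] [Module k W]
    (m : (n : ℕ) → MultilinearMap k (fun _ : Fin n => V) V)
    (g : (n : ℕ) → MultilinearMap k (fun _ : Fin n => V) W) (n : ℕ) (p : ℕ → ℤ) (a : ℕ → V) : W :=
  ∑ s ∈ Finset.Icc 1 n, ∑ x ∈ Finset.HasAntidiagonal.antidiagonal (n - s),
    Int.negOnePow ((x.1 : ℤ) + (s : ℤ) * (x.2 : ℤ) +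
        (2 - (s : ℤ)) * ∑ i ∈ Finset.range x.1, p i) •
      g (x.1 + 1 + x.2)
        (fun i => splice a x.1 s (m s (fun l => a (x.1 + (l : ℕ)))) i)

/-- The (strictly unital) `A_∞`-algebra structures with `Γ`-Adams grading on the vector space `V`
with bigrading `𝒱`.  Operations `m n` are considered for `n ≥ 1` only; `m 0` plays no role. -/
structure AInfinityAlgebra {V : Type*} [AddCommGroup V] [Module k V]
    (𝒱 : ℤ × Γ → Submodule k V) where
  isInternal : DirectSum.IsInternal 𝒱
  m : (n : ℕ) → MultilinearMap k (fun _ : Fin n => V) V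
  /-- `m n` has degree `2 - n` and preserves the Adams grading. -/
  m_mem : ∀ n, 1 ≤ n → ∀ (p : Fin n → ℤ × Γ) (a : Fin n → V), (∀ i, a i ∈ 𝒱 (p i)) →
    m n a ∈ 𝒱 (∑ i, p i + (2 - (n : ℤ), 0))
  /-- Stasheff's identities, evaluated on homogeneous elements. -/
  stasheff : ∀ n, 1 ≤ n → ∀ (p : ℕ → ℤ × Γ) (a : ℕ → V), (∀ i, a i ∈ 𝒱 (p i)) →
    stasheffSum m m n (fun i => (p i).1) a = 0
  one : V
  one_mem : one ∈ 𝒱 0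
  one_m : ∀ a, m 2 ![one, a] = a
  m_one : ∀ a, m 2 ![a, one] = a
  m_of_one : ∀ n, n ≠ 2 → ∀ a : Fin n → V, (∃ i, a i = one) → m n a = 0

/-- DG algebra structures (with `Γ`-Adams grading) on the direct sum of the subspaces `deg j` of
an algebra `D`.  `diff p` is the differential on elements of degree `p`. -/
structure DGAlgebra (k : Type*) [Field k] (Γ : Type*) [AddCommGroup Γ] (D : Type*) [Ring D]
    [Algebra k D] where
  deg : ℤ × Γ → Submodule k D
  independent : iSupIndep deg
  one_mem : 1 ∈ deg 0
  mul_mem : ∀ i j x y, x ∈ deg i → y ∈ deg j → x * y ∈ deg (i + j)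
  diff : ℤ → D →ₗ[k] D
  diff_mem : ∀ j x, x ∈ deg j → diff j.1 x ∈ deg (j.1 + 1, j.2)
  diff_diff : ∀ j x, x ∈ deg j → diff (j.1 + 1) (diff j.1 x) = 0
  leibniz : ∀ i j x y, x ∈ deg i → y ∈ deg j →
    diff (i.1 + j.1) (x * y) = diff i.1 x * y + i.1.negOnePow • (x * diff j.1 y)

namespace DGAlgebra

variable {D : Type*} [Ring D] [Algebra k D] (C : DGAlgebra k Γ D)

def cocycles (j : ℤ × Γ) : Submodule k D := C.deg j ⊓ LinearMap.ker (C.diff j.1)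

def coboundaries (j : ℤ × Γ) : Submodule k D := (C.deg (j.1 - 1, j.2)).map (C.diff (j.1 - 1))

/-- The bidegree `j` part of the cohomology. -/
def H (j : ℤ × Γ) : Type _ := C.cocycles j ⧸ (C.coboundaries j).submoduleOf (C.cocycles j)

instance (j : ℤ × Γ) : AddCommGroup (C.H j) :=
  Submodule.Quotient.addCommGroup ((C.coboundaries j).submoduleOf (C.cocycles j))

instance (j : ℤ × Γ) : Module k (C.H j) :=
  Submodule.Quotient.module ((C.coboundaries j).submoduleOf (C.cocycles j))

/-- The cohomology, a bigraded vector space. -/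
abbrev Cohomology : Type _ := ⨁ j : ℤ × Γ, C.H j

/-- The bigrading of the cohomology. -/
def cohomologyDeg (j : ℤ × Γ) : Submodule k C.Cohomology :=
  LinearMap.range (DirectSum.lof k (ℤ × Γ) C.H j)

/-- The class of a cocycle in bidegree `j` of the cohomology. -/
def toH (j : ℤ × Γ) (z : C.cocycles j) : C.H j :=
  Submodule.mkQ ((C.coboundaries j).submoduleOf (C.cocycles j)) z

/-- The class of a cocycle in the total cohomology. -/
def cls (j : ℤ × Γ) (z : C.cocycles j) : C.Cohomology :=
  DirectSum.lof k (ℤ × Γ) C.H j (C.toH j z)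

theorem mul_mem_cocycles {i j : ℤ × Γ} {x y : D} (hx : x ∈ C.cocycles i)
    (hy : y ∈ C.cocycles j) : x * y ∈ C.cocycles (i + j) := by
  obtain ⟨hx1, hx2⟩ := hx
  obtain ⟨hy1, hy2⟩ := hy
  refine ⟨C.mul_mem _ _ _ _ hx1 hy1, ?_⟩
  replace hx2 : C.diff i.1 x = 0 := hx2
  replace hy2 : C.diff j.1 y = 0 := hy2
  show C.diff (i + j).1 (x * y) = 0
  rw [Prod.fst_add, C.leibniz i j x y hx1 hy1, hx2, hy2]
  simp

/-- The product of cocycles. -/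
def mulCocycles {i j : ℤ × Γ} (x : C.cocycles i) (y : C.cocycles j) : C.cocycles (i + j) :=
  ⟨x.1 * y.1, C.mul_mem_cocycles x.2 y.2⟩

end DGAlgebra

/-- A (strictly unital) morphism of `A_∞`-algebras, preserving the Adams grading, from an
`A_∞`-algebra to a DG algebra `C`, where `C` is viewed as an `A_∞`-algebra with `m₁ = diff`, `m₂`
the product and `m_q = 0` for `q ≥ 3` (so only `q = 1, 2` occur on the right-hand side of
Stasheff's morphism identities).  Components `f n` are considered for `n ≥ 1` only. -/
structure AInfinityMorphismToDG {V : Type*} [AddCommGroup V] [Module k V]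
    {𝒱 : ℤ × Γ → Submodule k V} (M : AInfinityAlgebra 𝒱) {D : Type*} [Ring D] [Algebra k D]
    (C : DGAlgebra k Γ D) where
  f : (n : ℕ) → MultilinearMap k (fun _ : Fin n => V) D
  /-- `f n` has degree `1 - n` and preserves the Adams grading. -/
  f_mem : ∀ n, 1 ≤ n → ∀ (p : Fin n → ℤ × Γ) (a : Fin n → V), (∀ i, a i ∈ 𝒱 (p i)) →
    f n a ∈ C.deg (∑ i, p i + (1 - (n : ℤ), 0))
  /-- `∑ (-1)^(r+st) f_(r+1+t) (id^r ⊗ m_s ⊗ id^t) = m₁ f_n + ∑ (-1)^(i-1) m₂ (f_i ⊗ f_j)`,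
  evaluated on homogeneous elements with the Koszul signs. -/
  morphism : ∀ n, 1 ≤ n → ∀ (p : ℕ → ℤ × Γ) (a : ℕ → V), (∀ i, a i ∈ 𝒱 (p i)) →
    stasheffSum M.m f n (fun i => (p i).1) a =
      C.diff (∑ i ∈ Finset.range n, (p i).1 + 1 - (n : ℤ)) (f n (fun i => a i)) +
      ∑ x ∈ (Finset.HasAntidiagonal.antidiagonal n).filter (fun x => 1 ≤ x.1 ∧ 1 ≤ x.2),
        Int.negOnePow (((x.1 : ℤ) - 1) + (1 - (x.2 : ℤ)) * ∑ i ∈ Finset.range x.1, (p i).1) •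
          (f x.1 (fun i => a i) * f x.2 (fun i => a (x.1 + (i : ℕ))))
  f_one : f 1 (fun _ => M.one) = 1
  f_of_one : ∀ n, 2 ≤ n → ∀ a : Fin n → V, (∃ i, a i = M.one) → f n a = 0

/-- `M` is an `A_∞`-structure on the cohomology of the DG algebra `C` which is a model for `C`:
`m₁ = 0`, `m₂` is the product induced by that of `C`, and there is a quasi-isomorphism of
`A_∞`-algebras to `C` that lifts the identity of the cohomology. -/
structure IsModel {D : Type*} [Ring D] [Algebra k D] (C : DGAlgebra k Γ D)
    (M : AInfinityAlgebra C.cohomologyDeg) : Prop where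
  m_one_eq_zero : M.m 1 = 0
  m_two : ∀ (i j : ℤ × Γ) (x : C.cocycles i) (y : C.cocycles j),
    M.m 2 ![C.cls i x, C.cls j y] = C.cls (i + j) (C.mulCocycles x y)
  quasiIso : ∃ φ : AInfinityMorphismToDG M C, ∀ (j : ℤ × Γ) (z : C.cocycles j),
    φ.f 1 (fun _ => C.cls j z) - z.1 ∈ C.coboundaries j

end AInfinity

/-! ### Connected graded algebras, generators and relations -/

section Algebras

variable {k : Type*} [Field k] {G : Type*} [AddCommGroup G] [DecidableEq G]
  {A : Type*} [Ring A] [Algebra k A]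

/-- The degree `n` part of a `ℤ ⊕ G`-graded algebra with respect to the `ℤ`-grading. -/
def zPart (𝒜 : ℤ × G → Submodule k A) (n : ℤ) : Submodule k A := ⨆ g, 𝒜 (n, g)

/-- With respect to the `ℤ`-grading, `A = k ⊕ A₁ ⊕ A₂ ⊕ ⋯`. -/
structure IsConnectedGraded (𝒜 : ℤ × G → Submodule k A) : Prop where
  one_ne_zero : (1 : A) ≠ 0
  zero : zPart 𝒜 0 = Submodule.span k {1}
  neg : ∀ n, n < 0 → zPart 𝒜 n = ⊥

/-- With respect to the `ℤ`-grading, `A` is generated as an algebra by a set of homogeneous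
elements that has only finitely many elements in each degree. -/
def LocallyFinitelyGenerated (𝒜 : ℤ × G → Submodule k A) : Prop :=
  ∃ S : Set A, (∀ x ∈ S, ∃ n, x ∈ zPart 𝒜 n) ∧ (∀ n, {x ∈ S | x ∈ zPart 𝒜 n}.Finite) ∧
    Algebra.adjoin k S = ⊤

/-- The augmentation ideal `𝔪 = A₁ ⊕ A₂ ⊕ ⋯`. -/
def augIdeal (𝒜 : ℤ × G → Submodule k A) : Submodule k A :=
  ⨆ (d : ℤ × G) (_ : 0 < d.1), 𝒜 d

/-- The Adams degree `d` part of the tensor algebra of a graded subspace `Q` of `A`. -/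
def tensorDeg (𝒜 : ℤ × G → Submodule k A) (Q : Submodule k A) (d : ℤ × G) :
    Submodule k (TensorAlgebra k Q) :=
  Submodule.span k {x | ∃ (n : ℕ) (q : Fin n → Q) (e : Fin n → ℤ × G),
    (∀ i, (q i : A) ∈ 𝒜 (e i)) ∧ ∑ i, e i = d ∧ x = TensorAlgebra.tprod k Q n q}

/-- The multiplication map `T(Q) → A`. -/
def mulMap (Q : Submodule k A) : TensorAlgebra k Q →ₐ[k] A := TensorAlgebra.lift k Q.subtype

/-- Choices of generators and relations for `A`, all of them `ℤ ⊕ G`-graded. -/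
structure Presentation (𝒜 : ℤ × G → Submodule k A) where
  /-- A graded complement `Q` of `𝔪²` in `𝔪`, so that `Q ≅ 𝔪 / 𝔪²`. -/
  Q : Submodule k A
  Q_graded : IsGradedSubspace 𝒜 Q
  Q_sup : Q ⊔ augIdeal 𝒜 * augIdeal 𝒜 = augIdeal 𝒜
  Q_inf : Q ⊓ augIdeal 𝒜 * augIdeal 𝒜 = ⊥
  /-- A graded embedding of `A` into `T(Q)` that splits the multiplication map and is the
  identity on `k` and on `Q`.  It is of the form `θ = (id_Q ⊗ θ) ξ` on `𝔪`, for a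
  splitting `ξ` of the multiplication `Q ⊗ A → 𝔪`. -/
  θ : A →ₗ[k] TensorAlgebra k Q
  θ_graded : ∀ d, ∀ a ∈ 𝒜 d, θ a ∈ tensorDeg 𝒜 Q d
  θ_splits : ∀ a, mulMap Q (θ a) = a
  θ_one : θ 1 = 1
  θ_gen : ∀ q : Q, θ (q : A) = TensorAlgebra.ι k q
  θ_rec : ∀ a ∈ augIdeal 𝒜,
    θ a ∈ Submodule.span k {x | ∃ (q : Q) (b : A), x = TensorAlgebra.ι k q * θ b}
  /-- A minimal graded space of relations, contained in `Q ⊗ θ(𝔪)`. -/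
  R : Submodule k (TensorAlgebra k Q)
  R_graded : IsGradedSubspace (tensorDeg 𝒜 Q) R
  R_le : R ≤ Submodule.span k
    {x | ∃ (q : Q) (a : A), a ∈ augIdeal 𝒜 ∧ x = TensorAlgebra.ι k q * θ a}
  R_generates : (⊤ : Submodule k (TensorAlgebra k Q)) * R * ⊤ =
    LinearMap.ker (mulMap Q).toLinearMap
  R_minimal : ∀ R' ≤ R, IsGradedSubspace (tensorDeg 𝒜 Q) R' →
    (⊤ : Submodule k (TensorAlgebra k Q)) * R' * ⊤ = LinearMap.ker (mulMap Q).toLinearMap →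
    R' = R

/-- The functional `T(Q) → Q^{⊗n} → k` that takes the component of tensor length `n` and sends
`q₀ ⊗ ⋯ ⊗ q_{n-1}` to `b₀(q₀) ⋯ b_{n-1}(q_{n-1})`. (No Koszul sign is included here.) -/
noncomputable def wordPairing {Q : Submodule k A} {n : ℕ} (b : Fin n → Module.Dual k Q) :
    TensorAlgebra k Q →ₗ[k] k :=
  (PiTensorProduct.lift ((MultilinearMap.mkPiAlgebra k (Fin n) k).compLinearMap b)) ∘ₗ
    (DirectSum.component k ℕ (fun i => PiTensorProduct k (fun _ : Fin i => Q)) n) ∘ₗ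
      TensorAlgebra.equivDirectSum.toLinearMap

end Algebras

/-! ### Graded free resolutions of the trivial module and their endomorphism DG algebras -/

section Resolutions

variable {k : Type*} [Field k] {G : Type*} [AddCommGroup G] [DecidableEq G]
  {A : Type*} [Ring A] [Algebra k A]

/-- A graded free resolution `⋯ → P^{-1} → P^0 → k → 0` of the trivial right `A`-module
`k = A / A_{≥1}`.  The module `P` is the direct sum of all terms, bigraded by cohomological degree
`p ≤ 0` and Adams degree; right `A`-modules are `Aᵐᵒᵖ`-modules. -/
structure GradedFreeResolution (𝒜 : ℤ × G → Submodule k A) (P : Type*) [AddCommGroup P]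
    [Module k P] [Module Aᵐᵒᵖ P] [IsScalarTower k Aᵐᵒᵖ P] where
  deg : ℤ × (ℤ × G) → Submodule k P
  isInternal : DirectSum.IsInternal deg
  smul_mem : ∀ j d x a, x ∈ deg j → a ∈ 𝒜 d → MulOpposite.op a • x ∈ deg (j + (0, d))
  nonpos : ∀ j : ℤ × (ℤ × G), 0 < j.1 → deg j = ⊥
  /-- `P` has a basis of homogeneous elements over `A`. -/
  free : ∃ S : Set P, (∀ x ∈ S, ∃ j, x ∈ deg j) ∧
    LinearIndependent Aᵐᵒᵖ (Subtype.val : S → P) ∧ Submodule.span Aᵐᵒᵖ S = ⊤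
  /-- The differential. -/
  d : Module.End Aᵐᵒᵖ P
  d_mem : ∀ j x, x ∈ deg j → d x ∈ deg (j.1 + 1, j.2)
  /-- The augmentation `P → P^0 → k`. -/
  aug : P →ₗ[k] k
  aug_smul : ∀ x, ∀ a ∈ augIdeal 𝒜, aug (MulOpposite.op a • x) = 0
  aug_deg : ∀ j, j ≠ 0 → ∀ x ∈ deg j, aug x = 0
  aug_surjective : Function.Surjective aug
  exact : ∀ x, (d x = 0 ∧ aug x = 0) ↔ x ∈ LinearMap.range d

namespace GradedFreeResolution

variable {𝒜 : ℤ × G → Submodule k A} {P : Type*} [AddCommGroup P]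
    [Module k P] [Module Aᵐᵒᵖ P] [IsScalarTower k Aᵐᵒᵖ P] (F : GradedFreeResolution 𝒜 P)

/-- The `A`-linear endomorphisms of `P` that are homogeneous of bidegree `j`. -/
def endDeg (j : ℤ × (ℤ × G)) : Submodule k (Module.End Aᵐᵒᵖ P) where
  carrier := {f | ∀ i, ∀ x ∈ F.deg i, f x ∈ F.deg (j + i)}
  add_mem' := by
    intro f g hf hg i x hx
    exact add_mem (hf i x hx) (hg i x hx)
  zero_mem' := by
    intro i x hx
    simp
  smul_mem' := by
    intro c f hf i x hx
    exact Submodule.smul_mem _ c (hf i x hx)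

/-- The differential of the endomorphism algebra, `f ↦ d ∘ f - (-1)^p f ∘ d` in degree `p`. -/
noncomputable def endDiff (p : ℤ) : Module.End Aᵐᵒᵖ P →ₗ[k] Module.End Aᵐᵒᵖ P :=
  LinearMap.mulLeft k F.d - p.negOnePow • LinearMap.mulRight k F.d

theorem endDiff_apply (p : ℤ) (f : Module.End Aᵐᵒᵖ P) :
    F.endDiff p f = F.d * f - p.negOnePow • (f * F.d) := rfl

theorem d_mul_d : F.d * F.d = 0 := by
  ext x
  exact ((F.exact (F.d x)).2 ⟨x, rfl⟩).1

theorem ext_of_homogeneous {f g : Module.End Aᵐᵒᵖ P} (h : ∀ i, ∀ x ∈ F.deg i, f x = g x) :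
    f = g := by
  ext x
  have hx : x ∈ ⨆ i, F.deg i := by
    rw [F.isInternal.submodule_iSup_eq_top]; trivial
  induction hx using Submodule.iSup_induction' with
  | mem i x hx => exact h i x hx
  | zero => simp
  | add x y _ _ hx hy => simp [hx, hy]

theorem endDeg_independent : iSupIndep F.endDeg := by
  rw [iSupIndep_iff_finsetSum_eq_zero_imp_eq_zero]
  intro s f hf hsum j hj
  refine F.ext_of_homogeneous fun i x hx => ?_
  have hP : iSupIndep fun l => F.deg (l + i) :=
    F.isInternal.submodule_iSupIndep.comp (add_left_injective i)
  rw [iSupIndep_iff_finsetSum_eq_zero_imp_eq_zero] at hP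
  refine hP s (fun l => f l x) (fun l hl => hf l hl i x hx) ?_ j hj
  have := congrArg (fun g : Module.End Aᵐᵒᵖ P => g x) hsum
  simpa [LinearMap.sum_apply] using this

/-- The DG algebra `End_A(P)`: sums of homogeneous endomorphisms, with composition as product. -/
noncomputable def endDG : DGAlgebra k (ℤ × G) (Module.End Aᵐᵒᵖ P) where
  deg := F.endDeg
  independent := F.endDeg_independent
  one_mem := by
    intro i x hx
    simpa using hx
  mul_mem := by
    intro i j f g hf hg l x hx
    have := hf _ _ (hg l x hx)
    rwa [← add_assoc] at this
  diff := F.endDiff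
  diff_mem := by
    intro j f hf i x hx
    rw [endDiff_apply]
    have e1 : (j.1 + 1, j.2) + i = ((j + i).1 + 1, (j + i).2) := by
      ext <;> simp <;> ring
    have e2 : (j.1 + 1, j.2) + i = j + (i.1 + 1, i.2) := by
      ext <;> simp <;> ring
    have h1 : F.d (f x) ∈ F.deg ((j.1 + 1, j.2) + i) := by
      rw [e1]; exact F.d_mem _ _ (hf i x hx)
    have h2 : f (F.d x) ∈ F.deg ((j.1 + 1, j.2) + i) := by
      rw [e2]; exact hf _ _ (F.d_mem _ _ hx)
    rcases Int.even_or_odd j.1 with h | h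
    · simpa [Int.negOnePow_even _ h] using sub_mem h1 h2
    · simpa [Int.negOnePow_odd _ h] using add_mem h1 h2
  diff_diff := by
    intro j f hf
    have hd := F.d_mul_d
    simp only [endDiff_apply, Int.negOnePow_succ, mul_sub, sub_mul, ← mul_assoc, hd]
    rcases Int.even_or_odd j.1 with h | h
    · simp [Int.negOnePow_even _ h, mul_assoc, hd]
    · simp [Int.negOnePow_odd _ h, mul_assoc, hd]
  leibniz := by
    intro i j f g hf hg
    simp only [endDiff_apply, Int.negOnePow_add]
    rcases Int.even_or_odd i.1 with h | h <;> rcases Int.even_or_odd j.1 with h' | h' <;>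
      simp [Int.negOnePow_even, Int.negOnePow_odd, h, h', mul_sub, sub_mul, mul_add, add_mul,
        mul_assoc] <;>
      abel

/-- The term of `P` in cohomological degree `p`. -/
def term (p : ℤ) : Submodule k P := ⨆ e, F.deg (p, e)

/-- The bigraded vector space `Ext_A^*(k, k)`, as the cohomology of `End_A(P)`. -/
abbrev Ext : Type _ := F.endDG.Cohomology

/-- `φ` is the natural identification `Ext^1 = Q^#`: the value of the class of a cocycle `z` at
`q ∈ Q` is found by writing `u q = d y` with `y ∈ P^{-1}`, for an element `u ∈ P^0` of Adams degree
`0` over `1 ∈ k`, and taking the image of `z y ∈ P^0` in `k`. -/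
def IsNaturalOne (D : Presentation 𝒜)
    (φ : ∀ e, F.endDG.H (1, e) ≃ₗ[k] gradedDual 𝒜 D.Q e) : Prop :=
  ∀ (e : ℤ × G) (z : F.endDG.cocycles (1, e)) (u : P) (q : D.Q) (y : P),
    u ∈ F.deg 0 → F.aug u = 1 → y ∈ F.term (-1) → F.d y = MulOpposite.op (q : A) • u →
      (φ e (F.endDG.toH (1, e) z)).1 q = F.aug (z.1 y)

/-- `φ` is the natural identification `Ext^2 = R^#`: the value of the class of a cocycle `z` at
`r = ∑ qᵢ ⊗ θ(aᵢ) ∈ R` is found by writing `u qᵢ = d yᵢ` with `yᵢ ∈ P^{-1}`, then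
`∑ yᵢ aᵢ = d v` with `v ∈ P^{-2}`, and taking the image of `z v ∈ P^0` in `k`. -/
def IsNaturalTwo (D : Presentation 𝒜)
    (φ : ∀ e, F.endDG.H (2, e) ≃ₗ[k] gradedDual (tensorDeg 𝒜 D.Q) D.R e) : Prop :=
  ∀ (e : ℤ × G) (z : F.endDG.cocycles (2, e)) (u : P) (n : ℕ) (q : Fin n → D.Q) (a : Fin n → A)
    (y : Fin n → P) (v : P) (r : D.R),
    u ∈ F.deg 0 → F.aug u = 1 → (∀ i, a i ∈ augIdeal 𝒜) →
    (r : TensorAlgebra k D.Q) = ∑ i, TensorAlgebra.ι k (q i) * D.θ (a i) →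
    (∀ i, y i ∈ F.term (-1)) → (∀ i, F.d (y i) = MulOpposite.op (q i : A) • u) →
    v ∈ F.term (-2) → F.d v = ∑ i, MulOpposite.op (a i) • y i →
      (φ e (F.endDG.toH (2, e) z)).1 r = F.aug (z.1 v)

end GradedFreeResolution

end Resolutions

end ExtAInf

open ExtAInf

open scoped DirectSum

namespace ExtAInf

/-! ### Sums over the decompositions of a word -/

section SplitSum

variable {V M M' : Type*} [AddCommGroup M] [AddCommGroup M']

/-! The multiplications are read off from one well-chosen `A_∞`-quasi-isomorphism `f : E →
End_A(P)`. Homotopy transfer (Kadeishvili) builds the operations and the components `f_n` by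
recursion on the number of inputs, from linear representatives `f₁` of the classes and from
primitives of the coboundaries. If the primitives are taken in prescribed subspaces `W`, then every
`f_n` with `n ≥ 2` lies in `W` (`DGAlgebra.exists_model`). The freedom in `f₁` and `W` is spent on
making evaluation on relations easy.

In `P` fix `u` over `1`, elements `y_q` with `d y_q = u q`, and for each relation `r = ∑ qᵢ ⊗ θ(aᵢ)`
an element `v_r` with `d v_r = ∑ y_{qᵢ} aᵢ`. The resolution need not be minimal, but `q ↦ y_q` and
`r ↦ v_r` identify `Q` and `R` with the homology of `P / P𝔪` in degrees `-1` and `-2`. For `R` this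
rests on a graded Nakayama lemma (`ideal_eq_relIdeal`): minimality of `R` says that `R` meets the
decomposable relations `Q I + I T(Q)_{≥1}` trivially (`Presentation.R_inf_relSq`), where `I` is the
ideal of relations. Dualizing gives `E^1 = Q^#` and `E^2 = R^#` (`exists_identification`).

Linear maps prescribed on the `y_q`, or on the `v_r`, extend to `A`-linear endomorphisms
(`exists_extension`), so endomorphisms can be normalized by coboundaries. Let `κ'` be a section of
`d` with `κ'(u a) = ∑ y_{qᵢ} aᵢ` when `θ(a) = ∑ qᵢ ⊗ θ(aᵢ)`. Representatives of degree `1` are made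
to satisfy `z(y_q) = b(q) u` and `z(v_r) = κ'(d z(v_r))`; those of degree `2` have `z(v_r) ∈ k u`.
Elements of `W` in degree `1` kill the `y_q` and satisfy the same `κ'` equation; those in degree `2`
kill the `v_r`.

Now evaluate the morphism identity on `v_r` with inputs `b_1, …, b_n ∈ E^1`. The terms containing an
inner `m_s` with `s < n` vanish, `f_n` kills `d v_r`, and `f_i f_j` vanishes for `i ≥ 2` because
`f_j(v_r)` is an `A`-combination of the `y_q`. What remains is `m_n(b)(r) u = d f_n(v_r) ± f_1(b_1)
f_{n-1}(b_2, …, b_n)(v_r)`. Writing `d f_n(v_r) = u x_n`, this expresses `x_n` as `m_n(b)(r)` minus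
a signed contraction of `x_{n-1}` with `b_1`, and `θ` turns the contraction into contraction of the
first letter of a tensor. Inductively `θ(x_n)` is `m_n(b)(r)` minus `(-1)^(n(n-1)/2)` times the
contraction of the first `n` letters of `r`, with `b_n` applied to the first letter. Since `x_n ∈
𝔪`, the constant term of `θ(x_n)` is zero, which is the asserted formula (`coeff_eq_wordPairing`).

Presentations are constructed by solving `θ = ε + (id ⊗ θ) ξ` degree by degree, `ξ` being a section
of the multiplication `Q ⊗ A → 𝔪`, and by taking for `R` a complement of the decomposable relations
inside `I ∩ Q ⊗ θ(𝔪)`. -/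

/-- The sum of `g x y` over all decompositions `w = x ++ y`. -/
def splitSum {V M : Type*} [AddCommGroup M] : (List V → List V → M) → List V → M
  | g, [] => g [] []
  | g, a :: w => g [] (a :: w) + splitSum (fun x y => g (a :: x) y) w

@[simp] theorem splitSum_nil (g : List V → List V → M) : splitSum g [] = g [] [] := rfl

theorem splitSum_cons (g : List V → List V → M) (a : V) (w : List V) :
    splitSum g (a :: w) = g [] (a :: w) + splitSum (fun x y => g (a :: x) y) w := rfl

theorem splitSum_congr {g g' : List V → List V → M} {w : List V}
    (h : ∀ x y, x ++ y = w → g x y = g' x y) : splitSum g w = splitSum g' w := by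
  induction w generalizing g g' with
  | nil => exact h [] [] rfl
  | cons a w ih =>
    rw [splitSum_cons, splitSum_cons, h [] _ rfl, ih]
    rintro x y rfl
    exact h _ _ rfl

theorem splitSum_eq_zero {g : List V → List V → M} {w : List V}
    (h : ∀ x y, x ++ y = w → g x y = 0) : splitSum g w = 0 := by
  induction w generalizing g with
  | nil => exact h [] [] rfl
  | cons a w ih =>
    rw [splitSum_cons, h [] _ rfl, ih, add_zero]
    rintro x y rfl
    exact h _ _ rfl

theorem splitSum_add (g g' : List V → List V → M) (w : List V) :
    splitSum (fun x y => g x y + g' x y) w = splitSum g w + splitSum g' w := by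
  induction w generalizing g g' with
  | nil => rfl
  | cons a w ih => simp only [splitSum_cons, ih]; abel

theorem map_splitSum (f : M →+ M') (g : List V → List V → M) (w : List V) :
    f (splitSum g w) = splitSum (fun x y => f (g x y)) w := by
  induction w generalizing g with
  | nil => rfl
  | cons a w ih => simp only [splitSum_cons, map_add, ih]

theorem splitSum_neg (g : List V → List V → M) (w : List V) :
    splitSum (fun x y => - g x y) w = - splitSum g w :=
  (map_splitSum (-AddMonoidHom.id M) g w).symm

theorem splitSum_sub (g g' : List V → List V → M) (w : List V) :
    splitSum (fun x y => g x y - g' x y) w = splitSum g w - splitSum g' w := by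
  simp only [sub_eq_add_neg, splitSum_add, splitSum_neg]

theorem splitSum_mul {R : Type*} [Ring R] (g : List V → List V → R) (w : List V) (c : R) :
    splitSum g w * c = splitSum (fun x y => g x y * c) w :=
  map_splitSum (AddMonoidHom.mulRight c) g w

theorem mul_splitSum {R : Type*} [Ring R] (g : List V → List V → R) (w : List V) (c : R) :
    c * splitSum g w = splitSum (fun x y => c * g x y) w :=
  map_splitSum (AddMonoidHom.mulLeft c) g w

theorem splitSum_comm {V' : Type*} (g : List V → List V → List V' → List V' → M) (w : List V)
    (v : List V') :
    splitSum (fun x y => splitSum (fun x' y' => g x y x' y') v) w =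
      splitSum (fun x' y' => splitSum (fun x y => g x y x' y') w) v := by
  induction w generalizing g with
  | nil => rfl
  | cons a w ih => simp only [splitSum_cons, ih, splitSum_add]

/-- Coassociativity of deconcatenation: both sides run over all decompositions into three pieces.
Nearly all manipulations of coderivations below reduce to this and `splitSum_comm`. -/
theorem splitSum_assoc (g : List V → List V → List V → M) (w : List V) :
    splitSum (fun x z => splitSum (fun x₁ x₂ => g x₁ x₂ z) x) w =
      splitSum (fun x₁ y => splitSum (fun x₂ z => g x₁ x₂ z) y) w := by
  induction w generalizing g with
  | nil => rfl
  | cons a w ih =>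
    simp only [splitSum_cons, splitSum_nil, splitSum_add, ih]
    abel

/-- A cut lies either before or after the marked letter `a`. This is how a distinguished letter (a
variable one, an inserted one, or the unit) is followed through sums over decompositions. -/
theorem splitSum_append_cons (g : List V → List V → M) (x : List V) (a : V) (z : List V) :
    splitSum g (x ++ a :: z) = splitSum (fun x₁ x₂ => g x₁ (x₂ ++ a :: z)) x +
      splitSum (fun z₁ z₂ => g (x ++ a :: z₁) z₂) z := by
  induction x generalizing g with
  | nil => simp [splitSum_cons]
  | cons b x ih =>
    simp only [List.cons_append, splitSum_cons, ih]
    abel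

theorem splitSum_map {V' : Type*} (f : V' → V) (g : List V → List V → M) (w : List V') :
    splitSum g (w.map f) = splitSum (fun x y => g (x.map f) (y.map f)) w := by
  induction w generalizing g with
  | nil => rfl
  | cons a w ih => simp only [List.map_cons, splitSum_cons, ih, List.map_nil]

theorem splitSum_eq_left_nil {g : List V → List V → M} {w : List V}
    (h : ∀ a x y, (a :: x) ++ y = w → g (a :: x) y = 0) : splitSum g w = g [] w := by
  cases w with
  | nil => rfl
  | cons a w =>
    rw [splitSum_cons, splitSum_eq_zero, add_zero]
    rintro x y rfl
    exact h _ _ _ rfl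

theorem splitSum_eq_right_nil {g : List V → List V → M} {w : List V}
    (h : ∀ x y, y ≠ [] → x ++ y = w → g x y = 0) : splitSum g w = g w [] := by
  induction w generalizing g with
  | nil => rfl
  | cons a w ih =>
    rw [splitSum_cons, h [] _ (by simp) rfl, zero_add, ih]
    rintro x y hy rfl
    exact h _ _ hy rfl

theorem splitSum_mem {S : Type*} [SetLike S M] [AddSubmonoidClass S M] {s : S}
    {g : List V → List V → M} {w : List V}
    (h : ∀ x y, x ++ y = w → g x y ∈ s) : splitSum g w ∈ s := by
  induction w generalizing g with
  | nil => exact h [] [] rfl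
  | cons a w ih =>
    rw [splitSum_cons]
    refine add_mem (h _ _ rfl) (ih ?_)
    rintro x y rfl
    exact h _ _ rfl

theorem splitSum_eq_sum (g : List V → List V → M) (w : List V) :
    splitSum g w = ∑ i ∈ Finset.range (w.length + 1), g (w.take i) (w.drop i) := by
  induction w generalizing g with
  | nil => simp
  | cons a w ih =>
    rw [splitSum_cons, ih, List.length_cons, Finset.sum_range_succ' _ (w.length + 1), add_comm]
    simp

/-- The sum of `g x y z` over all decompositions `w = x ++ y ++ z`. -/
def tripleSum (g : List V → List V → List V → M) (w : List V) : M :=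
  splitSum (fun x w' => splitSum (fun y z => g x y z) w') w

theorem tripleSum_congr {g g' : List V → List V → List V → M} {w : List V}
    (h : ∀ x y z, x ++ (y ++ z) = w → g x y z = g' x y z) : tripleSum g w = tripleSum g' w :=
  splitSum_congr fun x w' hw => splitSum_congr fun y z hyz => h x y z (by rw [hyz, hw])

theorem tripleSum_eq_zero {g : List V → List V → List V → M} {w : List V}
    (h : ∀ x y z, x ++ (y ++ z) = w → g x y z = 0) : tripleSum g w = 0 :=
  splitSum_eq_zero fun x w' hw => splitSum_eq_zero fun y z hyz => h x y z (by rw [hyz, hw])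

theorem tripleSum_sub (g g' : List V → List V → List V → M) (w : List V) :
    tripleSum (fun x y z => g x y z - g' x y z) w = tripleSum g w - tripleSum g' w := by
  simp only [tripleSum, splitSum_sub]

theorem tripleSum_mem {S : Type*} [SetLike S M] [AddSubmonoidClass S M] {s : S}
    {g : List V → List V → List V → M} {w : List V}
    (h : ∀ x y z, x ++ (y ++ z) = w → g x y z ∈ s) : tripleSum g w ∈ s :=
  splitSum_mem fun x w' hw => splitSum_mem fun y z hyz => h x y z (by rw [hyz, hw])

/-- Isolates the term in which the middle block is the whole word, the only one that involves values
of top length in the inductive constructions. -/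
theorem tripleSum_eq_single {g : List V → List V → List V → M} {w : List V}
    (h : ∀ x y z, x ++ (y ++ z) = w → y.length < w.length → g x y z = 0) :
    tripleSum g w = g [] w [] := by
  unfold tripleSum
  rw [splitSum_eq_left_nil, splitSum_eq_right_nil]
  · rintro x y hy rfl
    refine h [] x y rfl ?_
    have := List.length_pos_iff.2 hy
    simp only [List.length_append]; omega
  · rintro a x y rfl
    refine splitSum_eq_zero ?_
    rintro y z rfl
    refine h _ _ _ rfl ?_
    simp only [List.length_append, List.length_cons]; omega

/-- A function on words that is linear in every letter. -/
def IsMultilinearOnWords (k : Type*) [Field k] {V M : Type*} [AddCommGroup V] [Module k V]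
    [AddCommGroup M] [Module k M] (c : List V → M) : Prop :=
  ∀ x z, IsLinearMap k fun v => c (x ++ v :: z)

variable {k : Type*} [Field k] [Module k M] [Module k M']

theorem IsLinearMap.splitSum {U : Type*} [AddCommGroup U] [Module k U]
    {g : U → List V → List V → M} {w : List V}
    (h : ∀ x y, x ++ y = w → IsLinearMap k fun v => g v x y) :
    IsLinearMap k fun v => splitSum (g v) w := by
  induction w generalizing g with
  | nil => exact h [] [] rfl
  | cons a w ih =>
    have h1 := h [] (a :: w) rfl
    have h2 := ih (g := fun v x y => g v (a :: x) y) (by rintro x y rfl; exact h _ _ rfl)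
    constructor
    · intro u v
      simp only [splitSum_cons, h1.map_add, h2.map_add]; abel
    · intro t v
      simp only [splitSum_cons, h1.map_smul, h2.map_smul, smul_add]

theorem isLinearMap_add {U : Type*} [AddCommGroup U] [Module k U] {f g : U → M}
    (hf : IsLinearMap k f) (hg : IsLinearMap k g) : IsLinearMap k fun v => f v + g v :=
  (hf.mk' f + hg.mk' g).isLinear

theorem isLinearMap_comp {U U' : Type*} [AddCommGroup U] [Module k U] [AddCommGroup U']
    [Module k U'] {f : U' → M} {g : U → U'}
    (hf : IsLinearMap k f) (hg : IsLinearMap k g) : IsLinearMap k fun v => f (g v) :=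
  (hf.mk' f ∘ₗ hg.mk' g).isLinear

end SplitSum

/-! ### Transfer of an `A_∞`-structure along a contraction -/

section Transfer

variable {k : Type*} [Field k] {V : Type*} [AddCommGroup V] [Module k V]
  {M : Type*} [AddCommGroup M] [Module k M] {N : Type*} [Ring N] [Algebra k N]

/-- The action of the coderivation with corestriction `b` on a cochain `c` (with the Koszul signs
given by the involution `σ`). -/
def insertion (σ : V →ₗ[k] V) (b : List V → V) (c : List V → M) (w : List V) : M :=
  tripleSum (fun x y z => c (x.map σ ++ b y :: z)) w

/-- The cup square of a cochain. -/
def cupSquare (σ : V →ₗ[k] V) (F : List V → N) (w : List V) : N :=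
  splitSum (fun x y => F (x.map σ) * F y) w

variable {σ : V →ₗ[k] V}

theorem IsMultilinearOnWords.insertion {b : List V → V} {c : List V → M}
    (hb : IsMultilinearOnWords k b) (hc : IsMultilinearOnWords k c) :
    IsMultilinearOnWords k (insertion σ b c) := by
  intro x z
  simp only [ExtAInf.insertion, tripleSum, splitSum_append_cons]
  refine isLinearMap_add (IsLinearMap.splitSum fun x₁ x₂ _ => isLinearMap_add
    (IsLinearMap.splitSum fun y₁ y₂ _ => ?_) (IsLinearMap.splitSum fun z₁ z₂ _ => ?_))
    (IsLinearMap.splitSum fun z₁ z₂ _ => IsLinearMap.splitSum fun y₁ y₂ _ => ?_)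
  · have := hc (x₁.map σ ++ b y₁ :: y₂) z
    simpa using this
  · exact isLinearMap_comp (f := fun v => c (x₁.map σ ++ v :: z₂)) (hc _ _) (hb _ _)
  · have := isLinearMap_comp (hc (x.map σ) (z₁.map σ ++ b y₁ :: y₂)) σ.isLinear
    simpa using this

theorem IsMultilinearOnWords.cupSquare {F : List V → N}
    (hF : IsMultilinearOnWords k F) : IsMultilinearOnWords k (cupSquare σ F) := by
  intro x z
  simp only [ExtAInf.cupSquare, splitSum_append_cons]
  refine isLinearMap_add (IsLinearMap.splitSum fun x₁ x₂ _ => ?_)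
    (IsLinearMap.splitSum fun x₁ x₂ _ => ?_)
  · exact isLinearMap_comp (LinearMap.mulLeft k (F (x₁.map σ))).isLinear (hF _ _)
  · have h1 := isLinearMap_comp (hF (x.map σ) (x₁.map σ)) σ.isLinear
    have := isLinearMap_comp (LinearMap.mulRight k (F x₂)).isLinear h1
    simpa using this

theorem IsMultilinearOnWords.map_zero {c : List V → M} (hc : IsMultilinearOnWords k c)
    (x z : List V) : c (x ++ 0 :: z) = 0 := (hc x z).map_zero

theorem IsMultilinearOnWords.map_neg {c : List V → M} (hc : IsMultilinearOnWords k c)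
    (x z : List V) (v : V) : c (x ++ (-v) :: z) = - c (x ++ v :: z) := (hc x z).map_neg v

theorem IsMultilinearOnWords.map_splitSum {c : List V → M} (hc : IsMultilinearOnWords k c)
    (x z : List V) (g : List V → List V → V) (w : List V) :
    c (x ++ splitSum g w :: z) = splitSum (fun y y' => c (x ++ g y y' :: z)) w :=
  ExtAInf.map_splitSum ((hc x z).mk' _).toAddMonoidHom g w

theorem map_map_of_involutive (hσ : ∀ v, σ (σ v) = v) (x : List V) : (x.map σ).map σ = x := by
  induction x with
  | nil => rfl
  | cons a x ih => simp only [List.map_cons, hσ, ih]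

/-- The square of a coderivation is the coderivation of its corestriction. -/
theorem insertion_insertion (hσ : ∀ v, σ (σ v) = v) {b : List V → V} {c : List V → M}
    (hbσ : ∀ w, b (w.map σ) = - σ (b w)) (hc : IsMultilinearOnWords k c) (w : List V) :
    insertion σ b (insertion σ b c) w =
      tripleSum (fun x y z => c (x ++ insertion σ b b y :: z)) w := by
  simp only [insertion, tripleSum, splitSum_append_cons, splitSum_map, List.map_append,
    List.map_cons, map_map_of_involutive hσ, splitSum_add, hc.map_splitSum]
  have key : ∀ x₁ x₂ x₃ y z : List V, c (x₁ ++ b (x₂.map σ) :: (x₃.map σ ++ b y :: z)) =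
      - c (x₁ ++ σ (b x₂) :: (x₃.map σ ++ b y :: z)) := by
    intro x₁ x₂ x₃ y z
    rw [hbσ, hc.map_neg]
  -- Insertions into two disjoint blocks occur in both orders. Since `b` is odd with respect to `σ`,
  -- the two orders carry opposite signs and cancel.
  have e1 : splitSum (fun x w' => splitSum (fun y z => splitSum (fun x₁ x' => splitSum
      (fun x₂ x₃ => c (x₁ ++ b (x₂.map σ) :: (x₃.map σ ++ b y :: z))) x') x) w') w =
      - splitSum (fun x w' => splitSum (fun y z => splitSum (fun z₁ z' => splitSum
      (fun z₂ z₃ => c ((x ++ σ (b y) :: z₁.map σ) ++ b z₂ :: z₃)) z') z) w') w := by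
    have h1 : ∀ x w' : List V, splitSum (fun y z => splitSum (fun x₁ x' => splitSum
        (fun x₂ x₃ => c (x₁ ++ b (x₂.map σ) :: (x₃.map σ ++ b y :: z))) x') x) w' =
        splitSum (fun x₁ x' => splitSum (fun x₂ x₃ => splitSum (fun y z =>
          c (x₁ ++ b (x₂.map σ) :: (x₃.map σ ++ b y :: z))) w') x') x := by
      intro x w'
      rw [splitSum_comm]
      refine splitSum_congr fun x₁ x' _ => ?_
      rw [splitSum_comm]
    simp only [h1]
    rw [splitSum_assoc (fun x₁ x' w' => splitSum (fun x₂ x₃ => splitSum (fun y z =>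
          c (x₁ ++ b (x₂.map σ) :: (x₃.map σ ++ b y :: z))) w') x')]
    rw [← splitSum_neg]
    refine splitSum_congr fun x₁ w' _ => ?_
    rw [splitSum_assoc (fun x₂ x₃ w' => splitSum (fun y z =>
          c (x₁ ++ b (x₂.map σ) :: (x₃.map σ ++ b y :: z))) w')]
    simp only [key, splitSum_neg]
    simp only [List.append_assoc, List.cons_append]
  -- What survives are the nested insertions, which regroup as an insertion of the corestriction of
  -- the square.
  have e2 : splitSum (fun x w' => splitSum (fun y z => splitSum (fun x₁ x₂ => splitSum
      (fun z₁ z₂ => c (x₁ ++ b (x₂.map σ ++ b y :: z₁) :: z₂)) z) x) w') w =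
      splitSum (fun x w' => splitSum (fun y z => splitSum (fun y₁ y' => splitSum
        (fun y₂ y₃ => c (x ++ b (y₁.map σ ++ b y₂ :: y₃) :: z)) y') y) w') w := by
    have h1 : ∀ x w' : List V, splitSum (fun y z => splitSum (fun x₁ x₂ => splitSum
        (fun z₁ z₂ => c (x₁ ++ b (x₂.map σ ++ b y :: z₁) :: z₂)) z) x) w' =
        splitSum (fun x₁ x₂ => splitSum (fun y z => splitSum
        (fun z₁ z₂ => c (x₁ ++ b (x₂.map σ ++ b y :: z₁) :: z₂)) z) w') x := by
      intro x w'
      rw [splitSum_comm]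
    simp only [h1]
    rw [splitSum_assoc (fun x₁ x₂ w' => splitSum (fun y z => splitSum
        (fun z₁ z₂ => c (x₁ ++ b (x₂.map σ ++ b y :: z₁) :: z₂)) z) w')]
    refine splitSum_congr fun x₁ w' _ => ?_
    rw [splitSum_assoc (fun y₁ y' z => splitSum
        (fun y₂ y₃ => c (x₁ ++ b (y₁.map σ ++ b y₂ :: y₃) :: z)) y')]
    refine splitSum_congr fun x₂ w' _ => ?_
    rw [splitSum_assoc (fun y₂ y₃ z => c (x₁ ++ b (x₂.map σ ++ b y₂ :: y₃) :: z))]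
  rw [e1, e2]
  abel

/-- The Leibniz rule for the odd coderivation. A block in the right factor makes `σ` act twice on
the left factor, which has no effect; a block in the left factor gives the minus sign because `b` is
odd. -/
theorem insertion_cupSquare (hσ : ∀ v, σ (σ v) = v) {b : List V → V} {F : List V → N}
    (hbσ : ∀ w, b (w.map σ) = - σ (b w)) (hF : IsMultilinearOnWords k F) (w : List V) :
    insertion σ b (cupSquare σ F) w =
      splitSum (fun x y => F x * insertion σ b F y) w -
        splitSum (fun x y => insertion σ b F (x.map σ) * F y) w := by
  simp only [insertion, cupSquare, tripleSum, splitSum_append_cons, splitSum_map, List.map_append,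
    List.map_cons, map_map_of_involutive hσ, splitSum_add, splitSum_mul, mul_splitSum]
  have e1 : splitSum (fun x w' => splitSum (fun y z => splitSum (fun x₁ x₂ =>
      F x₁ * F (x₂.map σ ++ b y :: z)) x) w') w = splitSum (fun x w' => splitSum (fun x₂ w'' =>
        splitSum (fun y z => F x * F (x₂.map σ ++ b y :: z)) w'') w') w := by
    rw [← splitSum_assoc (fun x x₂ w'' => splitSum (fun y z => F x * F (x₂.map σ ++ b y :: z)) w'')]
    refine splitSum_congr fun x w' _ => ?_
    rw [splitSum_comm]
  have e2 : splitSum (fun x w' => splitSum (fun y z => splitSum (fun z₁ z₂ =>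
      F (x ++ σ (b y) :: z₁.map σ) * F z₂) z) w') w =
      - splitSum (fun x w' => splitSum (fun x₁ x' => splitSum (fun y z =>
        F (x₁ ++ b (y.map σ) :: z.map σ) * F w') x') x) w := by
    rw [splitSum_assoc (fun x₁ x' w' => splitSum (fun y z =>
        F (x₁ ++ b (y.map σ) :: z.map σ) * F w') x'), ← splitSum_neg]
    refine splitSum_congr fun x w' _ => ?_
    rw [splitSum_assoc (fun y z w' => F (x ++ b (y.map σ) :: z.map σ) * F w')]
    simp only [hbσ, hF.map_neg, neg_mul, splitSum_neg, neg_neg]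
  rw [e1, e2]
  abel

end Transfer

end ExtAInf

open scoped DirectSum

namespace ExtAInf

/-! ### The recursive construction of the transferred operations and of the morphism -/

section Transfer

variable {k : Type*} [Field k] {V : Type*} [AddCommGroup V] [Module k V]
  {N : Type*} [Ring N] [Algebra k N]

/-- Among all insertions only the one with the full word as block depends on `b` at the full length
and on `c` at a single letter. Subtracting it leaves data of smaller length. -/
theorem insertion_congr {M : Type*} [AddCommGroup M] {σ : V →ₗ[k] V} {b b' : List V → V}
    {c c' : List V → M} {w : List V}
    (h : ∀ x y z, x ++ (y ++ z) = w → y.length < w.length →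
      c (x.map σ ++ b y :: z) = c' (x.map σ ++ b' y :: z)) :
    insertion σ b c w - c [b w] = insertion σ b' c' w - c' [b' w] := by
  rw [sub_eq_sub_iff_sub_eq_sub, insertion, insertion, ← tripleSum_sub,
    tripleSum_eq_single fun x y z hw hy => by rw [h x y z hw hy, sub_self]]
  simp

/-- A contraction of a DG algebra `N` (with differential `dif` and sign involution `dag`) onto a
vector space `V` (whose shifted sign involution is `σ`), given on cocycles. -/
structure Contraction (k V N : Type*) [Field k] [AddCommGroup V] [Module k V] [Ring N]
    [Algebra k N] where
  σ : V →ₗ[k] V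
  dag : N →ₗ[k] N
  dif : N →ₗ[k] N
  pr : N →ₗ[k] V
  inc : V →ₗ[k] N
  h : N →ₗ[k] N
  σ_σ : ∀ v, σ (σ v) = v
  dag_mul : ∀ x y, dag (x * y) = dag x * dag y
  dif_dif : ∀ x, dif (dif x) = 0
  leibniz : ∀ x y, dif (x * y) = dif x * y + dag x * dif y
  dag_inc : ∀ v, dag (inc v) = - inc (σ v)
  σ_pr : ∀ x, σ (pr x) = - pr (dag x)
  dag_h : ∀ x, dag (h x) = - h (dag x)
  dif_inc : ∀ v, dif (inc v) = 0
  pr_inc : ∀ v, pr (inc v) = v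
  pr_dif : ∀ x, pr (dif x) = 0
  dif_h : ∀ x, dif x = 0 → dif (h x) = x - inc (pr x)

namespace Contraction

variable (T : Contraction k V N)

/-- The defect of the morphism identities. -/
def curvature (b : List V → V) (F : List V → N) (w : List V) : N :=
  insertion T.σ b F w - T.dif (F w) + cupSquare T.σ F w

variable {T}

theorem dag_eq {F : List V → N} (hF : ∀ w, T.dag (F w) = - F (w.map T.σ)) (w : List V) :
    T.dag (F (w.map T.σ)) = - F w := by
  rw [hF, map_map_of_involutive T.σ_σ]

/-- The Bianchi identity. -/
theorem dif_curvature {b : List V → V} {F : List V → N}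
    (hb : ∀ w, b (w.map T.σ) = - T.σ (b w)) (hF : IsMultilinearOnWords k F)
    (hdag : ∀ w, T.dag (F w) = - F (w.map T.σ)) (w : List V) :
    T.dif (T.curvature b F w) =
      tripleSum (fun x y z => F (x ++ insertion T.σ b b y :: z)) w -
        insertion T.σ b (T.curvature b F) w -
        splitSum (fun x y => T.curvature b F (x.map T.σ) * F y) w +
        splitSum (fun x y => F x * T.curvature b F y) w := by
  -- Every differential of `F` is eliminated through the definition of the curvature. The terms
  -- without curvature then cancel, up to the square of the coderivation.
  have hdF : ∀ v, T.dif (F v) = insertion T.σ b F v + cupSquare T.σ F v - T.curvature b F v := by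
    intro v; simp only [curvature]; abel
  have h1 : T.dif (insertion T.σ b F w) = insertion T.σ b (fun v => T.dif (F v)) w := by
    simp only [insertion, tripleSum]
    rw [← LinearMap.toAddMonoidHom_coe, map_splitSum]
    simp only [map_splitSum]
  have h2 : insertion T.σ b (fun v => T.dif (F v)) w =
      insertion T.σ b (insertion T.σ b F) w + insertion T.σ b (cupSquare T.σ F) w -
        insertion T.σ b (T.curvature b F) w := by
    simp only [hdF]
    simp only [insertion, tripleSum, splitSum_add, splitSum_sub]
  have h3 : T.dif (cupSquare T.σ F w) =
      splitSum (fun x y => T.dif (F (x.map T.σ)) * F y) w -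
        splitSum (fun x y => F x * T.dif (F y)) w := by
    simp only [cupSquare]
    rw [← LinearMap.toAddMonoidHom_coe, map_splitSum, ← splitSum_sub]
    refine splitSum_congr fun x y _ => ?_
    simp only [LinearMap.toAddMonoidHom_coe]
    rw [T.leibniz, dag_eq hdag, neg_mul, sub_eq_add_neg]
  -- The two triple cup products agree by associativity and drop out.
  have h4 : splitSum (fun x y => cupSquare T.σ F (x.map T.σ) * F y) w =
      splitSum (fun x y => F x * cupSquare T.σ F y) w := by
    simp only [cupSquare, splitSum_map, splitSum_mul, mul_splitSum, map_map_of_involutive T.σ_σ]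
    rw [splitSum_assoc (fun x x₁ x₂ => F x * F (x₁.map T.σ) * F x₂)]
    simp only [mul_assoc]
  have h5 : T.dif (T.curvature b F w) = T.dif (insertion T.σ b F w) +
      T.dif (cupSquare T.σ F w) := by
    rw [curvature, map_add, map_sub, T.dif_dif, sub_zero]
  rw [h5, h1, h2, h3, insertion_insertion T.σ_σ hb hF, insertion_cupSquare T.σ_σ hb hF]
  simp only [hdF, sub_mul, add_mul, mul_sub, mul_add, splitSum_add, splitSum_sub, h4]
  abel

/-- The transferred operations and the components of the morphism, up to a given word length. -/
noncomputable def approx (T : Contraction k V N) : ℕ → (List V → V) × (List V → N)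
  | 0 => (fun _ => 0, fun _ => 0)
  | n + 1 =>
    (fun w => if w.length = n + 1 then
        (if n = 0 then 0 else
          - T.pr (insertion T.σ (T.approx n).1 (T.approx n).2 w + cupSquare T.σ (T.approx n).2 w))
      else (T.approx n).1 w,
    fun w => if w.length = n + 1 then
        -- In this branch the word has a single letter, so `w.sum` is that letter; the sum only
        -- serves to give a formula defined on all words.
        (if n = 0 then T.inc w.sum else
          T.h (insertion T.σ (T.approx n).1 (T.approx n).2 w + cupSquare T.σ (T.approx n).2 w))
      else (T.approx n).2 w)

/-- The transferred operations. -/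
noncomputable def op (T : Contraction k V N) (w : List V) : V := (T.approx w.length).1 w

/-- The components of the transferred morphism. -/
noncomputable def mor (T : Contraction k V N) (w : List V) : N := (T.approx w.length).2 w

/-- Stage `n` is the truncation of the final maps to words of length at most `n`, extended by zero.
-/
theorem approx_eq (n : ℕ) (w : List V) :
    (T.approx n).1 w = (if w.length ≤ n then T.op w else 0) ∧
      (T.approx n).2 w = (if w.length ≤ n then T.mor w else 0) := by
  induction n with
  | zero =>
    rcases w with _ | ⟨a, w⟩
    · simp [op, mor]
    · simp [approx]
  | succ n ih =>
    rcases lt_trichotomy w.length (n + 1) with h | h | h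
    · have h1 : w.length ≠ n + 1 := h.ne
      have h2 : w.length ≤ n := by omega
      simp only [h2, if_true] at ih
      simp only [approx, h1, if_false, h.le, if_true, ih, and_self]
    · simp only [op, mor, h, le_refl, if_true, and_self]
    · have h1 : w.length ≠ n + 1 := h.ne'
      have h2 : ¬ w.length ≤ n := by omega
      simp only [h2, if_false] at ih
      simp only [approx, h1, if_false, h.not_ge, ih, and_self]

theorem op_nil : T.op [] = 0 := rfl
theorem mor_nil : T.mor [] = 0 := rfl
theorem op_singleton (a : V) : T.op [a] = 0 := by simp [op, approx]
theorem mor_singleton (a : V) : T.mor [a] = T.inc a := by simp [mor, approx]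

theorem multilinear_approx (n : ℕ) : IsMultilinearOnWords k (T.approx n).1 ∧
    IsMultilinearOnWords k (T.approx n).2 := by
  induction n with
  | zero => exact ⟨fun _ _ => (0 : V →ₗ[k] V).isLinear, fun _ _ => (0 : V →ₗ[k] N).isLinear⟩
  | succ n ih =>
    have hU : ∀ x z, IsLinearMap k fun v => insertion T.σ (T.approx n).1 (T.approx n).2
        (x ++ v :: z) + cupSquare T.σ (T.approx n).2 (x ++ v :: z) := fun x z =>
      isLinearMap_add (ih.1.insertion ih.2 x z) (ih.2.cupSquare x z)
    constructor
    · intro x z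
      by_cases h : x.length + (z.length + 1) = n + 1
      · rcases eq_or_ne n 0 with rfl | hn
        · have e : (fun v => (T.approx (0 + 1)).1 (x ++ v :: z)) = ⇑(0 : V →ₗ[k] V) := by
            funext v; simp [approx]
          rw [e]
          exact LinearMap.isLinear _
        · have := isLinearMap_comp (-T.pr).isLinear (hU x z)
          simpa [approx, h, hn] using this
      · simpa [approx, h] using ih.1 x z
    · intro x z
      by_cases h : x.length + (z.length + 1) = n + 1
      · rcases eq_or_ne n 0 with rfl | hn
        · have hx : x = [] := List.length_eq_zero_iff.1 (by omega)
          have hz : z = [] := List.length_eq_zero_iff.1 (by omega)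
          subst hx hz
          simpa [approx] using T.inc.isLinear
        · have := isLinearMap_comp T.h.isLinear (hU x z)
          simpa [approx, h, hn] using this
      · simpa [approx, h] using ih.2 x z

theorem multilinear_op : IsMultilinearOnWords k T.op := by
  intro x z
  have := (T.multilinear_approx (x.length + (z.length + 1))).1 x z
  simpa [op] using this

theorem multilinear_mor : IsMultilinearOnWords k T.mor := by
  intro x z
  have := (T.multilinear_approx (x.length + (z.length + 1))).2 x z
  simpa [mor] using this

theorem insertion_map_σ {b : List V → V} (hb : ∀ w, b (w.map T.σ) = - T.σ (b w))
    {M : Type*} [AddCommGroup M] [Module k M] {c : List V → M} (hc : IsMultilinearOnWords k c)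
    (w : List V) :
    insertion T.σ b c (w.map T.σ) =
      - insertion T.σ b (fun v => c (v.map T.σ)) w := by
  simp only [insertion, tripleSum, splitSum_map, hb, hc.map_neg, splitSum_neg, List.map_append,
    List.map_cons]

/-- In shifted degrees all operations and components are odd; `σ` and `dag` are the parity
involutions. Compatibility propagates through the recursion because `pr`, `inc` and `h` anticommute
with these involutions, while the obstruction is even. -/
theorem odd_approx (n : ℕ) : (∀ w, (T.approx n).1 (w.map T.σ) = - T.σ ((T.approx n).1 w)) ∧
    (∀ w, T.dag ((T.approx n).2 w) = - (T.approx n).2 (w.map T.σ)) := by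
  induction n with
  | zero => simp [approx]
  | succ n ih =>
    obtain ⟨hb, hF⟩ := ih
    have hU : ∀ w, T.dag (insertion T.σ (T.approx n).1 (T.approx n).2 w +
        cupSquare T.σ (T.approx n).2 w) = insertion T.σ (T.approx n).1 (T.approx n).2 (w.map T.σ) +
        cupSquare T.σ (T.approx n).2 (w.map T.σ) := by
      intro w
      rw [insertion_map_σ hb (T.multilinear_approx n).2, map_add]
      congr 1
      · simp only [insertion, tripleSum]
        rw [← LinearMap.toAddMonoidHom_coe, map_splitSum]
        simp only [map_splitSum, LinearMap.toAddMonoidHom_coe, hF, splitSum_neg]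
      · simp only [cupSquare, splitSum_map]
        rw [← LinearMap.toAddMonoidHom_coe, map_splitSum]
        simp only [LinearMap.toAddMonoidHom_coe, T.dag_mul, hF, neg_mul_neg]
    constructor
    · intro w
      by_cases h : w.length = n + 1
      · rcases eq_or_ne n 0 with rfl | hn
        · simp [approx]
        · simp only [approx, List.length_map, h, if_true, hn, if_false, map_neg, T.σ_pr, hU]
          simp
      · simp only [approx, List.length_map, h, if_false, hb]
    · intro w
      by_cases h : w.length = n + 1
      · rcases eq_or_ne n 0 with rfl | hn
        · have : (w.map T.σ).sum = T.σ w.sum := (map_list_sum T.σ w).symm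
          simp [approx, h, T.dag_inc, this]
        · simp only [approx, List.length_map, h, if_true, hn, if_false, T.dag_h, hU]
      · simp only [approx, List.length_map, h, if_false, hF]

theorem approx_fst_of_lt_two (n : ℕ) {w : List V} (hw : w.length < 2) : (T.approx n).1 w = 0 := by
  rw [(T.approx_eq n w).1]
  rcases w with _ | ⟨a, _ | ⟨b, w⟩⟩
  · simp [op_nil]
  · simp [op_singleton]
  · simp at hw

theorem approx_succ_eq {n : ℕ} {w : List V} (hw : w.length ≤ n) :
    (T.approx (n + 1)).1 w = (T.approx n).1 w ∧ (T.approx (n + 1)).2 w = (T.approx n).2 w := by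
  have : w.length ≠ n + 1 := by omega
  simp [approx, this]

theorem cupSquare_approx_succ {n : ℕ} {w : List V} (hw : w.length ≤ n + 1) :
    cupSquare T.σ (T.approx (n + 1)).2 w = cupSquare T.σ (T.approx n).2 w := by
  refine splitSum_congr fun x y hxy => ?_
  have hnil : ∀ m, (T.approx m).2 [] = 0 := fun m => by rw [(T.approx_eq m []).2]; simp [mor_nil]
  rcases x with _ | ⟨a, x⟩
  · simp [hnil]
  rcases y with _ | ⟨b, y⟩
  · simp [hnil]
  have := congrArg List.length hxy
  simp only [List.length_append, List.length_cons] at this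
  rw [(T.approx_succ_eq (by simp; omega)).2, (T.approx_succ_eq (by simp; omega)).2]

/-- Passing from stage `n` to stage `n + 1` affects words of length `n + 1` only through the full
block: operations vanish on blocks of length below two, and any longer proper block leaves a word of
length at most `n`. -/
theorem insertion_approx_aux {M : Type*} [AddCommGroup M] [Module k M] {c c' : List V → M}
    {n : ℕ} {w : List V} (hc : IsMultilinearOnWords k c) (hc' : IsMultilinearOnWords k c')
    (h : ∀ w : List V, w.length ≤ n → c' w = c w) (hw : w.length ≤ n + 1) :
    insertion T.σ (T.approx (n + 1)).1 c' w - c' [(T.approx (n + 1)).1 w] =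
      insertion T.σ (T.approx n).1 c w - c [(T.approx n).1 w] := by
  refine insertion_congr fun x y z hxy hy => ?_
  rcases lt_or_ge y.length 2 with h2 | h2
  · rw [approx_fst_of_lt_two _ h2, approx_fst_of_lt_two _ h2, hc.map_zero, hc'.map_zero]
  · have := congrArg List.length hxy
    simp only [List.length_append] at this
    rw [(T.approx_succ_eq (by omega)).1, h]
    simp only [List.length_append, List.length_cons, List.length_map]
    omega

/-- The obstruction argument. By the Bianchi identity, the differential of the curvature of stage
`n` on a word of length `n + 1` is `inc` of the Stasheff expression. Applying `pr`, which kills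
boundaries and splits `inc`, shows that the Stasheff expression vanishes. Hence the obstruction is a
cocycle, and the choices `-pr` and `h` of it cancel it by the homotopy identity. -/
theorem identities_approx (n : ℕ) :
    (∀ w : List V, w.length ≤ n → insertion T.σ (T.approx n).1 (T.approx n).1 w = 0) ∧
    (∀ w : List V, w.length ≤ n → T.curvature (T.approx n).1 (T.approx n).2 w = 0) := by
  induction n with
  | zero =>
    have : ∀ w : List V, w.length ≤ 0 → w = [] := fun w h => List.length_eq_zero_iff.1 (by omega)
    refine ⟨fun w hw => ?_, fun w hw => ?_⟩
    · simp [approx, insertion, tripleSum_eq_zero]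
    · rw [this w hw]; simp [approx, insertion, cupSquare, curvature, tripleSum_eq_zero]
  | succ n ih =>
    obtain ⟨hΨ, hΘ⟩ := ih
    set b := (T.approx n).1 with hb
    set F := (T.approx n).2 with hF
    set b' := (T.approx (n + 1)).1 with hb'
    set F' := (T.approx (n + 1)).2 with hF'
    have hbm : IsMultilinearOnWords k b := (T.multilinear_approx n).1
    have hFm : IsMultilinearOnWords k F := (T.multilinear_approx n).2
    have hbm' : IsMultilinearOnWords k b' := (T.multilinear_approx _).1
    have hFm' : IsMultilinearOnWords k F' := (T.multilinear_approx _).2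
    have b1 : ∀ v, b [v] = 0 := fun v => approx_fst_of_lt_two _ (by simp)
    have b1' : ∀ v, b' [v] = 0 := fun v => approx_fst_of_lt_two _ (by simp)
    have F1' : ∀ v, F' [v] = T.inc v := fun v => by
      rw [hF', (T.approx_eq _ _).2]; simp [mor_singleton]
    have hbig : ∀ w : List V, w.length = n + 1 → F w = 0 ∧ b w = 0 := fun w hw => by
      rw [hF, hb, (T.approx_eq _ _).2, (T.approx_eq _ _).1]
      simp [hw]
    have hΨ' : ∀ w : List V, w.length ≤ n + 1 → insertion T.σ b' b' w = insertion T.σ b b w := by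
      intro w hw
      have := insertion_approx_aux (T := T) hbm hbm' (fun w hw => (T.approx_succ_eq hw).1) hw
      rwa [b1, b1', sub_zero, sub_zero] at this
    have hins : ∀ w : List V, w.length ≤ n + 1 →
        insertion T.σ b' F' w - F' [b' w] = insertion T.σ b F w - F [b w] := fun w hw =>
      insertion_approx_aux (T := T) hFm hFm' (fun w hw => (T.approx_succ_eq hw).2) hw
    have hcurv : ∀ w : List V, w.length = n + 1 → T.dif (T.curvature b F w) =
        T.inc (insertion T.σ b b w) := by
      intro w hw
      have hlt : ∀ x : List V, x.length < w.length → T.curvature b F x = 0 :=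
        fun x hx => hΘ x (by omega)
      rw [dif_curvature (T.odd_approx n).1 hFm (T.odd_approx n).2]
      -- Only blocks of length at least two matter, and inserting at such a block leaves a shorter
      -- word, on which the curvature vanishes by induction.
      have z1 : insertion T.σ b (T.curvature b F) w = 0 := by
        refine tripleSum_eq_zero fun x y z hxy => ?_
        have h0 : IsMultilinearOnWords k (T.curvature b F) := by
          intro x z
          have e1 := isLinearMap_add (hbm.insertion hFm (σ := T.σ) x z) (hFm.cupSquare (σ := T.σ) x z)
          have e2 := isLinearMap_add e1 (isLinearMap_comp (-T.dif).isLinear (hFm x z))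
          convert e2 using 2 with v
          simp only [curvature, LinearMap.neg_apply]; abel
        rcases lt_or_ge y.length 2 with h2 | h2
        · rw [hb, approx_fst_of_lt_two _ h2]
          exact h0.map_zero _ _
        · have := congrArg List.length hxy
          simp only [List.length_append] at this
          apply hlt
          simp only [List.length_append, List.length_cons, List.length_map]
          omega
      have Fnil : F [] = 0 := by rw [hF, (T.approx_eq _ _).2]; simp [mor_nil]
      have z2 : splitSum (fun x y => T.curvature b F (x.map T.σ) * F y) w = 0 := by
        refine splitSum_eq_zero fun x y hxy => ?_
        rcases y with _ | ⟨a, y⟩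
        · rw [Fnil, mul_zero]
        · have := congrArg List.length hxy
          simp only [List.length_append, List.length_cons] at this
          rw [hlt, zero_mul]
          simp; omega
      have z3 : splitSum (fun x y => F x * T.curvature b F y) w = 0 := by
        refine splitSum_eq_zero fun x y hxy => ?_
        rcases x with _ | ⟨a, x⟩
        · rw [Fnil, zero_mul]
        · have := congrArg List.length hxy
          simp only [List.length_append, List.length_cons] at this
          rw [hlt, mul_zero]
          omega
      rw [z1, z2, z3, tripleSum_eq_single]
      · rcases Nat.eq_zero_or_pos n with h0 | h0
        · obtain ⟨a, rfl⟩ := List.length_eq_one_iff.1 (hw.trans (by rw [h0]))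
          have hb0 : ∀ y : List V, b y = 0 := fun y => by rw [hb, h0]; rfl
          have hi : insertion T.σ b b [a] = 0 := tripleSum_eq_zero fun x y z _ => hb0 _
          rw [hi, show ([] : List V) ++ [(0 : V)] = [] ++ 0 :: [] from rfl, hFm.map_zero, map_zero]
          abel
        · rw [List.nil_append, hF, (T.approx_eq n _).2, if_pos (by simp; omega), mor_singleton]
          abel
      · intro x y z hxy hy
        rw [hΨ y (by omega), hFm.map_zero]
    have hΘU : ∀ w : List V, w.length = n + 1 → T.curvature b F w =
        insertion T.σ b F w + cupSquare T.σ F w := fun w hw => by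
      rw [curvature, (hbig w hw).1, map_zero, sub_zero]
    -- Apply `pr` to `hcurv`: the left side dies and `pr ∘ inc` is the identity.
    have hΨ0 : ∀ w : List V, w.length = n + 1 → insertion T.σ b b w = 0 := fun w hw => by
      have := congrArg T.pr (hcurv w hw)
      rwa [T.pr_dif, T.pr_inc, eq_comm] at this
    refine ⟨fun w hw => ?_, fun w hw => ?_⟩
    · rw [hΨ' w hw]
      rcases hw.lt_or_eq with h | h
      · exact hΨ w (by omega)
      · exact hΨ0 w h
    · have hins' := hins w hw
      rw [sub_eq_iff_eq_add] at hins'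
      rw [curvature, hins', cupSquare_approx_succ hw]
      rcases hw.lt_or_eq with h | h
      · have e := T.approx_succ_eq (n := n) (w := w) (by omega)
        rw [← hb, ← hF, ← hb', ← hF'] at e
        have := hΘ w (by omega)
        rw [curvature] at this
        rcases lt_or_ge w.length 2 with h2 | h2
        · have z : b w = 0 := approx_fst_of_lt_two _ h2
          have z' : b' w = 0 := approx_fst_of_lt_two _ h2
          have e3 : F [0] = 0 := hFm.map_zero [] []
          have e3' : F' [0] = 0 := hFm'.map_zero [] []
          rw [z, z', e3, e3', e.2, sub_zero, add_zero]
          exact this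
        · have e4 : F' [b w] = F [b w] :=
            (T.approx_succ_eq (n := n) (w := [b w]) (by simp; omega)).2
          rw [e.1, e.2, e4, sub_add_cancel]
          exact this
      · rw [(hbig w h).2, F1']
        have e3 : F [0] = 0 := hFm.map_zero [] []
        rw [e3, sub_zero]
        rcases eq_or_ne n 0 with rfl | hn
        · obtain ⟨a, rfl⟩ := List.length_eq_one_iff.1 h
          rw [b1', F1', T.dif_inc, map_zero, hF]
          have hb0 : ∀ y : List V, F y = 0 := fun y => by rw [hF]; rfl
          simp [insertion, cupSquare, ← hF, hb0, tripleSum_eq_zero, splitSum_cons]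
        · have hd : T.dif (insertion T.σ b F w + cupSquare T.σ F w) = 0 := by
            rw [← hΘU w h, hcurv w h, hΨ0 w h, map_zero]
          have e1 : b' w = - T.pr (insertion T.σ b F w + cupSquare T.σ F w) := by
            simp [hb', approx, h, hn, ← hb, ← hF]
          have e2 : F' w = T.h (insertion T.σ b F w + cupSquare T.σ F w) := by
            simp [hF', approx, h, hn, ← hb, ← hF]
          rw [e1, e2, T.dif_h _ hd, map_neg]
          abel

theorem insertion_eq_approx {M : Type*} [AddCommGroup M] [Module k M] {c c' : List V → M}
    (hc : IsMultilinearOnWords k c) (hc' : IsMultilinearOnWords k c') {w : List V}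
    (h : ∀ x : List V, x.length ≤ w.length → c' x = c x) :
    insertion T.σ T.op c w = insertion T.σ (T.approx w.length).1 c' w := by
  refine tripleSum_congr fun x y z hxy => ?_
  have := congrArg List.length hxy
  simp only [List.length_append] at this
  rw [(T.approx_eq _ y).1, if_pos (by omega)]
  rcases y with _ | ⟨a, y⟩
  · rw [op_nil, hc.map_zero, hc'.map_zero]
  · rw [h]
    simp only [List.length_append, List.length_cons, List.length_map] at this ⊢
    omega

/-- Stasheff's identities for the transferred operations. -/
theorem insertion_op (w : List V) : insertion T.σ T.op T.op w = 0 := by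
  rcases w with _ | ⟨a, w⟩
  · exact op_singleton _
  rw [insertion_eq_approx T.multilinear_op (T.multilinear_approx (a :: w).length).1
    (fun x hx => by rw [(T.approx_eq _ _).1, if_pos hx])]
  exact (T.identities_approx _).1 _ le_rfl

/-- The identities for the transferred morphism. -/
theorem insertion_mor (w : List V) :
    insertion T.σ T.op T.mor w = T.dif (T.mor w) - cupSquare T.σ T.mor w := by
  rcases w with _ | ⟨a, w⟩
  · simp [insertion, tripleSum, cupSquare, mor_nil, op_nil, mor_singleton]
  have h1 := (T.identities_approx (a :: w).length).2 (a :: w) le_rfl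
  rw [curvature, ← insertion_eq_approx T.multilinear_mor (T.multilinear_approx (a :: w).length).2
    (fun x hx => by rw [(T.approx_eq _ _).2, if_pos hx])] at h1
  have h2 : cupSquare T.σ (T.approx (a :: w).length).2 (a :: w) = cupSquare T.σ T.mor (a :: w) := by
    refine splitSum_congr fun x y hxy => ?_
    have := congrArg List.length hxy
    simp only [List.length_append] at this
    rw [(T.approx_eq _ _).2, (T.approx_eq _ _).2, if_pos (by simp only [List.length_map]; omega),
      if_pos (by omega)]
  rw [h2, (T.approx_eq _ _).2, if_pos le_rfl] at h1
  rw [← sub_eq_zero, ← h1]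
  abel

/-- The obstruction from which the operation and the morphism on a word are obtained. -/
noncomputable def obstruction (T : Contraction k V N) (w : List V) : N :=
  tripleSum (fun x y z => if y.length < w.length then T.mor (x.map T.σ ++ T.op y :: z) else 0) w +
    cupSquare T.σ T.mor w

/-- The recursion rewritten in terms of the final maps. The obstruction omits the full block, so
that only values on shorter words enter. -/
theorem op_mor_eq {w : List V} (hw : 2 ≤ w.length) :
    T.op w = - T.pr (T.obstruction w) ∧ T.mor w = T.h (T.obstruction w) := by
  obtain ⟨n, hn⟩ : ∃ n, w.length = n + 1 := ⟨w.length - 1, by omega⟩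
  have hn0 : n ≠ 0 := by omega
  have key : insertion T.σ (T.approx n).1 (T.approx n).2 w + cupSquare T.σ (T.approx n).2 w =
      T.obstruction w := by
    rw [obstruction]
    congr 1
    · refine tripleSum_congr fun x y z hxy => ?_
      have := congrArg List.length hxy
      simp only [List.length_append] at this
      split_ifs with h
      · rw [(T.approx_eq _ _).1, if_pos (by omega)]
        rcases lt_or_ge y.length 2 with h2 | h2
        · have : T.op y = 0 := by
            have := approx_fst_of_lt_two (T := T) y.length h2
            exact this
          rw [this, T.multilinear_mor.map_zero, (T.multilinear_approx n).2.map_zero]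
        · rw [(T.approx_eq _ _).2, if_pos]
          simp only [List.length_append, List.length_cons, List.length_map]
          omega
      · rw [(T.approx_eq _ _).1, if_neg (by omega), (T.multilinear_approx n).2.map_zero]
    · refine splitSum_congr fun x y hxy => ?_
      have := congrArg List.length hxy
      simp only [List.length_append] at this
      rcases x with _ | ⟨a, x⟩
      · simp [(T.approx_eq _ _).2, mor_nil]
      rcases y with _ | ⟨b, y⟩
      · simp [(T.approx_eq _ _).2, mor_nil]
      simp only [List.length_cons] at this
      rw [(T.approx_eq _ _).2, (T.approx_eq _ _).2, if_pos (by simp; omega),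
        if_pos (by simp; omega)]
  rw [← key]
  constructor
  · simp [op, hn, approx, hn0]
  · simp [mor, hn, approx, hn0]

end Contraction

end Transfer

end ExtAInf

open scoped DirectSum

namespace ExtAInf

/-! ### Strict unitality of the transferred structure -/

section TransferUnit

variable {k : Type*} [Field k] {V : Type*} [AddCommGroup V] [Module k V]
  {N : Type*} [Ring N] [Algebra k N]

namespace Contraction

variable {T : Contraction k V N}

theorem op_of_length_lt_two {w : List V} (hw : w.length < 2) : T.op w = 0 :=
  approx_fst_of_lt_two w.length hw

theorem obstruction_pair (a a' : V) : T.obstruction [a, a'] = T.inc (T.σ a) * T.inc a' := by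
  have h1 : tripleSum (fun x y z => if y.length < [a, a'].length then
      T.mor (x.map T.σ ++ T.op y :: z) else 0) [a, a'] = 0 := by
    refine tripleSum_eq_zero fun x y z _ => ?_
    split_ifs with h
    · rw [op_of_length_lt_two (by simpa using h), T.multilinear_mor.map_zero]
    · rfl
  rw [obstruction, h1, zero_add, cupSquare]
  simp [splitSum_cons, mor_nil, mor_singleton]

theorem op_pair (a a' : V) : T.op [a, a'] = - T.pr (T.inc (T.σ a) * T.inc a') := by
  rw [(op_mor_eq (T := T) (w := [a, a']) (by simp)).1, obstruction_pair]

section Unit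

variable {e : V}

theorem op_one_left (hσ : T.σ e = - e) (hinc : T.inc e = 1) (a : V) : T.op [e, a] = a := by
  simp [op_pair, hσ, hinc, T.pr_inc]

theorem op_one_right (hinc : T.inc e = 1) (a : V) : T.op [a, e] = - T.σ a := by
  simp [op_pair, hinc, T.pr_inc]

/-- By the inductive hypotheses a term can survive only if the unit sits in a block of two letters
or is a one-letter factor of the cup square. The block `[e, c]` contributes `c` and the block `[c,
e]` contributes `-σ c`. For a unit inside the word these two terms cancel; for a unit at an end the
single block term cancels the cup term. -/
theorem obstruction_unit (hσ : T.σ e = - e) (hinc : T.inc e = 1) (x z : List V)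
    (hL : 2 ≤ x.length + z.length)
    (hmor : ∀ x' z' : List V, 1 ≤ x'.length + z'.length →
      x'.length + z'.length < x.length + z.length → T.mor (x' ++ e :: z') = 0)
    (hop : ∀ x' z' : List V, 2 ≤ x'.length + z'.length →
      x'.length + z'.length < x.length + z.length → T.op (x' ++ e :: z') = 0) :
    T.obstruction (x ++ e :: z) = 0 := by
  have hmor' : ∀ x' z' : List V, 1 ≤ x'.length + z'.length →
      x'.length + z'.length < x.length + z.length → T.mor (x' ++ T.σ e :: z') = 0 := by
    intro x' z' h1 h2
    rw [hσ, T.multilinear_mor.map_neg, hmor x' z' h1 h2, neg_zero]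
  have hz1 : ∀ z₁ y z₃ : List V, z₁ ++ (y ++ z₃) = z →
      T.mor ((x ++ e :: z₁).map T.σ ++ T.op y :: z₃) = 0 := by
    rintro z₁ y z₃ rfl
    rcases lt_or_ge y.length 2 with h2 | h2
    · rw [op_of_length_lt_two h2, T.multilinear_mor.map_zero]
    · rw [List.map_append, List.map_cons, List.append_assoc, List.cons_append]
      apply hmor' <;> simp <;> omega
  have hz2 : ∀ x₁ y y' : List V, x₁ ++ (y ++ y') = x →
      T.mor (x₁.map T.σ ++ T.op y :: (y' ++ e :: z)) = 0 := by
    rintro x₁ y y' rfl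
    rcases lt_or_ge y.length 2 with h2 | h2
    · rw [op_of_length_lt_two h2, T.multilinear_mor.map_zero]
    · rw [show x₁.map T.σ ++ T.op y :: (y' ++ e :: z) =
        (x₁.map T.σ ++ T.op y :: y') ++ e :: z by simp]
      apply hmor <;> simp at hL ⊢ <;> omega
  -- `K` is the contribution of the block that contains the unit, split as the part before and the
  -- part after it.
  set K : List V → List V → List V → List V → N := fun x₁ x₂ z₁ z₂ =>
    if (x₂ ++ e :: z₁).length < (x ++ e :: z).length then
      T.mor (x₁.map T.σ ++ T.op (x₂ ++ e :: z₁) :: z₂) else 0 with hK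
  -- Only blocks of exactly two letters contribute: `[e]` has length below two, and longer blocks
  -- vanish by hypothesis.
  have hK0 : ∀ x₁ x₂ z₁ z₂, x₂.length + z₁.length ≠ 1 → K x₁ x₂ z₁ z₂ = 0 := by
    intro x₁ x₂ z₁ z₂ h1
    simp only [hK]
    split_ifs with h
    · have : T.op (x₂ ++ e :: z₁) = 0 := by
        rcases lt_or_ge (x₂ ++ e :: z₁).length 2 with h2 | h2
        · exact op_of_length_lt_two h2
        · simp only [List.length_append, List.length_cons] at h h2
          apply hop <;> omega
      rw [this, T.multilinear_mor.map_zero]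
    · rfl
  have hKr : ∀ x₁ c z₂, K x₁ [] [c] z₂ = T.mor (x₁.map T.σ ++ c :: z₂) := by
    intro x₁ c z₂
    have : (([] : List V) ++ e :: [c]).length < (x ++ e :: z).length := by simp; omega
    simp only [hK]
    rw [if_pos this, List.nil_append, op_one_left hσ hinc]
  have hKl : ∀ x₁ c z₂, K x₁ [c] [] z₂ = - T.mor (x₁.map T.σ ++ T.σ c :: z₂) := by
    intro x₁ c z₂
    have : ([c] ++ e :: []).length < (x ++ e :: z).length := by simp; omega
    simp only [hK]
    rw [if_pos this, List.singleton_append, op_one_right hinc, T.multilinear_mor.map_neg]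
  have htriple : tripleSum (fun x' y' z' => if y'.length < (x ++ e :: z).length then
      T.mor (x'.map T.σ ++ T.op y' :: z') else 0) (x ++ e :: z) =
      splitSum (fun x₁ x₂ => splitSum (fun z₁ z₂ => K x₁ x₂ z₁ z₂) z) x := by
    rw [tripleSum, splitSum_append_cons]
    rw [splitSum_eq_zero (w := z), add_zero]
    · refine splitSum_congr fun x₁ x₂ hx => ?_
      rw [splitSum_append_cons, splitSum_eq_zero (w := x₂), zero_add]
      intro y y' hy
      rw [hz2 x₁ y y' (by rw [hy, hx]), ite_self]
    · intro z₁ z₂ hz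
      refine splitSum_eq_zero fun y z₃ hy => ?_
      rw [hz1 z₁ y z₃ (by rw [hy, hz]), ite_self]
  -- A factor containing the unit together with another letter vanishes. So the unit must be a
  -- factor by itself, hence the first or the last letter of the word.
  have hcup : cupSquare T.σ T.mor (x ++ e :: z) =
      (if z = [] then T.mor (x.map T.σ) else 0) - (if x = [] then T.mor z else 0) := by
    rw [cupSquare, splitSum_append_cons, sub_eq_add_neg]
    congr 1
    · split_ifs with hz
      · subst hz
        rw [splitSum_eq_right_nil]
        · rw [List.nil_append, mor_singleton, hinc, mul_one]
        · rintro x₁ x₂ hx rfl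
          rcases x₁ with _ | ⟨a, x₁⟩
          · simp [mor_nil]
          · have := List.length_pos_iff.2 hx
            rw [hmor, mul_zero] <;> simp <;> omega
      · refine splitSum_eq_zero ?_
        rintro x₁ x₂ rfl
        have := List.length_pos_iff.2 hz
        rcases x₁ with _ | ⟨a, x₁⟩
        · simp [mor_nil]
        · rw [hmor, mul_zero] <;> try simp only [List.length_append, List.length_cons]
          all_goals omega
    · split_ifs with hx
      · subst hx
        rw [splitSum_eq_left_nil]
        · simp [mor_singleton, hσ, hinc]
        · rintro a z₁ z₂ rfl
          rcases z₂ with _ | ⟨b, z₂⟩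
          · simp [mor_nil]
          · simp only [List.nil_append, List.map_cons]
            rw [← List.nil_append (T.σ e :: _), hmor', zero_mul] <;> simp
      · rw [neg_zero]
        refine splitSum_eq_zero ?_
        rintro z₁ z₂ rfl
        have := List.length_pos_iff.2 hx
        rcases z₂ with _ | ⟨b, z₂⟩
        · simp [mor_nil]
        · rw [List.map_append, List.map_cons, hmor', zero_mul] <;> simp <;> omega
  have hzsum : ∀ x₁ x₂ c z', splitSum (fun z₁ z₂ => K x₁ x₂ z₁ z₂) (c :: z') =
      K x₁ x₂ [] (c :: z') + K x₁ x₂ [c] z' := by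
    intro x₁ x₂ c z'
    rw [splitSum_cons, splitSum_eq_left_nil]
    intro a z₁ z₂ _
    exact hK0 _ _ _ _ (by simp only [List.length_cons]; omega)
  have hxsum : ∀ g : List V → List V → N, (∀ x₁ x₂, 2 ≤ x₂.length → g x₁ x₂ = 0) →
      ∀ x' c, splitSum g (x' ++ [c]) = g (x' ++ [c]) [] + g x' [c] := by
    intro g hg x' c
    rw [splitSum_append_cons, splitSum_eq_right_nil]
    · simp only [List.nil_append, splitSum_nil]; abel
    · intro x₁ x₂ hx _
      have := List.length_pos_iff.2 hx
      exact hg _ _ (by simp; omega)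
  rw [obstruction, htriple, hcup]
  clear hK hz1 hz2 htriple hcup hmor hmor' hop
  clear_value K
  -- The left neighbour of the unit is the last letter of `x`, the right neighbour the first letter
  -- of `z`.
  rcases List.eq_nil_or_concat x with rfl | ⟨x', c, rfl⟩
  · rcases z with _ | ⟨c', z'⟩
    · simp at hL
    · rw [splitSum_nil, hzsum, hKr, hK0 _ _ _ _ (by simp)]
      simp
  · simp only [List.concat_eq_append]
    rcases z with _ | ⟨c', z'⟩
    · simp only [splitSum_nil]
      rw [hxsum _ fun x₁ x₂ h => hK0 _ _ _ _ (by simp only [List.length_nil]; omega), hKl, hK0 _ _ _ _ (by simp)]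
      simp
    · simp only [hzsum]
      rw [hxsum _ fun x₁ x₂ h => by
        rw [hK0 _ _ _ _ (by simp only [List.length_nil]; omega),
          hK0 _ _ _ _ (by simp only [List.length_cons, List.length_nil]; omega), add_zero],
        hKl, hKr, hK0 _ _ [] _ (by simp), hK0 _ [c] [c'] _ (by simp)]
      simp

/-- Induction on length. In length two the obstruction is `inc` of a vector up to sign, which is
where `h ∘ inc = 0` is needed; from length three on the whole obstruction vanishes. -/
theorem op_mor_unit (hσ : T.σ e = - e) (hinc : T.inc e = 1) (hh : ∀ a, T.h (T.inc a) = 0)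
    (x z : List V) : (1 ≤ x.length + z.length → T.mor (x ++ e :: z) = 0) ∧
      (2 ≤ x.length + z.length → T.op (x ++ e :: z) = 0) := by
  induction hn : x.length + z.length using Nat.strong_induction_on generalizing x z with
  | _ n ih =>
    subst hn
    rcases le_or_gt 2 (x.length + z.length) with h2 | h2
    · have h0 := obstruction_unit hσ hinc x z h2 (fun x' z' h1 h => (ih _ h x' z' rfl).1 h1)
        (fun x' z' h1 h => (ih _ h x' z' rfl).2 h1)
      have := op_mor_eq (T := T) (w := x ++ e :: z) (by simp; omega)
      rw [h0, map_zero, map_zero, neg_zero] at this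
      exact ⟨fun _ => this.2, fun _ => this.1⟩
    · refine ⟨fun h1 => ?_, fun h => by omega⟩
      rw [(op_mor_eq (by simp; omega)).2]
      rcases x with _ | ⟨a, x⟩
      · obtain ⟨b, rfl⟩ := List.length_eq_one_iff.1 (show z.length = 1 by simp at h1 h2; omega)
        simp [obstruction_pair, hσ, hinc, hh]
      · have hx : x = [] := List.length_eq_zero_iff.1 (by simp at h2; omega)
        have hz : z = [] := List.length_eq_zero_iff.1 (by simp at h2; omega)
        subst hx hz
        simp [obstruction_pair, hinc, hh]



end Unit

/-! ### Bidegrees of the transferred maps -/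

section Homogeneous

variable {Γ : Type*} [AddCommGroup Γ]

/-- The word consists of homogeneous letters of total (shifted) degree `d`. -/
def HasWordDegree (𝒱 : ℤ × Γ → Submodule k V) : List V → ℤ × Γ → Prop
  | [], d => d = 0
  | a :: w, d => ∃ j d', a ∈ 𝒱 j ∧ HasWordDegree 𝒱 w d' ∧ d = j + (-1, 0) + d'

theorem hasWordDegree_append {𝒱 : ℤ × Γ → Submodule k V} {x y : List V} {d : ℤ × Γ} :
    HasWordDegree 𝒱 (x ++ y) d ↔
      ∃ d₁ d₂, HasWordDegree 𝒱 x d₁ ∧ HasWordDegree 𝒱 y d₂ ∧ d = d₁ + d₂ := by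
  induction x generalizing d with
  | nil =>
    constructor
    · intro h
      exact ⟨0, d, rfl, h, (zero_add d).symm⟩
    · rintro ⟨_, d₂, rfl, h, rfl⟩
      rwa [zero_add]
  | cons a x ih =>
    simp only [List.cons_append, HasWordDegree, ih]
    constructor
    · rintro ⟨j, _, ha, ⟨d₁, d₂, h1, h2, rfl⟩, rfl⟩
      exact ⟨_, d₂, ⟨j, d₁, ha, h1, rfl⟩, h2, by abel⟩
    · rintro ⟨_, d₂, ⟨j, d₁, ha, h1, rfl⟩, h2, rfl⟩
      exact ⟨j, _, ha, ⟨d₁, d₂, h1, h2, rfl⟩, by abel⟩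

theorem HasWordDegree.map {𝒱 : ℤ × Γ → Submodule k V} {σ : V →ₗ[k] V}
    (hσ : ∀ j, ∀ a ∈ 𝒱 j, σ a ∈ 𝒱 j) {x : List V} {d : ℤ × Γ} (h : HasWordDegree 𝒱 x d) :
    HasWordDegree 𝒱 (x.map σ) d := by
  induction x generalizing d with
  | nil => exact h
  | cons a x ih =>
    obtain ⟨j, d', ha, h', rfl⟩ := h
    exact ⟨j, d', hσ j a ha, ih h', rfl⟩

/-- The maps of a contraction are compatible with gradings. -/
structure IsGraded (T : Contraction k V N) (𝒱 : ℤ × Γ → Submodule k V)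
    (𝒩 : ℤ × Γ → Submodule k N) : Prop where
  mul_mem : ∀ i j x y, x ∈ 𝒩 i → y ∈ 𝒩 j → x * y ∈ 𝒩 (i + j)
  σ_mem : ∀ j, ∀ a ∈ 𝒱 j, T.σ a ∈ 𝒱 j
  pr_mem : ∀ j, ∀ x ∈ 𝒩 j, T.pr x ∈ 𝒱 j
  inc_mem : ∀ j, ∀ a ∈ 𝒱 j, T.inc a ∈ 𝒩 j
  h_mem : ∀ j, ∀ x ∈ 𝒩 j, T.h x ∈ 𝒩 (j + (-1, 0))

theorem IsGraded.obstruction_mem_aux {𝒱 : ℤ × Γ → Submodule k V} {𝒩 : ℤ × Γ → Submodule k N}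
    (hT : T.IsGraded 𝒱 𝒩) {w : List V} {d : ℤ × Γ} (hw : HasWordDegree 𝒱 w d)
    (ih : ∀ (v : List V), v.length < w.length → ∀ d, HasWordDegree 𝒱 v d →
      T.op v ∈ 𝒱 (d + (2, 0)) ∧ T.mor v ∈ 𝒩 (d + (1, 0))) :
    T.obstruction w ∈ 𝒩 (d + (2, 0)) := by
  refine add_mem (tripleSum_mem ?_) (splitSum_mem ?_)
  · rintro x y z rfl
    split_ifs with h
    · rcases lt_or_ge y.length 2 with h2 | h2
      · rw [op_of_length_lt_two h2, T.multilinear_mor.map_zero]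
        exact zero_mem _
      obtain ⟨d₁, _, h1, h', rfl⟩ := hasWordDegree_append.1 hw
      obtain ⟨d₂, d₃, hy, hz, rfl⟩ := hasWordDegree_append.1 h'
      have := (ih (x.map T.σ ++ T.op y :: z) (by simp; omega) (d₁ + (d₂ + (2, 0) + (-1, 0) + d₃))
        (hasWordDegree_append.2 ⟨_, _, h1.map hT.σ_mem, ⟨_, _, (ih y h _ hy).1, hz, rfl⟩, rfl⟩)).2
      convert this using 2
      ext <;> simp; ring
    · exact zero_mem _
  · rintro x y rfl
    obtain ⟨d₁, d₂, h1, h2, rfl⟩ := hasWordDegree_append.1 hw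
    rcases x with _ | ⟨a, x⟩
    · simp [mor_nil]
    rcases y with _ | ⟨b, y⟩
    · simp [mor_nil]
    have := hT.mul_mem _ _ _ _ (ih ((a :: x).map T.σ) (by simp) _ (h1.map hT.σ_mem)).2
      (ih (b :: y) (by simp) _ h2).2
    convert this using 2
    ext <;> simp; ring

theorem IsGraded.op_mor_mem {𝒱 : ℤ × Γ → Submodule k V} {𝒩 : ℤ × Γ → Submodule k N}
    (hT : T.IsGraded 𝒱 𝒩) (w : List V) (d : ℤ × Γ) (hw : HasWordDegree 𝒱 w d) :
    T.op w ∈ 𝒱 (d + (2, 0)) ∧ T.mor w ∈ 𝒩 (d + (1, 0)) := by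
  induction hn : w.length using Nat.strong_induction_on generalizing w d with
  | _ n ih =>
    subst hn
    rcases lt_or_ge w.length 2 with h | h
    · rw [op_of_length_lt_two h]
      refine ⟨zero_mem _, ?_⟩
      rcases w with _ | ⟨a, _ | ⟨b, w⟩⟩
      · rw [mor_nil]; exact zero_mem _
      · obtain ⟨j, d', ha, rfl, rfl⟩ := hw
        rw [mor_singleton]
        convert hT.inc_mem j a ha using 2
        ext <;> simp
      · simp at h
    · have := hT.obstruction_mem_aux hw fun v hv d hd => ih _ hv v d hd rfl
      rw [(op_mor_eq h).1, (op_mor_eq h).2]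
      refine ⟨neg_mem (hT.pr_mem _ _ this), ?_⟩
      convert hT.h_mem _ _ this using 2
      ext <;> simp; ring

theorem IsGraded.obstruction_mem {𝒱 : ℤ × Γ → Submodule k V} {𝒩 : ℤ × Γ → Submodule k N}
    (hT : T.IsGraded 𝒱 𝒩) {w : List V} {d : ℤ × Γ} (hw : HasWordDegree 𝒱 w d) :
    T.obstruction w ∈ 𝒩 (d + (2, 0)) :=
  hT.obstruction_mem_aux hw fun v _ d hd => hT.op_mor_mem v d hd

end Homogeneous

end Contraction

end TransferUnit

end ExtAInf

open scoped DirectSum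

namespace ExtAInf

set_option linter.unusedSectionVars false

/-! ### Linear maps out of graded vector spaces -/

section GradedMaps

variable {k : Type*} [Field k] {ι : Type*} [DecidableEq ι] {V M : Type*} [AddCommGroup V]
  [Module k V] [AddCommGroup M] [Module k M]

/-- The linear map with given restrictions to the homogeneous components. -/
noncomputable def gradedLift {𝒱 : ι → Submodule k V} (h : DirectSum.IsInternal 𝒱)
    (g : ∀ j, 𝒱 j →ₗ[k] M) : V →ₗ[k] M :=
  DirectSum.toModule k ι M g ∘ₗ
    (LinearEquiv.ofBijective (DirectSum.coeLinearMap 𝒱) h).symm.toLinearMap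

theorem gradedLift_of_mem {𝒱 : ι → Submodule k V} (h : DirectSum.IsInternal 𝒱)
    (g : ∀ j, 𝒱 j →ₗ[k] M) {j : ι} {x : V} (hx : x ∈ 𝒱 j) :
    gradedLift h g x = g j ⟨x, hx⟩ := by
  have : (LinearEquiv.ofBijective (DirectSum.coeLinearMap 𝒱) h).symm x =
      DirectSum.lof k ι (fun j => 𝒱 j) j ⟨x, hx⟩ := by
    rw [LinearEquiv.symm_apply_eq]
    exact (DirectSum.coeLinearMap_lof 𝒱 j ⟨x, hx⟩).symm
  simp [gradedLift, this]

theorem linearMap_ext_of_homogeneous {𝒱 : ι → Submodule k V} (h : ⨆ j, 𝒱 j = ⊤)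
    {f g : V →ₗ[k] M} (hfg : ∀ j, ∀ x ∈ 𝒱 j, f x = g x) : f = g := by
  ext x
  have hx : x ∈ ⨆ j, 𝒱 j := by rw [h]; trivial
  induction hx using Submodule.iSup_induction' with
  | mem i x hx => exact hfg i x hx
  | zero => simp
  | add x y _ _ hx hy => simp [hx, hy]

end GradedMaps

/-! ### A DG algebra contracts onto its cohomology -/

section TotalAlgebra

variable {k : Type*} [Field k] {Γ : Type*} [AddCommGroup Γ] [DecidableEq Γ]
  {D : Type*} [Ring D] [Algebra k D] (C : DGAlgebra k Γ D)

namespace DGAlgebra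

/-- The sums of homogeneous elements of a DG algebra. -/
def total : Subalgebra k D :=
  Submodule.toSubalgebra (⨆ j, C.deg j) (Submodule.mem_iSup_of_mem 0 C.one_mem) (by
    intro x y hx hy
    induction hx using Submodule.iSup_induction' with
    | mem i x hx =>
      induction hy using Submodule.iSup_induction' with
      | mem j y hy => exact Submodule.mem_iSup_of_mem _ (C.mul_mem i j x y hx hy)
      | zero => simp
      | add y y' _ _ h h' => rw [mul_add]; exact add_mem h h'
    | zero => simp
    | add x x' _ _ h h' => rw [add_mul]; exact add_mem h h')

theorem mem_total {j : ℤ × Γ} {x : D} (hx : x ∈ C.deg j) : x ∈ C.total :=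
  Submodule.mem_iSup_of_mem j hx

/-- The grading of the algebra of sums of homogeneous elements. -/
def totalDeg (j : ℤ × Γ) : Submodule k C.total := (C.deg j).comap C.total.val.toLinearMap

theorem mem_totalDeg {j : ℤ × Γ} {x : C.total} : x ∈ C.totalDeg j ↔ (x : D) ∈ C.deg j := Iff.rfl

theorem totalDeg_isInternal : DirectSum.IsInternal C.totalDeg := by
  rw [DirectSum.isInternal_submodule_iff_iSupIndep_and_iSup_eq_top]
  constructor
  · have h := C.independent
    rw [iSupIndep_iff_finsetSum_eq_zero_imp_eq_zero] at h ⊢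
    intro s f hf hsum j hj
    apply Subtype.ext
    refine h s (fun l => (f l : D)) (fun l hl => hf l hl) ?_ j hj
    have := congrArg (Subtype.val) hsum
    simpa using this
  · rw [eq_top_iff]
    rintro ⟨x, hx⟩ -
    change x ∈ ⨆ j, C.deg j at hx
    have : ∀ (y : D) (hy : y ∈ ⨆ j, C.deg j), (⟨y, hy⟩ : C.total) ∈ ⨆ j, C.totalDeg j := by
      intro y hy
      induction hy using Submodule.iSup_induction' with
      | mem i y hy => exact Submodule.mem_iSup_of_mem i hy
      | zero => exact zero_mem _
      | add y z hy hz h h' => exact add_mem h h'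
    exact this x hx

/-- `D` itself may be larger than the sum of its homogeneous parts. On the subalgebra `total` the
grading is internal, so maps given separately in each degree, such as `diff`, glue to a single
linear map. -/
theorem exists_totalMap (g : ℤ × Γ → D →ₗ[k] D) (hg : ∀ j, ∀ x ∈ C.deg j, g j x ∈ C.total) :
    ∃ f : C.total →ₗ[k] C.total, ∀ j (x : C.total), (x : D) ∈ C.deg j → (f x : D) = g j x := by
  refine ⟨gradedLift C.totalDeg_isInternal fun j =>
    ((g j).restrict (p := C.deg j) (q := Subalgebra.toSubmodule C.total) (hg j)) ∘ₗ
      (C.total.val.toLinearMap.restrict (p := C.totalDeg j) fun x hx => hx), fun j x hx => ?_⟩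
  rw [gradedLift_of_mem _ _ (C.mem_totalDeg.2 hx)]
  rfl

theorem cohomologyDeg_isInternal : DirectSum.IsInternal C.cohomologyDeg := by
  rw [DirectSum.isInternal_submodule_iff_iSupIndep_and_iSup_eq_top]
  constructor
  · rw [iSupIndep_iff_finsetSum_eq_zero_imp_eq_zero]
    intro s f hf hsum j hj
    choose! g hg using hf
    have hs : ∑ l ∈ s, DirectSum.lof k _ C.H l (g l) = 0 := by
      rw [← hsum]; exact Finset.sum_congr rfl hg
    have := congrArg (DirectSum.component k _ C.H j) hs
    rw [map_sum, Finset.sum_eq_single j, map_zero] at this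
    · rw [DirectSum.component.lof_self] at this
      rw [← hg j hj, this, map_zero]
    · intro l _ hl
      rw [DirectSum.component.of, dif_neg hl]
    · exact fun h => absurd hj h
  · exact DFinsupp.iSup_range_lsingle

theorem total_ext {M : Type*} [AddCommGroup M] [Module k M] {f g : C.total →ₗ[k] M}
    (h : ∀ j (x : C.total), (x : D) ∈ C.deg j → f x = g x) : f = g :=
  linearMap_ext_of_homogeneous C.totalDeg_isInternal.submodule_iSup_eq_top h

theorem cohomology_ext {M : Type*} [AddCommGroup M] [Module k M] {f g : C.Cohomology →ₗ[k] M}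
    (h : ∀ j, ∀ a ∈ C.cohomologyDeg j, f a = g a) : f = g :=
  linearMap_ext_of_homogeneous C.cohomologyDeg_isInternal.submodule_iSup_eq_top h

theorem lof_mem (j : ℤ × Γ) (a : C.H j) : DirectSum.lof k _ C.H j a ∈ C.cohomologyDeg j := ⟨a, rfl⟩

theorem toH_eq_zero_iff {j : ℤ × Γ} (z : C.cocycles j) :
    C.toH j z = 0 ↔ (z : D) ∈ C.coboundaries j := by
  exact Submodule.Quotient.mk_eq_zero ((C.coboundaries j).submoduleOf (C.cocycles j))

/-- The class map as a linear map. -/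
def toHₗ (j : ℤ × Γ) : C.cocycles j →ₗ[k] C.H j :=
  Submodule.mkQ ((C.coboundaries j).submoduleOf (C.cocycles j))

theorem toHₗ_apply {j : ℤ × Γ} (z : C.cocycles j) : C.toHₗ j z = C.toH j z := rfl

theorem toH_surjective (j : ℤ × Γ) : Function.Surjective (C.toH j) := Submodule.mkQ_surjective _

theorem diff_mem_coboundaries {j : ℤ × Γ} {x : D} (hx : x ∈ C.deg j) :
    C.diff j.1 x ∈ C.coboundaries (j.1 + 1, j.2) :=
  ⟨x, by simpa using hx, by simp⟩

theorem coboundaries_le_cocycles (j : ℤ × Γ) : C.coboundaries j ≤ C.cocycles j := by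
  rintro _ ⟨x, hx, rfl⟩
  have h1 := C.diff_mem _ x hx
  have h2 := C.diff_diff _ x hx
  simp only [sub_add_cancel] at h1 h2
  exact ⟨h1, h2⟩

/-- A contraction of a DG algebra onto its cohomology, from a choice of cocycles representing the
classes and of primitives of the coboundaries. -/
theorem exists_contraction (f₁ : ∀ j, C.H j →ₗ[k] C.cocycles j)
    (hf₁ : ∀ j a, C.toH j (f₁ j a) = a) (W : ℤ × Γ → Submodule k D) (hW : ∀ j, W j ≤ C.deg j)
    (hWd : ∀ j, ∀ β ∈ C.coboundaries j, ∃ w ∈ W (j.1 - 1, j.2), C.diff (j.1 - 1) w = β) :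
    ∃ T : Contraction k C.Cohomology C.total,
      (∀ j, ∀ a ∈ C.cohomologyDeg j, T.σ a = (j.1 - 1).negOnePow • a) ∧
      (∀ j a, (T.inc (DirectSum.lof k _ C.H j a) : D) = f₁ j a) ∧
      (∀ j (x : C.total), (x : D) ∈ C.deg j → (T.dif x : D) = C.diff j.1 x) ∧
      (∀ j (z : C.cocycles j) (x : C.total), (x : D) = z → T.pr x = C.cls j z) ∧
      T.IsGraded C.cohomologyDeg C.totalDeg ∧ (∀ a, T.h (T.inc a) = 0) ∧
      ∀ j (x : C.total), (x : D) ∈ C.deg j → (T.h x : D) ∈ W (j.1 - 1, j.2) := by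
  -- A linear choice of primitives inside `W`: split the surjection from the part of `W` with
  -- differential in the coboundaries, then extend the splitting to all of `D`.
  have hS : ∀ j, ∃ S : D →ₗ[k] D, ∀ β ∈ C.coboundaries j,
      S β ∈ W (j.1 - 1, j.2) ∧ C.diff (j.1 - 1) (S β) = β := by
    intro j
    let W' : Submodule k D := W (j.1 - 1, j.2) ⊓ (C.coboundaries j).comap (C.diff (j.1 - 1))
    let δ : W' →ₗ[k] C.coboundaries j := (C.diff (j.1 - 1)).restrict fun x hx => hx.2
    have hδ : LinearMap.range δ = ⊤ := by
      rw [LinearMap.range_eq_top]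
      rintro ⟨β, hβ⟩
      obtain ⟨w, hw, rfl⟩ := hWd j β hβ
      exact ⟨⟨w, hw, hβ⟩, rfl⟩
    obtain ⟨s, hs⟩ := δ.exists_rightInverse_of_surjective hδ
    obtain ⟨S, hS⟩ := LinearMap.exists_extend (W'.subtype ∘ₗ s)
    refine ⟨S, fun β hβ => ?_⟩
    have e1 : S β = s ⟨β, hβ⟩ := LinearMap.congr_fun hS ⟨β, hβ⟩
    rw [e1]
    refine ⟨(s ⟨β, hβ⟩).2.1, ?_⟩
    exact congrArg Subtype.val (LinearMap.congr_fun hs ⟨β, hβ⟩)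
  choose S hSW hSd using hS
  have hSdeg : ∀ j x, x ∈ C.deg j → S (j.1 + 1, j.2) (C.diff j.1 x) ∈ C.deg j := fun j x hx => by
    have := hW _ (hSW _ _ (C.diff_mem_coboundaries hx))
    simpa using this
  have hSdd : ∀ j x, x ∈ C.deg j → C.diff j.1 (S (j.1 + 1, j.2) (C.diff j.1 x)) = C.diff j.1 x :=
    fun j x hx => by
      have := hSd _ _ (C.diff_mem_coboundaries hx)
      simpa using this
  -- Subtracting the chosen primitive of `d x` from `x` gives a projection onto the cocycles.
  let Z : ∀ j, C.deg j →ₗ[k] C.cocycles j := fun j =>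
    ((LinearMap.id - S (j.1 + 1, j.2) ∘ₗ C.diff j.1).restrict fun x hx =>
      ⟨sub_mem hx (hSdeg j x hx), by
        change C.diff j.1 (x - S (j.1 + 1, j.2) (C.diff j.1 x)) = 0
        rw [map_sub, hSdd j x hx, sub_self]⟩)
  have hZ : ∀ j x (hx : x ∈ C.deg j), ((Z j ⟨x, hx⟩ : C.cocycles j) : D) =
      x - S (j.1 + 1, j.2) (C.diff j.1 x) := fun j x hx => rfl
  have hZz : ∀ j (z : C.cocycles j), Z j ⟨z, z.2.1⟩ = z := fun j z => by
    apply Subtype.ext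
    rw [hZ, show C.diff j.1 (z : D) = 0 from z.2.2, map_zero, sub_zero]
  let pr' : ∀ j, C.deg j →ₗ[k] C.H j := fun j => C.toHₗ j ∘ₗ Z j
  have hpr' : ∀ j x, pr' j x = C.toH j (Z j x) := fun j x => rfl
  have hcob : ∀ j (x : C.deg j), ((Z j x : C.cocycles j) : D) - f₁ j (pr' j x) ∈
      C.coboundaries j := by
    intro j x
    have h0 : C.toH j (Z j x - f₁ j (pr' j x)) = 0 := by
      rw [← toHₗ_apply, map_sub, toHₗ_apply, toHₗ_apply, hf₁, hpr', sub_self]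
    exact (C.toH_eq_zero_iff _).1 h0
  obtain ⟨dag, hdag⟩ := C.exists_totalMap (fun j => j.1.negOnePow • LinearMap.id)
    (fun j x hx => C.mem_total (j := j) (by
      rcases Int.even_or_odd j.1 with h | h <;> simp [Int.negOnePow_even, Int.negOnePow_odd, h, hx]))
  obtain ⟨dif, hdif⟩ := C.exists_totalMap (fun j => C.diff j.1)
    (fun j x hx => C.mem_total (C.diff_mem j x hx))
  -- The homotopy: the cocycle part minus its chosen representative is a coboundary, and its
  -- primitive under `S` lies in `W`.
  let h' : ∀ j, C.deg j →ₗ[k] D := fun j => S j ∘ₗ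
    ((C.cocycles j).subtype ∘ₗ Z j - (C.cocycles j).subtype ∘ₗ f₁ j ∘ₗ pr' j)
  have hh' : ∀ j x, h' j x = S j ((Z j x : C.cocycles j) - f₁ j (pr' j x)) := fun j x => rfl
  have hh'W : ∀ j x, h' j x ∈ W (j.1 - 1, j.2) := fun j x => hSW j _ (hcob j x)
  choose h'' hh'' using fun j => LinearMap.exists_extend (h' j)
  have hh''eq : ∀ j x (hx : x ∈ C.deg j), h'' j x = h' j ⟨x, hx⟩ := fun j x hx =>
    LinearMap.congr_fun (hh'' j) ⟨x, hx⟩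
  obtain ⟨h, hh⟩ := C.exists_totalMap h'' (fun j x hx => C.mem_total (j := (j.1 - 1, j.2)) (by
    rw [hh''eq j x hx]; exact hW _ (hh'W j _)))
  have hh1 : ∀ j (x : C.total) (hx : (x : D) ∈ C.deg j), (h x : D) = h' j ⟨x, hx⟩ :=
    fun j x hx => by rw [hh j x hx, hh''eq j x hx]
  let pr : C.total →ₗ[k] C.Cohomology := gradedLift C.totalDeg_isInternal fun j =>
    DirectSum.lof k _ C.H j ∘ₗ pr' j ∘ₗ
      (C.total.val.toLinearMap.restrict (p := C.totalDeg j) fun x hx => hx)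
  have hpr : ∀ j (x : C.total) (hx : (x : D) ∈ C.deg j),
      pr x = DirectSum.lof k _ C.H j (pr' j ⟨x, hx⟩) := fun j x hx => by
    rw [show pr x = _ from gradedLift_of_mem _ _ (C.mem_totalDeg.2 hx)]
    rfl
  have hprz : ∀ j (z : C.cocycles j) (x : C.total), (x : D) = z → pr x = C.cls j z := by
    intro j z x hx
    have hx' : (x : D) ∈ C.deg j := by rw [hx]; exact z.2.1
    have : (⟨x, hx'⟩ : C.deg j) = ⟨z, z.2.1⟩ := Subtype.ext hx
    rw [hpr j x hx', hpr', this, hZz, cls]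
  let inc : C.Cohomology →ₗ[k] C.total := DirectSum.toModule k _ _ fun j =>
    (Submodule.inclusion (show C.cocycles j ≤ Subalgebra.toSubmodule C.total from
      fun x hx => C.mem_total hx.1)) ∘ₗ f₁ j
  have hinc : ∀ j a, (inc (DirectSum.lof k _ C.H j a) : D) = f₁ j a := fun j a => by
    simp only [inc, DirectSum.toModule_lof]; rfl
  -- The sign involution of the suspension, hence the exponent `j.1 - 1`.
  let σ : C.Cohomology →ₗ[k] C.Cohomology := DirectSum.toModule k _ _ fun j =>
    (j.1 - 1).negOnePow • DirectSum.lof k _ C.H j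
  have hσ : ∀ j, ∀ a ∈ C.cohomologyDeg j, σ a = (j.1 - 1).negOnePow • a := by
    rintro j _ ⟨a, rfl⟩
    simp only [σ, DirectSum.toModule_lof]; rfl
  have hincd : ∀ j, ∀ a ∈ C.cohomologyDeg j, (inc a : D) ∈ C.cocycles j := by
    rintro j _ ⟨a, rfl⟩
    rw [hinc]; exact (f₁ j a).2
  have hdifd : ∀ j (x : C.total), (x : D) ∈ C.deg j → (dif x : D) ∈ C.deg (j.1 + 1, j.2) :=
    fun j x hx => by rw [hdif j x hx]; exact C.diff_mem j x hx
  have hhd : ∀ j (x : C.total), (x : D) ∈ C.deg j → (h x : D) ∈ C.deg (j.1 - 1, j.2) :=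
    fun j x hx => by rw [hh1 j x hx]; exact hW _ (hh'W j _)
  have hdagd : ∀ j (x : C.total), (x : D) ∈ C.deg j → dag x = j.1.negOnePow • x :=
    fun j x hx => by
      apply Subtype.ext
      rw [hdag j x hx]
      rcases Int.even_or_odd j.1 with h | h <;> simp [Int.negOnePow_even, Int.negOnePow_odd, h]
  have hprd : ∀ j (x : C.total), (x : D) ∈ C.deg j → pr x ∈ C.cohomologyDeg j :=
    fun j x hx => by rw [hpr j x hx]; exact C.lof_mem _ _
  have hprdif : ∀ j (x : C.total), (x : D) ∈ C.deg j → pr (dif x) = 0 := by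
    intro j x hx
    have hb : (dif x : D) ∈ C.coboundaries (j.1 + 1, j.2) := by
      rw [hdif j x hx]; exact C.diff_mem_coboundaries hx
    rw [hprz _ ⟨_, C.coboundaries_le_cocycles _ hb⟩ _ rfl, cls, (C.toH_eq_zero_iff _).2 hb, map_zero]
  have hprinc : ∀ v, pr (inc v) = v := by
    intro v
    refine LinearMap.congr_fun (f := pr ∘ₗ inc) (g := LinearMap.id) (C.cohomology_ext ?_) v
    rintro j _ ⟨a, rfl⟩
    simp only [LinearMap.comp_apply, LinearMap.id_apply]
    rw [hprz j (f₁ j a) _ (hinc j a), cls, hf₁]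
  have hdd : ∀ x, dif (dif x) = 0 := by
    intro x
    refine LinearMap.congr_fun (f := dif ∘ₗ dif) (g := 0) (C.total_ext fun j x hx => ?_) x
    apply Subtype.ext
    simp only [LinearMap.comp_apply, LinearMap.zero_apply]
    rw [hdif _ _ (hdifd j x hx), hdif j x hx]
    exact C.diff_diff j x hx
  have hhinc : ∀ a, h (inc a) = 0 := by
    intro v
    refine LinearMap.congr_fun (f := h ∘ₗ inc) (g := 0) (C.cohomology_ext ?_) v
    rintro j _ ⟨a, rfl⟩
    apply Subtype.ext
    simp only [LinearMap.comp_apply, LinearMap.zero_apply]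
    have hm : (inc (DirectSum.lof k _ C.H j a) : D) ∈ C.deg j := by rw [hinc]; exact (f₁ j a).2.1
    have e : (⟨inc (DirectSum.lof k _ C.H j a), hm⟩ : C.deg j) = ⟨f₁ j a, (f₁ j a).2.1⟩ :=
      Subtype.ext (hinc j a)
    rw [hh1 j _ hm, e, hh', hZz, hpr', hZz, hf₁, sub_self, map_zero]
    rfl
  -- The full identity `d h + h d = 1 - inc pr`; the contraction only uses it on cocycles.
  have hhomotopy : ∀ x, dif (h x) = x - h (dif x) - inc (pr x) := by
    intro x
    refine LinearMap.congr_fun (f := dif ∘ₗ h) (g := LinearMap.id - h ∘ₗ dif - inc ∘ₗ pr)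
      (C.total_ext fun j x hx => ?_) x
    apply Subtype.ext
    simp only [LinearMap.comp_apply, LinearMap.sub_apply, LinearMap.id_apply]
    have e1 : (dif (h x) : D) = (Z j ⟨x, hx⟩ : C.cocycles j) - f₁ j (pr' j ⟨x, hx⟩) := by
      rw [hdif _ _ (hhd j x hx), hh1 j x hx, hh']
      exact hSd j _ (hcob j _)
    have hb : (dif x : D) ∈ C.coboundaries (j.1 + 1, j.2) := by
      rw [hdif j x hx]; exact C.diff_mem_coboundaries hx
    have hz := C.coboundaries_le_cocycles _ hb
    have e2 : (h (dif x) : D) = S (j.1 + 1, j.2) (C.diff j.1 x) := by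
      have h0 : Z (j.1 + 1, j.2) ⟨dif x, hdifd j x hx⟩ = ⟨dif x, hz⟩ := hZz _ ⟨dif x, hz⟩
      rw [hh1 _ _ (hdifd j x hx), hh', hpr', h0, (C.toH_eq_zero_iff _).2 hb, map_zero,
        ZeroMemClass.coe_zero, sub_zero, hdif j x hx]
    have e3 : (inc (pr x) : D) = f₁ j (pr' j ⟨x, hx⟩) := by rw [hpr j x hx, hinc]
    simp only [AddSubgroupClass.coe_sub]
    rw [e1, e2, e3, hZ]
  refine ⟨{
    σ := σ, dag := dag, dif := dif, pr := pr, inc := inc, h := h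
    σ_σ := fun v => ?_
    dag_mul := fun x y => ?_
    dif_dif := hdd
    leibniz := fun x y => ?_
    dag_inc := fun v => ?_
    σ_pr := fun x => ?_
    dag_h := fun x => ?_
    dif_inc := fun v => ?_
    pr_inc := hprinc
    pr_dif := fun x => ?_
    dif_h := fun x hx => ?_ }, hσ, hinc, hdif, hprz, ?_, hhinc, fun j x hx => ?_⟩
  · refine LinearMap.congr_fun (f := σ ∘ₗ σ) (g := LinearMap.id) (C.cohomology_ext fun j a ha => ?_) v
    simp only [LinearMap.comp_apply, LinearMap.id_apply]
    rw [hσ j a ha, hσ j _ (by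
      rcases Int.even_or_odd (j.1 - 1) with h | h <;>
        simp [Int.negOnePow_even, Int.negOnePow_odd, h, ha]), smul_smul, ← Int.negOnePow_add,
      Int.negOnePow_even _ ⟨_, rfl⟩, one_smul]
  · refine LinearMap.congr_fun (f := dag ∘ₗ LinearMap.mulRight k y)
      (g := LinearMap.mulRight k (dag y) ∘ₗ dag) (C.total_ext fun i x hx => ?_) x
    refine LinearMap.congr_fun (f := dag ∘ₗ LinearMap.mulLeft k x)
      (g := LinearMap.mulLeft k (dag x) ∘ₗ dag) (C.total_ext fun j y hy => ?_) y
    simp only [LinearMap.comp_apply, LinearMap.mulLeft_apply]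
    rw [hdagd _ (x * y) (C.mul_mem _ _ _ _ hx hy), hdagd _ _ hx, hdagd _ _ hy, Prod.fst_add,
      Int.negOnePow_add, smul_mul_smul_comm]
  · refine LinearMap.congr_fun (f := dif ∘ₗ LinearMap.mulRight k y)
      (g := LinearMap.mulRight k y ∘ₗ dif + LinearMap.mulRight k (dif y) ∘ₗ dag)
      (C.total_ext fun i x hx => ?_) x
    refine LinearMap.congr_fun (f := dif ∘ₗ LinearMap.mulLeft k x)
      (g := LinearMap.mulLeft k (dif x) + LinearMap.mulLeft k (dag x) ∘ₗ dif)
      (C.total_ext fun j y hy => ?_) y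
    simp only [LinearMap.comp_apply, LinearMap.mulLeft_apply, LinearMap.add_apply]
    apply Subtype.ext
    rw [hdif _ (x * y) (C.mul_mem _ _ _ _ hx hy), hdagd _ _ hx, Prod.fst_add,
      Subalgebra.coe_add, Subalgebra.coe_mul, Subalgebra.coe_mul, hdif _ _ hx, Subalgebra.coe_mul,
      C.leibniz i j _ _ hx hy]
    congr 1
    rw [← hdif _ _ hy]
    rcases Int.even_or_odd i.1 with h | h <;> simp [Int.negOnePow_even, Int.negOnePow_odd, h]
  · refine LinearMap.congr_fun (f := dag ∘ₗ inc) (g := - (inc ∘ₗ σ)) (C.cohomology_ext fun j a ha => ?_) v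
    simp only [LinearMap.comp_apply, LinearMap.neg_apply]
    rw [hdagd j _ (hincd j a ha).1, hσ j a ha, Int.negOnePow_sub, Int.negOnePow_one]
    rcases Int.even_or_odd j.1 with h | h <;> simp [Int.negOnePow_even, Int.negOnePow_odd, h]
  · refine LinearMap.congr_fun (f := σ ∘ₗ pr) (g := - (pr ∘ₗ dag)) (C.total_ext fun j x hx => ?_) x
    simp only [LinearMap.comp_apply, LinearMap.neg_apply]
    rw [hdagd j _ hx, hσ j _ (hprd j x hx), Int.negOnePow_sub, Int.negOnePow_one]
    rcases Int.even_or_odd j.1 with h | h <;> simp [Int.negOnePow_even, Int.negOnePow_odd, h]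
  · refine LinearMap.congr_fun (f := dag ∘ₗ h) (g := - (h ∘ₗ dag)) (C.total_ext fun j x hx => ?_) x
    simp only [LinearMap.comp_apply, LinearMap.neg_apply]
    rw [hdagd j _ hx, hdagd _ _ (hhd j x hx), Int.negOnePow_sub, Int.negOnePow_one]
    rcases Int.even_or_odd j.1 with h | h <;> simp [Int.negOnePow_even, Int.negOnePow_odd, h]
  · refine LinearMap.congr_fun (f := dif ∘ₗ inc) (g := 0) (C.cohomology_ext fun j a ha => ?_) v
    apply Subtype.ext
    simp only [LinearMap.comp_apply, LinearMap.zero_apply]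
    rw [hdif j _ (hincd j a ha).1]
    exact (hincd j a ha).2
  · exact LinearMap.congr_fun (f := pr ∘ₗ dif) (g := 0) (C.total_ext fun j x hx => hprdif j x hx) x
  · rw [hhomotopy, hx, map_zero, sub_zero]
  · exact
      { mul_mem := fun i j x y hx hy => C.mul_mem i j _ _ hx hy
        σ_mem := fun j a ha => by
          change σ a ∈ _
          rw [hσ j a ha]
          rcases Int.even_or_odd (j.1 - 1) with h | h <;>
            simp [Int.negOnePow_even, Int.negOnePow_odd, h, ha]
        pr_mem := hprd
        inc_mem := fun j a ha => (hincd j a ha).1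
        h_mem := fun j x hx => by
          have := hhd j x hx
          rw [mem_totalDeg]
          convert this using 2
          ext <;> simp; ring }
  · change (h x : D) ∈ _
    rw [hh1 j x hx]; exact hh'W j _

end DGAlgebra

end TotalAlgebra

end ExtAInf

open scoped DirectSum

namespace ExtAInf

set_option linter.unusedSectionVars false

/-! ### From words to multilinear operations -/

section Words

variable {k : Type*} [Field k] {V M : Type*} [AddCommGroup V] [Module k V]
  [AddCommGroup M] [Module k M]

theorem list_ofFn_update {n : ℕ} [DecidableEq (Fin n)] (a : Fin n → V) (i : Fin n) (v : V) :
    List.ofFn (Function.update a i v) =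
      (List.ofFn a).take i ++ v :: (List.ofFn a).drop (i + 1) := by
  have h0 := List.set_eq_take_append_cons_drop (l := List.ofFn a) (i := i) (a := v)
  rw [if_pos (by simp)] at h0
  rw [← h0]
  refine List.ext_getElem (by simp) fun l h1 h2 => ?_
  rw [List.getElem_set, List.getElem_ofFn]
  split_ifs with h
  · subst h; simp
  · rw [Function.update_of_ne, List.getElem_ofFn]
    intro h'
    apply h
    rw [← h']

/-- The multilinear maps given by a function on words that is linear in every letter. -/
def IsMultilinearOnWords.toMultilinearMap {c : List V → M} (hc : IsMultilinearOnWords k c)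
    (n : ℕ) : MultilinearMap k (fun _ : Fin n => V) M where
  toFun a := c (List.ofFn a)
  map_update_add' a i u v := by
    simp only [list_ofFn_update]
    exact (hc _ _).map_add u v
  map_update_smul' a i t v := by
    simp only [list_ofFn_update]
    exact (hc _ _).map_smul t v

/-- The word `a_r ⋯ a_{r+s-1}`. -/
def wordOf (a : ℕ → V) (r s : ℕ) : List V := (List.range s).map fun l => a (r + l)

@[simp] theorem length_wordOf (a : ℕ → V) (r s : ℕ) : (wordOf a r s).length = s := by
  simp [wordOf]

theorem wordOf_add (a : ℕ → V) (r s t : ℕ) :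
    wordOf a r (s + t) = wordOf a r s ++ wordOf a (r + s) t := by
  simp [wordOf, List.range_add, List.map_append, add_assoc]

theorem wordOf_succ (a : ℕ → V) (r s : ℕ) : wordOf a r (s + 1) = wordOf a r s ++ [a (r + s)] := by
  simp [wordOf, List.range_succ]

theorem wordOf_eq_ofFn (a : ℕ → V) (r s : ℕ) :
    wordOf a r s = List.ofFn fun l : Fin s => a (r + l) := by
  refine List.ext_getElem (by simp) fun l h1 h2 => ?_
  simp [wordOf]

theorem wordOf_congr {a a' : ℕ → V} {r r' s : ℕ} (h : ∀ l < s, a (r + l) = a' (r' + l)) :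
    wordOf a r s = wordOf a' r' s := by
  refine List.ext_getElem (by simp) fun l h1 h2 => ?_
  simp only [length_wordOf] at h1
  simpa [wordOf] using h l h1

theorem wordOf_splice (a : ℕ → V) (r s t : ℕ) (x : V) :
    wordOf (splice a r s x) 0 (r + 1 + t) = wordOf a 0 r ++ x :: wordOf a (r + s) t := by
  rw [wordOf_add, wordOf_succ, List.append_assoc, List.singleton_append]
  congr 1
  · apply wordOf_congr
    intro l hl
    simp [splice, hl]
  · congr 1
    · simp [splice]
    · apply wordOf_congr
      intro l hl
      simp only [splice]
      rw [if_neg (by omega), if_neg (by omega)]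
      congr 1
      omega

theorem splitSum_wordOf (g : List V → List V → M) (a : ℕ → V) (r n : ℕ) :
    splitSum g (wordOf a r n) =
      ∑ i ∈ Finset.range (n + 1), g (wordOf a r i) (wordOf a (r + i) (n - i)) := by
  rw [splitSum_eq_sum, length_wordOf]
  refine Finset.sum_congr rfl fun i hi => ?_
  obtain ⟨j, rfl⟩ := Nat.exists_eq_add_of_le (Nat.lt_succ_iff.1 (Finset.mem_range.1 hi))
  rw [wordOf_add, List.take_left' (by simp), List.drop_left' (by simp), Nat.add_sub_cancel_left]

theorem tripleSum_wordOf (g : List V → List V → List V → M) (a : ℕ → V) (n : ℕ)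
    (hg : ∀ x z, g x [] z = 0) :
    tripleSum g (wordOf a 0 n) =
      ∑ s ∈ Finset.Icc 1 n, ∑ x ∈ Finset.HasAntidiagonal.antidiagonal (n - s),
        g (wordOf a 0 x.1) (wordOf a x.1 s) (wordOf a (x.1 + s) x.2) := by
  have h1 : tripleSum g (wordOf a 0 n) = ∑ r ∈ Finset.range (n + 1), ∑ s ∈ Finset.Icc 1 (n - r),
      g (wordOf a 0 r) (wordOf a r s) (wordOf a (r + s) (n - r - s)) := by
    rw [tripleSum, splitSum_wordOf]
    refine Finset.sum_congr rfl fun r _ => ?_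
    rw [splitSum_wordOf, zero_add, Finset.sum_range_succ']
    have : wordOf a r 0 = [] := rfl
    rw [this, hg, add_zero, Finset.range_eq_Ico, Finset.sum_Ico_add' (fun i =>
      g (wordOf a 0 r) (wordOf a r i) (wordOf a (r + i) (n - r - i))) 0 (n - r) 1]
    rfl
  rw [h1, Finset.sum_sigma', Finset.sum_sigma']
  refine Finset.sum_bij' (fun x _ => ⟨x.2, (x.1, n - x.1 - x.2)⟩) (fun x _ => ⟨x.2.1, x.1⟩)
    ?_ ?_ ?_ ?_ ?_
  · rintro ⟨r, s⟩ h
    simp only [Finset.mem_sigma, Finset.mem_range, Finset.mem_Icc,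
      Finset.HasAntidiagonal.mem_antidiagonal] at h ⊢
    omega
  · rintro ⟨s, r, t⟩ h
    simp only [Finset.mem_sigma, Finset.mem_range, Finset.mem_Icc,
      Finset.HasAntidiagonal.mem_antidiagonal] at h ⊢
    omega
  · rintro ⟨r, s⟩ h
    rfl
  · rintro ⟨s, r, t⟩ h
    simp only [Finset.mem_sigma, Finset.mem_Icc, Finset.HasAntidiagonal.mem_antidiagonal] at h
    have : n - r - s = t := by omega
    simp [this]
  · rintro ⟨r, s⟩ h
    rfl

/-! #### Signs -/

variable {Γ : Type*} [AddCommGroup Γ] {𝒱 : ℤ × Γ → Submodule k V} {σ : V →ₗ[k] V}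

/-- The exponent of the sign relating the shifted and the unshifted operations. -/
def shiftExponent (n : ℕ) (p : ℕ → ℤ) : ℤ := ∑ i ∈ Finset.range n, ((n : ℤ) - 1 - i) * p i

theorem shiftExponent_congr {n : ℕ} {p p' : ℕ → ℤ} (h : ∀ i < n, p i = p' i) :
    shiftExponent n p = shiftExponent n p' :=
  Finset.sum_congr rfl fun i hi => by rw [h i (Finset.mem_range.1 hi)]

theorem shiftExponent_add (r s : ℕ) (p : ℕ → ℤ) :
    shiftExponent (r + s) p = shiftExponent r p + s * ∑ i ∈ Finset.range r, p i +
      shiftExponent s (fun i => p (r + i)) := by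
  rw [shiftExponent, Finset.sum_range_add, shiftExponent, shiftExponent, Finset.mul_sum,
    ← Finset.sum_add_distrib]
  congr 1
  · refine Finset.sum_congr rfl fun i _ => ?_
    push_cast; ring
  · refine Finset.sum_congr rfl fun i _ => ?_
    push_cast; ring

/-- `-σ` acts by `(-1)^deg`, so its powers produce signs linear in the degrees without naming a
degree. This permits a definition of the unshifted operations as genuine multilinear maps. -/
theorem pow_apply_of_mem (hσ : ∀ j, ∀ a ∈ 𝒱 j, σ a = (j.1 - 1).negOnePow • a) {j : ℤ × Γ} {a : V}
    (ha : a ∈ 𝒱 j) (m : ℕ) : ((-σ : Module.End k V) ^ m) a = ((m : ℤ) * j.1).negOnePow • a := by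
  have h1 : (-σ : Module.End k V) a = j.1.negOnePow • a := by
    rw [LinearMap.neg_apply, hσ j a ha, Int.negOnePow_sub, Int.negOnePow_one]
    rcases Int.even_or_odd j.1 with h | h <;> simp [Int.negOnePow_even, Int.negOnePow_odd, h]
  induction m with
  | zero => simp
  | succ m ih =>
    rw [pow_succ', Module.End.mul_apply, ih]
    have : (-σ : Module.End k V) (((m : ℤ) * j.1).negOnePow • a) =
        ((m : ℤ) * j.1).negOnePow • (-σ : Module.End k V) a := by
      rcases Int.even_or_odd ((m : ℤ) * j.1) with h | h <;>
        simp [Int.negOnePow_even, Int.negOnePow_odd, h]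
    rw [this, h1, smul_smul, ← Int.negOnePow_add]
    congr 2
    push_cast; ring

theorem map_negOnePow_smul {f : V → M} (hf : IsLinearMap k f) (n : ℤ) (v : V) :
    f (n.negOnePow • v) = n.negOnePow • f v := by
  rcases Int.even_or_odd n with h | h <;>
    simp [Int.negOnePow_even, Int.negOnePow_odd, h, hf.map_neg]

/-- The unshifted operations. -/
noncomputable def unshift (σ : V →ₗ[k] V) {c : List V → M} (hc : IsMultilinearOnWords k c) (n : ℕ) :
    MultilinearMap k (fun _ : Fin n => V) M :=
  -- The exponents `n - 1 - i` give the total sign `∑ (n - 1 - i) pᵢ`, which comes from moving `n`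
  -- suspensions past the arguments.
  (hc.toMultilinearMap n).compLinearMap fun i => ((-σ : Module.End k V) ^ (n - 1 - (i : ℕ)))

theorem IsMultilinearOnWords.map_scaled {c : List V → M} (hc : IsMultilinearOnWords k c)
    (a a' : ℕ → V) (q : ℕ → ℤ) (r s : ℕ) (h : ∀ l < s, a' (r + l) = (q l).negOnePow • a (r + l))
    (y z : List V) :
    c (y ++ (wordOf a' r s ++ z)) =
      (∑ l ∈ Finset.range s, q l).negOnePow • c (y ++ (wordOf a r s ++ z)) := by
  induction s generalizing z with
  | zero => simp [wordOf]
  | succ s ih =>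
    rw [wordOf_succ, wordOf_succ, List.append_assoc, List.append_assoc,
      ih (fun l hl => h l (by omega)), h s (by omega), Finset.sum_range_succ, Int.negOnePow_add,
      mul_smul, List.singleton_append, List.singleton_append, ← List.append_assoc,
      map_negOnePow_smul (hc _ _), List.append_assoc]

theorem unshift_apply (hσ : ∀ j, ∀ a ∈ 𝒱 j, σ a = (j.1 - 1).negOnePow • a) {c : List V → M}
    (hc : IsMultilinearOnWords k c) (n : ℕ) (p : ℕ → ℤ × Γ) (a : ℕ → V)
    (ha : ∀ i < n, a i ∈ 𝒱 (p i)) :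
    unshift σ hc n (fun i => a i) =
      (shiftExponent n fun i => (p i).1).negOnePow • c (wordOf a 0 n) := by
  let a' : ℕ → V := fun i => ((-σ : Module.End k V) ^ (n - 1 - i)) (a i)
  have h1 : unshift σ hc n (fun i => a i) = c (wordOf a' 0 n) := by
    rw [wordOf_eq_ofFn]
    simp only [zero_add]
    rfl
  have h2 := hc.map_scaled a a' (fun i => ((n : ℤ) - 1 - i) * (p i).1) 0 n (fun l hl => by
    simp only [zero_add, a']
    rw [pow_apply_of_mem hσ (ha l hl)]
    congr 3
    omega) [] []
  simp only [List.nil_append, List.append_nil] at h2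
  rw [h1, h2]
  rfl

theorem negOnePow_smul_eq {m n : ℤ} (h : Even (m - n)) (x : M) :
    m.negOnePow • x = n.negOnePow • x := by
  rw [(Int.negOnePow_eq_iff m n).2 h]

theorem map_σ_wordOf (a : ℕ → V) (r s : ℕ) :
    (wordOf a r s).map σ = wordOf (fun i => σ (a i)) r s := by
  simp [wordOf]

/-- Term by term, the Koszul signs of the unshifted identity, the shift signs of the two operations
and the `σ`-signs on the initial letters combine to one overall sign depending only on the
arguments. Stasheff's identities thus become the sign-free statement about coderivations. -/
theorem stasheffSum_unshift (hσ : ∀ j, ∀ a ∈ 𝒱 j, σ a = (j.1 - 1).negOnePow • a)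
    {b : List V → V} (hb : IsMultilinearOnWords k b) {c : List V → M}
    (hc : IsMultilinearOnWords k c) (hb0 : b [] = 0)
    (hbm : ∀ n, 1 ≤ n → ∀ (p : ℕ → ℤ × Γ) (a : ℕ → V), (∀ i, a i ∈ 𝒱 (p i)) →
      unshift σ hb n (fun i => a i) ∈ 𝒱 (∑ i ∈ Finset.range n, p i + (2 - (n : ℤ), 0)))
    (n : ℕ) (p : ℕ → ℤ × Γ) (a : ℕ → V) (ha : ∀ i, a i ∈ 𝒱 (p i)) :
    stasheffSum (unshift σ hb) (unshift σ hc) n (fun i => (p i).1) a =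
      (shiftExponent n fun i => (p i).1).negOnePow • insertion σ b c (wordOf a 0 n) := by
  rw [insertion, tripleSum_wordOf _ _ _ (fun x z => by rw [hb0, hc.map_zero]), stasheffSum,
    Finset.smul_sum]
  refine Finset.sum_congr rfl fun s hs => ?_
  rw [Finset.smul_sum]
  refine Finset.sum_congr rfl fun x hx => ?_
  obtain ⟨r, t⟩ := x
  simp only [Finset.mem_Icc, Finset.HasAntidiagonal.mem_antidiagonal] at hs hx ⊢
  have hn : n = r + (s + t) := by omega
  set X := unshift σ hb s (fun l => a (r + (l : ℕ))) with hX
  have hXmem := hbm s hs.1 (fun l => p (r + l)) (fun l => a (r + l)) (fun l => ha _)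
  rw [← hX] at hXmem
  -- The inner operation is its shifted version up to the sign of the block, which starts at
  -- position `r`.
  have hXe : X = (shiftExponent s fun l => (p (r + l)).1).negOnePow • b (wordOf a r s) := by
    rw [hX, unshift_apply hσ hb s (fun l => p (r + l)) (fun l => a (r + l)) (fun l _ => ha _)]
    congr 2
    apply wordOf_congr
    simp
  set P := ∑ l ∈ Finset.range s, p (r + l) + (2 - (s : ℤ), (0 : Γ)) with hP
  rw [unshift_apply hσ hc (r + 1 + t) (splice p r s P) (splice a r s X) (by
    intro i _
    unfold splice
    split_ifs
    · exact ha i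
    · exact hXmem
    · exact ha _), wordOf_splice, hXe, map_negOnePow_smul (hc _ _), map_σ_wordOf]
  have h3 := hc.map_scaled a (fun i => σ (a i)) (fun i => (p i).1 - 1) 0 r (fun l _ => by
    simp only [zero_add]; exact hσ _ _ (ha l)) [] (b (wordOf a r s) :: wordOf a (r + s) t)
  simp only [List.nil_append] at h3
  rw [h3, smul_smul, smul_smul, smul_smul, ← Int.negOnePow_add, ← Int.negOnePow_add,
    ← Int.negOnePow_add]
  apply negOnePow_smul_eq
  have e1 : shiftExponent (r + 1 + t) (fun i => (splice p r s P i).1) =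
      shiftExponent r (fun i => (p i).1) + (1 + t) * ∑ i ∈ Finset.range r, (p i).1 +
        (t * P.1 + shiftExponent t (fun i => (p (r + (s + i))).1)) := by
    rw [add_assoc, shiftExponent_add, shiftExponent_add]
    have f1 : shiftExponent r (fun i => (splice p r s P i).1) =
        shiftExponent r (fun i => (p i).1) := shiftExponent_congr fun i hi => by simp [splice, hi]
    have f2 : ∑ i ∈ Finset.range r, (splice p r s P i).1 = ∑ i ∈ Finset.range r, (p i).1 :=
      Finset.sum_congr rfl fun i hi => by simp [splice, Finset.mem_range.1 hi]
    have f3 : shiftExponent 1 (fun i => (splice p r s P (r + i)).1) = 0 := by simp [shiftExponent]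
    have f4 : ∑ i ∈ Finset.range 1, (splice p r s P (r + i)).1 = P.1 := by simp [splice]
    have f5 : shiftExponent t (fun i => (splice p r s P (r + (1 + i))).1) =
        shiftExponent t (fun i => (p (r + (s + i))).1) := shiftExponent_congr fun i hi => by
      simp only [splice]
      rw [if_neg (by omega), if_neg (by omega)]
      congr 2
      omega
    rw [f1, f2, f3, f4, f5]
    push_cast; ring
  have e2 : P.1 = ∑ l ∈ Finset.range s, (p (r + l)).1 + (2 - s) := by
    rw [hP, Prod.fst_add, Prod.fst_sum]
  rw [e1, e2, hn, shiftExponent_add, shiftExponent_add, Finset.sum_sub_distrib]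
  simp only [Finset.sum_const, Finset.card_range, nsmul_eq_mul, mul_one]
  push_cast
  set S1 := ∑ i ∈ Finset.range r, (p i).1
  set S2 := ∑ l ∈ Finset.range s, (p (r + l)).1
  -- Half of the difference of the two exponents; the equality of signs is a parity statement.
  refine ⟨(r : ℤ) + t + (1 - s) * S1, ?_⟩
  ring

end Words

/-! ### Kadeishvili's theorem -/

section Model

variable {k : Type*} [Field k] {Γ : Type*} [AddCommGroup Γ] [DecidableEq Γ]
  {D : Type*} [Ring D] [Algebra k D] (C : DGAlgebra k Γ D)

theorem hasWordDegree_wordOf {V : Type*} [AddCommGroup V] [Module k V]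
    {𝒱 : ℤ × Γ → Submodule k V} (p : ℕ → ℤ × Γ) (a : ℕ → V) (n : ℕ) (ha : ∀ i < n, a i ∈ 𝒱 (p i)) :
    Contraction.HasWordDegree 𝒱 (wordOf a 0 n) (∑ i ∈ Finset.range n, p i + (-(n : ℤ), 0)) := by
  induction n with
  | zero => simp [wordOf, Contraction.HasWordDegree]
  | succ n ih =>
    rw [wordOf_succ, Contraction.hasWordDegree_append]
    refine ⟨_, p n + (-1, 0), ih fun i hi => ha i (by omega), ⟨p n, 0, ?_, rfl, by simp⟩, ?_⟩
    · simpa using ha n (by omega)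
    · rw [Finset.sum_range_succ]
      ext <;> simp <;> ring

/-- **Kadeishvili's theorem** for a DG algebra, with control over the higher components of the
quasi-isomorphism. -/
theorem DGAlgebra.exists_model (f₁ : ∀ j, C.H j →ₗ[k] C.cocycles j)
    (hf₁ : ∀ j a, C.toH j (f₁ j a) = a)
    (hone : ∀ z : C.cocycles 0, (z : D) = 1 → (f₁ 0 (C.toH 0 z) : D) = 1)
    (W : ℤ × Γ → Submodule k D) (hW : ∀ j, W j ≤ C.deg j)
    (hWd : ∀ j, ∀ β ∈ C.coboundaries j, ∃ w ∈ W (j.1 - 1, j.2), C.diff (j.1 - 1) w = β) :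
    ∃ (M : AInfinityAlgebra C.cohomologyDeg) (φ : AInfinityMorphismToDG M C), IsModel C M ∧
      (∀ j a, φ.f 1 (fun _ => DirectSum.lof k _ C.H j a) = f₁ j a) ∧
      ∀ n, 2 ≤ n → ∀ (p : ℕ → ℤ × Γ) (a : ℕ → C.Cohomology), (∀ i, a i ∈ C.cohomologyDeg (p i)) →
        φ.f n (fun i => a i) ∈ W (∑ i ∈ Finset.range n, p i + (1 - (n : ℤ), 0)) := by
  obtain ⟨T, hσ, hinc, hdif, hpr, hgr, hhinc, hhW⟩ := C.exists_contraction f₁ hf₁ W hW hWd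
  have h1c : (1 : D) ∈ C.cocycles 0 := by
    refine ⟨C.one_mem, ?_⟩
    have := C.leibniz 0 0 1 1 C.one_mem C.one_mem
    simpa using this
  set e : C.Cohomology := C.cls 0 ⟨1, h1c⟩ with he
  have hemem : e ∈ C.cohomologyDeg 0 := C.lof_mem _ _
  have hσe : T.σ e = - e := by rw [hσ 0 e hemem]; simp
  have hince : T.inc e = 1 := by
    apply Subtype.ext
    rw [he, DGAlgebra.cls, hinc]
    exact hone _ rfl
  have hunit := Contraction.op_mor_unit (T := T) hσe hince hhinc
  have hmulb := T.multilinear_op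
  have hmulF := T.multilinear_mor
  have hopmem : ∀ n, ∀ (p : ℕ → ℤ × Γ) (a : ℕ → C.Cohomology),
      (∀ i < n, a i ∈ C.cohomologyDeg (p i)) →
      unshift T.σ hmulb n (fun i => a i) ∈
        C.cohomologyDeg (∑ i ∈ Finset.range n, p i + (2 - (n : ℤ), 0)) := by
    intro n p a ha
    rw [unshift_apply hσ hmulb n p a ha]
    have := (hgr.op_mor_mem _ _ (hasWordDegree_wordOf p a n ha)).1
    have e2 : ∑ i ∈ Finset.range n, p i + (2 - (n : ℤ), 0) =
        ∑ i ∈ Finset.range n, p i + (-(n : ℤ), 0) + (2, 0) := by ext <;> simp; ring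
    rw [e2]
    rcases Int.even_or_odd (shiftExponent n fun i => (p i).1) with h | h <;>
      simp [Int.negOnePow_even, Int.negOnePow_odd, h, this]
  have hmormem : ∀ n, ∀ (p : ℕ → ℤ × Γ) (a : ℕ → C.Cohomology),
      (∀ i < n, a i ∈ C.cohomologyDeg (p i)) →
      (T.mor (wordOf a 0 n) : D) ∈ C.deg (∑ i ∈ Finset.range n, p i + (1 - (n : ℤ), 0)) := by
    intro n p a ha
    have := (hgr.op_mor_mem _ _ (hasWordDegree_wordOf p a n ha)).2
    have e2 : ∑ i ∈ Finset.range n, p i + (1 - (n : ℤ), 0) =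
        ∑ i ∈ Finset.range n, p i + (-(n : ℤ), 0) + (1, 0) := by ext <;> simp; ring
    rw [e2]
    exact this
  have hlist : ∀ (c : List C.Cohomology → C.Cohomology) (hc : IsMultilinearOnWords k c) (n : ℕ)
    (a : Fin n → C.Cohomology), unshift T.σ hc n a = c (List.ofFn fun i : Fin n =>
      ((-T.σ : Module.End k C.Cohomology) ^ (n - 1 - (i : ℕ))) (a i)) := fun c hc n a => rfl
  have hpowe : ∀ m : ℕ, ((-T.σ : Module.End k C.Cohomology) ^ m) e = e := by
    intro m
    rw [pow_apply_of_mem hσ hemem]; simp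
  -- The unit has degree zero, so the sign twists fix it and it remains a letter of the twisted
  -- word.
  have hsplit : ∀ (n : ℕ) (a : Fin n → C.Cohomology) (i : Fin n), a i = e →
      ∃ x z : List C.Cohomology, (List.ofFn fun i : Fin n =>
        ((-T.σ : Module.End k C.Cohomology) ^ (n - 1 - (i : ℕ))) (a i)) = x ++ e :: z ∧
        x.length + z.length + 1 = n := by
    intro n a i hi
    have hm : e ∈ List.ofFn fun i : Fin n =>
        ((-T.σ : Module.End k C.Cohomology) ^ (n - 1 - (i : ℕ))) (a i) :=
      List.mem_ofFn.2 ⟨i, by rw [hi, hpowe]⟩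
    obtain ⟨x, z, h⟩ := List.append_of_mem hm
    refine ⟨x, z, h, ?_⟩
    have := congrArg List.length h
    simp only [List.length_ofFn, List.length_append, List.length_cons] at this
    omega
  let M : AInfinityAlgebra C.cohomologyDeg :=
    { isInternal := C.cohomologyDeg_isInternal
      m := unshift T.σ hmulb
      m_mem := by
        intro n hn p a ha
        have := hopmem n (fun i => if h : i < n then p ⟨i, h⟩ else 0)
          (fun i => if h : i < n then a ⟨i, h⟩ else 0) (fun i hi => by simpa [hi] using ha ⟨i, hi⟩)
        simpa [Finset.sum_range] using this
      stasheff := by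
        intro n hn p a ha
        rw [stasheffSum_unshift hσ hmulb hmulb T.op_nil
          (fun n _ p a ha => hopmem n p a fun i _ => ha i) n p a ha, T.insertion_op, smul_zero]
      one := e
      one_mem := hemem
      one_m := by
        intro a
        rw [hlist]
        have : (List.ofFn fun i : Fin 2 => ((-T.σ : Module.End k C.Cohomology) ^ (2 - 1 - (i : ℕ)))
          ((![e, a] : Fin 2 → C.Cohomology) i)) = [e, a] := by
          simp [List.ofFn_succ, hσe]
        rw [this, Contraction.op_one_left hσe hince]
      m_one := by
        intro a
        rw [hlist]
        have : (List.ofFn fun i : Fin 2 => ((-T.σ : Module.End k C.Cohomology) ^ (2 - 1 - (i : ℕ)))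
          ((![a, e] : Fin 2 → C.Cohomology) i)) = [-T.σ a, e] := by
          simp [List.ofFn_succ]
        rw [this, Contraction.op_one_right hince, map_neg, T.σ_σ, neg_neg]
      m_of_one := by
        rintro n hn a ⟨i, hi⟩
        rw [hlist]
        obtain ⟨x, z, h, hl⟩ := hsplit n a i hi
        rw [h]
        rcases lt_or_ge n 2 with h2 | h2
        · exact Contraction.op_of_length_lt_two (by simp; omega)
        · exact (hunit x z).2 (by omega) }
  have hMm : M.m = unshift T.σ hmulb := rfl
  let fN : (n : ℕ) → MultilinearMap k (fun _ : Fin n => C.Cohomology) D := fun n =>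
    C.total.val.toLinearMap.compMultilinearMap (unshift T.σ hmulF n)
  have hfN : ∀ n a, fN n a = (unshift T.σ hmulF n a : C.total) := fun n a => rfl
  have hfN' : ∀ n, ∀ (p : ℕ → ℤ × Γ) (a : ℕ → C.Cohomology),
      (∀ i < n, a i ∈ C.cohomologyDeg (p i)) → fN n (fun i => a i) =
      (shiftExponent n fun i => (p i).1).negOnePow • (T.mor (wordOf a 0 n) : D) := by
    intro n p a ha
    rw [hfN, unshift_apply hσ hmulF n p a ha]
    rcases Int.even_or_odd (shiftExponent n fun i => (p i).1) with h | h <;>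
      simp [Int.negOnePow_even, Int.negOnePow_odd, h]
  have hfNmem : ∀ n, ∀ (p : ℕ → ℤ × Γ) (a : ℕ → C.Cohomology),
      (∀ i < n, a i ∈ C.cohomologyDeg (p i)) → fN n (fun i => a i) ∈
      C.deg (∑ i ∈ Finset.range n, p i + (1 - (n : ℤ), 0)) := by
    intro n p a ha
    rw [hfN' n p a ha]
    have := hmormem n p a ha
    rcases Int.even_or_odd (shiftExponent n fun i => (p i).1) with h | h <;>
      simp [Int.negOnePow_even, Int.negOnePow_odd, h, this]
  have hφ : ∃ φ : AInfinityMorphismToDG M C, φ.f = fN := by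
    refine ⟨{
      f := fN
      f_mem := ?_
      morphism := ?_
      f_one := ?_
      f_of_one := ?_ }, rfl⟩
    · intro n hn p a ha
      have := hfNmem n (fun i => if h : i < n then p ⟨i, h⟩ else 0)
        (fun i => if h : i < n then a ⟨i, h⟩ else 0) (fun i hi => by simpa [hi] using ha ⟨i, hi⟩)
      simpa [Finset.sum_range] using this
    · intro n hn p a ha
      have h1 : stasheffSum M.m fN n (fun i => (p i).1) a =
          (stasheffSum (unshift T.σ hmulb) (unshift T.σ hmulF) n (fun i => (p i).1) a : C.total) := by
        simp only [stasheffSum, hMm, hfN]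
        rw [AddSubmonoidClass.coe_finsetSum]
        refine Finset.sum_congr rfl fun s _ => ?_
        rw [AddSubmonoidClass.coe_finsetSum]
        refine Finset.sum_congr rfl fun x _ => ?_
        generalize ((x.1 : ℤ) + (s : ℤ) * (x.2 : ℤ) +
          (2 - (s : ℤ)) * ∑ i ∈ Finset.range x.1, (p i).1) = q
        rcases Int.even_or_odd q with h | h <;> simp [Int.negOnePow_even, Int.negOnePow_odd, h]
      have hdeg := hmormem n p a (fun i _ => ha i)
      have h2 : (T.dif (T.mor (wordOf a 0 n)) : D) =
          C.diff (∑ i ∈ Finset.range n, (p i).1 + 1 - n) (T.mor (wordOf a 0 n) : D) := by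
        rw [hdif _ _ hdeg, Prod.fst_add, Prod.fst_sum]
        congr 2
        ring
      rw [h1, stasheffSum_unshift hσ hmulb hmulF T.op_nil
          (fun n _ p a ha => hopmem n p a fun i _ => ha i) n p a ha, T.insertion_mor,
        hfN' n p a (fun i _ => ha i)]
      have h3 : ∀ (q : ℤ) (x : C.total), ((q.negOnePow • x : C.total) : D) = q.negOnePow • (x : D) := by
        intro q x
        rcases Int.even_or_odd q with h | h <;> simp [Int.negOnePow_even, Int.negOnePow_odd, h]
      have h4 : ∀ (q : ℤ) (δ : D →ₗ[k] D) (x : D), δ (q.negOnePow • x) = q.negOnePow • δ x :=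
        fun q δ x => map_negOnePow_smul δ.isLinear q x
      rw [h3, h4, AddSubgroupClass.coe_sub, h2, smul_sub, sub_eq_add_neg]
      congr 1
      have h5 : ((cupSquare T.σ T.mor (wordOf a 0 n) : C.total) : D) =
          ∑ x ∈ (Finset.HasAntidiagonal.antidiagonal n).filter (fun x => 1 ≤ x.1 ∧ 1 ≤ x.2),
            ((T.mor ((wordOf a 0 x.1).map T.σ) * T.mor (wordOf a x.1 x.2) : C.total) : D) := by
        rw [cupSquare, splitSum_wordOf, AddSubmonoidClass.coe_finsetSum, Finset.sum_filter,
          Finset.Nat.sum_antidiagonal_eq_sum_range_succ_mk]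
        refine Finset.sum_congr rfl fun i hi => ?_
        rw [zero_add]
        split_ifs with h
        · rfl
        · rcases Nat.eq_zero_or_pos i with h0 | h0
          · subst h0
            simp [wordOf, T.mor_nil]
          · have : n - i = 0 := by simp at h; omega
            simp [this, wordOf, T.mor_nil]
      rw [h5, Finset.smul_sum, ← Finset.sum_neg_distrib]
      refine Finset.sum_congr rfl fun x hx => ?_
      obtain ⟨i, j⟩ := x
      simp only [Finset.mem_filter, Finset.HasAntidiagonal.mem_antidiagonal] at hx ⊢
      -- The involution on the left factor of the cup square yields one sign for each letter; with
      -- the shift exponents this reproduces the sign in front of `f_i · f_j`.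
      have h6 : T.mor ((wordOf a 0 i).map T.σ) =
          (∑ l ∈ Finset.range i, ((p l).1 - 1)).negOnePow • T.mor (wordOf a 0 i) := by
        have := hmulF.map_scaled a (fun l => T.σ (a l)) (fun l => (p l).1 - 1) 0 i (fun l _ => by
          simp only [zero_add]; exact hσ _ _ (ha l)) [] []
        simpa [map_σ_wordOf] using this
      have h7 : wordOf (fun l => a (i + l)) 0 j = wordOf a i j := wordOf_congr (by simp)
      rw [h6, hfN' i p a (fun i _ => ha i),
        hfN' j (fun l => p (i + l)) (fun l => a (i + l)) (fun l _ => ha _), h7,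
        Subalgebra.coe_mul, h3]
      generalize (T.mor (wordOf a 0 i) : D) = x
      generalize (T.mor (wordOf a i j) : D) = y
      have h8 : ∀ (q q' : ℤ) (x y : D), (q.negOnePow • x) * (q'.negOnePow • y) =
          (q + q').negOnePow • (x * y) := by
        intro q q' x y
        rw [Int.negOnePow_add]
        rcases Int.even_or_odd q with h | h <;> rcases Int.even_or_odd q' with h' | h' <;>
          simp [Int.negOnePow_even, Int.negOnePow_odd, h, h']
      have h9 : ∀ (q : ℤ) (x : D), -(q.negOnePow • x) = (q + 1).negOnePow • x := by
        intro q x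
        rw [Int.negOnePow_succ, Units.neg_smul]
      have h10 : ∀ (q : ℤ) (x y : D), (q.negOnePow • x) * y = q.negOnePow • (x * y) := by
        intro q x y
        have := h8 q 0 x y
        simpa using this
      rw [h8, h10, smul_smul, smul_smul, ← Int.negOnePow_add, ← Int.negOnePow_add, h9]
      apply negOnePow_smul_eq
      rw [← hx.1, shiftExponent_add, Finset.sum_sub_distrib]
      simp only [Finset.sum_const, Finset.card_range, nsmul_eq_mul, mul_one]
      set S1 := ∑ i ∈ Finset.range i, (p i).1
      refine ⟨j * S1 - i + 1, ?_⟩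
      ring
    · change fN 1 (fun _ => e) = 1
      have := hfN' 1 (fun _ => 0) (fun _ => e) (fun _ _ => hemem)
      rw [this]
      simp [wordOf, T.mor_singleton, hince, shiftExponent]
    · rintro n hn a ⟨i, hi⟩
      obtain ⟨x, z, h, hl⟩ := hsplit n a i hi
      have : (unshift T.σ hmulF n a) = T.mor (List.ofFn fun i : Fin n =>
        ((-T.σ : Module.End k C.Cohomology) ^ (n - 1 - (i : ℕ))) (a i)) := rfl
      rw [hfN, this, h, (hunit x z).1 (by omega)]
      rfl
  obtain ⟨φ, hφ⟩ := hφ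
  have hφ1 : ∀ j a, φ.f 1 (fun _ => DirectSum.lof k _ C.H j a) = f₁ j a := by
    intro j a
    rw [hφ, hfN' 1 (fun _ => j) (fun _ => DirectSum.lof k _ C.H j a) (fun _ _ => C.lof_mem _ _)]
    simp [wordOf, T.mor_singleton, hinc, shiftExponent]
  refine ⟨M, φ, ⟨?_, ?_, φ, ?_⟩, hφ1, ?_⟩
  · rw [hMm]
    refine MultilinearMap.ext fun a => ?_
    rw [hlist, Contraction.op_of_length_lt_two (by simp)]
    rfl
  · intro i j x y
    rw [hMm, hlist]
    have : (List.ofFn fun l : Fin 2 => ((-T.σ : Module.End k C.Cohomology) ^ (2 - 1 - (l : ℕ)))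
      ((![C.cls i x, C.cls j y] : Fin 2 → C.Cohomology) l)) = [-T.σ (C.cls i x), C.cls j y] := by
      simp [List.ofFn_succ]
    rw [this, Contraction.op_pair, map_neg, T.σ_σ, map_neg, neg_mul, map_neg, neg_neg]
    -- The transferred product is the class of the product of the chosen representatives. It remains
    -- to see that changing representatives by coboundaries does not change this class.
    set z : C.cocycles (i + j) := C.mulCocycles (f₁ i (C.toH i x)) (f₁ j (C.toH j y)) with hz
    rw [hpr (i + j) z _ (by
      rw [Subalgebra.coe_mul, DGAlgebra.cls, DGAlgebra.cls, hinc, hinc]; rfl)]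
    rw [DGAlgebra.cls, DGAlgebra.cls]
    congr 1
    rw [← sub_eq_zero, ← DGAlgebra.toHₗ_apply, ← DGAlgebra.toHₗ_apply, ← map_sub,
      DGAlgebra.toHₗ_apply, DGAlgebra.toH_eq_zero_iff]
    have hcob : ∀ j (x : C.cocycles j), (f₁ j (C.toH j x) : D) - x ∈ C.coboundaries j := by
      intro j x
      have : C.toH j (f₁ j (C.toH j x) - x) = 0 := by
        rw [← DGAlgebra.toHₗ_apply, map_sub, DGAlgebra.toHₗ_apply, DGAlgebra.toHₗ_apply, hf₁,
          sub_self]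
      exact (C.toH_eq_zero_iff _).1 this
    have hcm : ∀ (i j : ℤ × Γ) (β γ : D), β ∈ C.coboundaries i → γ ∈ C.cocycles j →
        β * γ ∈ C.coboundaries (i + j) := by
      rintro i j _ γ ⟨w, hw, rfl⟩ hγ
      have hl := C.leibniz _ _ _ _ hw hγ.1
      rw [show C.diff j.1 γ = 0 from hγ.2, mul_zero, smul_zero, add_zero] at hl
      refine ⟨w * γ, ?_, ?_⟩
      · have := C.mul_mem _ _ _ _ hw hγ.1
        change w * γ ∈ C.deg ((i + j).1 - 1, (i + j).2)
        rwa [show ((i + j).1 - 1, (i + j).2) = (i.1 - 1, i.2) + j by ext <;> simp; ring]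
      · rw [← hl]
        congr 2
        simp; ring
    have hmc : ∀ (i j : ℤ × Γ) (β γ : D), β ∈ C.cocycles i → γ ∈ C.coboundaries j →
        β * γ ∈ C.coboundaries (i + j) := by
      rintro i j β _ hβ ⟨w, hw, rfl⟩
      have hl := C.leibniz _ _ _ _ hβ.1 hw
      rw [show C.diff i.1 β = 0 from hβ.2, zero_mul, zero_add] at hl
      have hmem : β * w ∈ C.deg ((i + j).1 - 1, (i + j).2) := by
        have := C.mul_mem _ _ _ _ hβ.1 hw
        rwa [show ((i + j).1 - 1, (i + j).2) = i + (j.1 - 1, j.2) by ext <;> simp; ring]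
      refine ⟨i.1.negOnePow • (β * w), ?_, ?_⟩
      · change _ ∈ C.deg ((i + j).1 - 1, (i + j).2)
        rcases Int.even_or_odd i.1 with h | h
        · rwa [Int.negOnePow_even _ h, one_smul]
        · rw [Int.negOnePow_odd _ h, Units.neg_smul, one_smul]
          exact neg_mem hmem
      · rw [map_negOnePow_smul (LinearMap.isLinear _),
          show (i + j).1 - 1 = i.1 + (j.1 - 1) by simp; ring, hl, smul_smul, ← Int.negOnePow_add,
          Int.negOnePow_even _ ⟨_, rfl⟩, one_smul]
    have h1 := hcm i j _ _ (hcob i x) y.2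
    have h2 := hmc i j _ _ (f₁ i (C.toH i x)).2 (hcob j y)
    have h3 := add_mem h1 h2
    convert h3 using 1
    change (f₁ i (C.toH i x) : D) * (f₁ j (C.toH j y) : D) - (x : D) * y = _
    noncomm_ring
  · intro j z
    rw [DGAlgebra.cls, hφ1]
    have : C.toH j (f₁ j (C.toH j z) - z) = 0 := by
      rw [← DGAlgebra.toHₗ_apply, map_sub, DGAlgebra.toHₗ_apply, DGAlgebra.toHₗ_apply, hf₁,
        sub_self]
    exact (C.toH_eq_zero_iff _).1 this
  · intro n hn p a ha
    rw [hφ, hfN' n p a (fun i _ => ha i)]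
    -- For `n ≥ 2` the component is, up to sign, the homotopy applied to the obstruction, and the
    -- homotopy takes values in `W`.
    have h1 := (Contraction.op_mor_eq (T := T) (w := wordOf a 0 n) (by simpa using hn)).2
    have h2 := hgr.obstruction_mem (hasWordDegree_wordOf p a n fun i _ => ha i)
    have h3 := hhW _ _ h2
    rw [← h1] at h3
    have e2 : ∑ i ∈ Finset.range n, p i + (1 - (n : ℤ), 0) =
        ((∑ i ∈ Finset.range n, p i + (-(n : ℤ), 0) + (2, 0)).1 - 1,
          (∑ i ∈ Finset.range n, p i + (-(n : ℤ), 0) + (2, 0)).2) := by ext <;> simp; ring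
    rw [e2]
    rcases Int.even_or_odd (shiftExponent n fun i => (p i).1) with h | h <;>
      simpa [Int.negOnePow_even, Int.negOnePow_odd, h] using h3

end Model

end ExtAInf

open scoped DirectSum

namespace ExtAInf

set_option linter.unusedSectionVars false

/-! ### Projections and graded subspaces -/

section GradedTools

variable {k : Type*} [Field k] {ι : Type*} [DecidableEq ι] {V : Type*} [AddCommGroup V]
  [Module k V] {𝒱 : ι → Submodule k V} (h : DirectSum.IsInternal 𝒱)

/-- The projection onto a homogeneous component. -/
noncomputable def gproj (d : ι) : V →ₗ[k] V :=
  gradedLift h (fun j => if j = d then (𝒱 j).subtype else 0)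

theorem gproj_of_mem {d : ι} {x : V} (hx : x ∈ 𝒱 d) : gproj h d x = x := by
  rw [gproj, gradedLift_of_mem h _ hx, if_pos rfl]; rfl

theorem gproj_of_mem_ne {d j : ι} {x : V} (hx : x ∈ 𝒱 j) (hj : j ≠ d) : gproj h d x = 0 := by
  rw [gproj, gradedLift_of_mem h _ hx, if_neg hj]; rfl

include h in
theorem isInternal_induction {C : V → Prop} (hz : C 0) (hadd : ∀ x y, C x → C y → C (x + y))
    (hm : ∀ d, ∀ x ∈ 𝒱 d, C x) (x : V) : C x := by
  have hx : x ∈ ⨆ d, 𝒱 d := by rw [h.submodule_iSup_eq_top]; trivial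
  induction hx using Submodule.iSup_induction' with
  | mem i x hx => exact hm i x hx
  | zero => exact hz
  | add x y _ _ hx hy => exact hadd x y hx hy

theorem gproj_mem (d : ι) (x : V) : gproj h d x ∈ 𝒱 d := by
  refine isInternal_induction h (C := fun x => gproj h d x ∈ 𝒱 d) (by simp) ?_ ?_ x
  · intro x y hx hy; rw [map_add]; exact add_mem hx hy
  · intro j x hx
    by_cases hj : j = d
    · subst hj; rwa [gproj_of_mem h hx]
    · rw [gproj_of_mem_ne h hx hj]; exact zero_mem _

theorem mem_span_gproj (x : V) : x ∈ Submodule.span k (Set.range fun d => gproj h d x) := by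
  obtain ⟨s, hs⟩ : ∃ s : Finset ι, x = ∑ d ∈ s, gproj h d x := by
    -- Asking for the formula on all larger index sets makes the property stable under addition.
    have key : ∃ s : Finset ι, ∀ t, s ⊆ t → x = ∑ d ∈ t, gproj h d x := by
      refine isInternal_induction h
        (C := fun x => ∃ s : Finset ι, ∀ t, s ⊆ t → x = ∑ d ∈ t, gproj h d x) ⟨∅, by simp⟩ ?_ ?_ x
      · rintro x y ⟨s, hs⟩ ⟨t, ht⟩
        refine ⟨s ∪ t, fun w hw => ?_⟩
        simp only [map_add, Finset.sum_add_distrib]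
        rw [← hs w (Finset.union_subset_left hw), ← ht w (Finset.union_subset_right hw)]
      · intro j x hx
        refine ⟨{j}, fun t ht => ?_⟩
        rw [Finset.sum_eq_single j, gproj_of_mem h hx]
        · intro i _ hi; exact gproj_of_mem_ne h hx (Ne.symm hi)
        · intro hj; exact absurd (ht (Finset.mem_singleton_self j)) hj
    obtain ⟨s, hs⟩ := key
    exact ⟨s, hs s subset_rfl⟩
  rw [hs]
  refine sum_mem fun d _ => ?_
  rw [← hs]
  exact Submodule.subset_span ⟨d, rfl⟩

theorem mem_of_gproj_mem {W : Submodule k V} {x : V} (hx : ∀ d, gproj h d x ∈ W) : x ∈ W :=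
  (Submodule.span_le.2 (by rintro _ ⟨d, rfl⟩; exact hx d)) (mem_span_gproj h x)

theorem eq_zero_of_gproj {x : V} (hx : ∀ d, gproj h d x = 0) : x = 0 := by
  simpa using mem_of_gproj_mem h (W := ⊥) (x := x) (by simpa using hx)

theorem map_gproj {M : Type*} [AddCommGroup M] [Module k M] {ℳ : ι → Submodule k M}
    (hM : DirectSum.IsInternal ℳ) {f : V →ₗ[k] M} (hf : ∀ d, ∀ x ∈ 𝒱 d, f x ∈ ℳ d) (d : ι)
    (x : V) : f (gproj h d x) = gproj hM d (f x) := by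
  refine isInternal_induction h (C := fun x => f (gproj h d x) = gproj hM d (f x)) (by simp) ?_ ?_ x
  · intro x y hx hy; simp [hx, hy]
  · intro j x hx
    by_cases hj : j = d
    · subst hj; rw [gproj_of_mem h hx, gproj_of_mem hM (hf _ _ hx)]
    · rw [gproj_of_mem_ne h hx hj, gproj_of_mem_ne hM (hf _ _ hx) hj, map_zero]

theorem IsGradedSubspace.gproj_mem {W : Submodule k V} (hW : IsGradedSubspace 𝒱 W) {x : V}
    (hx : x ∈ W) (d : ι) : gproj h d x ∈ W := by
  have hx' := hW hx
  induction hx' using Submodule.iSup_induction' with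
  | mem i x hx' =>
    by_cases hj : i = d
    · subst hj; rw [gproj_of_mem h hx'.2]; exact hx'.1
    · rw [gproj_of_mem_ne h hx'.2 hj]; exact zero_mem _
  | zero => simp
  | add x y hx' hy' h1 h2 =>
    have hle : ⨆ d, W ⊓ 𝒱 d ≤ W := iSup_le fun d => inf_le_left
    rw [map_add]; exact add_mem (h1 (hle hx')) (h2 (hle hy'))

theorem isGradedSubspace_of_gproj {W : Submodule k V}
    (hW : ∀ d, ∀ x ∈ W, gproj h d x ∈ W) : IsGradedSubspace 𝒱 W := by
  intro x hx
  exact mem_of_gproj_mem h fun d =>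
    Submodule.mem_iSup_of_mem d ⟨hW d x hx, ExtAInf.gproj_mem h d x⟩

include h in
theorem IsGradedSubspace.inf {W W' : Submodule k V} (hW : IsGradedSubspace 𝒱 W)
    (hW' : IsGradedSubspace 𝒱 W') : IsGradedSubspace 𝒱 (W ⊓ W') :=
  isGradedSubspace_of_gproj h fun d _ hx => ⟨hW.gproj_mem h hx.1 d, hW'.gproj_mem h hx.2 d⟩

theorem IsGradedSubspace.sup {W W' : Submodule k V} (hW : IsGradedSubspace 𝒱 W)
    (hW' : IsGradedSubspace 𝒱 W') : IsGradedSubspace 𝒱 (W ⊔ W') :=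
  sup_le (hW.trans (iSup_mono fun _ => inf_le_inf_right _ le_sup_left))
    (hW'.trans (iSup_mono fun _ => inf_le_inf_right _ le_sup_right))

include h in
theorem isGradedSubspace_ker {M : Type*} [AddCommGroup M] [Module k M] {ℳ : ι → Submodule k M}
    (hM : DirectSum.IsInternal ℳ) {f : V →ₗ[k] M} (hf : ∀ d, ∀ x ∈ 𝒱 d, f x ∈ ℳ d) :
    IsGradedSubspace 𝒱 (LinearMap.ker f) :=
  isGradedSubspace_of_gproj h fun d x hx => by
    rw [LinearMap.mem_ker] at hx ⊢
    rw [map_gproj h hM hf, hx, map_zero]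

include h in
theorem isGradedSubspace_range {M : Type*} [AddCommGroup M] [Module k M] {ℳ : ι → Submodule k M}
    {f : V →ₗ[k] M} (hf : ∀ d, ∀ x ∈ 𝒱 d, f x ∈ ℳ d) :
    IsGradedSubspace ℳ (LinearMap.range f) := by
  rintro _ ⟨x, rfl⟩
  refine isInternal_induction h (C := fun x => f x ∈ ⨆ d, LinearMap.range f ⊓ ℳ d) (by simp) ?_ ?_ x
  · intro x y hx hy; rw [map_add]; exact add_mem hx hy
  · intro d x hx; exact Submodule.mem_iSup_of_mem d ⟨⟨x, rfl⟩, hf d x hx⟩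

include h in
-- Choose a complement of `W'` in every degree separately, intersect it with `W`, and add up; both
-- claims are then checked on homogeneous components.
theorem exists_graded_compl {W W' : Submodule k V} (hle : W' ≤ W) (hW : IsGradedSubspace 𝒱 W)
    (hW' : IsGradedSubspace 𝒱 W') :
    ∃ U : Submodule k V, IsGradedSubspace 𝒱 U ∧ U ⊔ W' = W ∧ U ⊓ W' = ⊥ := by
  have hC : ∀ d, ∃ C : Submodule k V, IsCompl (W' ⊓ 𝒱 d) C :=
    fun d => (W' ⊓ 𝒱 d).exists_isCompl
  choose C hC using hC
  set U := ⨆ d, C d ⊓ (W ⊓ 𝒱 d) with hU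
  have hUg : IsGradedSubspace 𝒱 U := by
    refine iSup_le fun d x hx => Submodule.mem_iSup_of_mem d ⟨?_, hx.2.2⟩
    exact Submodule.mem_iSup_of_mem d hx
  have hUW : U ≤ W := iSup_le fun d x hx => hx.2.1
  have hUC : ∀ d, ∀ x ∈ U, gproj h d x ∈ C d := by
    intro d x hx
    induction hx using Submodule.iSup_induction' with
    | mem i x hx =>
      by_cases hj : i = d
      · subst hj; rw [gproj_of_mem h hx.2.2]; exact hx.1
      · rw [gproj_of_mem_ne h hx.2.2 hj]; exact zero_mem _
    | zero => simp
    | add x y _ _ h1 h2 => rw [map_add]; exact add_mem h1 h2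
  refine ⟨U, hUg, le_antisymm (sup_le hUW hle) ?_, ?_⟩
  · intro x hx
    refine mem_of_gproj_mem h fun d => ?_
    obtain ⟨a, ha, b, hb, hab⟩ := Submodule.mem_sup.1
      (show gproj h d x ∈ (W' ⊓ 𝒱 d) ⊔ C d by rw [(hC d).sup_eq_top]; trivial)
    rw [← hab, add_comm]
    refine Submodule.add_mem_sup (Submodule.mem_iSup_of_mem d ⟨hb, ?_⟩) ha.1
    have : b = gproj h d x - a := by rw [← hab]; abel
    rw [this]
    exact ⟨sub_mem (hW.gproj_mem h hx d) (hle ha.1), sub_mem (gproj_mem h d x) ha.2⟩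
  · rw [eq_bot_iff]
    rintro x ⟨h1, h2⟩
    refine eq_zero_of_gproj h fun d => ?_
    have : gproj h d x ∈ (W' ⊓ 𝒱 d) ⊓ C d :=
      ⟨⟨hW'.gproj_mem h h2 d, gproj_mem h d x⟩, hUC d x h1⟩
    rwa [(hC d).inf_eq_bot] at this

include h in
theorem IsGradedSubspace.isInternal {W : Submodule k V} (hW : IsGradedSubspace 𝒱 W) :
    DirectSum.IsInternal fun d => (𝒱 d).comap W.subtype := by
  rw [DirectSum.isInternal_submodule_iff_iSupIndep_and_iSup_eq_top]
  constructor
  · have hi := h.submodule_iSupIndep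
    rw [iSupIndep_iff_finsetSum_eq_zero_imp_eq_zero] at hi ⊢
    intro s f hf hsum j hj
    apply Subtype.ext
    refine hi s (fun l => (f l : V)) (fun l hl => hf l hl) ?_ j hj
    simpa using congrArg Subtype.val hsum
  · rw [eq_top_iff]
    rintro ⟨x, hx⟩ -
    have hx' := hW hx
    have hle : ⨆ d, W ⊓ 𝒱 d ≤ W := iSup_le fun d => inf_le_left
    have : ∀ (y : V) (hy : y ∈ ⨆ d, W ⊓ 𝒱 d),
        (⟨y, hle hy⟩ : W) ∈ ⨆ d, (𝒱 d).comap W.subtype := by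
      intro y hy
      induction hy using Submodule.iSup_induction' with
      | mem i y hy => exact Submodule.mem_iSup_of_mem i hy.2
      | zero => exact zero_mem _
      | add y z _ _ h1 h2 => exact add_mem h1 h2
    exact this x hx'

end GradedTools

/-! ### Tensor algebras -/

section Tensor

variable {k : Type*} [Field k] {Q : Type*} [AddCommGroup Q] [Module k Q]

open TensorAlgebra in
-- Induction on the first letter, the form suited to `θ`, which is defined by splitting off a first
-- letter.
theorem tensor_induction {C : TensorAlgebra k Q → Prop} (hadd : ∀ x y, C x → C y → C (x + y))
    (hs : ∀ r : k, C (algebraMap k _ r)) (hι : ∀ q t, C t → C (ι k q * t))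
    (t : TensorAlgebra k Q) : C t := by
  -- Multiplication on the left by an arbitrary tensor preserves the property. Scalars are carried
  -- along because the property is not assumed stable under scaling.
  have key : ∀ s : TensorAlgebra k Q, ∀ (t : TensorAlgebra k Q), (∀ r : k, C (r • t)) →
      ∀ r : k, C (r • (s * t)) := by
    intro s
    induction s using TensorAlgebra.induction with
    | algebraMap r =>
      intro t ht r'
      rw [← Algebra.smul_def, smul_smul]; exact ht _
    | ι q =>
      intro t ht r
      rw [← mul_smul_comm]; exact hι q _ (ht r)
    | mul a b ha hb =>
      intro t ht r
      rw [mul_assoc]; exact ha _ (hb _ ht) r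
    | add a b ha hb =>
      intro t ht r
      rw [add_mul, smul_add]; exact hadd _ _ (ha t ht r) (hb t ht r)
  have := key t 1 (fun r => by rw [← Algebra.algebraMap_eq_smul_one]; exact hs r) 1
  rwa [one_smul, mul_one] at this

open TensorAlgebra in
/-- Linear maps out of the tensor algebra defined by separating the first letter. -/
theorem exists_tensorRec {M : Type*} [AddCommGroup M] [Module k M] (m₀ : M)
    (β : Q →ₗ[k] TensorAlgebra k Q →ₗ[k] M) :
    ∃ c : TensorAlgebra k Q →ₗ[k] M, c 1 = m₀ ∧ ∀ q t, c (ι k q * t) = β q t := by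
  let T := TensorAlgebra k Q
  -- The tensor algebra acts on `T × M` with `q` sending `(t, m)` to `(q t, β q t)`. Acting on `(1,
  -- m₀)` and taking the second coordinate gives the required map.
  let g : Q →ₗ[k] Module.End k (T × M) :=
    { toFun := fun q => LinearMap.prod (LinearMap.mulLeft k (ι k q) ∘ₗ LinearMap.fst k T M)
        (β q ∘ₗ LinearMap.fst k T M)
      map_add' := by intro x y; ext <;> simp [add_mul]
      map_smul' := by intro x y; ext <;> simp }
  have hfst : ∀ (t : T) (w : T × M), (TensorAlgebra.lift k g t w).1 = t * w.1 := by
    intro t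
    induction t using TensorAlgebra.induction with
    | algebraMap r =>
      intro w
      simp only [AlgHom.commutes, Module.algebraMap_end_apply, Prod.smul_fst, Algebra.smul_def]
      rfl
    | ι q => intro w; simp [g]
    | mul a b ha hb => intro w; simp [ha, hb, mul_assoc]
    | add a b ha hb => intro w; simp [ha, hb, add_mul]
  refine ⟨LinearMap.snd k T M ∘ₗ LinearMap.applyₗ (1, m₀) ∘ₗ
    (TensorAlgebra.lift k g).toLinearMap, by simp, fun q t => ?_⟩
  have := hfst t (1, m₀)
  simp only [mul_one] at this
  simp [g, this]

open TensorAlgebra in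
theorem tensor_ext {M : Type*} [AddCommGroup M] [Module k M] {f g : TensorAlgebra k Q →ₗ[k] M}
    (h1 : f 1 = g 1) (hι : ∀ q t, f t = g t → f (ι k q * t) = g (ι k q * t)) : f = g := by
  ext t
  induction t using tensor_induction with
  | hadd x y hx hy => simp [hx, hy]
  | hs r => simp [Algebra.algebraMap_eq_smul_one, h1]
  | hι q t ht => exact hι q t ht

theorem tprod_zero (q : Fin 0 → Q) : TensorAlgebra.tprod k Q 0 q = 1 := by
  simp [TensorAlgebra.tprod_apply]

theorem ι_mul_tprod {n : ℕ} (q₀ : Q) (q : Fin n → Q) :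
    TensorAlgebra.ι k q₀ * TensorAlgebra.tprod k Q n q =
      TensorAlgebra.tprod k Q (n + 1) (Fin.cons q₀ q) := by
  simp [TensorAlgebra.tprod_apply, List.ofFn_succ]

theorem tprod_succ {n : ℕ} (q : Fin (n + 1) → Q) : TensorAlgebra.tprod k Q (n + 1) q =
    TensorAlgebra.ι k (q 0) * TensorAlgebra.tprod k Q n (fun i => q i.succ) := by
  simp [TensorAlgebra.tprod_apply, List.ofFn_succ]

theorem span_tprod : Submodule.span k {x | ∃ (n : ℕ) (q : Fin n → Q),
    x = TensorAlgebra.tprod k Q n q} = ⊤ := by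
  rw [eq_top_iff]
  rintro t -
  induction t using tensor_induction with
  | hadd x y hx hy => exact add_mem hx hy
  | hs r =>
    rw [Algebra.algebraMap_eq_smul_one]
    exact Submodule.smul_mem _ _ (Submodule.subset_span ⟨0, Fin.elim0, (tprod_zero _).symm⟩)
  | hι q t ht =>
    induction ht using Submodule.span_induction with
    | mem x hx =>
      obtain ⟨n, w, rfl⟩ := hx
      exact Submodule.subset_span ⟨n + 1, Fin.cons q w, ι_mul_tprod q w⟩
    | zero => simp
    | add x y _ _ hx hy => rw [mul_add]; exact add_mem hx hy
    | smul r x _ hx => rw [mul_smul_comm]; exact Submodule.smul_mem _ _ hx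

theorem algebraMapInv_ι_mul (q : Q) (t : TensorAlgebra k Q) :
    TensorAlgebra.algebraMapInv (TensorAlgebra.ι k q * t) = 0 := by
  rw [map_mul]; simp [TensorAlgebra.algebraMapInv]

/-- The subspace of the elements `∑ ι(q) t` with `t` in `W`. -/
def consSpan (W : Submodule k (TensorAlgebra k Q)) : Submodule k (TensorAlgebra k Q) :=
  LinearMap.range (TensorAlgebra.ι k) * W

theorem ι_mul_mem_consSpan {W : Submodule k (TensorAlgebra k Q)} (q : Q) {t : TensorAlgebra k Q}
    (ht : t ∈ W) : TensorAlgebra.ι k q * t ∈ consSpan W :=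
  Submodule.mul_mem_mul ⟨q, rfl⟩ ht

theorem consSpan_le {W U : Submodule k (TensorAlgebra k Q)}
    (hU : ∀ q, ∀ t ∈ W, TensorAlgebra.ι k q * t ∈ U) : consSpan W ≤ U := by
  refine Submodule.mul_le.2 ?_
  rintro _ ⟨q, rfl⟩ t ht
  exact hU q t ht

theorem sub_algebraMapInv_mem_consSpan (t : TensorAlgebra k Q) :
    t - algebraMap k _ (TensorAlgebra.algebraMapInv t) ∈ consSpan (⊤ : Submodule k _) := by
  induction t using tensor_induction with
  | hadd x y hx hy =>
    have := add_mem hx hy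
    simp only [map_add]
    convert this using 1; abel
  | hs r => simp
  | hι q t _ =>
    rw [algebraMapInv_ι_mul, map_zero, sub_zero]
    exact ι_mul_mem_consSpan q trivial

theorem mem_consSpan_top {t : TensorAlgebra k Q} :
    t ∈ consSpan (⊤ : Submodule k _) ↔ TensorAlgebra.algebraMapInv t = 0 := by
  constructor
  · intro ht
    have : consSpan (⊤ : Submodule k (TensorAlgebra k Q)) ≤
        LinearMap.ker (TensorAlgebra.algebraMapInv (R := k) (M := Q)).toLinearMap :=
      consSpan_le fun q t _ => algebraMapInv_ι_mul q t
    exact this ht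
  · intro ht
    simpa [ht] using sub_algebraMapInv_mem_consSpan t

end Tensor

/-! ### Pairing tensors with words of functionals -/

section WordPairing

variable {k : Type*} [Field k] {A : Type*} [Ring A] [Algebra k A] {Q : Submodule k A}

theorem wordPairing_tprod {n : ℕ} (b : Fin n → Module.Dual k Q) (q : Fin n → Q) :
    wordPairing b (TensorAlgebra.tprod k Q n q) = ∏ i, b i (q i) := by
  have : TensorAlgebra.equivDirectSum (TensorAlgebra.tprod k Q n q) =
      DirectSum.lof k ℕ (fun i => PiTensorProduct k (fun _ : Fin i => Q)) n
        (PiTensorProduct.tprod k q) :=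
    TensorAlgebra.toDirectSum_tensorPower_tprod q
  rw [wordPairing, LinearMap.comp_apply, LinearMap.comp_apply, AlgEquiv.toLinearMap_apply, this,
    DirectSum.component.lof_self]
  simp

theorem wordPairing_tprod_ne {n m : ℕ} (h : m ≠ n) (b : Fin n → Module.Dual k Q)
    (q : Fin m → Q) : wordPairing b (TensorAlgebra.tprod k Q m q) = 0 := by
  have : TensorAlgebra.equivDirectSum (TensorAlgebra.tprod k Q m q) =
      DirectSum.lof k ℕ (fun i => PiTensorProduct k (fun _ : Fin i => Q)) m
        (PiTensorProduct.tprod k q) :=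
    TensorAlgebra.toDirectSum_tensorPower_tprod q
  rw [wordPairing, LinearMap.comp_apply, LinearMap.comp_apply, AlgEquiv.toLinearMap_apply, this,
    DirectSum.component.of, dif_neg h, map_zero]

theorem linearMap_ext_tprod {M : Type*} [AddCommGroup M] [Module k M]
    {f g : TensorAlgebra k Q →ₗ[k] M} (h : ∀ (n : ℕ) (q : Fin n → Q),
      f (TensorAlgebra.tprod k Q n q) = g (TensorAlgebra.tprod k Q n q)) : f = g := by
  refine LinearMap.ext_on span_tprod ?_
  rintro _ ⟨n, q, rfl⟩
  exact h n q

theorem wordPairing_ι_mul {n : ℕ} (b : Fin (n + 1) → Module.Dual k Q) (q : Q)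
    (t : TensorAlgebra k Q) : wordPairing b (TensorAlgebra.ι k q * t) =
      b 0 q * wordPairing (fun i : Fin n => b i.succ) t := by
  have : wordPairing b ∘ₗ LinearMap.mulLeft k (TensorAlgebra.ι k q) =
      b 0 q • wordPairing (fun i : Fin n => b i.succ) := by
    refine linearMap_ext_tprod fun m w => ?_
    simp only [LinearMap.comp_apply, LinearMap.mulLeft_apply, LinearMap.smul_apply, smul_eq_mul,
      ι_mul_tprod]
    by_cases hm : m = n
    · subst hm
      rw [wordPairing_tprod, wordPairing_tprod, Fin.prod_univ_succ]
      simp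
    · rw [wordPairing_tprod_ne (by omega), wordPairing_tprod_ne hm, mul_zero]
  exact LinearMap.congr_fun this t

theorem wordPairing_zero (b : Fin 0 → Module.Dual k Q) (t : TensorAlgebra k Q) :
    wordPairing b t = TensorAlgebra.algebraMapInv t := by
  have : wordPairing b = (TensorAlgebra.algebraMapInv (R := k) (M := Q)).toLinearMap := by
    refine tensor_ext ?_ fun q t _ => ?_
    · rw [← tprod_zero (k := k) (Q := Q) Fin.elim0, wordPairing_tprod]
      simp
    · have h0 : wordPairing b ∘ₗ LinearMap.mulLeft k (TensorAlgebra.ι k q) = 0 := by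
        refine linearMap_ext_tprod fun m w => ?_
        simp only [LinearMap.comp_apply, LinearMap.mulLeft_apply, LinearMap.zero_apply,
          ι_mul_tprod]
        exact wordPairing_tprod_ne (by omega) _ _
      have := LinearMap.congr_fun h0 t
      simp only [LinearMap.comp_apply, LinearMap.mulLeft_apply, LinearMap.zero_apply] at this
      rw [this, AlgHom.toLinearMap_apply, algebraMapInv_ι_mul]
  exact LinearMap.congr_fun this t

end WordPairing

/-! ### The Adams grading of the tensor algebra -/

section TensorDeg

variable {k : Type*} [Field k] {G : Type*} [AddCommGroup G] [DecidableEq G]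
  {A : Type*} [Ring A] [Algebra k A] {𝒜 : ℤ × G → Submodule k A} {Q : Submodule k A}

theorem one_mem_tensorDeg : (1 : TensorAlgebra k Q) ∈ tensorDeg 𝒜 Q 0 :=
  Submodule.subset_span ⟨0, Fin.elim0, Fin.elim0, fun i => i.elim0, by simp, (tprod_zero _).symm⟩

theorem ι_mul_mem_tensorDeg {d e : ℤ × G} {q : Q} (hq : (q : A) ∈ 𝒜 d) {t : TensorAlgebra k Q}
    (ht : t ∈ tensorDeg 𝒜 Q e) : TensorAlgebra.ι k q * t ∈ tensorDeg 𝒜 Q (d + e) := by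
  induction ht using Submodule.span_induction with
  | mem x hx =>
    obtain ⟨n, w, f, hf, hs, rfl⟩ := hx
    refine Submodule.subset_span ⟨n + 1, Fin.cons q w, Fin.cons d f, ?_, ?_, ι_mul_tprod q w⟩
    · intro i
      refine Fin.cases ?_ (fun j => ?_) i
      · simpa using hq
      · simpa using hf j
    · rw [Fin.sum_univ_succ]; simp [hs]
  | zero => simp
  | add x y _ _ hx hy => rw [mul_add]; exact add_mem hx hy
  | smul r x _ hx => rw [mul_smul_comm]; exact Submodule.smul_mem _ _ hx

theorem mul_mem_tensorDeg {d e : ℤ × G} {s t : TensorAlgebra k Q} (hs : s ∈ tensorDeg 𝒜 Q d)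
    (ht : t ∈ tensorDeg 𝒜 Q e) : s * t ∈ tensorDeg 𝒜 Q (d + e) := by
  induction hs using Submodule.span_induction with
  | mem x hx =>
    obtain ⟨n, w, f, hf, rfl, rfl⟩ := hx
    induction n with
    | zero => simpa [tprod_zero] using ht
    | succ n ih =>
      rw [tprod_succ, mul_assoc, Fin.sum_univ_succ, add_assoc]
      exact ι_mul_mem_tensorDeg (hf 0) (ih _ _ fun i => hf i.succ)
  | zero => simp
  | add x y _ _ hx hy => rw [add_mul]; exact add_mem hx hy
  | smul r x _ hx => rw [smul_mul_assoc]; exact Submodule.smul_mem _ _ hx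

theorem ι_mem_tensorDeg {d : ℤ × G} {q : Q} (hq : (q : A) ∈ 𝒜 d) :
    TensorAlgebra.ι k q ∈ tensorDeg 𝒜 Q d := by
  simpa using ι_mul_mem_tensorDeg hq (one_mem_tensorDeg (𝒜 := 𝒜))

theorem mulMap_mem [GradedAlgebra 𝒜] {d : ℤ × G} {t : TensorAlgebra k Q}
    (ht : t ∈ tensorDeg 𝒜 Q d) : mulMap Q t ∈ 𝒜 d := by
  induction ht using Submodule.span_induction with
  | mem x hx =>
    obtain ⟨n, w, f, hf, rfl, rfl⟩ := hx
    induction n with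
    | zero => simpa [tprod_zero] using SetLike.GradedOne.one_mem
    | succ n ih =>
      rw [tprod_succ, map_mul, Fin.sum_univ_succ]
      refine SetLike.GradedMul.mul_mem ?_ (ih _ _ fun i => hf i.succ)
      simpa [mulMap] using hf 0
  | zero => simp
  | add x y _ _ hx hy => rw [map_add]; exact add_mem hx hy
  | smul r x _ hx => rw [map_smul]; exact Submodule.smul_mem _ _ hx

/-- The algebra map to the group algebra of the grading group with coefficients in `T(Q)`, marking
each homogeneous letter by its degree, puts the homogeneous tensors of degree `d` over the group
element `d`. Its coefficients therefore separate the degrees. -/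
theorem tensorDeg_isInternal (h𝒜 : DirectSum.IsInternal 𝒜) (hQ : IsGradedSubspace 𝒜 Q) :
    DirectSum.IsInternal (tensorDeg 𝒜 Q) := by
  have hQi := hQ.isInternal h𝒜
  let T := TensorAlgebra k Q
  let g : Q →ₗ[k] AddMonoidAlgebra T (ℤ × G) := gradedLift hQi fun d =>
    { toFun := fun q => AddMonoidAlgebra.single d (TensorAlgebra.ι k (q : Q))
      map_add' := by intro x y; simp [AddMonoidAlgebra.single_add]
      map_smul' := by intro r x; simp [AddMonoidAlgebra.smul_single] }
  have hg : ∀ (d : ℤ × G) (q : Q), (q : A) ∈ 𝒜 d →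
      g q = AddMonoidAlgebra.single d (TensorAlgebra.ι k q) := by
    intro d q hq
    exact gradedLift_of_mem hQi _ (j := d) (x := q) hq
  let c := TensorAlgebra.lift k g
  have hc : ∀ d, ∀ t ∈ tensorDeg 𝒜 Q d, c t = AddMonoidAlgebra.single d t := by
    intro d t ht
    induction ht using Submodule.span_induction with
    | mem x hx =>
      obtain ⟨n, w, f, hf, rfl, rfl⟩ := hx
      induction n with
      | zero => simp [tprod_zero, AddMonoidAlgebra.one_def]
      | succ n ih =>
        rw [tprod_succ, map_mul, Fin.sum_univ_succ, ih _ _ fun i => hf i.succ]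
        simp [c, hg _ _ (hf 0), AddMonoidAlgebra.single_mul_single]
    | zero => simp
    | add x y _ _ hx hy => rw [map_add, hx, hy, AddMonoidAlgebra.single_add]
    | smul r x _ hx => rw [map_smul, hx, AddMonoidAlgebra.smul_single]
  rw [DirectSum.isInternal_submodule_iff_iSupIndep_and_iSup_eq_top]
  constructor
  · rw [iSupIndep_iff_finsetSum_eq_zero_imp_eq_zero]
    intro s f hf hsum j hj
    have h0 : ∑ l ∈ s, AddMonoidAlgebra.single l (f l) = 0 := by
      rw [← map_zero c, ← hsum, map_sum]
      exact Finset.sum_congr rfl fun l hl => (hc l _ (hf l hl)).symm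
    have h1 := congrArg (fun x : AddMonoidAlgebra T (ℤ × G) => x.coeff j) h0
    simp only [AddMonoidAlgebra.coeff_sum, AddMonoidAlgebra.coeff_single, Finsupp.finsetSum_apply,
      AddMonoidAlgebra.coeff_zero, Finsupp.zero_apply] at h1
    rw [Finset.sum_eq_single j] at h1
    · simpa using h1
    · intro i _ hi; simp [hi]
    · exact fun h => absurd hj h
  · rw [eq_top_iff]
    rintro t -
    induction t using tensor_induction with
    | hadd x y hx hy => exact add_mem hx hy
    | hs r =>
      rw [Algebra.algebraMap_eq_smul_one]
      exact Submodule.smul_mem _ _ (Submodule.mem_iSup_of_mem 0 one_mem_tensorDeg)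
    | hι q t ht =>
      refine isInternal_induction hQi
        (C := fun q => TensorAlgebra.ι k q * t ∈ ⨆ d, tensorDeg 𝒜 Q d) (by simp) ?_ ?_ q
      · intro x y hx hy; rw [map_add, add_mul]; exact add_mem hx hy
      · intro d q hq
        induction ht using Submodule.iSup_induction' with
        | mem i x hx => exact Submodule.mem_iSup_of_mem _ (ι_mul_mem_tensorDeg hq hx)
        | zero => simp
        | add x y _ _ hx hy => rw [mul_add]; exact add_mem hx hy

end TensorDeg

end ExtAInf

open scoped DirectSum

namespace ExtAInf

set_option linter.unusedSectionVars false

open TensorProduct MulOpposite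

/-! ### Free modules and connected algebras -/

section FreeLift

variable {k : Type*} [Field k] {B : Type*} [Ring B] [Algebra k B] {Q : Type*} [AddCommGroup Q]
  [Module k Q] {P : Type*} [AddCommGroup P] [Module k P] [Module B P] [IsScalarTower k B P]

/-- The `B`-linear extension of a linear map to the free module `B ⊗ Q`. -/
noncomputable def freeLift (f : Q →ₗ[k] P) : B ⊗[k] Q →ₗ[B] P :=
  TensorProduct.AlgebraTensorModule.lift
    { toFun := fun b =>
        { toFun := fun q => b • f q
          map_add' := by intro x y; simp
          map_smul' := by intro c x; simp [smul_algebra_smul_comm] }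
      map_add' := by intro x y; ext q; simp [add_smul]
      map_smul' := by intro c x; ext q; simp [mul_smul] }

@[simp] theorem freeLift_tmul (f : Q →ₗ[k] P) (b : B) (q : Q) : freeLift f (b ⊗ₜ q) = b • f q := rfl

theorem free_ext {f g : B ⊗[k] Q →ₗ[B] P} (h : ∀ q, f (1 ⊗ₜ q) = g (1 ⊗ₜ q)) : f = g := by
  refine LinearMap.ext fun x => ?_
  induction x using TensorProduct.induction_on with
  | zero => simp
  | tmul b q =>
    have : b ⊗ₜ[k] q = b • (1 ⊗ₜ[k] q) := by simp [TensorProduct.smul_tmul']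
    rw [this, map_smul, map_smul, h]
  | add x y hx hy => simp [hx, hy]

end FreeLift

section GradedMul

variable {k : Type*} [Field k] {ι : Type*} [Add ι] {A : Type*} [Ring A] [Algebra k A]
  {𝒱 : ι → Submodule k A}

theorem IsGradedSubspace.mul (hmul : ∀ d e x y, x ∈ 𝒱 d → y ∈ 𝒱 e → x * y ∈ 𝒱 (d + e))
    {W U : Submodule k A} (hW : IsGradedSubspace 𝒱 W) (hU : IsGradedSubspace 𝒱 U) :
    IsGradedSubspace 𝒱 (W * U) := by
  refine Submodule.mul_le.2 fun x hx y hy => ?_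
  have hx' := hW hx
  have hy' := hU hy
  clear hx hy
  induction hx' using Submodule.iSup_induction' with
  | mem d x hx =>
    induction hy' using Submodule.iSup_induction' with
    | mem e y hy =>
      exact Submodule.mem_iSup_of_mem (d + e) ⟨Submodule.mul_mem_mul hx.1 hy.1,
        hmul d e x y hx.2 hy.2⟩
    | zero => simp
    | add y y' _ _ h h' => rw [mul_add]; exact add_mem h h'
  | zero => simp
  | add x x' _ _ h h' => rw [add_mul]; exact add_mem h h'

theorem IsGradedSubspace.map {M : Type*} [AddCommGroup M] [Module k M] {ℳ : ι → Submodule k M}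
    {f : A →ₗ[k] M} (hf : ∀ d, ∀ x ∈ 𝒱 d, f x ∈ ℳ d) {W : Submodule k A}
    (hW : IsGradedSubspace 𝒱 W) : IsGradedSubspace ℳ (W.map f) := by
  rintro _ ⟨x, hx, rfl⟩
  have hx' := hW hx
  clear hx
  induction hx' using Submodule.iSup_induction' with
  | mem d x hx => exact Submodule.mem_iSup_of_mem d ⟨⟨x, hx.1, rfl⟩, hf d x hx.2⟩
  | zero => simp
  | add x y _ _ h h' => rw [map_add]; exact add_mem h h'

end GradedMul

/-! ### Connected graded algebras and their augmentation -/

section Connected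

variable {k : Type*} [Field k] {G : Type*} [AddCommGroup G] [DecidableEq G]
  {A : Type*} [Ring A] [Algebra k A] {𝒜 : ℤ × G → Submodule k A} [GradedAlgebra 𝒜]

theorem gradedAlgebra_isInternal (𝒜 : ℤ × G → Submodule k A) [GradedAlgebra 𝒜] :
    DirectSum.IsInternal 𝒜 := DirectSum.Decomposition.isInternal 𝒜

theorem mem_augIdeal {d : ℤ × G} (hd : 0 < d.1) {x : A} (hx : x ∈ 𝒜 d) : x ∈ augIdeal 𝒜 :=
  Submodule.mem_iSup_of_mem d (Submodule.mem_iSup_of_mem hd hx)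

theorem augIdeal_induction {C : A → Prop} (hz : C 0) (hadd : ∀ x y, C x → C y → C (x + y))
    (hm : ∀ d : ℤ × G, 0 < d.1 → ∀ x ∈ 𝒜 d, C x) {x : A} (hx : x ∈ augIdeal 𝒜) : C x := by
  induction hx using Submodule.iSup_induction' with
  | mem d x hx =>
    by_cases hd : 0 < d.1
    · rw [iSup_pos hd] at hx; exact hm d hd x hx
    · rw [iSup_neg hd, Submodule.mem_bot] at hx; rw [hx]; exact hz
  | zero => exact hz
  | add x y _ _ hx hy => exact hadd x y hx hy

theorem augIdeal_isGraded : IsGradedSubspace 𝒜 (augIdeal 𝒜) := by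
  refine iSup_le fun d => iSup_le fun hd x hx => ?_
  exact Submodule.mem_iSup_of_mem d ⟨mem_augIdeal hd hx, hx⟩

theorem eq_zero_of_mem_augIdeal {d : ℤ × G} (hd : d.1 ≤ 0) {x : A} (hx : x ∈ 𝒜 d)
    (hm : x ∈ augIdeal 𝒜) : x = 0 := by
  rw [← gproj_of_mem (gradedAlgebra_isInternal 𝒜) hx]
  refine augIdeal_induction (C := fun x => gproj (gradedAlgebra_isInternal 𝒜) d x = 0) (by simp)
    ?_ ?_ hm
  · intro x y hx hy; simp [hx, hy]
  · intro e he x hx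
    exact gproj_of_mem_ne _ hx (by rintro rfl; omega)

theorem augIdeal_mul_augIdeal_le : augIdeal 𝒜 * augIdeal 𝒜 ≤ augIdeal 𝒜 := by
  refine Submodule.mul_le.2 fun x hx y hy => ?_
  refine augIdeal_induction (C := fun x => x * y ∈ augIdeal 𝒜) (by simp) ?_ ?_ hx
  · intro x x' h h'; rw [add_mul]; exact add_mem h h'
  · intro d hd x hx
    refine augIdeal_induction (C := fun y => x * y ∈ augIdeal 𝒜) (by simp) ?_ ?_ hy
    · intro x x' h h'; rw [mul_add]; exact add_mem h h'
    · intro e he y hy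
      exact mem_augIdeal (d := d + e) (by simpa using add_pos hd he) (SetLike.mul_mem_graded hx hy)

variable (hconn : IsConnectedGraded 𝒜)
include hconn

theorem IsConnectedGraded.eq_zero_of_neg {d : ℤ × G} (hd : d.1 < 0) {x : A} (hx : x ∈ 𝒜 d) :
    x = 0 := by
  have : x ∈ zPart 𝒜 d.1 := Submodule.mem_iSup_of_mem d.2 hx
  rwa [hconn.neg _ hd] at this

theorem IsConnectedGraded.exists_smul_one {x : A} (hx : x ∈ 𝒜 0) : ∃ c : k, x = c • 1 := by
  have : x ∈ zPart 𝒜 0 := Submodule.mem_iSup_of_mem (0 : G) hx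
  rw [hconn.zero, Submodule.mem_span_singleton] at this
  obtain ⟨c, hc⟩ := this
  exact ⟨c, hc.symm⟩

theorem IsConnectedGraded.eq_zero_of_fst_eq_zero {d : ℤ × G} (hd : d.1 = 0) (hd' : d ≠ 0) {x : A}
    (hx : x ∈ 𝒜 d) : x = 0 := by
  have : x ∈ zPart 𝒜 0 := by
    rw [← hd]; exact Submodule.mem_iSup_of_mem d.2 hx
  rw [hconn.zero, Submodule.mem_span_singleton] at this
  obtain ⟨c, rfl⟩ := this
  have h0 : c • (1 : A) ∈ 𝒜 0 := Submodule.smul_mem _ _ SetLike.GradedOne.one_mem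
  rw [← gproj_of_mem (gradedAlgebra_isInternal 𝒜) hx]
  exact gproj_of_mem_ne _ h0 hd'.symm

theorem IsConnectedGraded.one_notMem_augIdeal : (1 : A) ∉ augIdeal 𝒜 := fun h =>
  hconn.one_ne_zero (eq_zero_of_mem_augIdeal (d := (0 : ℤ × G)) le_rfl
    SetLike.GradedOne.one_mem h)

/-- The augmentation of a connected graded algebra. -/
theorem IsConnectedGraded.exists_augmentation : ∃ ε : A →ₗ[k] k, ε 1 = 1 ∧
    (∀ a ∈ augIdeal 𝒜, ε a = 0) ∧ ∀ a, a - ε a • 1 ∈ augIdeal 𝒜 := by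
  have hdec : ∀ a : A, ∃ c : k, a - c • 1 ∈ augIdeal 𝒜 := by
    refine isInternal_induction (gradedAlgebra_isInternal 𝒜) ⟨0, by simp⟩ ?_ ?_
    · rintro x y ⟨c, hc⟩ ⟨c', hc'⟩
      refine ⟨c + c', ?_⟩
      rw [add_smul, add_sub_add_comm]; exact add_mem hc hc'
    · intro d x hx
      rcases lt_trichotomy d.1 0 with hd | hd | hd
      · exact ⟨0, by rw [hconn.eq_zero_of_neg hd hx]; simp⟩
      · by_cases hd' : d = 0
        · subst hd'
          obtain ⟨c, rfl⟩ := hconn.exists_smul_one hx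
          exact ⟨c, by simp⟩
        · exact ⟨0, by rw [hconn.eq_zero_of_fst_eq_zero hd hd' hx]; simp⟩
      · exact ⟨0, by simpa using mem_augIdeal hd hx⟩
  -- Any functional that kills `𝔪` but not `1` is the augmentation up to scaling.
  obtain ⟨g, hg1, hg2⟩ : ∃ g : A →ₗ[k] k, g 1 ≠ 0 ∧ ∀ a ∈ augIdeal 𝒜, g a = 0 := by
    obtain ⟨g, hg, hg'⟩ := Submodule.exists_le_ker_of_notMem hconn.one_notMem_augIdeal
    exact ⟨g, hg, fun a ha => hg' ha⟩
  refine ⟨(g 1)⁻¹ • g, by simp [hg1], fun a ha => by simp [hg2 a ha], fun a => ?_⟩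
  obtain ⟨c, hc⟩ := hdec a
  have h1 := hg2 _ hc
  rw [map_sub, map_smul, sub_eq_zero] at h1
  simp only [LinearMap.smul_apply, h1, smul_eq_mul]
  rwa [mul_comm c, inv_mul_cancel_left₀ hg1]

theorem IsConnectedGraded.mul_mem_augIdeal {a b : A} (ha : a ∈ augIdeal 𝒜) :
    a * b ∈ augIdeal 𝒜 := by
  obtain ⟨ε, -, -, h⟩ := hconn.exists_augmentation
  have : a * b = a * (b - ε b • 1) + ε b • a := by
    rw [mul_sub, mul_smul_comm, mul_one]; abel
  rw [this]
  exact add_mem (augIdeal_mul_augIdeal_le (Submodule.mul_mem_mul ha (h b)))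
    (Submodule.smul_mem _ _ ha)

end Connected

/-! ### The subspace `P 𝔪` of a right module -/

section RadSub

variable {k : Type*} [Field k] {G : Type*} [AddCommGroup G] [DecidableEq G]
  {A : Type*} [Ring A] [Algebra k A] (𝒜 : ℤ × G → Submodule k A)
  {P : Type*} [AddCommGroup P] [Module k P] [Module Aᵐᵒᵖ P] [IsScalarTower k Aᵐᵒᵖ P]

/-- The subspace `W 𝔪` of a right module. -/
def radSub (W : Set P) : Submodule k P :=
  Submodule.span k {z | ∃ a ∈ augIdeal 𝒜, ∃ x ∈ W, z = op a • x}

variable {𝒜}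

theorem op_smul_mem_radSub {W : Set P} {a : A} (ha : a ∈ augIdeal 𝒜) {x : P} (hx : x ∈ W) :
    op a • x ∈ radSub 𝒜 W := Submodule.subset_span ⟨a, ha, x, hx, rfl⟩

theorem radSub_le {W : Set P} {U : Submodule k P}
    (h : ∀ a ∈ augIdeal 𝒜, ∀ x ∈ W, op a • x ∈ U) : radSub 𝒜 W ≤ U := by
  refine Submodule.span_le.2 ?_
  rintro _ ⟨a, ha, x, hx, rfl⟩
  exact h a ha x hx

theorem map_mem_radSub {P' : Type*} [AddCommGroup P'] [Module k P'] [Module Aᵐᵒᵖ P']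
    [IsScalarTower k Aᵐᵒᵖ P'] (f : P →ₗ[Aᵐᵒᵖ] P') {W : Set P} {W' : Set P'}
    (h : ∀ x ∈ W, f x ∈ W') {x : P} (hx : x ∈ radSub 𝒜 W) : f x ∈ radSub 𝒜 W' := by
  have : radSub 𝒜 W ≤ (radSub 𝒜 W').comap (f.restrictScalars k) :=
    radSub_le fun a ha x hx => by
      show f (op a • x) ∈ radSub 𝒜 W'
      rw [map_smul]; exact op_smul_mem_radSub ha (h x hx)
  exact this hx

end RadSub

/-! ### The first letter of a tensor -/

section Lam

variable {k : Type*} [Field k] {A : Type*} [Ring A] [Algebra k A] (Q : Submodule k A)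

theorem mulMap_ι (q : Q) : mulMap Q (TensorAlgebra.ι k q) = q := by simp [mulMap]

theorem exists_lam : ∃ c : TensorAlgebra k Q →ₗ[k] Aᵐᵒᵖ ⊗[k] Q, c 1 = 0 ∧
    ∀ q t, c (TensorAlgebra.ι k q * t) = op (mulMap Q t) ⊗ₜ q :=
  exists_tensorRec 0 (LinearMap.flip
    ((TensorProduct.mk k Aᵐᵒᵖ Q) ∘ₗ (opLinearEquiv k).toLinearMap ∘ₗ (mulMap Q).toLinearMap))

/-- The map `q ⊗ t ↦ q ⊗ μ(t)` from `T(Q)` to the free right module generated by `Q`. -/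
noncomputable def lam : TensorAlgebra k Q →ₗ[k] Aᵐᵒᵖ ⊗[k] Q := (exists_lam Q).choose

theorem lam_one : lam Q 1 = 0 := (exists_lam Q).choose_spec.1

theorem lam_ι_mul (q : Q) (t : TensorAlgebra k Q) :
    lam Q (TensorAlgebra.ι k q * t) = op (mulMap Q t) ⊗ₜ q := (exists_lam Q).choose_spec.2 q t

/-- The first letter of a product comes from the left factor unless that factor is a scalar; the
identity is the resulting product rule. -/
theorem lam_mul (t w : TensorAlgebra k Q) : lam Q (t * w) =
    op (mulMap Q w) • lam Q t + TensorAlgebra.algebraMapInv t • lam Q w := by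
  induction t using tensor_induction with
  | hadd x y hx hy => simp only [add_mul, map_add, hx, hy, smul_add, add_smul]; abel
  | hs r =>
    rw [Algebra.algebraMap_eq_smul_one, smul_mul_assoc, one_mul, map_smul, map_smul, lam_one,
      map_smul, map_one]
    simp
  | hι q t _ =>
    rw [mul_assoc, lam_ι_mul, lam_ι_mul, algebraMapInv_ι_mul, zero_smul, add_zero, map_mul, op_mul,
      TensorProduct.smul_tmul', smul_eq_mul]

/-- The multiplication map from the free module generated by `Q`. -/
noncomputable def muQ : Aᵐᵒᵖ ⊗[k] Q →ₗ[Aᵐᵒᵖ] A := freeLift Q.subtype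

theorem muQ_tmul (a : A) (q : Q) : muQ Q (op a ⊗ₜ q) = q * a := by
  simp [muQ]

theorem muQ_lam (t : TensorAlgebra k Q) :
    muQ Q (lam Q t) = mulMap Q t - algebraMap k A (TensorAlgebra.algebraMapInv t) := by
  induction t using tensor_induction with
  | hadd x y hx hy => simp only [map_add, hx, hy]; abel
  | hs r =>
    rw [Algebra.algebraMap_eq_smul_one, map_smul, lam_one]
    simp [Algebra.algebraMap_eq_smul_one]
  | hι q t _ =>
    rw [lam_ι_mul, muQ_tmul, algebraMapInv_ι_mul, map_mul, mulMap_ι]; simp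

variable {Q} (θ : A →ₗ[k] TensorAlgebra k Q)

/-- The map `q ⊗ a ↦ q ⊗ θ(a)`. -/
noncomputable def psi : Aᵐᵒᵖ ⊗[k] Q →ₗ[k] TensorAlgebra k Q :=
  TensorProduct.lift (LinearMap.flip (LinearMap.mul k (TensorAlgebra k Q) ∘ₗ TensorAlgebra.ι k) ∘ₗ
    θ ∘ₗ (opLinearEquiv k).symm.toLinearMap)

theorem psi_tmul (a : A) (q : Q) : psi θ (op a ⊗ₜ q) = TensorAlgebra.ι k q * θ a := by
  simp [psi]

theorem algebraMapInv_psi (x : Aᵐᵒᵖ ⊗[k] Q) : TensorAlgebra.algebraMapInv (psi θ x) = 0 := by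
  induction x using TensorProduct.induction_on with
  | zero => simp
  | tmul b q => obtain ⟨a, rfl⟩ := op_surjective b; rw [psi_tmul, algebraMapInv_ι_mul]
  | add x y hx hy => simp [hx, hy]

variable {θ} (hθ : ∀ a, mulMap Q (θ a) = a)
include hθ

theorem lam_psi (x : Aᵐᵒᵖ ⊗[k] Q) : lam Q (psi θ x) = x := by
  induction x using TensorProduct.induction_on with
  | zero => simp
  | tmul b q => obtain ⟨a, rfl⟩ := op_surjective b; rw [psi_tmul, lam_ι_mul, hθ]
  | add x y hx hy => simp [hx, hy]

theorem mulMap_psi (x : Aᵐᵒᵖ ⊗[k] Q) : mulMap Q (psi θ x) = muQ Q x := by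
  have := muQ_lam Q (psi θ x)
  rw [lam_psi hθ, algebraMapInv_psi, map_zero, sub_zero] at this
  exact this.symm

/-- Passing to `psi ∘ lam` replaces the tail `t` of each `q ⊗ t` by `θ(μ(t))`, where `μ` is
multiplication, and so changes it by a relation. -/
theorem sub_psi_lam_mem {t : TensorAlgebra k Q} (ht : TensorAlgebra.algebraMapInv t = 0) :
    t - psi θ (lam Q t) ∈ consSpan (LinearMap.ker (mulMap Q).toLinearMap) := by
  have : consSpan (⊤ : Submodule k (TensorAlgebra k Q)) ≤
      (consSpan (LinearMap.ker (mulMap Q).toLinearMap)).comap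
        (LinearMap.id - psi θ ∘ₗ lam Q) := by
    refine consSpan_le fun q t _ => ?_
    simp only [Submodule.mem_comap, LinearMap.sub_apply, LinearMap.id_apply, LinearMap.comp_apply,
      lam_ι_mul, psi_tmul, ← mul_sub]
    refine ι_mul_mem_consSpan q ?_
    simp [hθ]
  exact this (mem_consSpan_top.2 ht)

end Lam

end ExtAInf

open scoped DirectSum

namespace ExtAInf

set_option linter.unusedSectionVars false

open TensorProduct MulOpposite

/-! ### Relations modulo decomposable relations -/

section Relations

variable {k : Type*} [Field k] {A : Type*} [Ring A] [Algebra k A] (Q : Submodule k A)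

/-- The ideal of relations. -/
abbrev relIdeal : Submodule k (TensorAlgebra k Q) := LinearMap.ker (mulMap Q).toLinearMap

/-- The relations of the form `∑ q x` and `∑ x q` with `q ∈ Q` and relations `x`, and their
multiples. -/
def relSq : Submodule k (TensorAlgebra k Q) :=
  consSpan (relIdeal Q) ⊔ relIdeal Q * consSpan ⊤

variable {Q}

theorem mem_relIdeal {t : TensorAlgebra k Q} : t ∈ relIdeal Q ↔ mulMap Q t = 0 := Iff.rfl

theorem mul_mem_relIdeal {t : TensorAlgebra k Q} (ht : t ∈ relIdeal Q) (w : TensorAlgebra k Q) :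
    t * w ∈ relIdeal Q := by
  rw [mem_relIdeal] at *; rw [map_mul, ht, zero_mul]

theorem mul_mem_relIdeal' {t : TensorAlgebra k Q} (ht : t ∈ relIdeal Q) (w : TensorAlgebra k Q) :
    w * t ∈ relIdeal Q := by
  rw [mem_relIdeal] at *; rw [map_mul, ht, mul_zero]

/-- In a product `s r t` the positive-length parts of `s` and `t` give decomposable relations, so
only scalar multiples of `r` remain modulo `relSq`. -/
theorem span_mul_le_sup {R : Submodule k (TensorAlgebra k Q)} (hR : R ≤ relIdeal Q) :
    ⊤ * R * ⊤ ≤ R ⊔ relSq Q := by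
  have hstep : ⊤ * R ≤ R ⊔ consSpan (relIdeal Q) := by
    refine Submodule.mul_le.2 fun s hs r hr => ?_
    clear hs
    induction s using tensor_induction with
    | hadd x y hx hy => rw [add_mul]; exact add_mem hx hy
    | hs c =>
      rw [← Algebra.smul_def]
      exact Submodule.smul_mem _ _ (Submodule.mem_sup_left hr)
    | hι q t _ =>
      rw [mul_assoc]
      exact Submodule.mem_sup_right (ι_mul_mem_consSpan q (mul_mem_relIdeal' (hR hr) t))
  refine Submodule.mul_le.2 fun x hx t _ => ?_
  have hx' := hstep hx
  obtain ⟨r, hr, y, hy, rfl⟩ := Submodule.mem_sup.1 hx'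
  have ht : t = algebraMap k _ (TensorAlgebra.algebraMapInv t) +
    (t - algebraMap k _ (TensorAlgebra.algebraMapInv t)) := by abel
  rw [add_mul]
  refine add_mem ?_ (Submodule.mem_sup_right (Submodule.mem_sup_left ?_))
  · rw [ht, mul_add, ← Algebra.commutes, ← Algebra.smul_def]
    refine Submodule.add_mem_sup (Submodule.smul_mem _ _ hr) (Submodule.mem_sup_right ?_)
    exact Submodule.mul_mem_mul (hR hr) (sub_algebraMapInv_mem_consSpan t)
  · have : consSpan (relIdeal Q) * ⊤ ≤ consSpan (relIdeal Q) := by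
      refine Submodule.mul_le.2 fun x hx t _ => ?_
      refine Submodule.mul_induction_on hx (fun a ha b hb => ?_) (fun x y hx hy => ?_)
      · rw [mul_assoc]; exact Submodule.mul_mem_mul ha (mul_mem_relIdeal hb t)
      · rw [add_mul]; exact add_mem hx hy
    exact this (Submodule.mul_mem_mul hy trivial)

theorem mul_mem_ideal {R : Submodule k (TensorAlgebra k Q)} {x : TensorAlgebra k Q}
    (hx : x ∈ ⊤ * R * ⊤) (t : TensorAlgebra k Q) : x * t ∈ ⊤ * R * ⊤ := by
  have : ⊤ * R * ⊤ * ⊤ ≤ ⊤ * R * (⊤ : Submodule k (TensorAlgebra k Q)) := by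
    rw [mul_assoc (⊤ * R)]; exact mul_le_mul' le_rfl le_top
  exact this (Submodule.mul_mem_mul hx trivial)

theorem mul_mem_ideal' {R : Submodule k (TensorAlgebra k Q)} {x : TensorAlgebra k Q}
    (hx : x ∈ ⊤ * R * ⊤) (t : TensorAlgebra k Q) : t * x ∈ ⊤ * R * ⊤ := by
  have : ⊤ * (⊤ * R * ⊤) ≤ ⊤ * R * (⊤ : Submodule k (TensorAlgebra k Q)) := by
    rw [← mul_assoc, ← mul_assoc]
    exact mul_le_mul' (mul_le_mul' le_top le_rfl) le_rfl
  exact this (Submodule.mul_mem_mul trivial hx)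

theorem le_ideal {R : Submodule k (TensorAlgebra k Q)} :
    R ≤ ⊤ * R * (⊤ : Submodule k (TensorAlgebra k Q)) := fun r hr => by
  have h1 : (1 : TensorAlgebra k Q) ∈ (⊤ : Submodule k (TensorAlgebra k Q)) := trivial
  have := Submodule.mul_mem_mul (Submodule.mul_mem_mul h1 hr) h1
  rwa [one_mul, mul_one] at this

end Relations

/-! ### Graded Nakayama lemma for the ideal of relations -/

section Nakayama

variable {k : Type*} [Field k] {G : Type*} [AddCommGroup G] [DecidableEq G]
  {A : Type*} [Ring A] [Algebra k A] {𝒜 : ℤ × G → Submodule k A} [GradedAlgebra 𝒜]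
  {Q : Submodule k A} (hQ : IsGradedSubspace 𝒜 Q) (hQm : Q ≤ augIdeal 𝒜)

include hQ in
theorem tensorDeg_internal : DirectSum.IsInternal (tensorDeg 𝒜 Q) :=
  tensorDeg_isInternal (gradedAlgebra_isInternal 𝒜) hQ

include hQ in
theorem relIdeal_isGraded : IsGradedSubspace (tensorDeg 𝒜 Q) (relIdeal Q) :=
  isGradedSubspace_ker (tensorDeg_internal hQ) (gradedAlgebra_isInternal 𝒜)
    fun _ _ ht => mulMap_mem ht

theorem top_isGraded {ι V : Type*} [AddCommGroup V] [Module k V] [DecidableEq ι]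
    {𝒱 : ι → Submodule k V} (h : DirectSum.IsInternal 𝒱) :
    IsGradedSubspace 𝒱 (⊤ : Submodule k V) := by
  have := h.submodule_iSup_eq_top
  simp [IsGradedSubspace, this]

include hQ in
theorem range_ι_isGraded :
    IsGradedSubspace (tensorDeg 𝒜 Q) (LinearMap.range (TensorAlgebra.ι k (M := Q))) :=
  isGradedSubspace_range (hQ.isInternal (gradedAlgebra_isInternal 𝒜))
    (fun _ _ hq => ι_mem_tensorDeg hq)

include hQ in
theorem consSpan_isGraded {W : Submodule k (TensorAlgebra k Q)}
    (hW : IsGradedSubspace (tensorDeg 𝒜 Q) W) : IsGradedSubspace (tensorDeg 𝒜 Q) (consSpan W) := by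
  have h := IsGradedSubspace.mul (𝒱 := tensorDeg 𝒜 Q) (fun _ _ _ _ hx hy => mul_mem_tensorDeg hx hy)
    (range_ι_isGraded hQ) hW
  exact h

include hQ in
theorem relSq_isGraded : IsGradedSubspace (tensorDeg 𝒜 Q) (relSq Q) := by
  have h := IsGradedSubspace.mul (𝒱 := tensorDeg 𝒜 Q) (fun _ _ _ _ hx hy => mul_mem_tensorDeg hx hy)
    (relIdeal_isGraded hQ) (consSpan_isGraded hQ (top_isGraded (tensorDeg_internal hQ)))
  exact (consSpan_isGraded hQ (relIdeal_isGraded hQ)).sup h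

include hQm in
theorem pos_of_ne_zero {d : ℤ × G} {q : Q} (hq : (q : A) ∈ 𝒜 d) (h0 : q ≠ 0) : 0 < d.1 := by
  by_contra hd
  exact h0 (Subtype.ext (eq_zero_of_mem_augIdeal (not_lt.1 hd) hq (hQm q.2)))

include hQm in
theorem tensorDeg_eq_zero {d : ℤ × G} (hd : d.1 < 0) {t : TensorAlgebra k Q}
    (ht : t ∈ tensorDeg 𝒜 Q d) : t = 0 := by
  induction ht using Submodule.span_induction with
  | mem x hx =>
    obtain ⟨n, q, f, hf, rfl, rfl⟩ := hx
    by_cases h : ∃ i, q i = 0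
    · obtain ⟨i, hi⟩ := h
      exact MultilinearMap.map_coord_zero _ i hi
    · push Not at h
      exfalso
      have : 0 ≤ (∑ i, f i).1 := by
        rw [Prod.fst_sum]
        exact Finset.sum_nonneg fun i _ => (pos_of_ne_zero hQm (hf i) (h i)).le
      omega
  | zero => rfl
  | add x y _ _ hx hy => rw [hx, hy, add_zero]
  | smul r x _ hx => rw [hx, smul_zero]

include hQ hQm in
/-- A graded version of Nakayama's lemma. -/
theorem ideal_eq_relIdeal {R : Submodule k (TensorAlgebra k Q)}
    (hR : R ≤ relIdeal Q) (hRg : IsGradedSubspace (tensorDeg 𝒜 Q) R)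
    (h : relIdeal Q ≤ R ⊔ relSq Q) : ⊤ * R * ⊤ = relIdeal Q := by
  have hT := tensorDeg_internal hQ
  have hQi := hQ.isInternal (gradedAlgebra_isInternal 𝒜)
  have hIg := relIdeal_isGraded hQ
  refine le_antisymm (Submodule.mul_le.2 fun x hx t _ => mul_mem_relIdeal
    (Submodule.mul_le.2 (fun s _ r hr => mul_mem_relIdeal' (hR hr) s) hx) t) ?_
  -- Induction on the `ℤ`-degree. A decomposable relation contains a letter outside its relation
  -- factor; letters have positive degree, so that factor has smaller degree and lies in the ideal
  -- already.
  have key : ∀ n : ℕ, ∀ d : ℤ × G, d.1 < n → ∀ x ∈ relIdeal Q, x ∈ tensorDeg 𝒜 Q d →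
      x ∈ ⊤ * R * (⊤ : Submodule k (TensorAlgebra k Q)) := by
    intro n
    induction n with
    | zero =>
      intro d hd x _ hxd
      rw [tensorDeg_eq_zero hQm (by simpa using hd) hxd]; exact zero_mem _
    | succ n ih =>
      intro d hd x hx hxd
      obtain ⟨r, hr, y, hy, hxy⟩ := Submodule.mem_sup.1 (h hx)
      obtain ⟨y₁, hy₁, y₂, hy₂, rfl⟩ := Submodule.mem_sup.1 hy
      rw [← gproj_of_mem hT hxd, ← hxy, map_add, map_add]
      refine add_mem (le_ideal (hRg.gproj_mem hT hr d)) (add_mem ?_ ?_)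
      · have : consSpan (relIdeal Q) ≤ (⊤ * R * ⊤).comap (gproj hT d) := by
          refine consSpan_le fun q s hs => ?_
          rw [Submodule.mem_comap]
          refine isInternal_induction hQi (C := fun q => gproj hT d (TensorAlgebra.ι k q * s) ∈
            ⊤ * R * ⊤) (by simp) ?_ ?_ q
          · intro x y hx hy; rw [map_add, add_mul, map_add]; exact add_mem hx hy
          · intro e q hq
            have hs' := hIg hs
            clear hs
            induction hs' using Submodule.iSup_induction' with
            | mem f s hs =>
              have hmem := ι_mul_mem_tensorDeg hq hs.2
              by_cases hef : e + f = d
              · by_cases hq0 : q = 0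
                · simp [hq0]
                have hpos := pos_of_ne_zero hQm hq hq0
                rw [hef] at hmem
                rw [gproj_of_mem hT hmem]
                refine mul_mem_ideal' (ih f ?_ s hs.1 hs.2) _
                have := congrArg Prod.fst hef
                simp only [Prod.fst_add] at this
                push_cast at hd; omega
              · rw [gproj_of_mem_ne hT hmem hef]; exact zero_mem _
            | zero => simp
            | add x y _ _ hx hy => rw [mul_add, map_add]; exact add_mem hx hy
        exact this hy₁
      · have : relIdeal Q * consSpan ⊤ ≤ (⊤ * R * ⊤).comap (gproj hT d) := by
          refine Submodule.mul_le.2 fun s hs w hw => ?_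
          have : consSpan (⊤ : Submodule k (TensorAlgebra k Q)) ≤
              ((⊤ * R * ⊤).comap (gproj hT d)).comap (LinearMap.mulLeft k s) := by
            refine consSpan_le fun q t _ => ?_
            rw [Submodule.mem_comap, Submodule.mem_comap, LinearMap.mulLeft_apply]
            refine isInternal_induction hQi (C := fun q => gproj hT d
              (s * (TensorAlgebra.ι k q * t)) ∈ ⊤ * R * ⊤) (by simp) ?_ ?_ q
            · intro x y hx hy; rw [map_add, add_mul, mul_add, map_add]; exact add_mem hx hy
            intro e q hq
            refine isInternal_induction hT (C := fun t => gproj hT d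
              (s * (TensorAlgebra.ι k q * t)) ∈ ⊤ * R * ⊤) (by simp) ?_ ?_ t
            · intro x y hx hy; rw [mul_add, mul_add, map_add]; exact add_mem hx hy
            intro g t ht
            have hs' := hIg hs
            clear hs
            induction hs' using Submodule.iSup_induction' with
            | mem f s hs =>
              have hmem := mul_mem_tensorDeg hs.2 (ι_mul_mem_tensorDeg hq ht)
              by_cases hef : f + (e + g) = d
              · by_cases hq0 : q = 0
                · simp [hq0]
                by_cases ht0 : t = 0
                · simp [ht0]
                have hpos := pos_of_ne_zero hQm hq hq0
                have hpos' : ¬ g.1 < 0 := fun hg => ht0 (tensorDeg_eq_zero hQm hg ht)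
                rw [hef] at hmem
                rw [gproj_of_mem hT hmem]
                refine mul_mem_ideal (ih f ?_ s hs.1 hs.2) _
                have := congrArg Prod.fst hef
                simp only [Prod.fst_add] at this
                push_cast at hd; omega
              · rw [gproj_of_mem_ne hT hmem hef]; exact zero_mem _
            | zero => simp
            | add x y _ _ hx hy => rw [add_mul, map_add]; exact add_mem hx hy
          exact this hw
        exact this hy₂
  intro x hx
  have hx' := hIg hx
  clear hx
  induction hx' using Submodule.iSup_induction' with
  | mem d x hx => exact key (d.1 + 1).toNat d (by omega) x hx.1 hx.2
  | zero => exact zero_mem _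
  | add x y _ _ hx hy => exact add_mem hx hy

end Nakayama

/-! ### Consequences for presentations -/

section Presentation

variable {k : Type*} [Field k] {G : Type*} [AddCommGroup G] [DecidableEq G]
  {A : Type*} [Ring A] [Algebra k A] {𝒜 : ℤ × G → Submodule k A} (D : Presentation 𝒜)

namespace Presentation

theorem Q_le : D.Q ≤ augIdeal 𝒜 := le_sup_left.trans D.Q_sup.le

theorem R_le_relIdeal : D.R ≤ relIdeal D.Q := by
  rw [relIdeal, ← D.R_generates]; exact le_ideal

/-- Tensors in `Q ⊗ θ(A)` are recovered from their images in the free module `Q ⊗ A`. By `R_le` and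
`θ_rec` this applies to relations and to `θ(𝔪)`. -/
theorem psi_lam_of_mem_span {P : A → Prop} {t : TensorAlgebra k D.Q}
    (ht : t ∈ Submodule.span k {x | ∃ (q : D.Q) (a : A), P a ∧
      x = TensorAlgebra.ι k q * D.θ a}) : psi D.θ (lam D.Q t) = t := by
  induction ht using Submodule.span_induction with
  | mem x hx =>
    obtain ⟨q, a, -, rfl⟩ := hx
    rw [lam_ι_mul, psi_tmul, D.θ_splits]
  | zero => simp
  | add x y _ _ hx hy => simp [hx, hy]
  | smul r x _ hx => simp [hx]

theorem psi_lam {r : TensorAlgebra k D.Q} (hr : r ∈ D.R) : psi D.θ (lam D.Q r) = r :=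
  D.psi_lam_of_mem_span (D.R_le hr)

theorem psi_lam_θ {a : A} (ha : a ∈ augIdeal 𝒜) : psi D.θ (lam D.Q (D.θ a)) = D.θ a :=
  D.psi_lam_of_mem_span (P := fun _ => True) (by simpa using D.θ_rec a ha)

theorem algebraMapInv_R {r : TensorAlgebra k D.Q} (hr : r ∈ D.R) :
    TensorAlgebra.algebraMapInv r = 0 := by
  rw [← D.psi_lam hr, algebraMapInv_psi]

theorem algebraMapInv_θ {a : A} (ha : a ∈ augIdeal 𝒜) :
    TensorAlgebra.algebraMapInv (D.θ a) = 0 := by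
  rw [← D.psi_lam_θ ha, algebraMapInv_psi]

theorem muQ_lam_θ {a : A} (ha : a ∈ augIdeal 𝒜) : muQ D.Q (lam D.Q (D.θ a)) = a := by
  rw [muQ_lam, D.algebraMapInv_θ ha, D.θ_splits, map_zero, sub_zero]

theorem muQ_lam_R {r : TensorAlgebra k D.Q} (hr : r ∈ D.R) : muQ D.Q (lam D.Q r) = 0 := by
  rw [muQ_lam, D.algebraMapInv_R hr, mem_relIdeal.1 (D.R_le_relIdeal hr), map_zero, sub_zero]

theorem lam_R_mem_radSub {r : TensorAlgebra k D.Q} (hr : r ∈ D.R) :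
    lam D.Q r ∈ radSub 𝒜 (Set.univ : Set (Aᵐᵒᵖ ⊗[k] D.Q)) := by
  have hr' := D.R_le hr
  clear hr
  induction hr' using Submodule.span_induction with
  | mem x hx =>
    obtain ⟨q, a, ha, rfl⟩ := hx
    rw [lam_ι_mul, D.θ_splits]
    have : op a ⊗ₜ[k] q = op a • (1 ⊗ₜ[k] q : Aᵐᵒᵖ ⊗[k] D.Q) := by
      rw [TensorProduct.smul_tmul', smul_eq_mul, mul_one]
    rw [this]; exact op_smul_mem_radSub ha trivial
  | zero => simp
  | add x y _ _ hx hy => rw [map_add]; exact add_mem hx hy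
  | smul r x _ hx => rw [map_smul]; exact Submodule.smul_mem _ _ hx

/-- Syzygies of the generators are generated by `R`: `psi x` is a relation, hence a sum of products
`s r t`, and by the product rule `lam (s r t)` is the scalar part of `s` times `lam r` acted on by
the image of `t`. Finally `lam (psi x) = x`. -/
theorem ker_muQ_le {x : Aᵐᵒᵖ ⊗[k] D.Q} (hx : muQ D.Q x = 0) :
    x ∈ Submodule.span Aᵐᵒᵖ (lam D.Q '' D.R) := by
  have h1 : psi D.θ x ∈ ⊤ * D.R * (⊤ : Submodule k (TensorAlgebra k D.Q)) := by
    rw [D.R_generates]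
    show mulMap D.Q (psi D.θ x) = 0
    rw [mulMap_psi D.θ_splits, hx]
  have h2 : ⊤ * D.R * ⊤ ≤
      ((Submodule.span Aᵐᵒᵖ (lam D.Q '' D.R)).restrictScalars k).comap (lam D.Q) := by
    refine Submodule.mul_le.2 fun x hx t _ => ?_
    refine Submodule.mul_induction_on hx (fun s _ r hr => ?_) (fun x y hx hy => ?_)
    · have hr0 : mulMap D.Q r = 0 := D.R_le_relIdeal hr
      have hrs : TensorAlgebra.algebraMapInv (s * r) = (0 : k) := by
        rw [map_mul, D.algebraMapInv_R hr, mul_zero]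
      rw [Submodule.mem_comap, lam_mul, hrs, zero_smul, add_zero, lam_mul, hr0, op_zero, zero_smul,
        zero_add, Submodule.restrictScalars_mem]
      refine Submodule.smul_mem _ _ ?_
      rw [← algebraMap_smul Aᵐᵒᵖ]
      exact Submodule.smul_mem _ _ (Submodule.subset_span ⟨r, hr, rfl⟩)
    · rw [add_mul]; exact add_mem hx hy
  have h3 := h2 h1
  rwa [Submodule.mem_comap, lam_psi D.θ_splits] at h3

variable [GradedAlgebra 𝒜]

/-- Minimality in usable form. A graded complement in `R` of `R ∩ relSq` still generates the ideal
by Nakayama, so it must be all of `R`. -/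
theorem R_inf_relSq : D.R ⊓ relSq D.Q = ⊥ := by
  have hT := tensorDeg_internal D.Q_graded
  obtain ⟨U, hU, hsup, hinf⟩ := exists_graded_compl hT inf_le_left D.R_graded
    (D.R_graded.inf hT (relSq_isGraded D.Q_graded))
  have hUR : U ≤ D.R := le_sup_left.trans hsup.le
  have hgen := ideal_eq_relIdeal D.Q_graded D.Q_le (hUR.trans D.R_le_relIdeal) hU (by
    have h1 := span_mul_le_sup D.R_le_relIdeal
    rw [D.R_generates] at h1
    refine h1.trans (sup_le ?_ le_sup_right)
    rw [← hsup]
    exact sup_le le_sup_left (inf_le_right.trans le_sup_right))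
  have hUR' := D.R_minimal U hUR hU hgen
  rw [hUR'] at hinf
  rwa [inf_eq_right.2 inf_le_left] at hinf

/-- The map `psi` carries syzygies times `𝔪` into the decomposable relations and sends `lam r` back
to `r`. Thus relations stay independent among the syzygies modulo `𝔪`. -/
theorem eq_zero_of_lam_mem {r : TensorAlgebra k D.Q} (hr : r ∈ D.R)
    (h : lam D.Q r ∈ radSub 𝒜 {x : Aᵐᵒᵖ ⊗[k] D.Q | muQ D.Q x = 0}) : r = 0 := by
  have h1 : radSub 𝒜 {x : Aᵐᵒᵖ ⊗[k] D.Q | muQ D.Q x = 0} ≤ (relSq D.Q).comap (psi D.θ) := by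
    refine radSub_le fun a ha x hx => ?_
    replace hx : muQ D.Q x = 0 := hx
    have e0 : TensorAlgebra.algebraMapInv (psi D.θ x * D.θ a) = (0 : k) := by
      rw [map_mul, algebraMapInv_psi, zero_mul]
    have e1 : op a • x = lam D.Q (psi D.θ x * D.θ a) := by
      rw [lam_mul, algebraMapInv_psi, zero_smul, add_zero, D.θ_splits, lam_psi D.θ_splits]
    rw [Submodule.mem_comap, e1]
    have e2 := sub_psi_lam_mem D.θ_splits e0
    have e3 : psi D.θ x * D.θ a ∈ relIdeal D.Q * consSpan ⊤ := by
      refine Submodule.mul_mem_mul ?_ (mem_consSpan_top.2 (D.algebraMapInv_θ ha))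
      rw [mem_relIdeal, mulMap_psi D.θ_splits, hx]
    have := sub_mem (Submodule.mem_sup_right e3 : _ ∈ relSq D.Q) (Submodule.mem_sup_left e2)
    rwa [sub_sub_cancel] at this
  have h2 := h1 h
  rw [Submodule.mem_comap, D.psi_lam hr] at h2
  have : r ∈ D.R ⊓ relSq D.Q := ⟨hr, h2⟩
  rwa [D.R_inf_relSq] at this

end Presentation

end Presentation

end ExtAInf

open scoped DirectSum

namespace ExtAInf

set_option linter.unusedSectionVars false

open TensorProduct MulOpposite

/-! ### Existence of presentations -/

section Existence

variable {k : Type*} [Field k] {G : Type*} [AddCommGroup G] [DecidableEq G]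
  {A : Type*} [Ring A] [Algebra k A] (𝒜 : ℤ × G → Submodule k A)
  (Q : Submodule k A)

/-- The homogeneous components of the free right module generated by `Q`. -/
def freeDeg (d : ℤ × G) : Submodule k (Aᵐᵒᵖ ⊗[k] Q) :=
  Submodule.span k {x | ∃ (f e : ℤ × G) (q : Q) (a : A), (q : A) ∈ 𝒜 f ∧ a ∈ 𝒜 e ∧ f + e = d ∧
    x = op a ⊗ₜ q}

variable {𝒜 Q}

theorem one_tmul_mem_freeDeg [GradedAlgebra 𝒜] {d : ℤ × G} {q : Q} (hq : (q : A) ∈ 𝒜 d) :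
    (1 ⊗ₜ q : Aᵐᵒᵖ ⊗[k] Q) ∈ freeDeg 𝒜 Q d :=
  Submodule.subset_span ⟨d, 0, q, 1, hq, SetLike.GradedOne.one_mem, add_zero d, rfl⟩

theorem smul_mem_freeDeg [GradedAlgebra 𝒜] {d e : ℤ × G} {x : Aᵐᵒᵖ ⊗[k] Q}
    (hx : x ∈ freeDeg 𝒜 Q d) {a : A} (ha : a ∈ 𝒜 e) : op a • x ∈ freeDeg 𝒜 Q (d + e) := by
  induction hx using Submodule.span_induction with
  | mem x hx =>
    obtain ⟨f, g, q, b, hq, hb, rfl, rfl⟩ := hx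
    refine Submodule.subset_span ⟨f, g + e, q, b * a, hq, SetLike.mul_mem_graded hb ha,
      (add_assoc _ _ _).symm, ?_⟩
    rw [TensorProduct.smul_tmul', smul_eq_mul, ← op_mul]
  | zero => simp
  | add x y _ _ hx hy => rw [smul_add]; exact add_mem hx hy
  | smul r x _ hx => rw [smul_algebra_smul_comm]; exact Submodule.smul_mem _ _ hx

theorem freeDeg_induction (hQm : Q ≤ augIdeal 𝒜) [GradedAlgebra 𝒜] {d : ℤ × G}
    {C : Aᵐᵒᵖ ⊗[k] Q → Prop} (hz : C 0)
    (hadd : ∀ x y, C x → C y → C (x + y)) (hs : ∀ (r : k) x, C x → C (r • x))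
    (hm : ∀ (f e : ℤ × G) (q : Q) (a : A), (q : A) ∈ 𝒜 f → a ∈ 𝒜 e → f + e = d → 0 < f.1 →
      C (op a ⊗ₜ q)) {x : Aᵐᵒᵖ ⊗[k] Q} (hx : x ∈ freeDeg 𝒜 Q d) : C x := by
  induction hx using Submodule.span_induction with
  | mem x hx =>
    obtain ⟨f, e, q, a, hq, ha, hd, rfl⟩ := hx
    by_cases hq0 : q = 0
    · subst hq0; simpa using hz
    · exact hm f e q a hq ha hd (pos_of_ne_zero hQm hq hq0)
  | zero => exact hz
  | add x y _ _ hx hy => exact hadd x y hx hy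
  | smul r x _ hx => exact hs r x hx

/-- Splitting off a letter lowers the degree by at least one, so `psi` in degree at most `n + 1`
sees `θ` only up to degree `n`. This makes the recursion for `θ` well founded. -/
theorem psi_congr_of_mem_freeDeg (hQm : Q ≤ augIdeal 𝒜) [GradedAlgebra 𝒜] {n : ℕ}
    {θ θ' : A →ₗ[k] TensorAlgebra k Q}
    (h : ∀ e : ℤ × G, e.1 ≤ n → ∀ a ∈ 𝒜 e, θ a = θ' a) {d : ℤ × G} (hd : d.1 ≤ n + 1)
    {x : Aᵐᵒᵖ ⊗[k] Q} (hx : x ∈ freeDeg 𝒜 Q d) : psi θ x = psi θ' x := by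
  refine freeDeg_induction hQm (C := fun x => psi θ x = psi θ' x) (by simp) ?_ ?_ ?_ hx
  · intro x y hx hy; simp [hx, hy]
  · intro r x hx; simp [hx]
  · intro f e q a _ ha hfe hf
    have := congrArg Prod.fst hfe
    simp only [Prod.fst_add] at this
    rw [psi_tmul, psi_tmul, h e (by omega) a ha]

theorem mulMap_psi_of_mem_freeDeg (hQm : Q ≤ augIdeal 𝒜) [GradedAlgebra 𝒜] {n : ℕ}
    {θ : A →ₗ[k] TensorAlgebra k Q}
    (h : ∀ e : ℤ × G, e.1 ≤ n → ∀ a ∈ 𝒜 e, mulMap Q (θ a) = a) {d : ℤ × G} (hd : d.1 ≤ n + 1)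
    {x : Aᵐᵒᵖ ⊗[k] Q} (hx : x ∈ freeDeg 𝒜 Q d) : mulMap Q (psi θ x) = muQ Q x := by
  refine freeDeg_induction hQm (C := fun x => mulMap Q (psi θ x) = muQ Q x) (by simp) ?_ ?_ ?_ hx
  · intro x y hx hy; simp [hx, hy]
  · intro r x hx
    have : muQ Q (r • x) = r • muQ Q x := (muQ Q).map_smul_of_tower r x
    rw [this, map_smul, map_smul, hx]
  · intro f e q a _ ha hfe hf
    have := congrArg Prod.fst hfe
    simp only [Prod.fst_add] at this
    rw [psi_tmul, muQ_tmul, map_mul, mulMap_ι, h e (by omega) a ha]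

theorem psi_mem_tensorDeg {θ : A →ₗ[k] TensorAlgebra k Q}
    (h : ∀ e, ∀ a ∈ 𝒜 e, θ a ∈ tensorDeg 𝒜 Q e) {d : ℤ × G} {x : Aᵐᵒᵖ ⊗[k] Q}
    (hx : x ∈ freeDeg 𝒜 Q d) : psi θ x ∈ tensorDeg 𝒜 Q d := by
  induction hx using Submodule.span_induction with
  | mem x hx =>
    obtain ⟨f, e, q, a, hq, ha, rfl, rfl⟩ := hx
    rw [psi_tmul]
    exact ι_mul_mem_tensorDeg hq (h e a ha)
  | zero => simp
  | add x y _ _ hx hy => rw [map_add]; exact add_mem hx hy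
  | smul r x _ hx => rw [map_smul]; exact Submodule.smul_mem _ _ hx

variable [GradedAlgebra 𝒜] (hQ : IsGradedSubspace 𝒜 Q)
  (hsup : Q ⊔ augIdeal 𝒜 * augIdeal 𝒜 = augIdeal 𝒜)

include hQ hsup in
-- Since `𝔪 = Q + 𝔪²`, an element of `𝔪` is a generator plus products `x y`; the factor `x` has
-- smaller degree and is in `Q A` by induction.
theorem exists_mem_freeDeg (n : ℕ) : ∀ d : ℤ × G, 0 < d.1 → d.1 ≤ n → ∀ a ∈ 𝒜 d,
    a ∈ (freeDeg 𝒜 Q d).map ((muQ Q).restrictScalars k) := by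
  have h𝒜 := gradedAlgebra_isInternal 𝒜
  induction n with
  | zero => intro d h1 h2; simp at h2; omega
  | succ n ih =>
    intro d h1 h2 a ha
    have ha' : a ∈ Q ⊔ augIdeal 𝒜 * augIdeal 𝒜 := by rw [hsup]; exact mem_augIdeal h1 ha
    obtain ⟨q, hq, m, hm, hqm⟩ := Submodule.mem_sup.1 ha'
    rw [← gproj_of_mem h𝒜 ha, ← hqm, map_add]
    refine add_mem ?_ ?_
    · refine ⟨1 ⊗ₜ ⟨gproj h𝒜 d q, hQ.gproj_mem h𝒜 hq d⟩,
        one_tmul_mem_freeDeg (gproj_mem h𝒜 d q), ?_⟩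
      rw [LinearMap.restrictScalars_apply, ← op_one, muQ_tmul, mul_one]
    · have : augIdeal 𝒜 * augIdeal 𝒜 ≤
          ((freeDeg 𝒜 Q d).map ((muQ Q).restrictScalars k)).comap (gproj h𝒜 d) := by
        refine Submodule.mul_le.2 fun x hx y hy => ?_
        rw [Submodule.mem_comap]
        refine augIdeal_induction (C := fun x => gproj h𝒜 d (x * y) ∈ _) (by simp) ?_ ?_ hx
        · intro x x' h h'; rw [add_mul, map_add]; exact add_mem h h'
        intro e he x hx
        refine augIdeal_induction (C := fun y => gproj h𝒜 d (x * y) ∈ _) (by simp) ?_ ?_ hy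
        · intro x x' h h'; rw [mul_add, map_add]; exact add_mem h h'
        intro f hf y hy
        have hmem := SetLike.mul_mem_graded hx hy
        by_cases hef : e + f = d
        · have h3 := congrArg Prod.fst hef
          simp only [Prod.fst_add] at h3
          push_cast at h2
          obtain ⟨w, hw, hwx⟩ := ih e he (by omega) x hx
          rw [hef] at hmem
          rw [gproj_of_mem h𝒜 hmem]
          refine ⟨op y • w, hef ▸ smul_mem_freeDeg hw hy, ?_⟩
          rw [LinearMap.restrictScalars_apply] at hwx ⊢
          rw [map_smul, hwx, op_smul_eq_mul]
        · rw [gproj_of_mem_ne h𝒜 hmem hef]; exact zero_mem _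
      exact this hm

include hQ hsup in
theorem exists_graded_section : ∃ ξ : A →ₗ[k] Aᵐᵒᵖ ⊗[k] Q,
    (∀ d : ℤ × G, 0 < d.1 → ∀ a ∈ 𝒜 d, muQ Q (ξ a) = a ∧ ξ a ∈ freeDeg 𝒜 Q d) ∧
    (∀ d : ℤ × G, d.1 ≤ 0 → ∀ a ∈ 𝒜 d, ξ a = 0) ∧ ∀ q : Q, ξ q = 1 ⊗ₜ q := by
  have h𝒜 := gradedAlgebra_isInternal 𝒜
  have hQm : Q ≤ augIdeal 𝒜 := le_sup_left.trans hsup.le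
  have hd : ∀ d : ℤ × G, ∃ x : A →ₗ[k] Aᵐᵒᵖ ⊗[k] Q, (0 < d.1 → ∀ a ∈ 𝒜 d,
      muQ Q (x a) = a ∧ x a ∈ freeDeg 𝒜 Q d) ∧ ∀ q : Q, (q : A) ∈ 𝒜 d → x q = 1 ⊗ₜ q := by
    intro d
    let p : freeDeg 𝒜 Q d →ₗ[k] A := (muQ Q).restrictScalars k ∘ₗ (freeDeg 𝒜 Q d).subtype
    obtain ⟨s, hs⟩ := p.rangeRestrict.exists_rightInverse_of_surjective p.range_rangeRestrict
    obtain ⟨s', hs'⟩ := LinearMap.exists_extend (K := k) (V' := freeDeg 𝒜 Q d) s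
    obtain ⟨π, hπ⟩ := LinearMap.exists_extend (p := Q ⊓ 𝒜 d) (LinearMap.id)
    have hps : ∀ a ∈ LinearMap.range p, p (s' a) = a := by
      intro a ha
      have h1 : s' a = s ⟨a, ha⟩ := LinearMap.congr_fun hs' ⟨a, ha⟩
      rw [h1]
      exact congrArg Subtype.val (LinearMap.congr_fun hs ⟨a, ha⟩)
    have hππ : ∀ (a : A) (ha : a ∈ Q ⊓ 𝒜 d), π a = ⟨a, ha⟩ := fun a ha =>
      LinearMap.congr_fun hπ ⟨a, ha⟩
    let i : (Q ⊓ 𝒜 d : Submodule k A) →ₗ[k] Q := Submodule.inclusion inf_le_left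
    -- An arbitrary section is corrected along a projection `π` onto `Q` in degree `d`, so that
    -- generators are sent to `1 ⊗ q`.
    refine ⟨(freeDeg 𝒜 Q d).subtype ∘ₗ s' ∘ₗ (LinearMap.id - (Q ⊓ 𝒜 d).subtype ∘ₗ π) +
      TensorProduct.mk k Aᵐᵒᵖ Q 1 ∘ₗ i ∘ₗ π, ?_, ?_⟩
    · intro hpos a ha
      have hr : a - (π a : A) ∈ LinearMap.range p := by
        obtain ⟨w, hw, hwx⟩ := exists_mem_freeDeg hQ hsup d.1.toNat d hpos (by omega) _
          (sub_mem ha (π a).2.2)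
        exact ⟨⟨w, hw⟩, hwx⟩
      constructor
      · have h1 : muQ Q (s' (a - (π a : A))) = a - (π a : A) := hps _ hr
        simp only [LinearMap.add_apply, LinearMap.comp_apply, LinearMap.sub_apply,
          LinearMap.id_apply, Submodule.subtype_apply, TensorProduct.mk_apply, map_add, h1]
        rw [← op_one, muQ_tmul, mul_one]
        exact sub_add_cancel a (π a : A)
      · exact add_mem (Submodule.coe_mem _) (one_tmul_mem_freeDeg (π a).2.2)
    · intro q hq
      have h1 := hππ q ⟨q.2, hq⟩
      simp only [LinearMap.add_apply, LinearMap.comp_apply, LinearMap.sub_apply,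
          LinearMap.id_apply, Submodule.subtype_apply, TensorProduct.mk_apply, h1]
      simp [i]
      rfl
  choose x hx hx' using hd
  let ξ : A →ₗ[k] Aᵐᵒᵖ ⊗[k] Q := gradedLift h𝒜 fun d =>
    if 0 < d.1 then x d ∘ₗ (𝒜 d).subtype else 0
  have hξ : ∀ d : ℤ × G, 0 < d.1 → ∀ a ∈ 𝒜 d, ξ a = x d a := by
    intro d hd a ha
    simp only [ξ]
    rw [gradedLift_of_mem h𝒜 _ ha, if_pos hd]; rfl
  refine ⟨ξ, ?_, ?_, ?_⟩
  · intro d hd a ha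
    rw [hξ d hd a ha]; exact hx d hd a ha
  · intro d hd a ha
    simp only [ξ]
    rw [gradedLift_of_mem h𝒜 _ ha, if_neg (not_lt.2 hd)]; rfl
  · intro q
    refine isInternal_induction (hQ.isInternal h𝒜) (C := fun q : Q => ξ q = 1 ⊗ₜ q) (by simp)
      ?_ ?_ q
    · intro q q' h h'; simp [h, h', TensorProduct.tmul_add]
    · intro d q hq
      by_cases hq0 : q = 0
      · simp [hq0]
      · rw [hξ d (pos_of_ne_zero hQm hq hq0) q hq, hx' d q hq]

variable (hconn : IsConnectedGraded 𝒜)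

include hQ hsup hconn in
-- `θ` is the fixed point of `θ = ε + (id ⊗ θ) ξ`. Iterating from `ε`, the `n`-th iterate is already
-- correct in degrees at most `n`, and the diagonal limit inherits all properties.
theorem exists_theta : ∃ θ : A →ₗ[k] TensorAlgebra k Q,
    (∀ d, ∀ a ∈ 𝒜 d, θ a ∈ tensorDeg 𝒜 Q d) ∧ (∀ a, mulMap Q (θ a) = a) ∧ θ 1 = 1 ∧
    (∀ q : Q, θ q = TensorAlgebra.ι k q) ∧ ∀ a ∈ augIdeal 𝒜, ∃ x, θ a = psi θ x := by
  have h𝒜 := gradedAlgebra_isInternal 𝒜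
  have hQm : Q ≤ augIdeal 𝒜 := le_sup_left.trans hsup.le
  obtain ⟨ξ, hξ, hξ0, hξQ⟩ := exists_graded_section hQ hsup
  obtain ⟨ε, hε1, hε, -⟩ := hconn.exists_augmentation
  let E : A →ₗ[k] TensorAlgebra k Q := LinearMap.toSpanSingleton k _ 1 ∘ₗ ε
  have hE : ∀ a, E a = ε a • 1 := fun a => rfl
  have hcases : ∀ (d : ℤ × G) (a : A), a ∈ 𝒜 d → 0 < d.1 ∨ a = 0 ∨
      (d = 0 ∧ ∃ c : k, a = c • 1) := by
    intro d a ha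
    rcases lt_trichotomy d.1 0 with hd | hd | hd
    · exact Or.inr (Or.inl (hconn.eq_zero_of_neg hd ha))
    · by_cases hd' : d = 0
      · subst hd'
        exact Or.inr (Or.inr ⟨rfl, hconn.exists_smul_one ha⟩)
      · exact Or.inr (Or.inl (hconn.eq_zero_of_fst_eq_zero hd hd' ha))
    · exact Or.inl hd
  have hξ1 : ξ 1 = 0 := hξ0 0 le_rfl 1 SetLike.GradedOne.one_mem
  let Th : ℕ → A →ₗ[k] TensorAlgebra k Q := fun n =>
    Nat.rec E (fun _ θ => E + psi θ ∘ₗ ξ) n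
  have hTh0 : Th 0 = E := rfl
  have hThs : ∀ n a, Th (n + 1) a = ε a • 1 + psi (Th n) (ξ a) := fun n a => rfl
  have hEd : ∀ d, ∀ a ∈ 𝒜 d, ε a • (1 : TensorAlgebra k Q) ∈ tensorDeg 𝒜 Q d := by
    intro d a ha
    rcases hcases d a ha with hd | rfl | ⟨rfl, c, rfl⟩
    · rw [hε a (mem_augIdeal hd ha), zero_smul]; exact zero_mem _
    · simp
    · exact Submodule.smul_mem _ _ one_mem_tensorDeg
  have hξd : ∀ d, ∀ a ∈ 𝒜 d, ξ a ∈ freeDeg 𝒜 Q d := by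
    intro d a ha
    by_cases hd : 0 < d.1
    · exact (hξ d hd a ha).2
    · rw [hξ0 d (not_lt.1 hd) a ha]; exact zero_mem _
  have hgr : ∀ n d, ∀ a ∈ 𝒜 d, Th n a ∈ tensorDeg 𝒜 Q d := by
    intro n
    induction n with
    | zero => exact hEd
    | succ n ih =>
      intro d a ha
      rw [hThs]
      exact add_mem (hEd d a ha) (psi_mem_tensorDeg ih (hξd d a ha))
  have hsplit : ∀ n : ℕ, ∀ d : ℤ × G, d.1 ≤ n → ∀ a ∈ 𝒜 d, mulMap Q (Th n a) = a := by
    intro n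
    induction n with
    | zero =>
      intro d hd a ha
      rw [hTh0, hE]
      rcases hcases d a ha with hd' | rfl | ⟨rfl, c, rfl⟩
      · simp at hd; omega
      · simp
      · simp [hε1]
    | succ n ih =>
      intro d hd a ha
      rw [hThs]
      rcases hcases d a ha with hd' | rfl | ⟨rfl, c, rfl⟩
      · rw [hε a (mem_augIdeal hd' ha), zero_smul, zero_add,
          mulMap_psi_of_mem_freeDeg hQm ih (by push_cast at hd; exact hd) (hξd d a ha),
          (hξ d hd' a ha).1]
      · simp
      · simp [hε1, hξ1]
  have hstab : ∀ n : ℕ, ∀ d : ℤ × G, d.1 ≤ n → ∀ a ∈ 𝒜 d, Th (n + 1) a = Th n a := by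
    intro n
    induction n with
    | zero =>
      intro d hd a ha
      rw [hThs, hTh0, hE, hξ0 d (by simpa using hd) a ha, map_zero, add_zero]
    | succ n ih =>
      intro d hd a ha
      rw [hThs (n + 1), hThs n, psi_congr_of_mem_freeDeg hQm ih (by push_cast at hd; exact hd) (hξd d a ha)]
  have hstab' : ∀ (m n : ℕ), n ≤ m → ∀ d : ℤ × G, d.1 ≤ n → ∀ a ∈ 𝒜 d, Th m a = Th n a := by
    intro m n hmn
    induction m, hmn using Nat.le_induction with
    | base => intros; rfl
    | succ m hm ih =>
      intro d hd a ha
      rw [hstab m d (hd.trans (by exact_mod_cast hm)) a ha, ih d hd a ha]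
  let θ : A →ₗ[k] TensorAlgebra k Q := gradedLift h𝒜 fun d => Th d.1.toNat ∘ₗ (𝒜 d).subtype
  have hθ : ∀ (n : ℕ) (d : ℤ × G), d.1 ≤ n → ∀ a ∈ 𝒜 d, θ a = Th n a := by
    intro n d hd a ha
    have : θ a = Th d.1.toNat a := gradedLift_of_mem h𝒜 _ ha
    rw [this, hstab' n d.1.toNat (by omega) d (by omega) a ha]
  have hfix : ∀ a, θ a = ε a • 1 + psi θ (ξ a) := by
    intro a
    refine isInternal_induction h𝒜 (C := fun a => θ a = ε a • 1 + psi θ (ξ a)) (by simp) ?_ ?_ a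
    · intro x y hx hy
      simp only [map_add, hx, hy, add_smul]; abel
    · intro d a ha
      rw [hθ (d.1.toNat + 1) d (by omega) a ha, hThs,
        psi_congr_of_mem_freeDeg hQm (n := d.1.toNat) (θ' := θ)
          (fun e he b hb => (hθ _ e he b hb).symm) (by omega) (hξd d a ha)]
  have hθ1 : θ 1 = 1 := by rw [hfix, hε1, hξ1]; simp
  refine ⟨θ, ?_, ?_, hθ1, ?_, ?_⟩
  · intro d a ha
    rw [hθ d.1.toNat d (by omega) a ha]; exact hgr _ d a ha
  · intro a
    refine isInternal_induction h𝒜 (C := fun a => mulMap Q (θ a) = a) (by simp) ?_ ?_ a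
    · intro x y hx hy; simp [hx, hy]
    · intro d a ha
      rw [hθ d.1.toNat d (by omega) a ha]; exact hsplit _ d (by omega) a ha
  · intro q
    rw [hfix, hε _ (hQm q.2), zero_smul, zero_add, hξQ, ← op_one, psi_tmul, hθ1, mul_one]
  · intro a ha
    exact ⟨ξ a, by rw [hfix, hε a ha, zero_smul, zero_add]⟩

include hconn in
-- Let `J` be the space of relations in `Q ⊗ θ(𝔪)`. Every relation lies in `J` modulo decomposables,
-- so a graded complement `R` in `J` of the decomposables of `J` generates by Nakayama. It is
-- minimal because `R` meets `relSq` trivially.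
theorem nonempty_presentation : Nonempty (Presentation 𝒜) := by
  have h𝒜 := gradedAlgebra_isInternal 𝒜
  have hmg := augIdeal_isGraded (𝒜 := 𝒜)
  obtain ⟨Q, hQ, hsup, hinf⟩ := exists_graded_compl h𝒜 augIdeal_mul_augIdeal_le hmg
    (hmg.mul (fun d e x y hx hy => SetLike.mul_mem_graded hx hy) hmg)
  have hQm : Q ≤ augIdeal 𝒜 := le_sup_left.trans hsup.le
  obtain ⟨θ, hθd, hθs, hθ1, hθQ, hθr⟩ := exists_theta hQ hsup hconn
  have hT := tensorDeg_internal hQ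
  let J : Submodule k (TensorAlgebra k Q) := relIdeal Q ⊓ consSpan ((augIdeal 𝒜).map θ)
  have hJg : IsGradedSubspace (tensorDeg 𝒜 Q) J :=
    (relIdeal_isGraded hQ).inf hT (consSpan_isGraded hQ (IsGradedSubspace.map hθd hmg))
  obtain ⟨R, hR, hRsup, hRinf⟩ := exists_graded_compl hT inf_le_left hJg
    (hJg.inf hT (relSq_isGraded hQ))
  have hRJ : R ≤ J := le_sup_left.trans hRsup.le
  have hRI : R ≤ relIdeal Q := hRJ.trans inf_le_left
  -- Elements of `Q ⊗ θ(A)` are a single letter plus an element of `Q ⊗ θ(𝔪)`.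
  have hrange : ∀ x : Aᵐᵒᵖ ⊗[k] Q, ∃ q : Q,
      psi θ x - TensorAlgebra.ι k q ∈ consSpan ((augIdeal 𝒜).map θ) := by
    obtain ⟨ε, -, -, hε⟩ := hconn.exists_augmentation
    intro x
    induction x using TensorProduct.induction_on with
    | zero => exact ⟨0, by simp⟩
    | tmul b q =>
      obtain ⟨a, rfl⟩ := op_surjective b
      refine ⟨ε a • q, ?_⟩
      have : psi θ (op a ⊗ₜ q) - TensorAlgebra.ι k (ε a • q) =
          TensorAlgebra.ι k q * θ (a - ε a • 1) := by
        rw [psi_tmul, θ.map_sub, θ.map_smul, hθ1, mul_sub, mul_smul_comm, mul_one, map_smul]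
      rw [this]
      exact ι_mul_mem_consSpan q ⟨_, hε a, rfl⟩
    | add x y hx hy =>
      obtain ⟨q, hq⟩ := hx
      obtain ⟨q', hq'⟩ := hy
      refine ⟨q + q', ?_⟩
      rw [map_add, map_add, add_sub_add_comm]; exact add_mem hq hq'
  have hdec : relIdeal Q ≤ R ⊔ relSq Q := by
    intro t ht
    -- A relation has no constant term, since otherwise `1` would lie in `𝔪`.
    have hεt : TensorAlgebra.algebraMapInv t = (0 : k) := by
      have h1 := muQ_lam Q t
      rw [mem_relIdeal.1 ht, zero_sub] at h1
      have h2 : muQ Q (lam Q t) ∈ augIdeal 𝒜 := by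
        generalize lam Q t = x
        induction x using TensorProduct.induction_on with
        | zero => simp
        | tmul b q =>
          obtain ⟨a, rfl⟩ := op_surjective b
          rw [muQ_tmul]; exact hconn.mul_mem_augIdeal (hQm q.2)
        | add x y hx hy => rw [map_add]; exact add_mem hx hy
      rw [h1, neg_mem_iff, Algebra.algebraMap_eq_smul_one] at h2
      by_contra hne
      have h3 := Submodule.smul_mem _ (TensorAlgebra.algebraMapInv t)⁻¹ h2
      rw [smul_smul, inv_mul_cancel₀ hne, one_smul] at h3
      exact hconn.one_notMem_augIdeal h3
    have h1 := sub_psi_lam_mem hθs hεt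
    have h2 : psi θ (lam Q t) ∈ J := by
      have hI : psi θ (lam Q t) ∈ relIdeal Q := by
        rw [mem_relIdeal, mulMap_psi hθs, muQ_lam, mem_relIdeal.1 ht, hεt]; simp
      refine ⟨hI, ?_⟩
      obtain ⟨q, hq⟩ := hrange (lam Q t)
      have hmm : ∀ w ∈ consSpan ((augIdeal 𝒜).map θ), mulMap Q w ∈ augIdeal 𝒜 * augIdeal 𝒜 := by
        intro w hw
        have : consSpan ((augIdeal 𝒜).map θ) ≤
            (augIdeal 𝒜 * augIdeal 𝒜).comap (mulMap Q).toLinearMap := by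
          refine consSpan_le ?_
          rintro q _ ⟨a, ha, rfl⟩
          rw [Submodule.mem_comap, AlgHom.toLinearMap_apply, map_mul, mulMap_ι, hθs]
          exact Submodule.mul_mem_mul (hQm q.2) ha
        exact this hw
      -- A relation has no linear term either: this term lies in `Q` and in `𝔪²`, hence is zero.
      have h3 := hmm _ hq
      rw [map_sub, mem_relIdeal.1 hI, zero_sub, neg_mem_iff, mulMap_ι] at h3
      have h4 : (q : A) ∈ Q ⊓ augIdeal 𝒜 * augIdeal 𝒜 := ⟨q.2, h3⟩
      rw [hinf, Submodule.mem_bot] at h4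
      have h5 : q = 0 := Subtype.ext h4
      rwa [h5, map_zero, sub_zero] at hq
    rw [← hRsup] at h2
    have h3 : psi θ (lam Q t) ∈ R ⊔ relSq Q :=
      (sup_le_sup le_rfl inf_le_right : R ⊔ J ⊓ relSq Q ≤ _) h2
    have h4 := add_mem (Submodule.mem_sup_right (Submodule.mem_sup_left h1) : _ ∈ R ⊔ relSq Q) h3
    rwa [sub_add_cancel] at h4
  exact ⟨{
    Q := Q
    Q_graded := hQ
    Q_sup := hsup
    Q_inf := hinf
    θ := θ
    θ_graded := hθd
    θ_splits := hθs
    θ_one := hθ1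
    θ_gen := hθQ
    θ_rec := by
      intro a ha
      obtain ⟨x, hx⟩ := hθr a ha
      rw [hx]
      clear hx
      induction x using TensorProduct.induction_on with
      | zero => simp
      | tmul b q =>
        obtain ⟨c, rfl⟩ := op_surjective b
        exact Submodule.subset_span ⟨q, c, psi_tmul θ c q⟩
      | add x y hx hy => rw [map_add]; exact add_mem hx hy
    R := R
    R_graded := hR
    R_le := by
      refine hRJ.trans (inf_le_right.trans (consSpan_le ?_))
      rintro q _ ⟨a, ha, rfl⟩
      exact Submodule.subset_span ⟨q, a, ha, rfl⟩
    R_generates := ideal_eq_relIdeal hQ hQm hRI hR hdec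
    R_minimal := by
      intro R' hR' _ hgen
      refine le_antisymm hR' fun r hr => ?_
      -- A smaller generating space fills `R` modulo `relSq`, and the remainder lies in `R ∩ relSq =
      -- 0`.
      have h1 : r ∈ R' ⊔ relSq Q := by
        refine span_mul_le_sup (hR'.trans hRI) ?_
        rw [hgen]; exact hRI hr
      obtain ⟨r', hr', y, hy, rfl⟩ := Submodule.mem_sup.1 h1
      have h2 : y ∈ R := by simpa using sub_mem hr (hR' hr')
      have h3 : y ∈ R ⊓ (J ⊓ relSq Q) := ⟨h2, hRJ h2, hy⟩
      rw [hRinf, Submodule.mem_bot] at h3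
      rwa [h3, add_zero] }⟩

end Existence

end ExtAInf

open scoped DirectSum

namespace ExtAInf

set_option linter.unusedSectionVars false

open TensorProduct MulOpposite

/-! ### Graded free resolutions: linear maps, homotopies -/

section Sign

variable (k : Type*) [Field k]

/-- The sign `(-1)^n`, as a scalar. -/
def sgn (n : ℤ) : k := ((n.negOnePow : ℤ) : k)

theorem sgn_succ (n : ℤ) : sgn k (n + 1) = -sgn k n := by
  simp [sgn, Int.negOnePow_succ]

theorem sgn_pred (n : ℤ) : sgn k (n - 1) = -sgn k n := by
  have := sgn_succ k (n - 1)
  rw [sub_add_cancel] at this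
  rw [this, neg_neg]

theorem sgn_mul_self (n : ℤ) : sgn k n * sgn k n = 1 := by
  rcases Int.even_or_odd n with h | h <;> simp [sgn, Int.negOnePow_even, Int.negOnePow_odd, h]

theorem negOnePow_smul {M : Type*} [AddCommGroup M] [Module k M] (n : ℤ) (x : M) :
    n.negOnePow • x = sgn k n • x := by
  rcases Int.even_or_odd n with h | h <;> simp [sgn, Int.negOnePow_even, Int.negOnePow_odd, h]

end Sign

section Resolution

variable {k : Type*} [Field k] {G : Type*} [AddCommGroup G] [DecidableEq G]
  {A : Type*} [Ring A] [Algebra k A] {𝒜 : ℤ × G → Submodule k A} [GradedAlgebra 𝒜]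
  {P : Type*} [AddCommGroup P] [Module k P] [Module Aᵐᵒᵖ P] [IsScalarTower k Aᵐᵒᵖ P]
  (F : GradedFreeResolution 𝒜 P)

namespace GradedFreeResolution

/-- The index set of a homogeneous basis. -/
abbrev basisIndex : Type _ := (F.free.choose : Set P)

/-- A homogeneous basis. -/
noncomputable def basis : Module.Basis F.basisIndex Aᵐᵒᵖ P :=
  Module.Basis.mk F.free.choose_spec.2.1 (by
    rw [Subtype.range_coe_subtype]
    exact F.free.choose_spec.2.2.ge)

theorem exists_basis_mem (s : F.basisIndex) : ∃ j, F.basis s ∈ F.deg j := by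
  have h : F.basis s = (s : P) := Module.Basis.mk_apply _ _ _
  rw [h]
  exact F.free.choose_spec.1 _ s.2

/-- The degrees of the basis elements. -/
noncomputable def basisDeg (s : F.basisIndex) : ℤ × (ℤ × G) := (F.exists_basis_mem s).choose

theorem basis_mem (s : F.basisIndex) : F.basis s ∈ F.deg (F.basisDeg s) :=
  (F.exists_basis_mem s).choose_spec

theorem hom_ext' {M : Type*} [AddCommMonoid M] {f g : P →+ M}
    (h : ∀ s, ∀ d, ∀ a ∈ 𝒜 d, f (op a • F.basis s) = g (op a • F.basis s)) : f = g := by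
  ext x
  have h1 : ∀ s (a : A), f (op a • F.basis s) = g (op a • F.basis s) := by
    intro s a
    refine isInternal_induction (gradedAlgebra_isInternal 𝒜)
      (C := fun a => f (op a • F.basis s) = g (op a • F.basis s)) (by simp) ?_ (h s) a
    intro a b ha hb
    rw [op_add, add_smul, map_add, map_add, ha, hb]
  rw [← F.basis.linearCombination_repr x, Finsupp.linearCombination_apply, map_finsuppSum,
    map_finsuppSum]
  refine Finsupp.sum_congr fun s _ => ?_
  exact h1 s (unop _)

theorem hom_ext {M : Type*} [AddCommGroup M] [Module k M] {f g : P →ₗ[k] M}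
    (h : ∀ s, ∀ d, ∀ a ∈ 𝒜 d, f (op a • F.basis s) = g (op a • F.basis s)) : f = g := by
  have := F.hom_ext' (f := f.toAddMonoidHom) (g := g.toAddMonoidHom) h
  ext x
  exact DFunLike.congr_fun this x

theorem gproj_smul {d : ℤ × G} {a : A} (ha : a ∈ 𝒜 d) (j : ℤ × (ℤ × G)) (x : P) :
    gproj F.isInternal (j + (0, d)) (op a • x) = op a • gproj F.isInternal j x := by
  refine isInternal_induction F.isInternal (C := fun x =>
    gproj F.isInternal (j + (0, d)) (op a • x) = op a • gproj F.isInternal j x) (by simp) ?_ ?_ x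
  · intro x y hx hy; simp [hx, hy]
  · intro i x hx
    have hm := F.smul_mem i d x a hx ha
    by_cases hij : i = j
    · subst hij; rw [gproj_of_mem _ hm, gproj_of_mem _ hx]
    · rw [gproj_of_mem_ne _ hm (fun h => hij (add_right_cancel h)), gproj_of_mem_ne _ hx hij,
        smul_zero]

/-- The endomorphism with given values on the basis. -/
noncomputable def lift (v : F.basisIndex → P) : Module.End Aᵐᵒᵖ P := F.basis.constr ℕ v

@[simp] theorem lift_basis (v : F.basisIndex → P) (s : F.basisIndex) :
    F.lift v (F.basis s) = v s := F.basis.constr_basis ℕ v s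

theorem mem_endDeg_of_basis {f : Module.End Aᵐᵒᵖ P} {j : ℤ × (ℤ × G)}
    (h : ∀ s, f (F.basis s) ∈ F.deg (j + F.basisDeg s)) : f ∈ F.endDeg j := by
  intro i x hx
  have : (gproj F.isInternal (j + i)) ∘ₗ f.restrictScalars k ∘ₗ gproj F.isInternal i =
      f.restrictScalars k ∘ₗ gproj F.isInternal i := by
    refine F.hom_ext fun s d a ha => ?_
    simp only [LinearMap.comp_apply, LinearMap.restrictScalars_apply]
    have hm := F.smul_mem _ d _ a (F.basis_mem s) ha
    by_cases hi : F.basisDeg s + (0, d) = i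
    · subst hi
      rw [gproj_of_mem _ hm, map_smul, ← add_assoc, F.gproj_smul ha, gproj_of_mem _ (h s)]
    · rw [gproj_of_mem_ne _ hm hi]; simp
  have h2 := LinearMap.congr_fun this x
  simp only [LinearMap.comp_apply, LinearMap.restrictScalars_apply, gproj_of_mem _ hx] at h2
  rw [← h2]
  exact gproj_mem _ _ _

theorem lift_mem {v : F.basisIndex → P} {j : ℤ × (ℤ × G)}
    (h : ∀ s, v s ∈ F.deg (j + F.basisDeg s)) : F.lift v ∈ F.endDeg j :=
  F.mem_endDeg_of_basis fun s => by rw [lift_basis]; exact h s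

/-- The component of degree `j` of an endomorphism. -/
noncomputable def comp (j : ℤ × (ℤ × G)) (f : Module.End Aᵐᵒᵖ P) : Module.End Aᵐᵒᵖ P :=
  F.lift fun s => gproj F.isInternal (j + F.basisDeg s) (f (F.basis s))

theorem comp_mem (j : ℤ × (ℤ × G)) (f : Module.End Aᵐᵒᵖ P) : F.comp j f ∈ F.endDeg j :=
  F.lift_mem fun _ => gproj_mem _ _ _

theorem comp_apply (j : ℤ × (ℤ × G)) (f : Module.End Aᵐᵒᵖ P) {i : ℤ × (ℤ × G)} {x : P}
    (hx : x ∈ F.deg i) : F.comp j f x = gproj F.isInternal (j + i) (f x) := by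
  have : (F.comp j f).restrictScalars k ∘ₗ gproj F.isInternal i =
      gproj F.isInternal (j + i) ∘ₗ f.restrictScalars k ∘ₗ gproj F.isInternal i := by
    refine F.hom_ext fun s d a ha => ?_
    simp only [LinearMap.comp_apply, LinearMap.restrictScalars_apply]
    have hm := F.smul_mem _ d _ a (F.basis_mem s) ha
    by_cases hi : F.basisDeg s + (0, d) = i
    · subst hi
      rw [gproj_of_mem _ hm, map_smul, map_smul, ← add_assoc, F.gproj_smul ha, comp, lift_basis]
    · rw [gproj_of_mem_ne _ hm hi]; simp
  have h2 := LinearMap.congr_fun this x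
  simpa only [LinearMap.comp_apply, LinearMap.restrictScalars_apply, gproj_of_mem _ hx] using h2

theorem restrictScalars_eq_of_basis {M : Type*} [AddCommGroup M] [Module k M] [Module Aᵐᵒᵖ M]
    {f g : P →ₗ[Aᵐᵒᵖ] M} {p : ℤ} (h : ∀ s, (F.basisDeg s).1 = p → f (F.basis s) = g (F.basis s))
    {e : ℤ × G} {x : P} (hx : x ∈ F.deg (p, e)) : f x = g x := by
  have : f.toAddMonoidHom.comp (gproj F.isInternal (p, e)).toAddMonoidHom =
      g.toAddMonoidHom.comp (gproj F.isInternal (p, e)).toAddMonoidHom := by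
    refine F.hom_ext' fun s d a ha => ?_
    simp only [AddMonoidHom.comp_apply, LinearMap.toAddMonoidHom_coe]
    have hm := F.smul_mem _ d _ a (F.basis_mem s) ha
    by_cases hi : F.basisDeg s + (0, d) = (p, e)
    · rw [← hi, gproj_of_mem _ hm, map_smul, map_smul, h s (by simpa using congrArg Prod.fst hi)]
    · rw [gproj_of_mem_ne _ hm hi]; simp
  have h2 := DFunLike.congr_fun this x
  simpa only [AddMonoidHom.comp_apply, LinearMap.toAddMonoidHom_coe, gproj_of_mem _ hx] using h2

theorem d_d (x : P) : F.d (F.d x) = 0 := ((F.exact (F.d x)).2 ⟨x, rfl⟩).1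

theorem aug_d (x : P) : F.aug (F.d x) = 0 := ((F.exact (F.d x)).2 ⟨x, rfl⟩).2

theorem eq_zero_of_pos {j : ℤ × (ℤ × G)} (hj : 0 < j.1) {x : P} (hx : x ∈ F.deg j) : x = 0 := by
  rwa [F.nonpos j hj] at hx

theorem endDiff_eq (p : ℤ) (f : Module.End Aᵐᵒᵖ P) (x : P) :
    F.endDiff p f x = F.d (f x) - sgn k p • f (F.d x) := by
  rw [endDiff_apply, negOnePow_smul k]; rfl

theorem map_smul_k (f : Module.End Aᵐᵒᵖ P) (c : k) (x : P) : f (c • x) = c • f x :=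
  f.map_smul_of_tower c x

variable {F} in
-- A functional killing `P 𝔪` sees only the scalar part of each coefficient, so its values on a
-- basis determine it.
theorem aug_ext (hconn : IsConnectedGraded 𝒜) {ζ ζ' : P →ₗ[k] k}
    (hζ : ∀ x, ∀ a ∈ augIdeal 𝒜, ζ (op a • x) = 0) (hζ' : ∀ x, ∀ a ∈ augIdeal 𝒜, ζ' (op a • x) = 0)
    (h : ∀ s, ζ (F.basis s) = ζ' (F.basis s)) : ζ = ζ' := by
  refine F.hom_ext fun s d a ha => ?_
  obtain ⟨ε, -, -, hε⟩ := hconn.exists_augmentation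
  have h1 : op a • F.basis s = op (a - ε a • 1) • F.basis s + ε a • F.basis s := by
    rw [op_sub, sub_smul, op_smul, op_one, smul_assoc, one_smul, sub_add_cancel]
  rw [h1, map_add, map_add, hζ _ _ (hε a), hζ' _ _ (hε a), map_smul, map_smul, h]

theorem aug_comp_smul (f : Module.End Aᵐᵒᵖ P) (x : P) {a : A} (ha : a ∈ augIdeal 𝒜) :
    (F.aug ∘ₗ f.restrictScalars k) (op a • x) = 0 := by
  simp only [LinearMap.comp_apply, LinearMap.restrictScalars_apply, map_smul]
  exact F.aug_smul _ _ ha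

variable {F} in
theorem aug_comp_ext (hconn : IsConnectedGraded 𝒜) {ζ : P →ₗ[k] k} {f : Module.End Aᵐᵒᵖ P}
    (hζ : ∀ x, ∀ a ∈ augIdeal 𝒜, ζ (op a • x) = 0)
    (h : ∀ s, F.aug (f (F.basis s)) = ζ (F.basis s)) (x : P) : F.aug (f x) = ζ x :=
  LinearMap.congr_fun (aug_ext (F := F) hconn (ζ := F.aug ∘ₗ f.restrictScalars k)
    (fun x _ ha => F.aug_comp_smul f x ha) hζ h) x

theorem exists_unit : ∃ u ∈ F.deg 0, F.aug u = 1 := by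
  obtain ⟨x, hx⟩ := F.aug_surjective 1
  refine ⟨gproj F.isInternal 0 x, gproj_mem _ _ _, ?_⟩
  have : F.aug ∘ₗ gproj F.isInternal 0 = F.aug := by
    refine linearMap_ext_of_homogeneous F.isInternal.submodule_iSup_eq_top fun j x hx => ?_
    rw [LinearMap.comp_apply]
    by_cases hj : j = 0
    · subst hj; rw [gproj_of_mem _ hx]
    · rw [gproj_of_mem_ne _ hx hj, map_zero, F.aug_deg j hj x hx]
  rw [← hx]
  exact LinearMap.congr_fun this x

/-- A graded section of the differential. -/
theorem exists_section : ∃ κ : P →ₗ[k] P, (∀ x ∈ LinearMap.range F.d, F.d (κ x) = x) ∧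
    (∀ j, ∀ x ∈ F.deg j, κ x ∈ F.deg (j.1 - 1, j.2)) ∧ ∀ x, F.aug (κ x) = 0 := by
  let δ : P →ₗ[k] P := F.d.restrictScalars k
  obtain ⟨s, hs⟩ := δ.rangeRestrict.exists_rightInverse_of_surjective δ.range_rangeRestrict
  obtain ⟨s', hs'⟩ := LinearMap.exists_extend (K := k) (V' := P) s
  have hds : ∀ x, F.d (s' (F.d x)) = F.d x := by
    intro x
    have h1 : s' (F.d x) = s ⟨F.d x, x, rfl⟩ := LinearMap.congr_fun hs' ⟨F.d x, x, rfl⟩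
    rw [h1]
    exact congrArg Subtype.val (LinearMap.congr_fun hs ⟨F.d x, x, rfl⟩)
  let κ : P →ₗ[k] P := gradedLift F.isInternal fun j =>
    gproj F.isInternal (j.1 - 1, j.2) ∘ₗ s' ∘ₗ (F.deg j).subtype
  have hκ : ∀ j, ∀ x ∈ F.deg j, κ x = gproj F.isInternal (j.1 - 1, j.2) (s' x) := fun j x hx =>
    gradedLift_of_mem F.isInternal _ hx
  have hdp : ∀ j x, F.d (gproj F.isInternal (j.1 - 1, j.2) x) = gproj F.isInternal j (F.d x) := by
    intro j x
    refine isInternal_induction F.isInternal (C := fun x =>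
      F.d (gproj F.isInternal (j.1 - 1, j.2) x) = gproj F.isInternal j (F.d x)) (by simp) ?_ ?_ x
    · intro x y hx hy; simp [hx, hy]
    · intro i x hx
      have hm := F.d_mem i x hx
      by_cases hi : i = (j.1 - 1, j.2)
      · subst hi
        simp only [sub_add_cancel] at hm
        rw [gproj_of_mem _ hx, gproj_of_mem _ hm]
      · rw [gproj_of_mem_ne _ hx hi, gproj_of_mem_ne _ hm, map_zero]
        rintro rfl
        simp at hi
  refine ⟨κ, ?_, ?_, ?_⟩
  · rintro _ ⟨x, rfl⟩
    refine isInternal_induction F.isInternal (C := fun x => F.d (κ (F.d x)) = F.d x) (by simp)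
      ?_ ?_ x
    · intro x y hx hy; simp [hx, hy]
    · intro i x hx
      have hm := F.d_mem i x hx
      rw [hκ _ _ hm, hdp, hds, gproj_of_mem _ hm]
  · intro j x hx
    rw [hκ j x hx]; exact gproj_mem _ _ _
  · intro x
    refine isInternal_induction F.isInternal (C := fun x => F.aug (κ x) = 0) (by simp) ?_ ?_ x
    · intro x y hx hy; simp [hx, hy]
    · intro j x hx
      by_cases hj : 0 < j.1
      · rw [F.eq_zero_of_pos hj hx]; simp
      · refine F.aug_deg (j.1 - 1, j.2) ?_ _ (by rw [hκ j x hx]; exact gproj_mem _ _ _)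
        intro h
        have := congrArg Prod.fst h
        simp at this; omega

/-! ### Cocycles and coboundaries detected by the augmentation -/

section Homotopy

variable (hconn : IsConnectedGraded 𝒜)
include hconn

/-- Cocycles that vanish under the augmentation are coboundaries. -/
theorem exists_homotopy {j : ℤ × (ℤ × G)} {φ : Module.End Aᵐᵒᵖ P} (hφ : φ ∈ F.endDeg j)
    (hd : F.endDiff j.1 φ = 0) (haug : ∀ x, F.aug (φ x) = 0) :
    ∃ g ∈ F.endDeg (j.1 - 1, j.2), F.endDiff (j.1 - 1) g = φ ∧ ∀ x, F.aug (g x) = 0 := by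
  obtain ⟨κ, hκ, hκd, hκa⟩ := F.exists_section
  set ε : k := sgn k j.1 with hε
  have hdφ : ∀ x, F.d (φ x) = ε • φ (F.d x) := by
    intro x
    have := congrArg (fun f : Module.End Aᵐᵒᵖ P => f x) hd
    simp only [endDiff_eq, LinearMap.zero_apply] at this
    exact sub_eq_zero.1 this
  -- The usual construction of a null-homotopy, one cohomological degree at a time: the `n`-th map
  -- is final in degrees above `-n`. In each basis element the equation `d g + ε g d = φ` is solved
  -- with the section `κ`.
  let g : ℕ → Module.End Aᵐᵒᵖ P := fun n => Nat.rec 0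
    (fun _ g => F.lift fun s => κ (φ (F.basis s) - ε • g (F.d (F.basis s)))) n
  have hg0 : g 0 = 0 := rfl
  have hgs : ∀ n s, g (n + 1) (F.basis s) = κ (φ (F.basis s) - ε • g n (F.d (F.basis s))) :=
    fun n s => F.lift_basis _ s
  have hgd : ∀ n, g n ∈ F.endDeg (j.1 - 1, j.2) := by
    intro n
    induction n with
    | zero => exact zero_mem _
    | succ n ih =>
      refine F.mem_endDeg_of_basis fun s => ?_
      rw [hgs]
      have h1 : φ (F.basis s) - ε • g n (F.d (F.basis s)) ∈ F.deg (j + F.basisDeg s) := by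
        refine sub_mem (hφ _ _ (F.basis_mem s)) (Submodule.smul_mem _ _ ?_)
        have := ih _ _ (F.d_mem _ _ (F.basis_mem s))
        convert this using 2
        ext <;> simp
      convert hκd _ _ h1 using 2
      ext <;> simp; ring
  have hstab : ∀ n : ℕ, ∀ i : ℤ × (ℤ × G), -(n : ℤ) < i.1 → ∀ x ∈ F.deg i,
      g (n + 1) x = g n x := by
    intro n
    induction n with
    | zero =>
      intro i hi x hx
      rw [F.eq_zero_of_pos (by simpa using hi) hx, map_zero, map_zero]
    | succ n ih =>
      rintro ⟨p, e⟩ hi x hx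
      refine F.restrictScalars_eq_of_basis (fun s hs => ?_) hx
      rw [hgs (n + 1), hgs n, ih _ _ _ (F.d_mem _ _ (F.basis_mem s))]
      push_cast at hi
      simp only [hs] at hi ⊢; omega
  have hstab' : ∀ m n : ℕ, n ≤ m → ∀ i : ℤ × (ℤ × G), -(n : ℤ) < i.1 → ∀ x ∈ F.deg i,
      g m x = g n x := by
    intro m n hmn
    induction m, hmn using Nat.le_induction with
    | base => intros; rfl
    | succ m hm ih =>
      intro i hi x hx
      rw [hstab m i (by have : (n : ℤ) ≤ m := by exact_mod_cast hm
                        omega) x hx, ih i hi x hx]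
  let h : Module.End Aᵐᵒᵖ P := F.lift fun s =>
    g ((-(F.basisDeg s).1).toNat + 1) (F.basis s)
  have hh : ∀ n : ℕ, ∀ i : ℤ × (ℤ × G), -(n : ℤ) < i.1 → ∀ x ∈ F.deg i, h x = g n x := by
    rintro n ⟨p, e⟩ hi x hx
    refine F.restrictScalars_eq_of_basis (fun s hs => ?_) hx
    rw [F.lift_basis]
    simp only at hi
    rcases le_total ((-(F.basisDeg s).1).toNat + 1) n with hn | hn
    · exact (hstab' _ _ hn _ (by push_cast; omega) _ (F.basis_mem s)).symm
    · exact hstab' _ _ hn _ (by omega) _ (F.basis_mem s)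
  have hhs : ∀ s, h (F.basis s) = κ (φ (F.basis s) - ε • h (F.d (F.basis s))) := by
    intro s
    set n := (-(F.basisDeg s).1).toNat + 1
    rw [hh (n + 1) _ (by push_cast; omega) _ (F.basis_mem s), hgs n s,
      hh n _ (by simp only; omega) _ (F.d_mem _ _ (F.basis_mem s))]
  have hha : ∀ x, F.aug (h x) = 0 := fun x =>
    aug_comp_ext (F := F) hconn (ζ := 0) (fun _ _ _ => rfl)
      (fun s => by rw [hhs, hκa]; rfl) x
  have hhd : ∀ n : ℕ, ∀ i : ℤ × (ℤ × G), -(n : ℤ) < i.1 → ∀ x ∈ F.deg i,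
      F.d (h x) + ε • h (F.d x) = φ x := by
    intro n
    induction n with
    | zero =>
      intro i hi x hx
      rw [F.eq_zero_of_pos (by simpa using hi) hx]; simp
    | succ n ih =>
      rintro ⟨p, e⟩ hi x hx
      have key : ∀ s, (F.basisDeg s).1 = p →
          (F.d * h + ε • (h * F.d)) (F.basis s) = φ (F.basis s) := by
        intro s hs
        have h1 := ih _ (by push_cast at hi; simp only [hs] at hi ⊢; omega) _
          (F.d_mem _ _ (F.basis_mem s))
        rw [F.d_d, map_zero, smul_zero, add_zero] at h1
        -- The right side is a cycle by the previous degree and has zero augmentation, so exactness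
        -- makes it a boundary.
        have h2 : φ (F.basis s) - ε • h (F.d (F.basis s)) ∈ LinearMap.range F.d := by
          rw [← F.exact]
          constructor
          · rw [map_sub, map_smul_k F.d, h1, hdφ, sub_self]
          · rw [map_sub, map_smul, haug, hha, smul_zero, sub_zero]
        show F.d (h (F.basis s)) + ε • h (F.d (F.basis s)) = _
        rw [hhs, hκ _ h2, sub_add_cancel]
      exact F.restrictScalars_eq_of_basis key hx
  refine ⟨h, F.mem_endDeg_of_basis fun s => ?_, ?_, hha⟩
  · rw [F.lift_basis]; exact hgd ((-(F.basisDeg s).1).toNat + 1) _ _ (F.basis_mem s)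
  · refine F.ext_of_homogeneous fun i x hx => ?_
    rw [endDiff_eq, sgn_pred, ← hε, neg_smul, sub_neg_eq_add]
    exact hhd ((-i.1).toNat + 1) i (by push_cast; omega) x hx

variable {F} in
-- Send each basis element to the prescribed multiple of `u`; freeness does the rest.
theorem exists_aug_lift {u : P} (hu : u ∈ F.deg 0) (hu1 : F.aug u = 1) {j : ℤ × (ℤ × G)}
    {ζ : P →ₗ[k] k} (hζ : ∀ x, ∀ a ∈ augIdeal 𝒜, ζ (op a • x) = 0)
    (hζd : ∀ i, j + i ≠ 0 → ∀ x ∈ F.deg i, ζ x = 0) :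
    ∃ h ∈ F.endDeg j, ∀ x, F.aug (h x) = ζ x := by
  refine ⟨F.lift fun s => ζ (F.basis s) • u, F.lift_mem fun s => ?_, fun x =>
    aug_comp_ext (F := F) hconn hζ (fun s => ?_) x⟩
  · by_cases hs : j + F.basisDeg s = 0
    · rw [hs]; exact Submodule.smul_mem _ _ hu
    · rw [hζd _ hs _ (F.basis_mem s), zero_smul]; exact zero_mem _
  · rw [lift_basis, map_smul, hu1, smul_eq_mul, mul_one]

/-- Functionals on the complex that vanish on boundaries lift to cocycles. -/
theorem exists_cocycle {j : ℤ × (ℤ × G)}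
    {ζ : P →ₗ[k] k} (hζ : ∀ x, ∀ a ∈ augIdeal 𝒜, ζ (op a • x) = 0)
    (hζd : ∀ i, j + i ≠ 0 → ∀ x ∈ F.deg i, ζ x = 0) (hζ0 : ∀ x, ζ (F.d x) = 0) :
    ∃ z ∈ F.endDG.cocycles j, ∀ x, F.aug (z x) = ζ x := by
  obtain ⟨u, hu, hu1⟩ := F.exists_unit
  obtain ⟨z₀, hz₀, hz₀a⟩ := exists_aug_lift (F := F) hconn hu hu1 hζ hζd
  -- The differential of the naive lift `z₀` is a cocycle with zero augmentation, hence the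
  -- differential of some `g` that is itself invisible to the augmentation. Subtracting `g` gives a
  -- cocycle.
  obtain ⟨g, hg, hgd, hga⟩ := F.exists_homotopy hconn (j := (j.1 + 1, j.2))
    (F.endDG.diff_mem j z₀ hz₀) (F.endDG.diff_diff j z₀ hz₀) (fun x => by
      show F.aug (F.endDiff j.1 z₀ x) = 0
      rw [endDiff_eq, map_sub, map_smul, F.aug_d, hz₀a, hζ0, smul_zero, sub_zero])
  simp only [add_sub_cancel_right] at hg hgd
  refine ⟨z₀ - g, ⟨sub_mem hz₀ hg, ?_⟩, fun x => ?_⟩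
  · show F.endDiff j.1 (z₀ - g) = 0
    rw [map_sub, hgd]; exact sub_self _
  · rw [LinearMap.sub_apply, map_sub, hga, hz₀a, sub_zero]

/-- Cocycles whose augmentation factors through the differential are coboundaries. -/
theorem mem_coboundaries {j : ℤ × (ℤ × G)} {z : Module.End Aᵐᵒᵖ P} (hz : z ∈ F.endDG.cocycles j)
    {ζ : P →ₗ[k] k} (hζ : ∀ x, ∀ a ∈ augIdeal 𝒜, ζ (op a • x) = 0)
    (hζd : ∀ i : ℤ × (ℤ × G), (j.1 - 1, j.2) + i ≠ 0 → ∀ x ∈ F.deg i, ζ x = 0)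
    (h : ∀ x, F.aug (z x) = ζ (F.d x)) : z ∈ F.endDG.coboundaries j := by
  obtain ⟨u, hu, hu1⟩ := F.exists_unit
  obtain ⟨g, hg, hga⟩ := exists_aug_lift (F := F) hconn hu hu1 hζ hζd
  have hgc : F.endDiff (j.1 - 1) g ∈ F.endDG.coboundaries j := ⟨g, hg, rfl⟩
  -- Under the augmentation the coboundary of `g` becomes `(-1)^j.1 ζ ∘ d`, whence the scalar by
  -- which it is subtracted from `z`.
  have hgz := F.endDG.coboundaries_le_cocycles j hgc
  have hzz := sub_mem hz (Submodule.smul_mem _ (sgn k j.1) hgz)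
  obtain ⟨g', hg', hgd', -⟩ := F.exists_homotopy hconn hzz.1 hzz.2 (fun x => by
    rw [LinearMap.sub_apply, LinearMap.smul_apply, endDiff_eq, map_sub, map_smul, map_sub,
      map_smul, F.aug_d, hga, h, sgn_pred, zero_sub, neg_smul, neg_neg, smul_smul, sgn_mul_self,
      one_smul, sub_self])
  have h1 : z - sgn k j.1 • F.endDiff (j.1 - 1) g ∈ F.endDG.coboundaries j := ⟨g', hg', hgd'⟩
  have h2 := add_mem h1 (Submodule.smul_mem _ (sgn k j.1) hgc)
  rwa [sub_add_cancel] at h2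

end Homotopy

end GradedFreeResolution

end Resolution

end ExtAInf

open scoped DirectSum

namespace ExtAInf

set_option linter.unusedSectionVars false

open TensorProduct MulOpposite

/-! ### Generators and relations in a resolution -/

section Resolution

variable {k : Type*} [Field k] {G : Type*} [AddCommGroup G] [DecidableEq G]
  {A : Type*} [Ring A] [Algebra k A] {𝒜 : ℤ × G → Submodule k A} [GradedAlgebra 𝒜]
  {P : Type*} [AddCommGroup P] [Module k P] [Module Aᵐᵒᵖ P] [IsScalarTower k Aᵐᵒᵖ P]
  (F : GradedFreeResolution 𝒜 P)

theorem lam_mem_freeDeg {Q : Submodule k A} {d : ℤ × G} {t : TensorAlgebra k Q}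
    (ht : t ∈ tensorDeg 𝒜 Q d) : lam Q t ∈ freeDeg 𝒜 Q d := by
  induction ht using Submodule.span_induction with
  | mem x hx =>
    obtain ⟨n, q, e, he, rfl, rfl⟩ := hx
    cases n with
    | zero => rw [tprod_zero, lam_one]; exact zero_mem _
    | succ n =>
      rw [tprod_succ, lam_ι_mul, Fin.sum_univ_succ]
      refine Submodule.subset_span ⟨_, _, _, _, he 0, mulMap_mem ?_, rfl, rfl⟩
      exact Submodule.subset_span ⟨n, _, fun i => e i.succ, fun i => he i.succ, rfl, rfl⟩
  | zero => simp
  | add x y _ _ hx hy => rw [map_add]; exact add_mem hx hy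
  | smul r x _ hx => rw [map_smul]; exact Submodule.smul_mem _ _ hx

namespace GradedFreeResolution

variable {F} in
theorem gproj_mem_rad {x : P} (hx : x ∈ radSub 𝒜 (Set.univ : Set P)) (j : ℤ × (ℤ × G)) :
    gproj F.isInternal j x ∈ radSub 𝒜 (Set.univ : Set P) := by
  have : radSub 𝒜 (Set.univ : Set P) ≤
      (radSub 𝒜 (Set.univ : Set P)).comap (gproj F.isInternal j) := by
    refine radSub_le fun a ha x _ => ?_
    rw [Submodule.mem_comap]
    refine augIdeal_induction
      (C := fun a => gproj F.isInternal j (op a • x) ∈ radSub 𝒜 (Set.univ : Set P)) (by simp) ?_ ?_ ha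
    · intro a b ha hb; rw [op_add, add_smul, map_add]; exact add_mem ha hb
    · intro d hd a ha
      have h1 := F.gproj_smul ha (j - (0, d)) x
      rw [sub_add_cancel] at h1
      rw [h1]
      exact op_smul_mem_radSub (mem_augIdeal hd ha) trivial
  exact this hx

theorem aug_of_fst_ne {j : ℤ × (ℤ × G)} (hj : j.1 ≠ 0) {x : P} (hx : x ∈ F.deg j) :
    F.aug x = 0 := F.aug_deg j (by rintro rfl; exact hj rfl) x hx

theorem mem_range_d {x : P} (h1 : F.d x = 0) (h2 : F.aug x = 0) : ∃ w, F.d w = x :=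
  (F.exact x).1 ⟨h1, h2⟩

variable {F} in
theorem zeta_eq_zero_of_rad {ζ : P →ₗ[k] k} (hζ : ∀ x, ∀ a ∈ augIdeal 𝒜, ζ (op a • x) = 0) {x : P}
    (hx : x ∈ radSub 𝒜 (Set.univ : Set P)) : ζ x = 0 := by
  have : radSub 𝒜 (Set.univ : Set P) ≤ LinearMap.ker ζ := radSub_le fun a ha x _ => hζ x a ha
  exact this hx

/-- The projection onto the term of cohomological degree `p`. -/
noncomputable def termProj (p : ℤ) : Module.End Aᵐᵒᵖ P :=
  F.lift fun s => if (F.basisDeg s).1 = p then F.basis s else 0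

theorem termProj_of_mem {p : ℤ} {e : ℤ × G} {x : P} (hx : x ∈ F.deg (p, e)) :
    F.termProj p x = x :=
  F.restrictScalars_eq_of_basis (g := LinearMap.id) (fun s hs => by
    rw [termProj, lift_basis, if_pos hs]; rfl) hx

theorem termProj_of_ne {p p' : ℤ} (h : p' ≠ p) {e : ℤ × G} {x : P} (hx : x ∈ F.deg (p', e)) :
    F.termProj p x = 0 :=
  F.restrictScalars_eq_of_basis (g := 0) (fun s hs => by
    rw [termProj, lift_basis, if_neg (by rw [hs]; exact h)]; rfl) hx

section Extension

variable (hconn : IsConnectedGraded 𝒜) {X : Type*} [AddCommGroup X] [Module k X]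
  {𝒳 : ℤ × G → Submodule k X} (h𝒳 : DirectSum.IsInternal 𝒳)
  (hneg : ∀ d : ℤ × G, d.1 < 0 → ∀ x ∈ 𝒳 d, x = 0)

include hconn h𝒳 hneg in
/-- A graded map into a resolution that is injective modulo `P 𝔪` is, up to an automorphism, the
inclusion of a part of a basis: linear maps extend along it. -/
theorem exists_extension {p : ℤ} {i : X →ₗ[k] P} (hi : ∀ d, ∀ x ∈ 𝒳 d, i x ∈ F.deg (p, d))
    (hinj : ∀ x, i x ∈ radSub 𝒜 (Set.univ : Set P) → x = 0) {j : ℤ × (ℤ × G)} {t : X →ₗ[k] P}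
    (ht : ∀ d, ∀ x ∈ 𝒳 d, t x ∈ F.deg (j + (p, d))) :
    ∃ h ∈ F.endDeg j, (∀ x, h (i x) = t x) ∧ ∀ p', p' ≠ p → ∀ e, ∀ x ∈ F.deg (p', e), h x = 0 := by
  -- Over a field the injection `X → P / P 𝔪` has a linear retraction; `l₁` below is its
  -- degree-preserving version.
  obtain ⟨l, hl⟩ := LinearMap.exists_leftInverse_of_injective
    ((radSub 𝒜 (Set.univ : Set P)).mkQ ∘ₗ i) (by
      rw [LinearMap.ker_eq_bot']
      intro x hx
      rw [LinearMap.comp_apply, Submodule.mkQ_apply, Submodule.Quotient.mk_eq_zero] at hx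
      exact hinj x hx)
  let l₀ : P →ₗ[k] X := l ∘ₗ (radSub 𝒜 (Set.univ : Set P)).mkQ
  have hl₀i : ∀ x, l₀ (i x) = x := fun x => LinearMap.congr_fun hl x
  have hl₀r : ∀ x ∈ radSub 𝒜 (Set.univ : Set P), l₀ x = 0 := by
    intro x hx
    simp only [l₀, LinearMap.comp_apply, Submodule.mkQ_apply,
      (Submodule.Quotient.mk_eq_zero _).2 hx, map_zero]
  let l₁ : P →ₗ[k] X := gradedLift F.isInternal fun i =>
    if i.1 = p then gproj h𝒳 i.2 ∘ₗ l₀ ∘ₗ (F.deg i).subtype else 0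
  have hl₁ : ∀ d, ∀ x ∈ F.deg (p, d), l₁ x = gproj h𝒳 d (l₀ x) := by
    intro d x hx
    simp only [l₁]
    rw [gradedLift_of_mem _ _ hx, if_pos rfl]; rfl
  have hl₁' : ∀ i : ℤ × (ℤ × G), i.1 ≠ p → ∀ x ∈ F.deg i, l₁ x = 0 := by
    intro i hi x hx
    simp only [l₁]
    rw [gradedLift_of_mem _ _ hx, if_neg hi]; rfl
  have hl₁m : ∀ i : ℤ × (ℤ × G), ∀ x ∈ F.deg i, l₁ x ∈ 𝒳 i.2 := by
    rintro ⟨p', d⟩ x hx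
    by_cases hp : p' = p
    · subst hp; rw [hl₁ d x hx]; exact gproj_mem _ _ _
    · rw [hl₁' _ hp x hx]; exact zero_mem _
  have hl₁i : ∀ x, l₁ (i x) = x := by
    refine isInternal_induction h𝒳 (by simp) ?_ ?_
    · intro x y hx hy; rw [map_add, map_add, hx, hy]
    · intro d x hx; rw [hl₁ d _ (hi d x hx), hl₀i, gproj_of_mem _ hx]
  have hl₁a : ∀ d : ℤ × G, 0 < d.1 → ∀ a ∈ 𝒜 d, ∀ i, ∀ x ∈ F.deg i, l₁ (op a • x) = 0 := by
    rintro d hd a ha ⟨p', e⟩ x hx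
    have hm := F.smul_mem _ d x a hx ha
    by_cases hp : p' = p
    · subst hp
      simp only [Prod.mk_add_mk, add_zero] at hm
      rw [hl₁ _ _ hm, hl₀r _ (op_smul_mem_radSub (mem_augIdeal hd ha) trivial), map_zero]
    · exact hl₁' _ (by simpa using hp) _ hm
  -- The `A`-linear candidate for a retraction of `A ⊗ X → P`. On `i x` it is `1 ⊗ x` up to an error
  -- `n x`.
  let ρ : P →ₗ[Aᵐᵒᵖ] Aᵐᵒᵖ ⊗[k] X := F.basis.constr ℕ fun s => 1 ⊗ₜ l₁ (F.basis s)
  have hρ : ∀ s, ρ (F.basis s) = 1 ⊗ₜ l₁ (F.basis s) := fun s => F.basis.constr_basis ℕ _ s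
  -- Tensors whose `X`-components have degree below `m`. The error of `x` lies in `L` of its own
  -- degree because coefficients from `𝔪` have positive degree.
  let L : ℤ → Submodule k (Aᵐᵒᵖ ⊗[k] X) := fun m => Submodule.span k
    {w | ∃ (f : ℤ × G) (b : Aᵐᵒᵖ) (x : X), f.1 < m ∧ x ∈ 𝒳 f ∧ w = b ⊗ₜ x}
  let n : X →ₗ[k] Aᵐᵒᵖ ⊗[k] X := ρ.restrictScalars k ∘ₗ i - TensorProduct.mk k Aᵐᵒᵖ X 1
  have hρn : ∀ x, ρ (i x) = 1 ⊗ₜ x + n x := by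
    intro x
    simp only [n, LinearMap.sub_apply, LinearMap.comp_apply, LinearMap.restrictScalars_apply,
      TensorProduct.mk_apply]
    abel
  have hρL : ∀ d x, x ∈ F.deg (p, d) → ρ x - 1 ⊗ₜ l₁ x ∈ L d.1 := by
    intro d x hx
    have : (L d.1).mkQ ∘ₗ (ρ.restrictScalars k - TensorProduct.mk k Aᵐᵒᵖ X 1 ∘ₗ l₁) ∘ₗ
        gproj F.isInternal (p, d) = 0 := by
      refine F.hom_ext fun s e a ha => ?_
      have hm := F.smul_mem _ e _ a (F.basis_mem s) ha
      simp only [LinearMap.comp_apply, LinearMap.zero_apply]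
      by_cases hi : F.basisDeg s + (0, e) = (p, d)
      · rw [← hi, gproj_of_mem _ hm, Submodule.mkQ_apply, Submodule.Quotient.mk_eq_zero]
        simp only [LinearMap.sub_apply, LinearMap.restrictScalars_apply, LinearMap.comp_apply,
          TensorProduct.mk_apply, map_smul, hρ]
        by_cases he : 0 < e.1
        · rw [hl₁a e he a ha _ _ (F.basis_mem s), TensorProduct.tmul_zero, sub_zero]
          refine Submodule.subset_span ⟨(F.basisDeg s).2, op a, l₁ (F.basis s), ?_,
            hl₁m _ _ (F.basis_mem s), by simp [TensorProduct.smul_tmul']⟩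
          have h2 := congrArg (fun z : ℤ × (ℤ × G) => z.2.1) hi
          simp only [Prod.snd_add, Prod.fst_add] at h2
          omega
        · obtain ⟨c, rfl⟩ : ∃ c : k, a = c • 1 := by
            rcases (not_lt.1 he).lt_or_eq with he | he
            · exact ⟨0, by rw [hconn.eq_zero_of_neg he ha, zero_smul]⟩
            · by_cases he0 : e = 0
              · subst he0; exact hconn.exists_smul_one ha
              · exact ⟨0, by rw [hconn.eq_zero_of_fst_eq_zero he he0 ha, zero_smul]⟩
          rw [op_smul, op_one, smul_assoc, smul_assoc, one_smul, one_smul, map_smul,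
            TensorProduct.tmul_smul, sub_self]
          exact zero_mem _
      · rw [gproj_of_mem_ne _ hm hi]; simp
    have h2 := LinearMap.congr_fun this x
    simp only [LinearMap.comp_apply, gproj_of_mem _ hx, Submodule.mkQ_apply, LinearMap.zero_apply,
      Submodule.Quotient.mk_eq_zero] at h2
    exact h2
  have hn : ∀ d, ∀ x ∈ 𝒳 d, n x ∈ L d.1 := by
    intro d x hx
    have := hρL d _ (hi d x hx)
    rw [hl₁i] at this
    exact this
  -- The equation `τ(1 ⊗ x) + τ(n x) = t x` is solved by recursion on the degree of `x`, which is
  -- bounded below; in effect this inverts the unipotent map `1 + n`.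
  let τ : ℕ → Aᵐᵒᵖ ⊗[k] X →ₗ[Aᵐᵒᵖ] P := fun m => Nat.rec 0
    (fun _ τ => freeLift (t - τ.restrictScalars k ∘ₗ n)) m
  have hτs : ∀ m x, τ (m + 1) (1 ⊗ₜ x) = t x - τ m (n x) := by
    intro m x
    have : τ (m + 1) (1 ⊗ₜ x) = (1 : Aᵐᵒᵖ) • (t x - τ m (n x)) := rfl
    rw [this, one_smul]
  have hL : ∀ (f g : Aᵐᵒᵖ ⊗[k] X →ₗ[Aᵐᵒᵖ] P) (m : ℤ),
      (∀ d : ℤ × G, d.1 < m → ∀ x ∈ 𝒳 d, f (1 ⊗ₜ x) = g (1 ⊗ₜ x)) → ∀ w ∈ L m, f w = g w := by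
    intro f g m hfg w hw
    have : L m ≤ LinearMap.eqLocus (f.restrictScalars k) (g.restrictScalars k) := by
      refine Submodule.span_le.2 ?_
      rintro _ ⟨d, b, x, hd, hx, rfl⟩
      have hb : b ⊗ₜ[k] x = b • (1 ⊗ₜ[k] x : Aᵐᵒᵖ ⊗[k] X) := by simp [TensorProduct.smul_tmul']
      show f _ = g _
      rw [hb, map_smul, map_smul, hfg d hd x hx]
    exact this hw
  have hstab : ∀ m : ℕ, ∀ d : ℤ × G, d.1 < m → ∀ x ∈ 𝒳 d, τ (m + 1) (1 ⊗ₜ x) = τ m (1 ⊗ₜ x) := by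
    intro m
    induction m with
    | zero =>
      intro d hd x hx
      rw [hneg d (by simpa using hd) x hx, TensorProduct.tmul_zero, map_zero, map_zero]
    | succ m ih =>
      intro d hd x hx
      rw [hτs (m + 1) x, hτs m x]
      congr 1
      refine hL _ _ d.1 (fun e he y hy => ih e ?_ y hy) _ (hn d x hx)
      push_cast at hd; omega
  have hstab' : ∀ m' m : ℕ, m ≤ m' → ∀ d : ℤ × G, d.1 < m → ∀ x ∈ 𝒳 d,
      τ m' (1 ⊗ₜ x) = τ m (1 ⊗ₜ x) := by
    intro m' m hm
    induction m', hm using Nat.le_induction with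
    | base => intros; rfl
    | succ m' hm ih =>
      intro d hd x hx
      have h1 : (m : ℤ) ≤ m' := by exact_mod_cast hm
      rw [hstab m' d (by omega) x hx, ih d hd x hx]
  let τ' : Aᵐᵒᵖ ⊗[k] X →ₗ[Aᵐᵒᵖ] P := freeLift (gradedLift h𝒳 fun d =>
    (τ (d.1.toNat + 1)).restrictScalars k ∘ₗ TensorProduct.mk k Aᵐᵒᵖ X 1 ∘ₗ (𝒳 d).subtype)
  have hτ' : ∀ m : ℕ, ∀ d : ℤ × G, d.1 < m → ∀ x ∈ 𝒳 d, τ' (1 ⊗ₜ x) = τ m (1 ⊗ₜ x) := by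
    intro m d hd x hx
    have h1 : τ' (1 ⊗ₜ x) = τ (d.1.toNat + 1) (1 ⊗ₜ x) := by
      simp only [τ']
      rw [freeLift_tmul, one_smul, gradedLift_of_mem _ _ hx]; rfl
    rw [h1]
    rcases le_total (d.1.toNat + 1) m with hm | hm
    · exact (hstab' _ _ hm d (by push_cast; omega) x hx).symm
    · exact hstab' _ _ hm d hd x hx
  have hτi : ∀ x, τ' (ρ (i x)) = t x := by
    refine isInternal_induction h𝒳 (by simp) ?_ ?_
    · intro x y hx hy; simp only [map_add, hx, hy]
    · intro d x hx
      have h1 := hτ' (d.1.toNat + 1 + 1) d (by push_cast; omega) x hx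
      have h2 : τ' (n x) = τ (d.1.toNat + 1) (n x) :=
        hL _ _ d.1 (fun e he y hy => hτ' (d.1.toNat + 1) e (by push_cast; omega) y hy) _ (hn d x hx)
      rw [hρn, map_add, h1, h2, hτs (d.1.toNat + 1) x, sub_add_cancel]
  -- Taking the component of degree `j` and projecting first to the term `p` makes the extension
  -- homogeneous and zero on the other terms.
  refine ⟨F.comp j (τ' ∘ₗ ρ ∘ₗ F.termProj p), F.comp_mem _ _, ?_, ?_⟩
  · refine isInternal_induction h𝒳 (by simp) ?_ ?_
    · intro x y hx hy; simp only [map_add, hx, hy]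
    · intro d x hx
      rw [F.comp_apply _ _ (hi d x hx), LinearMap.comp_apply, LinearMap.comp_apply,
        F.termProj_of_mem (hi d x hx), hτi, gproj_of_mem _ (ht d x hx)]
  · intro p' hp e x hx
    rw [F.comp_apply _ _ hx, LinearMap.comp_apply, LinearMap.comp_apply, F.termProj_of_ne hp hx,
      map_zero, map_zero, map_zero]

end Extension

end GradedFreeResolution

end Resolution

end ExtAInf

open scoped DirectSum

namespace ExtAInf

set_option linter.unusedSectionVars false

open TensorProduct MulOpposite

/-! ### The elements `u`, `y` and `v` of a resolution and comparison maps to the free module on `Q`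
-/

section Resolution

variable {k : Type*} [Field k] {G : Type*} [AddCommGroup G] [DecidableEq G]
  {A : Type*} [Ring A] [Algebra k A] {𝒜 : ℤ × G → Submodule k A} [GradedAlgebra 𝒜]
  {P : Type*} [AddCommGroup P] [Module k P] [Module Aᵐᵒᵖ P] [IsScalarTower k Aᵐᵒᵖ P]
  (F : GradedFreeResolution 𝒜 P)

namespace GradedFreeResolution

/-- An element over `1 ∈ k` and a graded section of the differential. -/
structure SectionData where
  u : P
  u_mem : u ∈ F.deg 0
  aug_u : F.aug u = 1
  κ : P →ₗ[k] P
  d_κ : ∀ x ∈ LinearMap.range F.d, F.d (κ x) = x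
  κ_mem : ∀ j, ∀ x ∈ F.deg j, κ x ∈ F.deg (j.1 - 1, j.2)
  aug_κ : ∀ x, F.aug (κ x) = 0

theorem nonempty_sectionData : Nonempty F.SectionData := by
  obtain ⟨u, h1, h2⟩ := F.exists_unit
  obtain ⟨κ, h3, h4, h5⟩ := F.exists_section
  exact ⟨⟨u, h1, h2, κ, h3, h4, h5⟩⟩

namespace SectionData

variable {F} (C : F.SectionData) (D : Presentation 𝒜)

theorem d_u : F.d C.u = 0 := F.eq_zero_of_pos (by simp) (F.d_mem 0 _ C.u_mem)

theorem d_κ' {x : P} (h1 : F.d x = 0) (h2 : F.aug x = 0) : F.d (C.κ x) = x :=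
  C.d_κ x ((F.exact x).1 ⟨h1, h2⟩)

/-- The elements `y` of `P^{-1}` with `d y = u q`. -/
noncomputable def y : D.Q →ₗ[k] P where
  toFun q := C.κ (op (q : A) • C.u)
  map_add' p q := by simp [add_smul]
  map_smul' c q := by simp

theorem d_y (q : D.Q) : F.d (C.y D q) = op (q : A) • C.u :=
  C.d_κ' (by rw [map_smul, C.d_u, smul_zero]) (F.aug_smul _ _ (D.Q_le q.2))

theorem y_mem {d : ℤ × G} {q : D.Q} (hq : (q : A) ∈ 𝒜 d) : C.y D q ∈ F.deg (-1, d) := by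
  have := C.κ_mem _ _ (F.smul_mem 0 d C.u q C.u_mem hq)
  show C.κ _ ∈ _
  simpa using this

/-- The `A`-linear extension of `y`. -/
noncomputable def yA : Aᵐᵒᵖ ⊗[k] D.Q →ₗ[Aᵐᵒᵖ] P := freeLift (C.y D)

theorem yA_tmul (a : A) (q : D.Q) : C.yA D (op a ⊗ₜ q) = op a • C.y D q := rfl

theorem yA_one_tmul (q : D.Q) : C.yA D (1 ⊗ₜ q) = C.y D q := by
  rw [← op_one, yA_tmul, op_one, one_smul]

theorem d_yA (x : Aᵐᵒᵖ ⊗[k] D.Q) : F.d (C.yA D x) = op (muQ D.Q x) • C.u := by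
  induction x using TensorProduct.induction_on with
  | zero => simp
  | tmul b q =>
    obtain ⟨a, rfl⟩ := op_surjective b
    rw [yA_tmul, map_smul, d_y, muQ_tmul, smul_smul, op_mul]
  | add x y hx hy => rw [map_add, map_add, map_add, hx, hy, op_add, add_smul]

theorem yA_mem {d : ℤ × G} {x : Aᵐᵒᵖ ⊗[k] D.Q} (hx : x ∈ freeDeg 𝒜 D.Q d) :
    C.yA D x ∈ F.deg (-1, d) := by
  induction hx using Submodule.span_induction with
  | mem x hx =>
    obtain ⟨f, e, q, a, hq, ha, rfl, rfl⟩ := hx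
    simpa [yA_tmul] using F.smul_mem _ e _ a (C.y_mem D hq) ha
  | zero => simp
  | add x y _ _ hx hy => rw [map_add]; exact add_mem hx hy
  | smul r x _ hx =>
    have : C.yA D (r • x) = r • C.yA D x := (C.yA D).map_smul_of_tower r x
    rw [this]; exact Submodule.smul_mem _ _ hx

theorem aug_yA (x : Aᵐᵒᵖ ⊗[k] D.Q) : F.aug (C.yA D x) = 0 := by
  have hQi := D.Q_graded.isInternal (gradedAlgebra_isInternal 𝒜)
  induction x using TensorProduct.induction_on with
  | zero => simp
  | tmul b q =>
    obtain ⟨a, rfl⟩ := op_surjective b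
    rw [yA_tmul]
    refine isInternal_induction hQi (C := fun q => F.aug (op a • C.y D q) = 0) (by simp) ?_ ?_ q
    · intro x y hx hy; rw [map_add, smul_add, map_add, hx, hy, add_zero]
    · intro d q hq
      refine isInternal_induction (gradedAlgebra_isInternal 𝒜)
        (C := fun a => F.aug (op a • C.y D q) = 0) (by simp) ?_ ?_ a
      · intro a b ha hb; rw [op_add, add_smul, map_add, ha, hb, add_zero]
      · intro e a ha
        exact F.aug_of_fst_ne (by simp) (F.smul_mem _ e _ a (C.y_mem D hq) ha)
  | add x y hx hy => rw [map_add, map_add, hx, hy, add_zero]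

/-- The elements `v` of `P^{-2}` with `d v = ∑ yᵢ aᵢ` for a relation `∑ qᵢ ⊗ θ(aᵢ)`. -/
noncomputable def v : D.R →ₗ[k] P :=
  C.κ ∘ₗ (C.yA D).restrictScalars k ∘ₗ lam D.Q ∘ₗ D.R.subtype

theorem v_apply (r : D.R) : C.v D r = C.κ (C.yA D (lam D.Q r)) := rfl

theorem d_κ_yA {x : Aᵐᵒᵖ ⊗[k] D.Q} (hx : muQ D.Q x = 0) : F.d (C.κ (C.yA D x)) = C.yA D x :=
  C.d_κ' (by rw [d_yA, hx, op_zero, zero_smul]) (C.aug_yA D x)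

theorem d_v (r : D.R) : F.d (C.v D r) = C.yA D (lam D.Q r) := C.d_κ_yA D (D.muQ_lam_R r.2)

theorem v_mem {d : ℤ × G} {r : D.R} (hr : (r : TensorAlgebra k D.Q) ∈ tensorDeg 𝒜 D.Q d) :
    C.v D r ∈ F.deg (-2, d) :=
  C.κ_mem _ _ (C.yA_mem D (lam_mem_freeDeg hr))

/-- A lift of the augmentation to an `A`-linear map `P → A`. -/
noncomputable def ρ₀ (F : GradedFreeResolution 𝒜 P) : P →ₗ[Aᵐᵒᵖ] A :=
  F.basis.constr ℕ fun s => F.aug (F.basis s) • (1 : A)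

theorem ρ₀_basis (s : F.basisIndex) : ρ₀ F (F.basis s) = F.aug (F.basis s) • (1 : A) :=
  F.basis.constr_basis ℕ _ s

theorem ρ₀_mem {i : ℤ × (ℤ × G)} {x : P} (hx : x ∈ F.deg i) : ρ₀ F x ∈ 𝒜 i.2 := by
  have : gproj (gradedAlgebra_isInternal 𝒜) i.2 ∘ₗ (ρ₀ F).restrictScalars k ∘ₗ
      gproj F.isInternal i = (ρ₀ F).restrictScalars k ∘ₗ gproj F.isInternal i := by
    refine F.hom_ext fun s d a ha => ?_
    simp only [LinearMap.comp_apply, LinearMap.restrictScalars_apply]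
    have hm := F.smul_mem _ d _ a (F.basis_mem s) ha
    by_cases hi : F.basisDeg s + (0, d) = i
    · subst hi
      rw [gproj_of_mem _ hm, map_smul, ρ₀_basis]
      by_cases hs : F.basisDeg s = 0
      · refine gproj_of_mem _ ?_
        rw [hs, op_smul_eq_mul, smul_mul_assoc, one_mul, zero_add]
        exact Submodule.smul_mem _ _ ha
      · rw [F.aug_deg _ hs _ (F.basis_mem s)]; simp
    · rw [gproj_of_mem_ne _ hm hi]; simp
  have h2 := LinearMap.congr_fun this x
  simp only [LinearMap.comp_apply, LinearMap.restrictScalars_apply, gproj_of_mem _ hx] at h2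
  rw [← h2]
  exact gproj_mem _ _ _

variable (hconn : IsConnectedGraded 𝒜)
include hconn

/-- Modulo `𝔪` the lift `ρ₀` is the augmentation; on a multiple of a basis element both see only the
scalar part of the coefficient. -/
theorem sub_ρ₀_mem (x : P) : ρ₀ F x - F.aug x • 1 ∈ augIdeal 𝒜 := by
  have : (augIdeal 𝒜).mkQ ∘ₗ ((ρ₀ F).restrictScalars k - LinearMap.toSpanSingleton k A 1 ∘ₗ F.aug) =
      0 := by
    refine F.hom_ext fun s d a ha => ?_
    simp only [LinearMap.comp_apply, LinearMap.sub_apply, LinearMap.restrictScalars_apply,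
      LinearMap.toSpanSingleton_apply, LinearMap.zero_apply, Submodule.mkQ_apply,
      Submodule.Quotient.mk_eq_zero, map_smul, ρ₀_basis]
    obtain ⟨ε, -, -, hε⟩ := hconn.exists_augmentation
    have h1 : op a • F.basis s = op (a - ε a • 1) • F.basis s + ε a • F.basis s := by
      rw [op_sub, sub_smul, op_smul, op_one, smul_assoc, one_smul, sub_add_cancel]
    rw [h1, map_add, F.aug_smul _ _ (hε a), zero_add, map_smul, op_smul_eq_mul, smul_mul_assoc,
      one_mul, smul_eq_mul, mul_comm, mul_smul, ← smul_sub]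
    exact Submodule.smul_mem _ _ (hε a)
  have h2 := LinearMap.congr_fun this x
  simpa only [LinearMap.comp_apply, LinearMap.sub_apply, LinearMap.restrictScalars_apply,
      LinearMap.toSpanSingleton_apply, LinearMap.zero_apply, Submodule.mkQ_apply,
      Submodule.Quotient.mk_eq_zero] using h2

theorem ρ₀_d_mem (x : P) : ρ₀ F (F.d x) ∈ augIdeal 𝒜 := by
  simpa [F.aug_d] using sub_ρ₀_mem hconn (F := F) (F.d x)

theorem ρ₀_u : ρ₀ F C.u = 1 := by
  have h1 := ρ₀_mem C.u_mem
  obtain ⟨c, hc⟩ := hconn.exists_smul_one h1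
  have h2 := sub_ρ₀_mem hconn (F := F) C.u
  rw [C.aug_u, hc, ← sub_smul] at h2
  have h3 : (c - 1) • (1 : A) = 0 := eq_zero_of_mem_augIdeal (d := (0 : ℤ × G)) le_rfl
    (Submodule.smul_mem _ _ SetLike.GradedOne.one_mem) h2
  rw [sub_smul, one_smul, sub_eq_zero] at h3
  rw [hc, h3]

/-- Injectivity of `Q → P^{-1} / (P^{-1} 𝔪 + d P)`. -/
theorem eq_zero_of_y_mem {q : D.Q} {w : P}
    (h : C.y D q - F.d w ∈ radSub 𝒜 (Set.univ : Set P)) : q = 0 := by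
  -- `ρ₀ ∘ d` takes values in `𝔪`, hence maps `P 𝔪` into `𝔪²`; it kills boundaries and sends `y_q`
  -- to `q`, and `Q ∩ 𝔪² = 0`.
  have h1 : (radSub 𝒜 (Set.univ : Set P)) ≤
      (augIdeal 𝒜 * augIdeal 𝒜).comap ((ρ₀ F).restrictScalars k ∘ₗ F.d.restrictScalars k) :=
    radSub_le fun a ha x _ => by
      simp only [Submodule.mem_comap, LinearMap.comp_apply, LinearMap.restrictScalars_apply,
        map_smul, op_smul_eq_mul]
      exact Submodule.mul_mem_mul (ρ₀_d_mem hconn x) ha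
  have h2 := h1 h
  simp only [Submodule.mem_comap, LinearMap.comp_apply, LinearMap.restrictScalars_apply,
    map_sub, F.d_d, sub_zero, d_y, map_smul, C.ρ₀_u hconn, map_zero, op_smul_eq_mul, one_mul] at h2
  have h3 : (q : A) ∈ D.Q ⊓ augIdeal 𝒜 * augIdeal 𝒜 := ⟨q.2, h2⟩
  rw [D.Q_inf, Submodule.mem_bot] at h3
  exact Subtype.ext h3

omit hconn in
/-- A lift of `ρ₀ d` to the free module generated by `Q`. -/
noncomputable def ρ₁ (F : GradedFreeResolution 𝒜 P) (D : Presentation 𝒜) :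
    P →ₗ[Aᵐᵒᵖ] Aᵐᵒᵖ ⊗[k] D.Q :=
  F.basis.constr ℕ fun s => lam D.Q (D.θ (ρ₀ F (F.d (F.basis s))))

theorem muQ_ρ₁ (x : P) : muQ D.Q (ρ₁ F D x) = ρ₀ F (F.d x) := by
  have : muQ D.Q ∘ₗ ρ₁ F D = ρ₀ F ∘ₗ F.d := by
    refine F.basis.ext fun s => ?_
    have h1 : ρ₁ F D (F.basis s) = lam D.Q (D.θ (ρ₀ F (F.d (F.basis s)))) :=
      F.basis.constr_basis ℕ _ s
    rw [LinearMap.comp_apply, LinearMap.comp_apply, h1, D.muQ_lam_θ (ρ₀_d_mem hconn _)]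
  exact LinearMap.congr_fun this x

/-- Injectivity of `R → P^{-2} / (P^{-2} 𝔪 + d P)`. -/
theorem eq_zero_of_v_mem {r : D.R} {w : P}
    (h : C.v D r - F.d w ∈ radSub 𝒜 (Set.univ : Set P)) : r = 0 := by
  -- `ρ₁ ∘ d` takes values in the syzygies, so it maps `P 𝔪` into syzygies times `𝔪`.
  have h1 : (radSub 𝒜 (Set.univ : Set P)) ≤
      (radSub 𝒜 {x : Aᵐᵒᵖ ⊗[k] D.Q | muQ D.Q x = 0}).comap
        ((ρ₁ F D).restrictScalars k ∘ₗ F.d.restrictScalars k) :=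
    radSub_le fun a ha x _ => by
      simp only [Submodule.mem_comap, LinearMap.comp_apply, LinearMap.restrictScalars_apply,
        map_smul]
      refine op_smul_mem_radSub ha ?_
      show muQ D.Q _ = 0
      rw [muQ_ρ₁ D hconn, F.d_d, map_zero]
  have h2 := h1 h
  simp only [Submodule.mem_comap, LinearMap.comp_apply, LinearMap.restrictScalars_apply,
    map_sub, F.d_d, map_zero, sub_zero, d_v] at h2
  have h3 := D.lam_R_mem_radSub r.2
  -- The composite `ρ₁ ∘ yA` is the identity modulo syzygies. Since `lam r` has coefficients in `𝔪`,
  -- it is fixed modulo syzygies times `𝔪`, and `eq_zero_of_lam_mem` applies.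
  have h4 : radSub 𝒜 (Set.univ : Set (Aᵐᵒᵖ ⊗[k] D.Q)) ≤
      (radSub 𝒜 {x : Aᵐᵒᵖ ⊗[k] D.Q | muQ D.Q x = 0}).comap
        (((ρ₁ F D) ∘ₗ C.yA D).restrictScalars k - LinearMap.id) :=
    radSub_le fun a ha x _ => by
      simp only [Submodule.mem_comap, LinearMap.comp_apply, LinearMap.restrictScalars_apply,
        map_smul, LinearMap.sub_apply, LinearMap.id_apply]
      have h6 : muQ D.Q (ρ₁ F D (C.yA D x) - x) = 0 := by
        rw [map_sub, muQ_ρ₁ D hconn, d_yA, map_smul, C.ρ₀_u hconn, op_smul_eq_mul, one_mul,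
          sub_self]
      have h7 := op_smul_mem_radSub (W := {x : Aᵐᵒᵖ ⊗[k] D.Q | muQ D.Q x = 0}) ha h6
      rw [smul_sub] at h7
      exact h7
  have h5 := sub_mem h2 (h4 h3)
  simp only [LinearMap.comp_apply, LinearMap.restrictScalars_apply,
    LinearMap.sub_apply, LinearMap.id_apply, sub_sub_cancel] at h5
  exact Subtype.ext (D.eq_zero_of_lam_mem r.2 h5)

/-- Lifts of `1 - u ρ₀` to `P`. -/
theorem exists_h₀ : ∃ h : P →ₗ[Aᵐᵒᵖ] P, (∀ e, ∀ x ∈ F.deg (0, e),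
    F.d (h x) = x - op (ρ₀ F x) • C.u) ∧ ∀ x, F.aug (h x) = 0 := by
  let U : P →ₗ[Aᵐᵒᵖ] P :=
    F.basis.constr ℕ fun s => F.aug (F.basis s) • C.u
  have hU : ∀ x, U x = op (ρ₀ F x) • C.u := by
    have : U.toAddMonoidHom = (LinearMap.toSpanSingleton Aᵐᵒᵖ P C.u).toAddMonoidHom.comp
        (AddMonoidHom.comp (opAddEquiv : A ≃+ Aᵐᵒᵖ).toAddMonoidHom (ρ₀ F).toAddMonoidHom) := by
      refine F.hom_ext' fun s d a _ => ?_
      have h1 : U (F.basis s) = F.aug (F.basis s) • C.u := F.basis.constr_basis ℕ _ s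
      show U _ = op (ρ₀ F _) • C.u
      rw [map_smul, map_smul, h1, ρ₀_basis, op_smul_eq_mul, op_mul, mul_smul, op_smul, op_one,
        smul_assoc, one_smul]
    intro x
    exact DFunLike.congr_fun this x
  refine ⟨F.lift fun s => C.κ (F.basis s - U (F.basis s)), fun e x hx => ?_, fun x =>
    aug_comp_ext (F := F) hconn (ζ := 0) (fun _ _ _ => rfl)
      (fun s => by rw [lift_basis, C.aug_κ]; rfl) x⟩
  refine F.restrictScalars_eq_of_basis (f := F.d ∘ₗ F.lift fun s => C.κ (F.basis s - U (F.basis s)))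
    (g := LinearMap.id - U) (fun s hs => ?_) hx |>.trans (by
      rw [LinearMap.sub_apply, hU]; rfl)
  have h1 : U (F.basis s) = F.aug (F.basis s) • C.u := F.basis.constr_basis ℕ _ s
  rw [LinearMap.comp_apply, lift_basis, C.d_κ']
  · rfl
  · have h2 : F.d (F.basis s) = 0 :=
      F.eq_zero_of_pos (by simp [hs]) (F.d_mem _ _ (F.basis_mem s))
    rw [map_sub, h2, h1, map_smul_k F.d, C.d_u, smul_zero, sub_zero]
  · rw [map_sub, h1, map_smul, C.aug_u, smul_eq_mul, mul_one, sub_self]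

/-- `P^{-1}` is spanned by `Q` modulo boundaries and `P 𝔪`, up to elements with nontrivial
differential. -/
theorem exists_h₁ : ∃ h₀ h₁ : P →ₗ[Aᵐᵒᵖ] P, (∀ e, ∀ x ∈ F.deg (-1, e),
    F.d (h₁ x) = x - C.yA D (ρ₁ F D x) - h₀ (F.d x)) ∧ ∀ x, F.aug (h₁ x) = 0 := by
  obtain ⟨h₀, hh₀, hha⟩ := C.exists_h₀ hconn
  -- The next step of a homotopy from the identity to the composite of the comparison maps through
  -- the free module on `Q`; `h₀` makes `d ∘ E` vanish in degree `-1`.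
  let E : P →ₗ[Aᵐᵒᵖ] P := LinearMap.id - C.yA D ∘ₗ ρ₁ F D - h₀ ∘ₗ F.d
  refine ⟨h₀, F.lift fun s => C.κ (E (F.basis s)), fun e x hx => ?_, fun x =>
    aug_comp_ext (F := F) hconn (ζ := 0) (fun _ _ _ => rfl)
      (fun s => by rw [lift_basis, C.aug_κ]; rfl) x⟩
  refine F.restrictScalars_eq_of_basis (f := F.d ∘ₗ F.lift fun s => C.κ (E (F.basis s)))
    (g := E) (fun s hs => ?_) hx
  rw [LinearMap.comp_apply, lift_basis]
  have hdm := F.d_mem _ _ (F.basis_mem s)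
  rw [hs] at hdm
  have hE : F.d (E (F.basis s)) = 0 := by
    simp only [E, LinearMap.sub_apply, LinearMap.comp_apply, LinearMap.id_apply, map_sub]
    rw [d_yA, muQ_ρ₁ D hconn, hh₀ _ _ hdm, sub_sub, add_sub_cancel, sub_self]
  refine C.d_κ' hE ?_
  simp only [E, LinearMap.sub_apply, LinearMap.comp_apply, LinearMap.id_apply, map_sub]
  rw [aug_yA, hha, F.aug_of_fst_ne (by rw [hs]; decide) (F.basis_mem s), sub_zero, sub_zero]

end SectionData

end GradedFreeResolution

end Resolution

end ExtAInf

open scoped DirectSum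

namespace ExtAInf

set_option linter.unusedSectionVars false

open TensorProduct MulOpposite

/-! ### The natural identifications of `Ext¹` and `Ext²` -/

theorem DGAlgebra.exists_H_equiv {k : Type*} [Field k] {Γ : Type*} [AddCommGroup Γ]
    [DecidableEq Γ] {D : Type*} [Ring D] [Algebra k D] (C : DGAlgebra k Γ D) {j : ℤ × Γ}
    {N : Type*} [AddCommGroup N] [Module k N] (Ψ : C.cocycles j →ₗ[k] N)
    (hker : (C.coboundaries j).submoduleOf (C.cocycles j) = LinearMap.ker Ψ)
    (hΨ : Function.Surjective Ψ) : ∃ φ : C.H j ≃ₗ[k] N, ∀ z, φ (C.toH j z) = Ψ z :=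
  ⟨(Submodule.quotEquivOfEq _ _ hker).trans (Ψ.quotKerEquivOfSurjective hΨ), fun _ => rfl⟩

section Resolution

variable {k : Type*} [Field k] {G : Type*} [AddCommGroup G] [DecidableEq G]
  {A : Type*} [Ring A] [Algebra k A] {𝒜 : ℤ × G → Submodule k A} [GradedAlgebra 𝒜]
  {P : Type*} [AddCommGroup P] [Module k P] [Module Aᵐᵒᵖ P] [IsScalarTower k Aᵐᵒᵖ P]
  {F : GradedFreeResolution 𝒜 P} (hconn : IsConnectedGraded 𝒜)

include hconn in
theorem exists_sub_one_tmul_mem {Q : Type*} [AddCommGroup Q] [Module k Q] (x : Aᵐᵒᵖ ⊗[k] Q) :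
    ∃ q : Q, x - 1 ⊗ₜ q ∈ radSub 𝒜 (Set.univ : Set (Aᵐᵒᵖ ⊗[k] Q)) := by
  obtain ⟨ε, -, -, hε⟩ := hconn.exists_augmentation
  induction x using TensorProduct.induction_on with
  | zero => exact ⟨0, by simp⟩
  | tmul b q =>
    obtain ⟨a, rfl⟩ := op_surjective b
    refine ⟨ε a • q, ?_⟩
    have h1 : (op a ⊗ₜ[k] q - 1 ⊗ₜ[k] (ε a • q) : Aᵐᵒᵖ ⊗[k] Q) =
        op (a - ε a • 1) • (1 ⊗ₜ[k] q : Aᵐᵒᵖ ⊗[k] Q) := by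
      rw [TensorProduct.smul_tmul', smul_eq_mul, mul_one, op_sub, TensorProduct.sub_tmul, op_smul,
        op_one, TensorProduct.smul_tmul]
    rw [h1]
    exact op_smul_mem_radSub (hε a) trivial
  | add x y hx hy =>
    obtain ⟨q, hq⟩ := hx
    obtain ⟨q', hq'⟩ := hy
    refine ⟨q + q', ?_⟩
    rw [TensorProduct.tmul_add, add_sub_add_comm]; exact add_mem hq hq'

namespace GradedFreeResolution

theorem map_gproj_endDeg {j : ℤ × (ℤ × G)} {f : Module.End Aᵐᵒᵖ P} (hf : f ∈ F.endDeg j)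
    (i : ℤ × (ℤ × G)) (x : P) :
    f (gproj F.isInternal i x) = gproj F.isInternal (j + i) (f x) := by
  refine isInternal_induction F.isInternal (C := fun x =>
    f (gproj F.isInternal i x) = gproj F.isInternal (j + i) (f x)) (by simp) ?_ ?_ x
  · intro x y hx hy; simp only [map_add, hx, hy]
  · intro l x hx
    have hm := hf l x hx
    by_cases hi : l = i
    · subst hi; rw [gproj_of_mem _ hx, gproj_of_mem _ hm]
    · rw [gproj_of_mem_ne _ hx hi, gproj_of_mem_ne _ hm (fun h => hi (add_left_cancel h)), map_zero]

theorem d_mem_endDeg : F.d ∈ F.endDeg (1, 0) := by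
  intro i x hx
  have := F.d_mem i x hx
  convert this using 2
  ext <;> simp [add_comm]

/-- The augmentation kills boundaries, so for a cocycle `z` the relation `d z = ± z d` shows that `z
d` has zero augmentation. -/
theorem aug_cocycle_d {j : ℤ × (ℤ × G)} {z : Module.End Aᵐᵒᵖ P} (hz : z ∈ F.endDG.cocycles j)
    (x : P) : F.aug (z (F.d x)) = 0 := by
  have h1 : F.endDiff j.1 z = 0 := hz.2
  have h2 := congrArg (fun f : Module.End Aᵐᵒᵖ P => f x) h1
  simp only [endDiff_eq, LinearMap.zero_apply, sub_eq_zero] at h2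
  have h3 := congrArg F.aug h2
  rw [F.aug_d, map_smul, smul_eq_mul] at h3
  have h4 := sgn_mul_self k j.1
  rcases mul_eq_zero.1 h3.symm with h | h
  · rw [h, zero_mul] at h4; exact absurd h4 zero_ne_one
  · exact h

theorem aug_apply_rad (z : Module.End Aᵐᵒᵖ P) {x : P}
    (hx : x ∈ radSub 𝒜 (Set.univ : Set P)) : F.aug (z x) = 0 :=
  zeta_eq_zero_of_rad (ζ := F.aug ∘ₗ z.restrictScalars k)
    (fun x _ ha => F.aug_comp_smul z x ha) hx

include hconn in
-- The hypothesis says that `aug ∘ z` vanishes on the kernel of `d` modulo `P 𝔪`. By duality over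
-- the field it factors through `d` followed by the quotient map, and such cocycles are
-- coboundaries.
theorem mem_coboundaries_of_vanishing {j : ℤ × (ℤ × G)} {z : Module.End Aᵐᵒᵖ P}
    (hz : z ∈ F.endDG.cocycles j)
    (h : ∀ x ∈ F.deg (-j), F.d x ∈ radSub 𝒜 (Set.univ : Set P) → F.aug (z x) = 0) :
    z ∈ F.endDG.coboundaries j := by
  let δ : P →ₗ[k] P ⧸ radSub 𝒜 (Set.univ : Set P) :=
    (radSub 𝒜 (Set.univ : Set P)).mkQ ∘ₗ F.d.restrictScalars k
  let ζ : P →ₗ[k] k := F.aug ∘ₗ z.restrictScalars k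
  have hζg : ∀ x, ζ x = ζ (gproj F.isInternal (-j) x) := by
    intro x
    show F.aug (z x) = F.aug (z (gproj F.isInternal (-j) x))
    refine isInternal_induction F.isInternal (C := fun x =>
      F.aug (z x) = F.aug (z (gproj F.isInternal (-j) x))) (by simp) ?_ ?_ x
    · intro x y hx hy; simp only [map_add, hx, hy]
    · intro i x hx
      by_cases hi : i = -j
      · subst hi; rw [gproj_of_mem _ hx]
      · rw [gproj_of_mem_ne _ hx hi, map_zero, map_zero]
        exact F.aug_deg _ (fun h => hi (by rw [eq_neg_iff_add_eq_zero, add_comm]; exact h)) _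
          (hz.1 i x hx)
  have hker : ζ ∈ (LinearMap.ker δ).dualAnnihilator := by
    rw [Submodule.mem_dualAnnihilator]
    intro x hx
    have hx' : F.d x ∈ radSub 𝒜 (Set.univ : Set P) := by
      simpa [δ, Submodule.Quotient.mk_eq_zero] using hx
    rw [hζg]
    refine h _ (gproj_mem _ _ _) ?_
    rw [map_gproj_endDeg d_mem_endDeg]
    exact gproj_mem_rad hx' _
  -- Functionals killing the kernel of a linear map are pulled back from its target.
  rw [← LinearMap.range_dualMap_eq_dualAnnihilator_ker] at hker
  obtain ⟨l, hl⟩ := hker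
  have hl' : ∀ x, l (Submodule.Quotient.mk (F.d x)) = F.aug (z x) := fun x =>
    LinearMap.congr_fun hl x
  refine F.mem_coboundaries hconn hz
    (ζ := l ∘ₗ (radSub 𝒜 (Set.univ : Set P)).mkQ ∘ₗ gproj F.isInternal ((1, 0) + -j)) ?_ ?_ ?_
  · intro x a ha
    have h1 := gproj_mem_rad (F := F) (op_smul_mem_radSub (W := (Set.univ : Set P)) ha
      (trivial : x ∈ _)) ((1, 0) + -j)
    simp only [LinearMap.comp_apply, Submodule.mkQ_apply, (Submodule.Quotient.mk_eq_zero _).2 h1,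
      map_zero]
  · intro i hi x hx
    have h1 : i ≠ (1, 0) + -j := by
      rintro rfl
      apply hi
      ext
      · simp; ring
      · simp
      · simp
    simp only [LinearMap.comp_apply, gproj_of_mem_ne _ hx h1, map_zero]
  · intro x
    have := hζg x
    simp only [LinearMap.comp_apply, Submodule.mkQ_apply]
    rw [← map_gproj_endDeg d_mem_endDeg, hl']
    exact this

set_option maxHeartbeats 400000 in
include hconn in
/-- The cohomology in degree `p` of a complex in which the generators of degree `-p` are spanned by
a graded vector space. -/
theorem exists_identification {V : Type*} [AddCommGroup V] [Module k V]
    {𝒱 : ℤ × G → Submodule k V} {W : Submodule k V}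
    (hW : DirectSum.IsInternal fun d => (𝒱 d).comap W.subtype) {p : ℤ} {i : W →ₗ[k] P}
    (hi : ∀ (d : ℤ × G) (x : W), (x : V) ∈ 𝒱 d → i x ∈ F.deg (-p, d))
    (hinj : ∀ (x : W) (w : P), i x - F.d w ∈ radSub 𝒜 (Set.univ : Set P) → x = 0)
    (hspan : ∀ e, ∀ x ∈ F.deg (-p, e), F.d x ∈ radSub 𝒜 (Set.univ : Set P) →
      ∃ (x' : W) (w : P), x - i x' - F.d w ∈ radSub 𝒜 (Set.univ : Set P))
    (hd : ∀ x, F.d (i x) ∈ radSub 𝒜 (Set.univ : Set P)) :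
    ∃ φ : ∀ e, F.endDG.H (p, e) ≃ₗ[k] gradedDual 𝒱 W e, ∀ e (z : F.endDG.cocycles (p, e)) (x : W),
      (φ e (F.endDG.toH (p, e) z)).1 x = F.aug (z.1 (i x)) := by
  have key : ∀ e, ∃ φ : F.endDG.H (p, e) ≃ₗ[k] gradedDual 𝒱 W e,
      ∀ (z : F.endDG.cocycles (p, e)) (x : W),
        (φ (F.endDG.toH (p, e) z)).1 x = F.aug (z.1 (i x)) := by
    intro e
    let Ψ : F.endDG.cocycles (p, e) →ₗ[k] gradedDual 𝒱 W e :=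
      { toFun := fun z => ⟨F.aug ∘ₗ z.1.restrictScalars k ∘ₗ i, by
          intro d hde x hx
          refine F.aug_deg ((p, e) + (-p, d)) ?_ _ (z.2.1 _ _ (hi d x hx))
          intro h
          have h2 := congrArg Prod.snd h
          simp only [Prod.snd_add, Prod.snd_zero] at h2
          exact hde (eq_neg_of_add_eq_zero_right h2)⟩
        map_add' := by intro z z'; ext x; simp
        map_smul' := by intro c z; ext x; simp }
    have hΨ : ∀ z x, (Ψ z).1 x = F.aug (z.1 (i x)) := fun z x => rfl
    have hker : (F.endDG.coboundaries (p, e)).submoduleOf (F.endDG.cocycles (p, e)) =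
        LinearMap.ker Ψ := by
      ext z
      constructor
      · rintro ⟨g, hg, hgz⟩
        rw [LinearMap.mem_ker]
        ext x
        rw [hΨ]
        have h1 : z.1 = F.endDiff (p - 1) g := hgz.symm
        rw [h1, endDiff_eq, map_sub, F.aug_d, map_smul, aug_apply_rad g (hd x), smul_zero, sub_zero]
        rfl
      · intro hz
        refine mem_coboundaries_of_vanishing hconn z.2 fun x hx hdx => ?_
        obtain ⟨x', w, hxw⟩ := hspan (-e) x hx hdx
        have h1 : x = (x - i x' - F.d w) + i x' + F.d w := by abel
        change F.aug (z.1 x) = 0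
        have h2 : F.aug (z.1 (i x')) = 0 := by
          rw [← hΨ, LinearMap.mem_ker.1 hz]; rfl
        rw [h1, map_add, map_add, map_add, map_add, aug_apply_rad _ hxw, h2, aug_cocycle_d z.2,
          add_zero, add_zero]
    have hsurj : Function.Surjective Ψ := by
      intro b
      -- A functional on `W` is extended to `P` through the quotient by `P 𝔪 + d P`, where `W`
      -- embeds. Vanishing on boundaries lets it lift to a cocycle.
      let U : Submodule k P := radSub 𝒜 (Set.univ : Set P) ⊔
        LinearMap.range (F.d.restrictScalars k)
      have hinj' : LinearMap.ker (U.mkQ ∘ₗ i) = ⊥ := by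
        rw [LinearMap.ker_eq_bot']
        intro x hx
        rw [LinearMap.comp_apply, Submodule.mkQ_apply, Submodule.Quotient.mk_eq_zero] at hx
        obtain ⟨m, hm, _, ⟨w, rfl⟩, hmw⟩ := Submodule.mem_sup.1 hx
        refine hinj x w ?_
        rw [← hmw]
        simpa using hm
      obtain ⟨l, hl⟩ := LinearMap.exists_leftInverse_of_injective _ hinj'
      let ζ : P →ₗ[k] k := b.1 ∘ₗ l ∘ₗ U.mkQ ∘ₗ gproj F.isInternal (-p, -e)
      have hζU : ∀ x ∈ U, ζ (x) = 0 := by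
        intro x hx
        obtain ⟨m, hm, _, ⟨w, rfl⟩, rfl⟩ := Submodule.mem_sup.1 hx
        have h1 : gproj F.isInternal (-p, -e) (m + F.d w) ∈ U := by
          rw [map_add]
          refine Submodule.add_mem_sup (gproj_mem_rad hm _) ?_
          have h2 := map_gproj_endDeg (F := F) d_mem_endDeg (-p - 1, -e) w
          have h3 : ((1, 0) + (-p - 1, -e) : ℤ × (ℤ × G)) = (-p, -e) := by ext <;> simp
          rw [h3] at h2
          exact ⟨_, h2⟩
        show b.1 (l (Submodule.Quotient.mk (gproj F.isInternal (-p, -e) (m + F.d w)))) = 0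
        rw [(Submodule.Quotient.mk_eq_zero _).2 h1, map_zero, map_zero]
      obtain ⟨z, hz, hza⟩ := F.exists_cocycle hconn (j := (p, e)) (ζ := ζ)
        (fun x a ha => hζU _ (Submodule.mem_sup_left (op_smul_mem_radSub ha trivial)))
        (fun i hi x hx => by
          have h1 : i ≠ (-p, -e) := by
            rintro rfl; apply hi; ext <;> simp
          simp only [ζ, LinearMap.comp_apply, gproj_of_mem_ne _ hx h1, map_zero])
        (fun x => hζU _ (Submodule.mem_sup_right ⟨x, rfl⟩))
      refine ⟨⟨z, hz⟩, ?_⟩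
      ext x
      rw [hΨ, hza]
      refine isInternal_induction hW (C := fun x => ζ (i x) = b.1 x) (by simp) ?_ ?_ x
      · intro x y hx hy; simp only [map_add, hx, hy]
      · intro d x hx
        have h1 := hi d x hx
        by_cases hde : d = -e
        · subst hde
          have h2 : l (U.mkQ (i x)) = x := LinearMap.congr_fun hl x
          simp only [ζ, LinearMap.comp_apply, gproj_of_mem _ h1, h2]
        · have h2 : gproj F.isInternal (-p, -e) (i x) = 0 :=
            gproj_of_mem_ne _ h1 (fun h => hde (congrArg Prod.snd h))
          simp only [ζ, LinearMap.comp_apply, h2, map_zero]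
          exact (b.2 d hde x hx).symm
    obtain ⟨φ, hφ⟩ := F.endDG.exists_H_equiv (j := (p, e)) (N := gradedDual 𝒱 W e) Ψ hker hsurj
    exact ⟨φ, fun z x => by rw [hφ, hΨ]⟩
  choose φ hφ using key
  exact ⟨φ, hφ⟩

namespace SectionData

variable (C : F.SectionData) (D : Presentation 𝒜)

theorem d_y_mem_rad (q : D.Q) : F.d (C.y D q) ∈ radSub 𝒜 (Set.univ : Set P) := by
  rw [d_y]; exact op_smul_mem_radSub (D.Q_le q.2) trivial

theorem d_v_mem_rad (r : D.R) : F.d (C.v D r) ∈ radSub 𝒜 (Set.univ : Set P) := by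
  rw [d_v]; exact map_mem_radSub (C.yA D) (W' := Set.univ) (fun _ _ => Set.mem_univ _) (D.lam_R_mem_radSub r.2)

include hconn

/-- By `exists_h₁`, up to a boundary `x` is `yA (ρ₁ x) + h₀ (d x)`. The second term is in `P 𝔪`, and
`ρ₁ x` is some `1 ⊗ q` modulo `𝔪`. -/
theorem exists_sub_y_mem {e : ℤ × G} {x : P} (hx : x ∈ F.deg (-1, e))
    (hd : F.d x ∈ radSub 𝒜 (Set.univ : Set P)) :
    ∃ (q : D.Q) (w : P), x - C.y D q - F.d w ∈ radSub 𝒜 (Set.univ : Set P) := by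
  obtain ⟨h₀, h₁, hh, -⟩ := C.exists_h₁ D hconn
  obtain ⟨q, hq⟩ := exists_sub_one_tmul_mem hconn (ρ₁ F D x)
  refine ⟨q, h₁ x, ?_⟩
  have h1 := map_mem_radSub (C.yA D) (W' := Set.univ) (fun _ _ => trivial) hq
  rw [map_sub, yA_one_tmul] at h1
  have h2 := map_mem_radSub h₀ (W' := Set.univ) (fun _ _ => trivial) hd
  rw [hh e x hx]
  convert add_mem h1 h2 using 1
  abel

/-- `ρ₁ (d x)` is a syzygy, hence congruent to some `lam r` modulo syzygies times `𝔪`. The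
difference lifts through `d` to an element `m` of `P 𝔪`, so that `x - h₁ (d x) - v_r - m` is a cycle
in negative degree and therefore a boundary. -/
theorem exists_sub_v_mem {e : ℤ × G} {x : P} (hx : x ∈ F.deg (-2, e))
    (hd : F.d x ∈ radSub 𝒜 (Set.univ : Set P)) :
    ∃ (r : D.R) (w : P), x - C.v D r - F.d w ∈ radSub 𝒜 (Set.univ : Set P) := by
  obtain ⟨h₀, h₁, hh, hha⟩ := C.exists_h₁ D hconn
  obtain ⟨ε, -, -, hε⟩ := hconn.exists_augmentation
  have h1 : muQ D.Q (ρ₁ F D (F.d x)) = 0 := by rw [muQ_ρ₁ D hconn, F.d_d, map_zero]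
  have h2 : ∀ w ∈ Submodule.span Aᵐᵒᵖ (lam D.Q '' D.R), muQ D.Q w = 0 ∧
      ∃ r : D.R, w - lam D.Q r ∈ radSub 𝒜 {x : Aᵐᵒᵖ ⊗[k] D.Q | muQ D.Q x = 0} := by
    intro w hw
    induction hw using Submodule.span_induction with
    | mem w hw =>
      obtain ⟨r, hr, rfl⟩ := hw
      exact ⟨D.muQ_lam_R hr, ⟨r, hr⟩, by simp⟩
    | zero => exact ⟨map_zero _, 0, by simp⟩
    | add w w' _ _ h h' =>
      obtain ⟨h1, r, hr⟩ := h
      obtain ⟨h1', r', hr'⟩ := h'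
      refine ⟨by rw [map_add, h1, h1', add_zero], r + r', ?_⟩
      rw [Submodule.coe_add, map_add, add_sub_add_comm]; exact add_mem hr hr'
    | smul b w _ h =>
      obtain ⟨a, rfl⟩ := op_surjective b
      obtain ⟨h1, r, hr⟩ := h
      refine ⟨by rw [map_smul, h1, smul_zero], ε a • r, ?_⟩
      have h2 : op a • w - lam D.Q ((ε a • r : D.R) : TensorAlgebra k D.Q) =
          op (a - ε a • 1) • w + ε a • (w - lam D.Q r) := by
        have e1 : op a • w = op (a - ε a • 1) • w + ε a • w := by
          have e3 : op a = op (a - ε a • 1) + ε a • 1 := by rw [op_sub, op_smul, op_one]; abel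
          conv_lhs => rw [e3]
          rw [add_smul, smul_assoc, one_smul]
        have e2 : ε a • (w - lam D.Q (r : TensorAlgebra k D.Q)) = ε a • w - ε a • lam D.Q r :=
          smul_sub _ _ _
        rw [Submodule.coe_smul, map_smul, e1, e2]
        abel
      rw [h2]
      exact add_mem (op_smul_mem_radSub (hε a) h1) (Submodule.smul_mem _ _ hr)
  obtain ⟨-, r, hr⟩ := h2 _ (D.ker_muQ_le h1)
  obtain ⟨m, hm, hdm⟩ : ∃ m ∈ radSub 𝒜 (Set.univ : Set P),
      F.d m = C.yA D (ρ₁ F D (F.d x) - lam D.Q r) := by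
    generalize ρ₁ F D (F.d x) - lam D.Q r = w at hr
    induction hr using Submodule.span_induction with
    | mem w hw =>
      obtain ⟨a, ha, x, hx, rfl⟩ := hw
      exact ⟨op a • C.κ (C.yA D x), op_smul_mem_radSub ha trivial, by
        rw [map_smul, map_smul, C.d_κ_yA D hx]⟩
    | zero => exact ⟨0, zero_mem _, by simp⟩
    | add w w' _ _ h h' =>
      obtain ⟨m, hm, hdm⟩ := h
      obtain ⟨m', hm', hdm'⟩ := h'
      exact ⟨m + m', add_mem hm hm', by rw [map_add, map_add, hdm, hdm']⟩
    | smul c w _ h =>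
      obtain ⟨m, hm, hdm⟩ := h
      refine ⟨c • m, Submodule.smul_mem _ _ hm, ?_⟩
      rw [map_smul_k F.d, hdm]
      exact ((C.yA D).map_smul_of_tower c w).symm
  have hdx : F.d x ∈ F.deg (-1, e) := F.d_mem _ _ hx
  have h3 := hh e _ hdx
  rw [F.d_d, map_zero, sub_zero] at h3
  obtain ⟨w, hw⟩ := F.mem_range_d (x := x - h₁ (F.d x) - C.v D r - m) (by
      rw [map_sub, map_sub, map_sub, h3, hdm, d_v, map_sub]; abel) (by
      rw [map_sub, map_sub, map_sub, hha, F.aug_of_fst_ne (by simp) hx, v_apply, C.aug_κ,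
        zeta_eq_zero_of_rad (fun x a ha => F.aug_smul x a ha) hm]; simp)
  refine ⟨r, w, ?_⟩
  have h4 := add_mem (map_mem_radSub h₁ (W' := Set.univ) (fun _ _ => trivial) hd) hm
  rw [hw]
  convert h4 using 1
  abel

theorem exists_identification_one : ∃ φ : ∀ e, F.endDG.H (1, e) ≃ₗ[k] gradedDual 𝒜 D.Q e,
    ∀ e (z : F.endDG.cocycles (1, e)) (q : D.Q),
      (φ e (F.endDG.toH (1, e) z)).1 q = F.aug (z.1 (C.y D q)) :=
  exists_identification hconn (D.Q_graded.isInternal (gradedAlgebra_isInternal 𝒜))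
    (fun _ _ hq => C.y_mem D hq) (fun _ _ h => C.eq_zero_of_y_mem D hconn h)
    (fun _ _ hx hd => C.exists_sub_y_mem hconn D hx hd) (C.d_y_mem_rad D)

theorem exists_identification_two :
    ∃ φ : ∀ e, F.endDG.H (2, e) ≃ₗ[k] gradedDual (tensorDeg 𝒜 D.Q) D.R e,
    ∀ e (z : F.endDG.cocycles (2, e)) (r : D.R),
      (φ e (F.endDG.toH (2, e) z)).1 r = F.aug (z.1 (C.v D r)) :=
  exists_identification hconn (D.R_graded.isInternal (tensorDeg_internal D.Q_graded))
    (fun _ _ hr => C.v_mem D hr) (fun _ _ h => C.eq_zero_of_v_mem D hconn h)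
    (fun _ _ hx hd => C.exists_sub_v_mem hconn D hx hd) (C.d_v_mem_rad D)

end SectionData

theorem aug_of_mem_term {p : ℤ} (hp : p ≠ 0) {x : P} (hx : x ∈ F.term p) : F.aug x = 0 := by
  induction hx using Submodule.iSup_induction' with
  | mem e x hx => exact F.aug_of_fst_ne hp hx
  | zero => simp
  | add x y _ _ hx hy => rw [map_add, hx, hy, add_zero]

namespace SectionData

variable (C : F.SectionData) (D : Presentation 𝒜)

theorem exists_sub_u {u : P} (hu : u ∈ F.deg 0) (hu1 : F.aug u = 1) : ∃ w, F.d w = u - C.u := by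
  refine F.mem_range_d ?_ (by rw [map_sub, hu1, C.aug_u, sub_self])
  rw [map_sub, C.d_u, F.eq_zero_of_pos (by simp) (F.d_mem 0 _ hu), sub_zero]

theorem exists_sub_y {u w : P} (hw : F.d w = u - C.u) {q : D.Q} {y : P} (hy : y ∈ F.term (-1))
    (hdy : F.d y = op (q : A) • u) : ∃ w', F.d w' = y - C.y D q - op (q : A) • w := by
  refine F.mem_range_d ?_ ?_
  · rw [map_sub, map_sub, hdy, d_y, map_smul, hw, smul_sub]; abel
  · rw [map_sub, map_sub, aug_of_mem_term (by decide) hy, F.aug_smul _ _ (D.Q_le q.2)]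
    show 0 - F.aug (C.κ _) - 0 = 0
    rw [C.aug_κ]; simp

/-- Two choices of `u` and `y` differ by boundaries and elements of `P 𝔪`, on which a cocycle has
zero augmentation. -/
theorem isNaturalOne {φ : ∀ e, F.endDG.H (1, e) ≃ₗ[k] gradedDual 𝒜 D.Q e}
    (hφ : ∀ e (z : F.endDG.cocycles (1, e)) (q : D.Q),
      (φ e (F.endDG.toH (1, e) z)).1 q = F.aug (z.1 (C.y D q))) : F.IsNaturalOne D φ := by
  intro e z u q y hu hu1 hy hdy
  obtain ⟨w, hw⟩ := C.exists_sub_u hu hu1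
  obtain ⟨w', hw'⟩ := C.exists_sub_y D hw hy hdy
  have h1 : y = C.y D q + op (q : A) • w + F.d w' := by rw [hw']; abel
  rw [hφ, h1, map_add, map_add, map_add, map_add, aug_cocycle_d z.2, map_smul,
    F.aug_smul _ _ (D.Q_le q.2), add_zero, add_zero]

theorem isNaturalTwo {φ : ∀ e, F.endDG.H (2, e) ≃ₗ[k] gradedDual (tensorDeg 𝒜 D.Q) D.R e}
    (hφ : ∀ e (z : F.endDG.cocycles (2, e)) (r : D.R),
      (φ e (F.endDG.toH (2, e) z)).1 r = F.aug (z.1 (C.v D r))) : F.IsNaturalTwo D φ := by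
  intro e z u n q a y v r hu hu1 ha hr hy hdy hv hdv
  obtain ⟨w, hw⟩ := C.exists_sub_u hu hu1
  have hw' := fun i => C.exists_sub_y D hw (hy i) (hdy i)
  choose w' hw' using hw'
  have hlam : C.yA D (lam D.Q r) = ∑ i, op (a i) • C.y D (q i) := by
    rw [hr, map_sum, map_sum]
    refine Finset.sum_congr rfl fun i _ => ?_
    rw [lam_ι_mul, D.θ_splits, yA_tmul]
  -- The ambiguity `w` of `u` contributes `w` acted on by `∑ qᵢ aᵢ`, which is zero since `r` is a
  -- relation.
  have hμ : ∑ i, op (a i) • op (q i : A) • w = 0 := by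
    have h1 : mulMap D.Q r = 0 := D.R_le_relIdeal r.2
    rw [hr, map_sum] at h1
    have h2 : ∑ i, op (a i) • op (q i : A) • w = op (∑ i, (q i : A) * a i) • w := by
      rw [Finset.op_sum, Finset.sum_smul]
      refine Finset.sum_congr rfl fun i _ => ?_
      rw [smul_smul, op_mul]
    rw [h2, show ∑ i, (q i : A) * a i = 0 by
      rw [← h1]
      refine Finset.sum_congr rfl fun i _ => ?_
      rw [map_mul, mulMap_ι, D.θ_splits], op_zero, zero_smul]
  have hd : F.d v = F.d (C.v D r + ∑ i, op (a i) • w' i) := by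
    rw [hdv, map_add, d_v, hlam, map_sum]
    have : ∀ i, F.d (op (a i) • w' i) =
        op (a i) • y i - op (a i) • C.y D (q i) - op (a i) • op (q i : A) • w := by
      intro i
      rw [map_smul, hw', smul_sub, smul_sub]
    simp only [this, Finset.sum_sub_distrib, hμ]
    abel
  have hrad : ∑ i, op (a i) • w' i ∈ radSub 𝒜 (Set.univ : Set P) :=
    sum_mem fun i _ => op_smul_mem_radSub (ha i) trivial
  obtain ⟨x, hx⟩ := F.mem_range_d (x := v - (C.v D r + ∑ i, op (a i) • w' i))
    (by rw [map_sub, hd, sub_self]) (by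
      rw [map_sub, map_add, aug_of_mem_term (by decide) hv, v_apply, C.aug_κ,
        zeta_eq_zero_of_rad (fun x a ha => F.aug_smul x a ha) hrad]; simp)
  have h1 : v = C.v D r + ∑ i, op (a i) • w' i + F.d x := by rw [hx]; abel
  rw [hφ, h1, map_add, map_add, map_add, map_add, aug_cocycle_d z.2, aug_apply_rad _ hrad,
    add_zero, add_zero]

end SectionData

end GradedFreeResolution

end Resolution

end ExtAInf

open scoped DirectSum

namespace ExtAInf

set_option linter.unusedSectionVars false

open TensorProduct MulOpposite

/-! ### Normalized representatives -/

section Sections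

variable {k : Type*} [Field k] {Γ : Type*} [AddCommGroup Γ] [DecidableEq Γ]
  {E : Type*} [Ring E] [Algebra k E] (C : DGAlgebra k Γ E)

theorem DGAlgebra.exists_section_in {j : ℤ × Γ} (S : Submodule k (C.cocycles j))
    (hS : ∀ z : C.cocycles j, ∃ z' ∈ S, C.toH j z' = C.toH j z) :
    ∃ s : C.H j →ₗ[k] C.cocycles j, ∀ a, s a ∈ S ∧ C.toH j (s a) = a := by
  let p : S →ₗ[k] C.H j := C.toHₗ j ∘ₗ S.subtype
  have hp : LinearMap.range p = ⊤ := by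
    rw [LinearMap.range_eq_top]
    intro a
    obtain ⟨z, rfl⟩ := C.toH_surjective j a
    obtain ⟨z', hz', h⟩ := hS z
    exact ⟨⟨z', hz'⟩, h⟩
  obtain ⟨s, hs⟩ := p.exists_rightInverse_of_surjective hp
  exact ⟨S.subtype ∘ₗ s, fun a => ⟨(s a).2, LinearMap.congr_fun hs a⟩⟩

/-- A section of the projection to cohomology with a prescribed value. -/
theorem DGAlgebra.exists_section_of_ne {j : ℤ × Γ} (z : C.cocycles j) (hz : C.toH j z ≠ 0) :
    ∃ s : C.H j →ₗ[k] C.cocycles j, (∀ a, C.toH j (s a) = a) ∧ s (C.toH j z) = z := by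
  obtain ⟨s₀, hs₀⟩ := C.exists_section_in (j := j) ⊤ (fun z => ⟨z, trivial, rfl⟩)
  obtain ⟨f, hf⟩ := Module.Projective.exists_dual_ne_zero k hz
  let f' : C.H j →ₗ[k] k := (f (C.toH j z))⁻¹ • f
  have hf' : f' (C.toH j z) = 1 := by simp [f', hf]
  refine ⟨s₀ + LinearMap.toSpanSingleton k _ (z - s₀ (C.toH j z)) ∘ₗ f', fun a => ?_, ?_⟩
  · have h1 : C.toHₗ j (z - s₀ (C.toH j z)) = 0 := by
      rw [map_sub, C.toHₗ_apply, C.toHₗ_apply, (hs₀ _).2, sub_self]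
    rw [← C.toHₗ_apply, LinearMap.add_apply, map_add, C.toHₗ_apply, (hs₀ a).2]
    simp [h1]
  · simp [hf']

end Sections

/-! ### Normalization of endomorphisms by coboundaries -/

section Resolution

variable {k : Type*} [Field k] {G : Type*} [AddCommGroup G] [DecidableEq G]
  {A : Type*} [Ring A] [Algebra k A] {𝒜 : ℤ × G → Submodule k A} [GradedAlgebra 𝒜]
  {P : Type*} [AddCommGroup P] [Module k P] [Module Aᵐᵒᵖ P] [IsScalarTower k Aᵐᵒᵖ P]
  {F : GradedFreeResolution 𝒜 P}

namespace GradedFreeResolution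

namespace SectionData

variable (C : F.SectionData) (D : Presentation 𝒜)

theorem y_induction {p : D.Q → Prop} (hz : p 0) (hadd : ∀ x y, p x → p y → p (x + y))
    (h : ∀ d (q : D.Q), C.y D q ∈ F.deg (-1, d) → p q) (q : D.Q) : p q :=
  isInternal_induction (D.Q_graded.isInternal (gradedAlgebra_isInternal 𝒜)) hz hadd
    (fun d q hq => h d q (C.y_mem D hq)) q

theorem v_induction {p : D.R → Prop} (hz : p 0) (hadd : ∀ x y, p x → p y → p (x + y))
    (h : ∀ d (r : D.R), C.v D r ∈ F.deg (-2, d) → p r) (r : D.R) : p r :=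
  isInternal_induction (D.R_graded.isInternal (tensorDeg_internal D.Q_graded)) hz hadd
    (fun d r hr => h d r (C.v_mem D hr)) r

theorem aug_v {j : ℤ × (ℤ × G)} (hj : j.1 ≠ 2) {f : Module.End Aᵐᵒᵖ P} (hf : f ∈ F.endDeg j)
    (r : D.R) : F.aug (f (C.v D r)) = 0 := by
  refine C.v_induction D (p := fun r => F.aug (f (C.v D r)) = 0) (by simp) ?_ ?_ r
  · intro x y hx hy; simp only [map_add, hx, hy, add_zero]
  · intro d r hr
    refine F.aug_of_fst_ne ?_ (hf _ _ hr)
    simp only [Prod.fst_add]; omega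

theorem d_apply_y {j : ℤ × (ℤ × G)} (hj : j.1 = 1) {f : Module.End Aᵐᵒᵖ P} (hf : f ∈ F.endDeg j)
    (q : D.Q) : F.d (f (C.y D q)) = 0 := by
  refine C.y_induction D (p := fun q => F.d (f (C.y D q)) = 0) (by simp) ?_ ?_ q
  · intro x y hx hy; simp only [map_add, hx, hy, add_zero]
  · intro d q hq
    exact F.eq_zero_of_pos (by simp [hj]) (F.d_mem _ _ (hf _ _ hq))

theorem d_apply_v {j : ℤ × (ℤ × G)} (hj : j.1 = 2) {f : Module.End Aᵐᵒᵖ P} (hf : f ∈ F.endDeg j)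
    (r : D.R) : F.d (f (C.v D r)) = 0 := by
  refine C.v_induction D (p := fun r => F.d (f (C.v D r)) = 0) (by simp) ?_ ?_ r
  · intro x y hx hy; simp only [map_add, hx, hy, add_zero]
  · intro d r hr
    exact F.eq_zero_of_pos (by simp [hj]) (F.d_mem _ _ (hf _ _ hr))

theorem apply_d_v_eq_zero {f : Module.End Aᵐᵒᵖ P} (hf : ∀ e, ∀ x ∈ F.deg (-1, e), f x = 0)
    (r : D.R) : f (F.d (C.v D r)) = 0 := by
  refine C.v_induction D (p := fun r => f (F.d (C.v D r)) = 0) (by simp) ?_ ?_ r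
  · intro x y hx hy; simp only [map_add, hx, hy, add_zero]
  · intro d r hr
    exact hf d _ (F.d_mem _ _ hr)

/-- A section of the differential on the augmentation kernel in degree `0` with
`u a ↦ ∑ yᵢ aᵢ` for `θ(a) = ∑ qᵢ ⊗ θ(aᵢ)`. -/
noncomputable def κ' : P →ₗ[k] P :=
  C.κ ∘ₗ (LinearMap.id - ((LinearMap.toSpanSingleton Aᵐᵒᵖ P C.u).restrictScalars k ∘ₗ
    (opLinearEquiv k).toLinearMap ∘ₗ (ρ₀ F).restrictScalars k)) +
  (C.yA D).restrictScalars k ∘ₗ lam D.Q ∘ₗ D.θ ∘ₗ (ρ₀ F).restrictScalars k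

theorem κ'_apply (x : P) : C.κ' D x =
    C.κ (x - op (ρ₀ F x) • C.u) + C.yA D (lam D.Q (D.θ (ρ₀ F x))) := rfl

theorem aug_κ' (x : P) : F.aug (C.κ' D x) = 0 := by
  rw [κ'_apply, map_add, C.aug_κ, aug_yA, add_zero]

variable (hconn : IsConnectedGraded 𝒜)
include hconn

theorem d_κ'_apply {x : P} (h1 : F.d x = 0) (h2 : F.aug x = 0) : F.d (C.κ' D x) = x := by
  have h3 := sub_ρ₀_mem hconn (F := F) x
  rw [h2, zero_smul, sub_zero] at h3
  rw [κ'_apply, map_add, C.d_κ', d_yA, D.muQ_lam_θ h3, sub_add_cancel]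
  · rw [map_sub, h1, map_smul, C.d_u, smul_zero, sub_zero]
  · rw [map_sub, h2, F.aug_smul _ _ h3, sub_zero]

theorem κ'_smul_u {a : A} : C.κ' D (op a • C.u) = C.yA D (lam D.Q (D.θ a)) := by
  rw [κ'_apply, map_smul, C.ρ₀_u hconn, op_smul_eq_mul, one_mul, sub_self, map_zero, zero_add]

omit hconn in
theorem κ'_mem {e : ℤ × G} {x : P} (hx : x ∈ F.deg (0, e)) : C.κ' D x ∈ F.deg (-1, e) := by
  have h1 := ρ₀_mem hx
  rw [κ'_apply]
  refine add_mem ?_ (C.yA_mem D (lam_mem_freeDeg (D.θ_graded _ _ h1)))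
  have h2 := F.smul_mem 0 e C.u _ C.u_mem h1
  rw [show (0 + (0, e) : ℤ × (ℤ × G)) = (0, e) by simp] at h2
  exact C.κ_mem _ _ (sub_mem hx h2)

omit hconn in
theorem y_neg {d : ℤ × G} (hd : d.1 < 0) {q : D.Q} (hq : (q : A) ∈ 𝒜 d) : q = 0 :=
  Subtype.ext (eq_zero_of_mem_augIdeal hd.le hq (D.Q_le q.2))

theorem exists_extension_y {j : ℤ × (ℤ × G)} {t : D.Q →ₗ[k] P}
    (ht : ∀ (d : ℤ × G) (q : D.Q), C.y D q ∈ F.deg (-1, d) → (q : A) ∈ 𝒜 d →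
      t q ∈ F.deg (j + (-1, d))) :
    ∃ h ∈ F.endDeg j, (∀ q, h (C.y D q) = t q) ∧
      ∀ p', p' ≠ -1 → ∀ e, ∀ x ∈ F.deg (p', e), h x = 0 :=
  F.exists_extension hconn (D.Q_graded.isInternal (gradedAlgebra_isInternal 𝒜))
    (fun _ hd _ hq => y_neg D hd hq) (fun _ _ hq => C.y_mem D hq)
    (fun _ hq => C.eq_zero_of_y_mem D hconn (w := 0) (by simpa using hq))
    (fun d q hq => ht d q (C.y_mem D hq) hq)

theorem exists_extension_v {j : ℤ × (ℤ × G)} {t : D.R →ₗ[k] P}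
    (ht : ∀ (d : ℤ × G) (r : D.R), C.v D r ∈ F.deg (-2, d) → t r ∈ F.deg (j + (-2, d))) :
    ∃ h ∈ F.endDeg j, (∀ r, h (C.v D r) = t r) ∧
      ∀ p', p' ≠ -2 → ∀ e, ∀ x ∈ F.deg (p', e), h x = 0 :=
  F.exists_extension hconn (D.R_graded.isInternal (tensorDeg_internal D.Q_graded))
    (fun _ hd _ hr => Subtype.ext (tensorDeg_eq_zero D.Q_le hd hr)) (fun _ _ hr => C.v_mem D hr)
    (fun _ hr => C.eq_zero_of_v_mem D hconn (w := 0) (by simpa using hr))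
    (fun d r hr => ht d r (C.v_mem D hr))

/-- Normalization of endomorphisms of degree `1` by boundaries. -/
theorem exists_normalize_one {j : ℤ × (ℤ × G)} (hj : j.1 = 1) {g : Module.End Aᵐᵒᵖ P}
    (hg : g ∈ F.endDeg j) : ∃ h ∈ F.endDeg (j.1 - 1, j.2),
      (∀ q, (g - F.endDiff (j.1 - 1) h) (C.y D q) = F.aug (g (C.y D q)) • C.u) ∧
      ∀ r, (g - F.endDiff (j.1 - 1) h) (C.v D r) =
        C.κ' D (F.d ((g - F.endDiff (j.1 - 1) h) (C.v D r))) := by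
  obtain ⟨p, e⟩ := j
  obtain rfl : p = 1 := hj
  simp only [sub_self]
  have hs : sgn k 0 = 1 := by simp [sgn]
  have hdiff : ∀ (h : Module.End Aᵐᵒᵖ P) x, F.endDiff 0 h x = F.d (h x) - h (F.d x) := by
    intro h x; rw [endDiff_eq, hs, one_smul]
  -- First correct the values on the `y_q`. The extension `h` lives in degree `-1` only, so `h (d
  -- y_q) = h (u q)` vanishes and `d t` removes everything but the multiple of `u`.
  let t : D.Q →ₗ[k] P := C.κ ∘ₗ (LinearMap.id - LinearMap.toSpanSingleton k P C.u ∘ₗ F.aug) ∘ₗ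
    g.restrictScalars k ∘ₗ C.y D
  have ht : ∀ q, t q = C.κ (g (C.y D q) - F.aug (g (C.y D q)) • C.u) := fun q => rfl
  obtain ⟨h, hh, hhy, hh0⟩ := C.exists_extension_y D hconn (j := (0, e)) (t := t) (by
    intro d q hyq _
    have h1 := hg _ _ hyq
    rw [ht]
    have h2 : g (C.y D q) - F.aug (g (C.y D q)) • C.u ∈ F.deg ((1, e) + (-1, d)) := by
      refine sub_mem h1 ?_
      by_cases h3 : ((1, e) + (-1, d) : ℤ × (ℤ × G)) = 0
      · rw [h3]; exact Submodule.smul_mem _ _ C.u_mem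
      · rw [F.aug_deg _ h3 _ h1, zero_smul]; exact zero_mem _
    convert C.κ_mem _ _ h2 using 2
    ext <;> simp)
  have hdh : F.endDiff 0 h ∈ F.endDeg (1, e) := F.endDG.diff_mem (0, e) h hh
  have hu : h C.u = 0 := hh0 0 (by decide) 0 C.u C.u_mem
  let g₂ := g - F.endDiff 0 h
  have hg₂ : g₂ ∈ F.endDeg (1, e) := sub_mem hg hdh
  have hg₂y : ∀ q, g₂ (C.y D q) = F.aug (g (C.y D q)) • C.u := by
    intro q
    show g (C.y D q) - F.endDiff 0 h (C.y D q) = _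
    rw [hdiff, hhy, ht, C.d_κ', d_y, map_smul, hu, smul_zero, sub_zero, sub_sub_cancel]
    · rw [map_sub, C.d_apply_y D rfl hg, map_smul_k F.d, C.d_u, smul_zero, sub_zero]
    · rw [map_sub, map_smul, C.aug_u, smul_eq_mul, mul_one, sub_self]
  -- Then correct the values on the `v_r`. The new map lives in degree `-2` only, so it neither sees
  -- `d v_r` nor disturbs the values on the `y_q`.
  let t' : D.R →ₗ[k] P := C.κ ∘ₗ (LinearMap.id - C.κ' D ∘ₗ F.d.restrictScalars k) ∘ₗ
    g₂.restrictScalars k ∘ₗ C.v D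
  have ht' : ∀ r, t' r = C.κ (g₂ (C.v D r) - C.κ' D (F.d (g₂ (C.v D r)))) := fun r => rfl
  obtain ⟨h', hh', hhv', hh0'⟩ := C.exists_extension_v D hconn (j := (0, e)) (t := t') (by
    intro d r hr
    have h1 := hg₂ _ _ hr
    have h2 : C.κ' D (F.d (g₂ (C.v D r))) ∈ F.deg ((1, e) + (-2, d)) :=
      C.κ'_mem D (F.d_mem _ _ h1)
    rw [ht']
    convert C.κ_mem _ _ (sub_mem h1 h2) using 2
    ext <;> simp)
  have hdt' : ∀ r, F.d (t' r) = g₂ (C.v D r) - C.κ' D (F.d (g₂ (C.v D r))) := by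
    intro r
    rw [ht', C.d_κ']
    · rw [map_sub, C.d_κ'_apply D hconn (F.d_d _) (F.aug_d _), sub_self]
    · rw [map_sub, C.aug_κ', C.aug_v D (by simp) hg₂, sub_zero]
  have hv : ∀ r, (g - F.endDiff 0 (h + h')) (C.v D r) = C.κ' D (F.d (g₂ (C.v D r))) := by
    intro r
    have h1 : (g - F.endDiff 0 (h + h')) (C.v D r) = g₂ (C.v D r) - F.endDiff 0 h' (C.v D r) := by
      rw [map_add, ← sub_sub]; rfl
    rw [h1, hdiff, hhv', C.apply_d_v_eq_zero D (hh0' (-1) (by decide)), sub_zero, hdt',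
      sub_sub_cancel]
  refine ⟨h + h', add_mem hh hh', fun q => ?_, fun r => ?_⟩
  · have h1 : (g - F.endDiff 0 (h + h')) (C.y D q) = g₂ (C.y D q) - F.endDiff 0 h' (C.y D q) := by
      rw [map_add, ← sub_sub]; rfl
    have h2 : h' (C.y D q) = 0 := by
      refine C.y_induction D (p := fun q => h' (C.y D q) = 0) (by simp) ?_ ?_ q
      · intro x y hx hy; simp only [map_add, hx, hy, add_zero]
      · intro d q hq; exact hh0' (-1) (by decide) d _ hq
    have h3 : h' C.u = 0 := hh0' 0 (by decide) 0 C.u C.u_mem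
    rw [h1, hdiff, h2, d_y, map_smul, h3, smul_zero, map_zero, sub_zero, sub_zero, hg₂y]
  · rw [hv, C.d_κ'_apply D hconn (F.d_d _) (F.aug_d _)]

/-- Normalization of endomorphisms of degree `2` by boundaries. -/
theorem exists_normalize_two {j : ℤ × (ℤ × G)} (hj : j.1 = 2) {g : Module.End Aᵐᵒᵖ P}
    (hg : g ∈ F.endDeg j) : ∃ h ∈ F.endDeg (j.1 - 1, j.2),
      ∀ r, (g - F.endDiff (j.1 - 1) h) (C.v D r) = F.aug (g (C.v D r)) • C.u := by
  obtain ⟨p, e⟩ := j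
  obtain rfl : p = 2 := hj
  have e1 : (2 - 1 : ℤ) = 1 := by norm_num
  simp only [e1]
  let t : D.R →ₗ[k] P := C.κ ∘ₗ (LinearMap.id - LinearMap.toSpanSingleton k P C.u ∘ₗ F.aug) ∘ₗ
    g.restrictScalars k ∘ₗ C.v D
  have ht : ∀ r, t r = C.κ (g (C.v D r) - F.aug (g (C.v D r)) • C.u) := fun r => rfl
  obtain ⟨h, hh, hhv, hh0⟩ := C.exists_extension_v D hconn (j := (1, e)) (t := t) (by
    intro d r hr
    have h1 := hg _ _ hr
    rw [ht]
    have h2 : g (C.v D r) - F.aug (g (C.v D r)) • C.u ∈ F.deg ((2, e) + (-2, d)) := by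
      refine sub_mem h1 ?_
      by_cases h3 : ((2, e) + (-2, d) : ℤ × (ℤ × G)) = 0
      · rw [h3]; exact Submodule.smul_mem _ _ C.u_mem
      · rw [F.aug_deg _ h3 _ h1, zero_smul]; exact zero_mem _
    convert C.κ_mem _ _ h2 using 2
    ext <;> simp)
  refine ⟨h, hh, fun r => ?_⟩
  rw [LinearMap.sub_apply, endDiff_eq, C.apply_d_v_eq_zero D (hh0 (-1) (by decide)), smul_zero,
    sub_zero, hhv, ht, C.d_κ', sub_sub_cancel]
  · rw [map_sub, C.d_apply_v D rfl hg, map_smul_k F.d, C.d_u, smul_zero, sub_zero]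
  · rw [map_sub, map_smul, C.aug_u, smul_eq_mul, mul_one, sub_self]

omit hconn in
/-- The normalized endomorphisms; those of degrees `1` and `2` have no components dual to `Q`
resp. `R`. -/
def normal (j : ℤ × (ℤ × G)) : Submodule k (Module.End Aᵐᵒᵖ P) where
  carrier := {g | g ∈ F.endDeg j ∧ (j.1 = 1 → (∀ q, g (C.y D q) = 0) ∧
    ∀ r, g (C.v D r) = C.κ' D (F.d (g (C.v D r)))) ∧ (j.1 = 2 → ∀ r, g (C.v D r) = 0)}
  add_mem' := by
    rintro g g' ⟨h, h1, h2⟩ ⟨h', h1', h2'⟩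
    refine ⟨add_mem h h', fun hj => ⟨fun q => ?_, fun r => ?_⟩, fun hj r => ?_⟩
    · rw [LinearMap.add_apply, (h1 hj).1, (h1' hj).1, add_zero]
    · rw [LinearMap.add_apply, map_add, map_add, ← (h1 hj).2, ← (h1' hj).2]
    · rw [LinearMap.add_apply, h2 hj, h2' hj, add_zero]
  zero_mem' := ⟨zero_mem _, fun _ => ⟨fun _ => rfl, fun _ => by simp⟩, fun _ _ => rfl⟩
  smul_mem' := by
    rintro c g ⟨h, h1, h2⟩
    refine ⟨Submodule.smul_mem _ _ h, fun hj => ⟨fun q => ?_, fun r => ?_⟩, fun hj r => ?_⟩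
    · rw [LinearMap.smul_apply, (h1 hj).1, smul_zero]
    · rw [LinearMap.smul_apply, map_smul_k F.d, map_smul, ← (h1 hj).2]
    · rw [LinearMap.smul_apply, h2 hj, smul_zero]

/-- A primitive may be changed by any cocycle. In degrees `1` and `2` the identification of
cohomology supplies a cocycle with the same augmented values on the `y_q` or `v_r`; after
subtracting it, normalization by a coboundary leaves no multiple of `u`. -/
theorem exists_mem_normal {j : ℤ × (ℤ × G)} {β : Module.End Aᵐᵒᵖ P}
    (hβ : β ∈ F.endDG.coboundaries j) :
    ∃ w ∈ C.normal D (j.1 - 1, j.2), F.endDG.diff (j.1 - 1) w = β := by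
  obtain ⟨g, hg, rfl⟩ := hβ
  obtain ⟨p, e⟩ := j
  obtain ⟨p, rfl⟩ : ∃ p', p = p' + 1 := ⟨p - 1, by ring⟩
  simp only [add_sub_cancel_right] at hg ⊢
  replace hg : g ∈ F.endDeg (p, e) := hg
  by_cases hp1 : p = 1
  · subst hp1
    obtain ⟨φ, hφ⟩ := C.exists_identification_one hconn D
    let b : gradedDual 𝒜 D.Q e := ⟨F.aug ∘ₗ g.restrictScalars k ∘ₗ C.y D, by
      intro d hde q hq
      refine F.aug_deg ((1, e) + (-1, d)) ?_ _ (hg _ _ (C.y_mem D hq))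
      intro h
      have h2 := congrArg Prod.snd h
      simp only [Prod.snd_add, Prod.snd_zero] at h2
      exact hde (eq_neg_of_add_eq_zero_right h2)⟩
    obtain ⟨z, hz⟩ := F.endDG.toH_surjective (1, e) ((φ e).symm b)
    have hzb : ∀ q, F.aug (z.1 (C.y D q)) = F.aug (g (C.y D q)) := by
      intro q
      rw [← hφ, hz, LinearEquiv.apply_symm_apply]; rfl
    have hgz : g - z.1 ∈ F.endDeg (1, e) := sub_mem hg z.2.1
    obtain ⟨h, hh, hy, hv⟩ := C.exists_normalize_one D hconn rfl hgz
    refine ⟨g - z.1 - F.endDiff (1 - 1) h, ⟨sub_mem hgz ?_, fun _ => ⟨fun q => ?_, hv⟩,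
      fun h2 => absurd h2 (by norm_num)⟩, ?_⟩
    · exact F.endDG.diff_mem _ h hh
    · rw [hy, LinearMap.sub_apply, map_sub, hzb, sub_self, zero_smul]
    · have h1 : F.endDG.diff 1 z.1 = 0 := z.2.2
      have h2 : F.endDG.diff 1 (F.endDiff (1 - 1) h) = 0 := F.endDG.diff_diff (0, e) h hh
      rw [map_sub, map_sub, h1, h2, sub_zero, sub_zero]
  by_cases hp2 : p = 2
  · subst hp2
    obtain ⟨φ, hφ⟩ := C.exists_identification_two hconn D
    let b : gradedDual (tensorDeg 𝒜 D.Q) D.R e := ⟨F.aug ∘ₗ g.restrictScalars k ∘ₗ C.v D, by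
      intro d hde q hq
      refine F.aug_deg ((2, e) + (-2, d)) ?_ _ (hg _ _ (C.v_mem D hq))
      intro h
      have h2 := congrArg Prod.snd h
      simp only [Prod.snd_add, Prod.snd_zero] at h2
      exact hde (eq_neg_of_add_eq_zero_right h2)⟩
    obtain ⟨z, hz⟩ := F.endDG.toH_surjective (2, e) ((φ e).symm b)
    have hzb : ∀ r, F.aug (z.1 (C.v D r)) = F.aug (g (C.v D r)) := by
      intro r
      rw [← hφ, hz, LinearEquiv.apply_symm_apply]; rfl
    have hgz : g - z.1 ∈ F.endDeg (2, e) := sub_mem hg z.2.1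
    obtain ⟨h, hh, hv⟩ := C.exists_normalize_two D hconn rfl hgz
    refine ⟨g - z.1 - F.endDiff (2 - 1) h, ⟨sub_mem hgz ?_, fun h2 => absurd h2 (by norm_num),
      fun _ r => ?_⟩, ?_⟩
    · exact F.endDG.diff_mem _ h hh
    · rw [hv, LinearMap.sub_apply, map_sub, hzb, sub_self, zero_smul]
    · have h1 : F.endDG.diff 2 z.1 = 0 := z.2.2
      have h2 : F.endDG.diff 2 (F.endDiff (2 - 1) h) = 0 := F.endDG.diff_diff (1, e) h hh
      rw [map_sub, map_sub, h1, h2, sub_zero, sub_zero]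
  · exact ⟨g, ⟨hg, fun h => absurd h hp1, fun h => absurd h hp2⟩, rfl⟩

/-- Normalized representatives of the cohomology classes. -/
theorem exists_normal_section (j : ℤ × (ℤ × G)) :
    ∃ s : F.endDG.H j →ₗ[k] F.endDG.cocycles j, (∀ a, F.endDG.toH j (s a) = a) ∧
      (∀ z : F.endDG.cocycles j, (z : Module.End Aᵐᵒᵖ P) = 1 → j = 0 →
        (s (F.endDG.toH j z) : Module.End Aᵐᵒᵖ P) = 1) ∧
      (j.1 = 1 → ∀ a, (∀ q, (s a).1 (C.y D q) = F.aug ((s a).1 (C.y D q)) • C.u) ∧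
        ∀ r, (s a).1 (C.v D r) = C.κ' D (F.d ((s a).1 (C.v D r)))) ∧
      (j.1 = 2 → ∀ a r, (s a).1 (C.v D r) = F.aug ((s a).1 (C.v D r)) • C.u) := by
  by_cases hj0 : j = 0
  · subst hj0
    have h1 : (1 : Module.End Aᵐᵒᵖ P) ∈ F.endDG.cocycles 0 := by
      refine ⟨F.endDG.one_mem, ?_⟩
      show F.endDiff 0 1 = 0
      rw [endDiff_apply]; simp
    -- The identity is not a coboundary: its value on `u` has augmentation `1`, while that of a
    -- coboundary has augmentation `0`. So a linear section can be required to send its class to the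
    -- identity itself.
    obtain ⟨s, hs, hs1⟩ := F.endDG.exists_section_of_ne (j := 0) ⟨1, h1⟩ (by
      intro h
      rw [F.endDG.toH_eq_zero_iff] at h
      obtain ⟨g, hg, hg1⟩ := h
      have h2 := congrArg (fun f : Module.End Aᵐᵒᵖ P => F.aug (f C.u)) hg1
      have h3 : F.aug (F.endDiff (0 - 1) g C.u) = 1 := by rw [← C.aug_u]; exact h2
      rw [endDiff_eq, C.d_u, map_zero, smul_zero, sub_zero, F.aug_d] at h3
      exact zero_ne_one h3)
    refine ⟨s, hs, fun z hz _ => ?_, fun h => absurd h (by simp), fun h => absurd h (by simp)⟩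
    obtain rfl : z = ⟨1, h1⟩ := Subtype.ext hz
    rw [hs1]
  · by_cases hj1 : j.1 = 1
    · let S : Submodule k (F.endDG.cocycles j) :=
        { carrier := {z | (∀ q, z.1 (C.y D q) = F.aug (z.1 (C.y D q)) • C.u) ∧
            ∀ r, z.1 (C.v D r) = C.κ' D (F.d (z.1 (C.v D r)))}
          add_mem' := by
            rintro z z' ⟨h1, h2⟩ ⟨h1', h2'⟩
            refine ⟨fun q => ?_, fun r => ?_⟩
            · rw [Submodule.coe_add, LinearMap.add_apply, map_add, add_smul, ← h1, ← h1']
            · rw [Submodule.coe_add, LinearMap.add_apply, map_add, map_add, ← h2, ← h2']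
          zero_mem' := ⟨fun _ => by simp, fun _ => by simp⟩
          smul_mem' := by
            rintro c z ⟨h1, h2⟩
            refine ⟨fun q => ?_, fun r => ?_⟩
            · rw [Submodule.coe_smul, LinearMap.smul_apply, map_smul, smul_assoc, ← h1]
            · rw [Submodule.coe_smul, LinearMap.smul_apply, map_smul_k F.d, map_smul, ← h2] }
      obtain ⟨s, hs⟩ := F.endDG.exists_section_in S (by
        intro z
        obtain ⟨h, hh, hy, hv⟩ := C.exists_normalize_one D hconn hj1 z.2.1
        have hc : F.endDiff (j.1 - 1) h ∈ F.endDG.coboundaries j := ⟨h, hh, rfl⟩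
        refine ⟨z - ⟨_, F.endDG.coboundaries_le_cocycles j hc⟩, ⟨fun q => ?_, hv⟩, ?_⟩
        · have h1 := hy q
          show (z.1 - F.endDiff (j.1 - 1) h) (C.y D q) =
            F.aug ((z.1 - F.endDiff (j.1 - 1) h) (C.y D q)) • C.u
          rw [h1, map_smul, C.aug_u, smul_eq_mul, mul_one]
        · rw [← F.endDG.toHₗ_apply, map_sub, F.endDG.toHₗ_apply, F.endDG.toHₗ_apply,
            (F.endDG.toH_eq_zero_iff ⟨_, _⟩).2 hc, sub_zero])
      exact ⟨s, fun a => (hs a).2, fun _ _ h => absurd h hj0, fun _ a => (hs a).1,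
        fun h => absurd h (by rw [hj1]; decide)⟩
    · by_cases hj2 : j.1 = 2
      · let S : Submodule k (F.endDG.cocycles j) :=
          { carrier := {z | ∀ r, z.1 (C.v D r) = F.aug (z.1 (C.v D r)) • C.u}
            add_mem' := by
              intro z z' h1 h1' q
              rw [Submodule.coe_add, LinearMap.add_apply, map_add, add_smul, ← h1, ← h1']
            zero_mem' := fun _ => by simp
            smul_mem' := by
              intro c z h1 q
              rw [Submodule.coe_smul, LinearMap.smul_apply, map_smul, smul_assoc, ← h1] }
        obtain ⟨s, hs⟩ := F.endDG.exists_section_in S (by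
          intro z
          obtain ⟨h, hh, hv⟩ := C.exists_normalize_two D hconn hj2 z.2.1
          have hc : F.endDiff (j.1 - 1) h ∈ F.endDG.coboundaries j := ⟨h, hh, rfl⟩
          refine ⟨z - ⟨_, F.endDG.coboundaries_le_cocycles j hc⟩, fun r => ?_, ?_⟩
          · have h1 := hv r
            show (z.1 - F.endDiff (j.1 - 1) h) (C.v D r) =
              F.aug ((z.1 - F.endDiff (j.1 - 1) h) (C.v D r)) • C.u
            rw [h1, map_smul, C.aug_u, smul_eq_mul, mul_one]
          · rw [← F.endDG.toHₗ_apply, map_sub, F.endDG.toHₗ_apply, F.endDG.toHₗ_apply,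
              (F.endDG.toH_eq_zero_iff ⟨_, _⟩).2 hc, sub_zero])
        exact ⟨s, fun a => (hs a).2, fun _ _ h => absurd h hj0, fun h => absurd h hj1,
          fun _ a => (hs a).1⟩
      · obtain ⟨s, hs⟩ := F.endDG.exists_section_in (j := j) ⊤ (fun z => ⟨z, trivial, rfl⟩)
        exact ⟨s, fun a => (hs a).2, fun _ _ h => absurd h hj0, fun h => absurd h hj1,
          fun h => absurd h hj2⟩

end SectionData

end GradedFreeResolution

end Resolution

end ExtAInf

open scoped DirectSum

namespace ExtAInf

set_option linter.unusedSectionVars false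

open TensorProduct MulOpposite

/-! ### Contraction with functionals on the generators -/

section Contraction

variable {k : Type*} [Field k] {A : Type*} [Ring A] [Algebra k A] {Q : Submodule k A}

theorem exists_tensorContr (b : Module.Dual k Q) :
    ∃ c : TensorAlgebra k Q →ₗ[k] TensorAlgebra k Q, c 1 = 0 ∧
      ∀ q t, c (TensorAlgebra.ι k q * t) = b q • t :=
  exists_tensorRec 0 ((LinearMap.lsmul k (TensorAlgebra k Q)).comp b)

/-- The contraction `q ⊗ t ↦ b(q) t` of the first letter. -/
noncomputable def tensorContr (b : Module.Dual k Q) : TensorAlgebra k Q →ₗ[k] TensorAlgebra k Q :=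
  (exists_tensorContr b).choose

theorem tensorContr_one (b : Module.Dual k Q) : tensorContr b 1 = 0 :=
  (exists_tensorContr b).choose_spec.1

theorem tensorContr_ι_mul (b : Module.Dual k Q) (q : Q) (t : TensorAlgebra k Q) :
    tensorContr b (TensorAlgebra.ι k q * t) = b q • t :=
  (exists_tensorContr b).choose_spec.2 q t

theorem wordPairing_succ {n : ℕ} (b : Fin (n + 1) → Module.Dual k Q) (t : TensorAlgebra k Q) :
    wordPairing b t = wordPairing (fun i => b i.succ) (tensorContr (b 0) t) := by
  have : wordPairing b = wordPairing (fun i => b i.succ) ∘ₗ tensorContr (b 0) := by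
    refine tensor_ext ?_ fun q t _ => ?_
    · rw [LinearMap.comp_apply, tensorContr_one, map_zero,
        ← tprod_zero (k := k) (Q := Q) (fun i => i.elim0), wordPairing_tprod_ne (Nat.succ_ne_zero n).symm]
    · rw [LinearMap.comp_apply, tensorContr_ι_mul, wordPairing_ι_mul, map_smul, smul_eq_mul]
  exact LinearMap.congr_fun this t

/-- Iterated contraction with `b (s + n - 1), …, b s`. -/
noncomputable def iterContr (b : ℕ → Module.Dual k Q) :
    ℕ → ℕ → TensorAlgebra k Q →ₗ[k] TensorAlgebra k Q
  | 0, _ => LinearMap.id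
  | n + 1, s => tensorContr (b s) ∘ₗ iterContr b n (s + 1)

theorem iterContr_succ' (b : ℕ → Module.Dual k Q) (n s : ℕ) (t : TensorAlgebra k Q) :
    iterContr b (n + 1) s t = iterContr b n s (tensorContr (b (s + n)) t) := by
  induction n generalizing s with
  | zero => rfl
  | succ n ih =>
    show tensorContr (b s) (iterContr b (n + 1) (s + 1) t) = _
    rw [ih, add_right_comm s 1 n]; rfl

/-- Contractions remove letters from the left and `b (s + n - 1)` acts first, hence the reversal of
the index. Taking the constant term selects the component of length `n`. -/
theorem algebraMapInv_iterContr (b : ℕ → Module.Dual k Q) (n s : ℕ) (t : TensorAlgebra k Q) :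
    TensorAlgebra.algebraMapInv (iterContr b n s t) =
      wordPairing (fun i : Fin n => b (s + (i.rev : ℕ))) t := by
  induction n generalizing t with
  | zero => rw [wordPairing_zero]; rfl
  | succ n ih =>
    rw [iterContr_succ', ih, wordPairing_succ]
    have h1 : (fun i : Fin n => b (s + (i.succ.rev : ℕ))) = fun i => b (s + (i.rev : ℕ)) := by
      ext i; congr 2; simp [Fin.rev_succ]
    have h2 : (((0 : Fin (n + 1)).rev : Fin (n + 1)) : ℕ) = n := by simp
    rw [h1, h2]

/-- The contraction `q ⊗ a ↦ b(q) a`. -/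
noncomputable def freeContr (b : Module.Dual k Q) : Aᵐᵒᵖ ⊗[k] Q →ₗ[Aᵐᵒᵖ] A :=
  freeLift (LinearMap.toSpanSingleton k A 1 ∘ₗ b)

theorem freeContr_tmul (b : Module.Dual k Q) (a : A) (q : Q) :
    freeContr b (op a ⊗ₜ q) = b q • a := by
  simp [freeContr]

/-- `θ` intertwines the contraction in the free module with the contraction of the first letter,
because the tail of a tensor in `Q ⊗ θ(A)` is itself a value of `θ`. -/
theorem tensorContr_psi (b : Module.Dual k Q) (θ : A →ₗ[k] TensorAlgebra k Q)
    (x : Aᵐᵒᵖ ⊗[k] Q) : tensorContr b (psi θ x) = θ (freeContr b x) := by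
  induction x using TensorProduct.induction_on with
  | zero => simp
  | tmul c q =>
    obtain ⟨a, rfl⟩ := op_surjective c
    rw [psi_tmul, tensorContr_ι_mul, freeContr_tmul, map_smul]
  | add x y hx hy => simp only [map_add, hx, hy]

end Contraction

/-! ### The recursion for the values of the morphism on relations -/

section Resolution

variable {k : Type*} [Field k] {G : Type*} [AddCommGroup G] [DecidableEq G]
  {A : Type*} [Ring A] [Algebra k A] {𝒜 : ℤ × G → Submodule k A} [GradedAlgebra 𝒜]
  {P : Type*} [AddCommGroup P] [Module k P] [Module Aᵐᵒᵖ P] [IsScalarTower k Aᵐᵒᵖ P]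
  {F : GradedFreeResolution 𝒜 P}

namespace GradedFreeResolution

namespace SectionData

variable (C : F.SectionData) (D : Presentation 𝒜)

theorem apply_yA {g : Module.End Aᵐᵒᵖ P} {b : Module.Dual k D.Q}
    (h : ∀ q, g (C.y D q) = b q • C.u) (x : Aᵐᵒᵖ ⊗[k] D.Q) :
    g (C.yA D x) = op (freeContr b x) • C.u := by
  induction x using TensorProduct.induction_on with
  | zero => simp
  | tmul c q =>
    obtain ⟨a, rfl⟩ := op_surjective c
    rw [yA_tmul, map_smul, h, freeContr_tmul, op_smul, smul_assoc, smul_algebra_smul_comm]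
  | add x y hx hy => rw [map_add, map_add, map_add, hx, hy, op_add, add_smul]

theorem apply_yA_eq_zero {g : Module.End Aᵐᵒᵖ P} (h : ∀ q, g (C.y D q) = 0)
    (x : Aᵐᵒᵖ ⊗[k] D.Q) : g (C.yA D x) = 0 := by
  rw [C.apply_yA D (b := 0) (by simpa using h)]
  have : freeContr (0 : Module.Dual k D.Q) x = 0 := by
    have h0 : freeContr (0 : Module.Dual k D.Q) = 0 := free_ext fun q => by
      rw [← op_one, freeContr_tmul]; simp
    rw [h0]; rfl
  rw [this, op_zero, zero_smul]

variable (hconn : IsConnectedGraded 𝒜)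
include hconn

theorem mem_augIdeal_of_aug {a : A} (h : F.aug (op a • C.u) = 0) : a ∈ augIdeal 𝒜 := by
  have := sub_ρ₀_mem hconn (F := F) (op a • C.u)
  rwa [h, zero_smul, sub_zero, map_smul, C.ρ₀_u hconn, op_smul_eq_mul, one_mul] at this

/-- The inductive computation of the higher multiplications from the components of a normalized
`A_∞`-morphism. -/
theorem coeff_eq_wordPairing (b : ℕ → Module.Dual k D.Q) (g : ℕ → ℕ → Module.End Aᵐᵒᵖ P)
    (m : ℕ → ℕ → k) (r : D.R)
    (hy : ∀ s q, g 1 s (C.y D q) = b s q • C.u)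
    (hy' : ∀ n s, 2 ≤ n → ∀ q, g n s (C.y D q) = 0)
    (hv : ∀ n s, 1 ≤ n → g n s (C.v D r) = C.κ' D (F.d (g n s (C.v D r))))
    (hd : ∀ s, F.d (g 1 s (C.v D r)) = -g 1 s (F.d (C.v D r)))
    (hm : ∀ n s, 2 ≤ n → m n s • C.u = F.d (g n s (C.v D r)) +
      ∑ x ∈ (Finset.HasAntidiagonal.antidiagonal n).filter (fun x => 1 ≤ x.1 ∧ 1 ≤ x.2),
        sgn k (((x.1 : ℤ) - 1) + (1 - (x.2 : ℤ)) * x.1) • g x.1 s (g x.2 (s + x.1) (C.v D r)))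
    (n s : ℕ) (hn : 2 ≤ n) : m n s = (-1) ^ (n * (n - 1) / 2) *
      wordPairing (fun i : Fin n => b (s + (i.rev : ℕ))) (r : TensorAlgebra k D.Q) := by
  have hmem : ∀ n s (a : A), F.d (g n s (C.v D r)) = op a • C.u → a ∈ augIdeal 𝒜 := by
    intro n s a h
    exact C.mem_augIdeal_of_aug hconn (by rw [← h, F.aug_d])
  -- the step from `n` to `n + 1`
  have step : ∀ n, 1 ≤ n → ∀ s, ∀ x' ∈ augIdeal 𝒜,
      g n (s + 1) (C.v D r) = C.yA D (lam D.Q (D.θ x')) →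
      (∀ j < n, 1 ≤ j → ∀ s, ∃ x ∈ augIdeal 𝒜, g j s (C.v D r) = C.yA D (lam D.Q (D.θ x))) →
      F.d (g (n + 1) s (C.v D r)) =
        op (m (n + 1) s • (1 : A) - sgn k (1 - n) • freeContr (b s) (lam D.Q (D.θ x'))) • C.u := by
    intro n hn s x' hx' hgx hlt
    have h1 := hm (n + 1) s (by omega)
    -- Only `f_1 · f_n` survives: each `f_j (v_r)` with `j < n` is an `A`-combination of the `y_q`,
    -- which `f_i` kills for `i ≥ 2`.
    rw [Finset.sum_eq_single (1, n)] at h1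
    · rw [hgx, C.apply_yA D (hy s)] at h1
      have e1 : sgn k (((1 : ℕ) : ℤ) - 1 + (1 - (n : ℤ)) * ((1 : ℕ) : ℤ)) = sgn k (1 - n) := by
        congr 1; push_cast; ring
      rw [e1] at h1
      rw [eq_sub_of_add_eq h1.symm, op_sub, sub_smul, op_smul, op_smul, smul_assoc, op_one, one_smul,
        smul_assoc]
    · rintro ⟨i, j⟩ hx hne
      simp only [Finset.mem_filter, Finset.HasAntidiagonal.mem_antidiagonal] at hx
      obtain ⟨hij, hi, hj⟩ := hx
      have hi2 : 2 ≤ i := by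
        rcases hi.eq_or_lt with rfl | h
        · exact absurd (show ((1, j) : ℕ × ℕ) = (1, n) by rw [show j = n by omega]) hne
        · exact h
      obtain ⟨x, -, hx⟩ := hlt j (by omega) hj (s + i)
      simp only
      rw [hx, C.apply_yA_eq_zero D (hy' i s hi2), smul_zero]
    · intro h
      exact absurd (by simp [add_comm, hn]) h
  -- Here `d f_n(v_r) = u x`. The claim computes `θ(x)` as a constant minus the signed `n`-fold
  -- contraction of `r`; for `n ≥ 2` the constant is the wanted coefficient, and for `n = 1` it is
  -- zero.
  have claim : ∀ n, 1 ≤ n → ∀ s, ∃ x ∈ augIdeal 𝒜, g n s (C.v D r) = C.yA D (lam D.Q (D.θ x)) ∧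
      ∃ c : k, D.θ x = c • 1 - (-1 : k) ^ (n * (n - 1) / 2) • iterContr b n s r ∧
        (2 ≤ n → c = m n s) := by
    intro n hn
    induction n using Nat.strong_induction_on with
    | _ n ih =>
    intro s
    obtain ⟨n, rfl⟩ : ∃ n', n = n' + 1 := ⟨n - 1, by omega⟩
    obtain rfl | hn := Nat.eq_zero_or_pos n
    · have h1 : F.d (g 1 s (C.v D r)) = op (-freeContr (b s) (lam D.Q r)) • C.u := by
        rw [hd, C.d_v, C.apply_yA D (hy s), op_neg, neg_smul]
      refine ⟨_, hmem _ _ _ h1, ?_, 0, ?_, fun h => absurd h (by norm_num)⟩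
      · rw [zero_add, hv 1 s le_rfl, h1, C.κ'_smul_u D hconn]
      · rw [map_neg, ← tensorContr_psi, D.psi_lam r.2]; simp [iterContr]
    · obtain ⟨x', hx', hgx, c, hc, -⟩ := ih n (by omega) hn (s + 1)
      have h1 := step n hn s x' hx' hgx (fun j hj hj' s => by
        obtain ⟨x, hx, h, -⟩ := ih j (by omega) hj' s
        exact ⟨x, hx, h⟩)
      refine ⟨_, hmem _ _ _ h1, ?_, m (n + 1) s, ?_, fun _ => rfl⟩
      · rw [hv (n + 1) s (by omega), h1, C.κ'_smul_u D hconn]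
      -- Contraction kills the constant found at stage `n`. The sign `(-1)^n` gained here turns the
      -- exponent `n(n-1)/2` into `(n+1)n/2`.
      · rw [map_sub, map_smul, map_smul, D.θ_one, ← tensorContr_psi, D.psi_lam_θ hx', hc, map_sub,
          map_smul, map_smul, tensorContr_one, smul_zero, zero_sub, smul_neg, smul_smul,
          sub_neg_eq_add, Nat.triangle_succ, pow_add]
        have e1 : sgn k (1 - n) = -(-1) ^ n := by
          clear * -
          induction n with
          | zero => simp [sgn]
          | succ n ih =>
            rw [Nat.cast_succ, ← sub_sub, sgn_pred, ih, pow_succ]; ring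
        rw [e1, neg_mul, neg_smul, ← sub_eq_add_neg, mul_comm]
        rfl
  obtain ⟨x, hx, -, c, hc, hcm⟩ := claim n (by omega) s
  -- As `x` is in `𝔪`, `θ(x)` has no constant term, so the coefficient equals the constant term of
  -- the contraction, which is the word pairing.
  have h1 := congrArg (TensorAlgebra.algebraMapInv (R := k) (M := D.Q)) hc
  rw [D.algebraMapInv_θ hx, map_sub, map_smul, map_smul, map_one, algebraMapInv_iterContr, hcm hn,
    smul_eq_mul, mul_one, smul_eq_mul, eq_comm, sub_eq_zero] at h1
  exact h1

end SectionData

end GradedFreeResolution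

end Resolution

end ExtAInf

open scoped DirectSum

namespace ExtAInf

set_option linter.unusedSectionVars false

open TensorProduct MulOpposite

/-! ### Evaluation of the morphism identities on relations and the final model -/

section Splice

variable {k : Type*} [Field k] {Γ : Type*} [AddCommGroup Γ] [DecidableEq Γ]
  {V : Type*} [AddCommGroup V] [Module k V] {𝒱 : ℤ × Γ → Submodule k V}

theorem splice_mem {p : ℕ → ℤ × Γ} {a : ℕ → V} (ha : ∀ i, a i ∈ 𝒱 (p i)) {x : V} {j : ℤ × Γ}
    (hx : x ∈ 𝒱 j) (r s i : ℕ) : splice a r s x i ∈ 𝒱 (splice p r s j i) := by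
  unfold splice
  split_ifs
  · exact ha _
  · exact hx
  · exact ha _

theorem sum_splice_fst {p : ℕ → ℤ × Γ} (hp : ∀ i, (p i).1 = 1) {j : ℤ × Γ} (hj : j.1 = 2)
    (r s t : ℕ) : (∑ i ∈ Finset.range (r + 1 + t), splice p r s j i).1 = ((r + 1 + t : ℕ) : ℤ) + 1 := by
  have h : ∀ i, (splice p r s j i).1 = 1 + if i = r then 1 else 0 := by
    intro i
    unfold splice
    split_ifs with h1 h2 h2
    · omega
    · rw [hp]; rfl
    · rw [hj]; rfl
    · rw [hp]; rfl
  rw [Prod.fst_sum, Finset.sum_congr rfl fun i _ => h i, Finset.sum_add_distrib]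
  simp [add_assoc]

end Splice

section Resolution

variable {k : Type*} [Field k] {G : Type*} [AddCommGroup G] [DecidableEq G]
  {A : Type*} [Ring A] [Algebra k A] {𝒜 : ℤ × G → Submodule k A} [GradedAlgebra 𝒜]
  {P : Type*} [AddCommGroup P] [Module k P] [Module Aᵐᵒᵖ P] [IsScalarTower k Aᵐᵒᵖ P]
  {F : GradedFreeResolution 𝒜 P}

namespace GradedFreeResolution

namespace SectionData

variable (C : F.SectionData) (D : Presentation 𝒜)

/-- The morphism identities of a normalized morphism, evaluated on relations. -/
theorem morphism_apply_v {M : AInfinityAlgebra F.endDG.cohomologyDeg}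
    {φ : AInfinityMorphismToDG M F.endDG} (hM : M.m 1 = 0)
    (hφ : ∀ n, 2 ≤ n → ∀ (p : ℕ → ℤ × (ℤ × G)) (a : ℕ → F.Ext),
      (∀ i, a i ∈ F.endDG.cohomologyDeg (p i)) →
        φ.f n (fun i => a i) ∈ C.normal D (∑ i ∈ Finset.range n, p i + (1 - (n : ℤ), 0)))
    {e : ℕ → ℤ × G} {a : ℕ → F.Ext} (ha : ∀ i, a i ∈ F.endDG.cohomologyDeg (1, e i))
    {n : ℕ} (hn : 2 ≤ n) (r : D.R) :
    φ.f 1 (fun _ => M.m n (fun i => a i)) (C.v D r) = F.d (φ.f n (fun i => a i) (C.v D r)) +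
      ∑ x ∈ (Finset.HasAntidiagonal.antidiagonal n).filter (fun x => 1 ≤ x.1 ∧ 1 ≤ x.2),
        sgn k (((x.1 : ℤ) - 1) + (1 - (x.2 : ℤ)) * x.1) •
          φ.f x.1 (fun i => a i) (φ.f x.2 (fun i => a (x.1 + (i : ℕ))) (C.v D r)) := by
  have h1 := congrArg (fun g : Module.End Aᵐᵒᵖ P => g (C.v D r))
    (φ.morphism n (by omega) (fun i => (1, e i)) a ha)
  simp only at h1
  have hL : stasheffSum M.m φ.f n (fun _ => 1) a (C.v D r) =
      φ.f 1 (fun _ => M.m n (fun i => a i)) (C.v D r) := by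
    -- Only the outermost term `f_1(m_n)` acts nontrivially on `v_r`. For `s = 1` use `m_1 = 0`; for
    -- `1 < s < n` the component of the morphism has at least two inputs and total degree `2`, and
    -- normal endomorphisms of degree `2` kill `v_r`.
    rw [stasheffSum, LinearMap.sum_apply, Finset.sum_eq_single n]
    · rw [Nat.sub_self, Finset.HasAntidiagonal.antidiagonal_zero, Finset.sum_singleton]
      simp [splice]
    · intro s hs hsn
      rw [Finset.mem_Icc] at hs
      rw [LinearMap.sum_apply]
      refine Finset.sum_eq_zero fun x hx => ?_
      rw [Finset.HasAntidiagonal.mem_antidiagonal] at hx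
      rw [negOnePow_smul k, LinearMap.smul_apply]
      refine smul_eq_zero_of_right _ ?_
      have hmem := M.m_mem s hs.1 (fun l => (1, e (x.1 + l))) (fun l => a (x.1 + l))
        (fun l => ha _)
      obtain rfl | hs1 := hs.1.eq_or_lt
      · rw [(φ.f (x.1 + 1 + x.2)).map_coord_zero (⟨x.1, by omega⟩ : Fin (x.1 + 1 + x.2))]
        · rfl
        · simp [splice, hM]
      · have h2 := hφ (x.1 + 1 + x.2) (by omega) _ _ (splice_mem (p := fun i => (1, e i)) ha hmem x.1 s)
        refine h2.2.2 ?_ r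
        rw [Prod.fst_add, sum_splice_fst (fun _ => rfl)]
        · ring
        · simp [Prod.fst_sum]
    · intro h
      exact absurd (Finset.mem_Icc.2 ⟨by omega, le_rfl⟩) h
  have hdeg : (∑ i ∈ Finset.range n, ((1, e i) : ℤ × (ℤ × G)) + (1 - (n : ℤ), 0)).1 = 1 := by
    simp [Prod.fst_sum]
  rw [hL, LinearMap.add_apply, LinearMap.sum_apply] at h1
  rw [h1]
  congr 1
  · show F.endDiff _ _ _ = _
    -- `d v_r` is an `A`-combination of the `y_q`, which `f_n` kills for `n ≥ 2`.
    rw [endDiff_eq, C.d_v, C.apply_yA_eq_zero D ((hφ n hn _ _ ha).2.1 hdeg).1, smul_zero, sub_zero]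
  · refine Finset.sum_congr rfl fun x _ => ?_
    rw [negOnePow_smul k, Finset.sum_const, Finset.card_range, nsmul_eq_mul, mul_one]
    rfl

variable (hconn : IsConnectedGraded 𝒜)
include hconn

/-- An `A_∞`-model whose multiplications on `Ext^1` are dual to the relations. -/
theorem exists_model_pairing {φ₁ : ∀ e, F.endDG.H (1, e) ≃ₗ[k] gradedDual 𝒜 D.Q e}
    (hφ₁ : ∀ e (z : F.endDG.cocycles (1, e)) (q : D.Q),
      (φ₁ e (F.endDG.toH (1, e) z)).1 q = F.aug (z.1 (C.y D q)))
    {φ₂ : ∀ e, F.endDG.H (2, e) ≃ₗ[k] gradedDual (tensorDeg 𝒜 D.Q) D.R e}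
    (hφ₂ : ∀ e (z : F.endDG.cocycles (2, e)) (r : D.R),
      (φ₂ e (F.endDG.toH (2, e) z)).1 r = F.aug (z.1 (C.v D r))) :
    ∃ M : AInfinityAlgebra F.endDG.cohomologyDeg, IsModel F.endDG M ∧
      ∀ n, 2 ≤ n → ∀ (τ : Fin n → Σ e, F.endDG.H (1, e)) (r : D.R),
        (φ₂ (∑ i, (τ i).1) (M.m n (fun i => DirectSum.lof k _ F.endDG.H (1, (τ i).1) (τ i).2)
          (2, ∑ i, (τ i).1))).1 r = (-1) ^ (n * (n - 1) / 2) *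
            wordPairing (fun i : Fin n => (φ₁ (τ i.rev).1 (τ i.rev).2).1)
              (r : TensorAlgebra k D.Q) := by
  choose s hs using fun j => C.exists_normal_section D hconn j
  obtain ⟨M, φ, hM, hφs, hφ⟩ := F.endDG.exists_model s (fun j => (hs j).1)
    (fun z hz => (hs 0).2.1 z hz rfl) (C.normal D) (fun j g hg => hg.1)
    (fun j β hβ => C.exists_mem_normal D hconn hβ)
  refine ⟨M, hM, fun n hn τ r => ?_⟩
  -- The tuple is prolonged by zero to an infinite sequence, so that the components on all
  -- consecutive subwords can be indexed by a length and a starting point.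
  obtain ⟨σ, rfl⟩ : ∃ σ : ℕ → Σ e, F.endDG.H (1, e), (fun i : Fin n => σ i) = τ :=
    ⟨fun i => if h : i < n then τ ⟨i, h⟩ else ⟨0, 0⟩, funext fun i => dif_pos i.2⟩
  let L : (Σ e, F.endDG.H (1, e)) → F.Ext := fun x => DirectSum.lof k _ F.endDG.H (1, x.1) x.2
  have hL : ∀ x, L x ∈ F.endDG.cohomologyDeg (1, x.1) := fun x => ⟨x.2, rfl⟩
  have hL1 : ∀ x, φ.f 1 (fun _ => L x) = s (1, x.1) x.2 := fun x => hφs _ _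
  have hdeg : ∀ (m : ℕ) (e : ℕ → ℤ × G),
      (∑ i ∈ Finset.range m, ((1, e i) : ℤ × (ℤ × G)) + (1 - (m : ℤ), 0)).1 = 1 := by
    intro m e; simp [Prod.fst_sum]
  have hg1 : ∀ t, φ.f 1 (fun i : Fin 1 => L (σ (i + t))) = s (1, (σ t).1) (σ t).2 := fun t =>
    (congrArg (φ.f 1) (funext fun i => by rw [Fin.val_eq_zero, zero_add])).trans (hL1 _)
  obtain ⟨β, hβ⟩ : ∃ β : ℕ → Module.Dual k D.Q, β = fun i => (φ₁ (σ i).1 (σ i).2).1 := ⟨_, rfl⟩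
  have key := C.coeff_eq_wordPairing D hconn β (fun m t => φ.f m (fun i => L (σ (i + t))))
    (fun m t => (φ₂ (∑ i : Fin m, (σ (i + t)).1) (M.m m (fun i => L (σ (i + t)))
      (2, ∑ i : Fin m, (σ (i + t)).1))).1 r) r ?_ ?_ ?_ ?_ ?_ n 0 hn
  · rw [show (fun i : Fin n => β (0 + (i.rev : ℕ))) = fun i => β i.rev from
      funext fun i => by rw [zero_add], hβ] at key
    exact key
  · intro t q
    have h1 := ((hs (1, (σ t).1)).2.2.1 rfl (σ t).2).1 q
    have h2 := hφ₁ _ (s (1, (σ t).1) (σ t).2) q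
    rw [(hs _).1] at h2
    rw [hg1, h1, ← h2, hβ]
  · intro m t hm q
    exact ((hφ m hm _ _ fun i => hL (σ (i + t))).2.1 (hdeg m _)).1 q
  · intro m t hm
    obtain rfl | hm := hm.eq_or_lt
    · rw [hg1]
      exact ((hs (1, (σ t).1)).2.2.1 rfl (σ t).2).2 r
    · exact ((hφ m hm _ _ fun i => hL (σ (i + t))).2.1 (hdeg m _)).2 r
  · intro t
    rw [hg1]
    have h1 : F.endDiff 1 (s (1, (σ t).1) (σ t).2).1 = 0 := (s (1, (σ t).1) (σ t).2).2.2
    have h2 := LinearMap.congr_fun h1 (C.v D r)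
    rw [endDiff_eq, show sgn k 1 = -1 by simp [sgn], neg_one_smul, sub_neg_eq_add] at h2
    exact eq_neg_of_add_eq_zero_left h2
  · intro m t hm
    have h1 := C.morphism_apply_v D hM.m_one_eq_zero hφ (fun i => hL (σ (i + t))) hm r
    obtain ⟨c, hc⟩ : M.m m (fun i => L (σ (i + t))) ∈
        F.endDG.cohomologyDeg (2, ∑ i : Fin m, (σ (i + t)).1) := by
      have h2 := M.m_mem m (by omega) (fun i => (1, (σ (i + t)).1)) (fun i => L (σ (i + t)))
        (fun i => hL _)
      convert h2 using 1
      congr 1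
      ext <;> simp [Prod.fst_sum, Prod.snd_sum]
    have h2 := hφ₂ _ (s _ c) r
    rw [(hs _).1] at h2
    have h3 : (M.m m (fun i => L (σ (i + t)))) (2, ∑ i : Fin m, (σ (i + t)).1) = c := by
      rw [← hc]; exact DirectSum.lof_apply _ _ _
    simp only
    -- The normalized representative of degree `2` sends `v_r` to a multiple of `u`, so the
    -- augmented value determines the element and the identity holds in `P`.
    rw [h3, h2, ← (hs _).2.2.2 rfl c r, ← hφs, hc, h1]
    refine congrArg _ (Finset.sum_congr rfl fun x _ => ?_)
    have h4 : (fun i : Fin x.2 => L (σ (x.1 + (i : ℕ) + t))) =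
        fun i : Fin x.2 => L (σ (i + (t + x.1))) :=
      funext fun i => by rw [show x.1 + (i : ℕ) + t = i + (t + x.1) by omega]
    rw [h4]

end SectionData

end GradedFreeResolution

end Resolution

end ExtAInf

theorem proposition1p2 {k : Type*} [Field k] {G : Type*} [AddCommGroup G] [DecidableEq G]
    {A : Type*} [Ring A] [Algebra k A] (𝒜 : ℤ × G → Submodule k A) [GradedAlgebra 𝒜]
    (hconn : IsConnectedGraded 𝒜) (hfin : LocallyFinitelyGenerated 𝒜) :
    Nonempty (Presentation 𝒜) ∧
    ∀ (D : Presentation 𝒜) {P : Type*} [AddCommGroup P] [Module k P] [Module Aᵐᵒᵖ P]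
      [IsScalarTower k Aᵐᵒᵖ P] (F : GradedFreeResolution 𝒜 P),
      ∃ (φ₁ : ∀ e, F.endDG.H (1, e) ≃ₗ[k] gradedDual 𝒜 D.Q e)
        (φ₂ : ∀ e, F.endDG.H (2, e) ≃ₗ[k] gradedDual (tensorDeg 𝒜 D.Q) D.R e)
        (M : AInfinityAlgebra F.endDG.cohomologyDeg),
        F.IsNaturalOne D φ₁ ∧ F.IsNaturalTwo D φ₂ ∧ IsModel F.endDG M ∧
        ∀ (n : ℕ), 2 ≤ n → ∀ (e : Fin n → ℤ × G) (b : ∀ i, F.endDG.H (1, e i)) (r : D.R),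
          (φ₂ (∑ i, e i)
            (M.m n (fun i => DirectSum.lof k _ F.endDG.H (1, e i) (b i)) (2, ∑ i, e i))).1 r =
          (-1) ^ (n * (n - 1) / 2) *
            wordPairing (fun i : Fin n => (φ₁ (e i.rev) (b i.rev)).1) (r : TensorAlgebra k D.Q) := by
  refine ⟨nonempty_presentation hconn, fun D P _ _ _ _ F => ?_⟩
  obtain ⟨C⟩ := F.nonempty_sectionData
  obtain ⟨φ₁, h₁⟩ := C.exists_identification_one hconn D
  obtain ⟨φ₂, h₂⟩ := C.exists_identification_two hconn D
  obtain ⟨M, hM, h⟩ := C.exists_model_pairing D hconn h₁ h₂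
  exact ⟨φ₁, φ₂, M, C.isNaturalOne D h₁, C.isNaturalTwo D h₂, hM,
    fun n hn e b r => h n hn (fun i => ⟨e i, b i⟩) r⟩
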